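/- **Setting.** Let $R=\mathbb Z[X]/(X^{\mathcal N}+1)$ with $\mathcal N\ge 2$ a power of two, let $Q_\ell=\prod_{i=0}^{\ell}q_i$ with distinct primes $q_i$, and let $S>0$ be the initial scale. CKKS encodes a message in $\mathbb C^{\mathcal N/2}$ at scale $S$ into $R_{Q_L}$. Secrets have independent uniform ternary coefficients; errors $\chi_{err}$ have independent discrete Gaussian coefficients with $\sigma=3.2$, truncated at $\lfloor 6\sigma\rfloor=19$. Adversaries are non-uniform. Classical programs are straight-line programs on machine words, charged by word length; a quantum adversary is a classical program followed by a quantum circuit over $\{H,T,\mathrm{CNOT}\}$, and its cost is the length of the program plus the number of qubits and gates. **Assumption.** The parameters $(\mathcal N,Q_L,S)$ ensure a post-quantum security level $\lambda$: for a uniform ternary secret $s$, an adversary who adaptively submits classical functions $f_1,f_2,\dots$ and gets, for each, either a CKKS encryption $(a,\,-sa+e+f_k(s,\text{previous answers}))\in R_{Q_L}^2$ or a uniform pair (the same choice for all queries) distinguishes the two cases with advantage at most $T\cdot 2^{-\lambda}$, where $T$ is its total cost (cost of the functions and of the distinguisher, plus $2\mathcal N$ per query). That is, CKKS encryption is semantically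 secure also for key-dependent messages (circular security); for $f_k=0$ this is decisional RLWE. **Protocol.** $N\ge1$ parties hold packed data (samples and labels), and $P_1$ also holds initial weights. Each $P_i$ draws $sk_i$; the collective public key is $(\sum_i(-sk_i\,a+e_i),a)$; relinearization and rotation keys for the collective secret $\sum_i sk_i$ are set up. $P_1$ encrypts the initial weights. In each of $m$ global iterations $P_1$ sends the encrypted weights; each $P_i$ computes encrypted local gradients by an arbitrary public program over the operations addition, subtraction, multiplication by a ciphertext or by a plaintext (own data or public), rotation, rescaling, change of scale, and distributed bootstrapping with a public linear transformation $\phi$ of the slots (for any network, packing, polynomial activations and placement of bootstrappings); it sends them; they are summed; $P_1$ adds $\frac{\eta}{bN}$ times the sum to the weights, and the weights are bootstrapped. Every ciphertext sent, including one sent to be bootstrapped, is first re-randomized by a fresh encryption of $0$. To bootstrap $(c_0,c_1)\in R_{Q_\ell}^2$ with message bound $B$, a fresh common uniform $a\in R_{Q_L}$ is taken, each party draws a mask $M_i$ with uniform coefficients in $[0,B2^\lambda)$ and errors $e_{0,i},e_{1,i}$ from $\chi_{err}$, and sends $h_{0,i}=sk_i c_1+M_i+e_{0,i}\bmod Q_\ell$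 and $h_{1,i}=-sk_i a-M_i'+e_{1,i}\bmod Q_L$ with $M_i'=\mathrm{Encode}(\phi(\mathrm{Decode}(M_i)))$ in fixed-point arithmetic, rescaled to the initial scale; the result is $(c_0'+\sum_i h_{1,i},a)$ with $c_0'=\mathrm{Encode}(\phi(\mathrm{Decode}(c_0+\sum_i h_{0,i}\bmod Q_\ell)))$. The bounds $B$ are valid for the admissible inputs (a set of admissible inputs for each party is fixed): on all admissible inputs, except with probability $2^{-\lambda}$, every ciphertext that is bootstrapped decrypts to a polynomial of norm $\|\cdot\|_\infty\le B$. **Proposition.** There is a polynomial $p$, independent of all parameters, such that the following holds for every such protocol, where $\kappa$ is its size (number of parties, $\mathcal N$, levels, bit lengths of $Q_L$, of the decomposition base and of the bounds $B$, fixed-point precision, number of data and weight messages, iterations, $\lambda$, and total length of the local programs). For every set $A$ of at most $N-1$ parties, corrupted by a passive adversary, there is a classical simulator of cost at most $p(\kappa)$, which gets only the (encoded) inputs of the parties in $A$, such that for every distribution on the admissible inputs, every quantum distinguisher of cost $c$ tells the view of $A$ (the inputs and all random values of its members, and everything sent over the network by anyone) from the output of the simulator with advantage at most $p(\kappa)\,(c+1)\,2^{-\lambda}$,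 even when given in addition * (Data Confidentiality) any information about the inputs of the parties outside $A$; * (Model Confidentiality) any information about the weights of the trained model, i.e. the result of the same training on plaintexts by a trusted party. -/

import Mathlib

/-!
# Collective training under multiparty CKKS: protocol, adversaries, confidentiality

1. word programs, quantum distinguishers, advantage;
2. CKKS over `R_Q = ℤ_Q[X]/(X^n + 1)`;
3. the post-quantum security level of a CKKS parameter set;
4. the collective training protocol, as a probabilistic process producing a transcript;
5. the view of a coalition, the plaintext training, and confidentiality by simulation.
-/

noncomputable section

namespace Poseidon

/-! ## 1. Computation and adversaries

Classical computation is by straight-line programs over signed machine words; every instruction has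
its own word length `w` and costs `w + 1`.  Quantum computation is by circuits over the gate set
{H, T, CNOT}.  Everything is non-uniform. -/

/-- The operations of the word machine. -/
inductive WordOp where
  | const (z : ℤ)
  | add
  | sub
  | mul
  | div
  | mod

/-- One instruction: apply `op` to the cells `i` and `j`, on words of `w` bits. -/
structure WordInstr where
  op : WordOp
  i : ℕ
  j : ℕ
  w : ℕ

/-- The two's-complement value of `z` on `w` bits. -/
def wrap (w : ℕ) (z : ℤ) : ℤ := Int.bmod z (2 ^ w)

/-- The value of an operation on two words. -/
def WordOp.eval : WordOp → ℤ → ℤ → ℤ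
  | .const z, _, _ => z
  | .add, x, y => x + y
  | .sub, x, y => x - y
  | .mul, x, y => x * y
  | .div, x, y => x / y
  | .mod, x, y => x % y

/-- Run a straight-line program: every instruction appends one cell to the memory, which
initially holds the input. -/
def execWords : List WordInstr → List ℤ → List ℤ
  | [], mem => mem
  | I :: Is, mem =>
      execWords Is (mem ++ [wrap I.w
        (I.op.eval (wrap I.w (mem.getD I.i 0)) (wrap I.w (mem.getD I.j 0)))])

/-- The cost of a straight-line program. -/
def costWords (p : List WordInstr) : ℕ := (p.map fun I => I.w + 1).sum

/-- A classical function: a straight-line program and the list of its output cells. -/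
structure WordFn where
  prog : List WordInstr
  out : List ℕ

def WordFn.eval (f : WordFn) (x : List ℤ) : List ℤ :=
  f.out.map fun t => (execWords f.prog x).getD t 0

def WordFn.cost (f : WordFn) : ℕ := costWords f.prog + f.out.length

/-- Quantum gates on `k` qubits. -/
inductive Gate (k : ℕ) where
  | had (i : Fin k)
  | tee (i : Fin k)
  | cnot (i j : Fin k)

/-- The action of a gate on a state vector (a `cnot` whose control is its target does nothing). -/
def Gate.apply {k : ℕ} : Gate k → ((Fin k → Bool) → ℂ) → ((Fin k → Bool) → ℂ)
  | .had i, ψ => fun x =>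
      ((1 / Real.sqrt 2 : ℝ) : ℂ) *
        (ψ (Function.update x i false) +
          (if x i then -1 else 1) * ψ (Function.update x i true))
  | .tee i, ψ => fun x =>
      if x i then Complex.exp (Complex.I * (Real.pi / 4 : ℝ)) * ψ x else ψ x
  | .cnot i j, ψ => fun x =>
      if i = j then ψ x else ψ (Function.update x j (xor (x j) (x i)))

/-- A quantum distinguisher with a classical input: a classical program computes the basis state
in which the qubits start (qubit `t` from the low bit of the cell `wire t`; cells that do not exist
give `0`), then the circuit is run, and qubit `0` is measured. -/
structure Distinguisher where
  prog : List WordInstr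
  k : ℕ
  wire : Fin (k + 1) → ℕ
  gates : List (Gate (k + 1))

def Distinguisher.cost (D : Distinguisher) : ℕ :=
  costWords D.prog + (D.k + 1) + D.gates.length

/-- The final state of the circuit of `D` on the classical input `x`. -/
def Distinguisher.state (D : Distinguisher) (x : List ℤ) : (Fin (D.k + 1) → Bool) → ℂ :=
  D.gates.foldl (fun ψ g => g.apply ψ) fun y =>
    if ∀ t, y t = decide ((execWords D.prog x).getD (D.wire t) 0 % 2 = 1) then 1 else 0

/-- The probability that `D` outputs `1` on the input `x`. -/
def Distinguisher.prob (D : Distinguisher) (x : List ℤ) : ℝ :=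
  ∑ y : Fin (D.k + 1) → Bool, if y 0 then ‖D.state x y‖ ^ 2 else 0

/-- The probability that `D` outputs `1` on an input drawn from `μ`. -/
def Distinguisher.accept (D : Distinguisher) (μ : PMF (List ℤ)) : ℝ :=
  (∑' x, μ x * ENNReal.ofReal (D.prob x)).toReal

/-- The advantage of `D` in telling `μ` from `ν`. -/
def Distinguisher.adv (D : Distinguisher) (μ ν : PMF (List ℤ)) : ℝ :=
  |D.accept μ - D.accept ν|

/-! ## Sampling -/

/-- Run finitely many computations one after the other. -/
def seqFin {M : Type → Type} [Monad M] {α : Type} : {k : ℕ} → (Fin k → M α) → M (Fin k → α)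
  | 0, _ => pure Fin.elim0
  | _ + 1, f => do
      let x ← f 0
      let xs ← seqFin fun i => f i.succ
      pure (Fin.cons x xs)

/-- The uniform distribution on the integers `0, …, B - 1`. -/
def unif (B : ℕ) : PMF ℤ :=
  if h : 0 < B then
    (PMF.uniformOfFinset (Finset.range B) ⟨0, Finset.mem_range.2 h⟩).map fun t => (t : ℤ)
  else pure 0

/-- The uniform distribution on `{-1, 0, 1}`. -/
def ternary : PMF ℤ := (unif 3).map fun t => t - 1

/-- The weight of the integer `z` under the Gaussian of standard deviation `3.2`. -/
def gaussWeight (z : ℤ) : ENNReal :=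
  ENNReal.ofReal (Real.exp (-(z : ℝ) ^ 2 / (2 * (3.2 : ℝ) ^ 2)))

/-- The error distribution: the discrete Gaussian of standard deviation `σ = 3.2` restricted to
absolute value at most `⌊6σ⌋ = 19`. -/
def gaussErr : PMF ℤ :=
  (PMF.normalize (fun t : Fin 39 => gaussWeight ((t : ℤ) - 19))
    (by
      rw [tsum_fintype]
      intro h
      have h0 := (Finset.sum_eq_zero_iff.1 h) 0 (Finset.mem_univ _)
      rw [gaussWeight, ENNReal.ofReal_eq_zero] at h0
      exact absurd h0 (not_le.2 (Real.exp_pos _)))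
    (by
      rw [tsum_fintype]
      exact ENNReal.sum_ne_top.2 fun _ _ => ENNReal.ofReal_ne_top)).map
    fun t => (t : ℤ) - 19

/-! ## 2. CKKS

A polynomial modulo `X^n + 1` is the vector of its `n` integer coefficients; an element of `R_Q` is
such a vector with coefficients in `{0, …, Q - 1}`. -/

abbrev Vec (n : ℕ) := Fin n → ℤ

/-- The representative of `v` in `R_Q`. -/
def red {n : ℕ} (Q : ℕ) (v : Vec n) : Vec n := fun j => v j % (Q : ℤ)

/-- Multiplication modulo `X^n + 1`. -/
def nmul {n : ℕ} (v w : Vec n) : Vec n := fun j =>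
  ∑ i : Fin n, ∑ k : Fin n,
    if (i : ℕ) + k = j then v i * w k
    else if (i : ℕ) + k = j + n then -(v i * w k) else 0

/-- The substitution `X ↦ X^g` modulo `X^n + 1`. -/
def substPow {n : ℕ} (g : ℕ) (v : Vec n) : Vec n := fun j =>
  ∑ i : Fin n,
    if ((i : ℕ) * g) % (2 * n) = j then v i
    else if ((i : ℕ) * g) % (2 * n) = j + n then -(v i) else 0

/-- The nearest integer to `x / m`. -/
def roundDiv (x : ℤ) (m : ℕ) : ℤ := (2 * x + m) / (2 * m)

def vecDist (n : ℕ) (μ : PMF ℤ) : PMF (Vec n) := seqFin fun _ : Fin n => μ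

/-- CKKS parameters: the ring dimension is `n = 2^(logSlots + 1)`, the ciphertext modulus at level
`ℓ` is `Q_ℓ = q_0 ⋯ q_ℓ`, fresh plaintexts have scale `S`.  `base` is the radix of the digit
decomposition in the local key switch, `prec` the number of fractional bits kept for the
coefficients of a linear transformation. -/
structure Params where
  logSlots : ℕ
  L : ℕ
  q : ℕ → ℕ
  q_prime : ∀ i ≤ L, (q i).Prime
  q_inj : ∀ i ≤ L, ∀ j ≤ L, q i = q j → i = j
  S : ℝ
  S_pos : 0 < S
  base : ℕ
  two_le_base : 2 ≤ base
  prec : ℕ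

namespace Params

variable (P : Params)

/-- The number of slots, half the ring dimension. -/
def slots : ℕ := 2 ^ P.logSlots

/-- The ring dimension. -/
def n : ℕ := 2 ^ (P.logSlots + 1)

/-- The modulus at level `l`. -/
def Q (l : ℕ) : ℕ := ∏ i ∈ Finset.range (l + 1), P.q i

/-- The modulus of fresh ciphertexts. -/
def QL : ℕ := P.Q P.L

/-- The number of digits in the local key switch. -/
def digits : ℕ := Nat.clog P.base P.QL

/-- Messages: vectors of `n / 2` complex numbers. -/
abbrev Msg := Fin P.slots → ℂ

/-- Polynomials. -/
abbrev Poly := Vec P.n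

/-- The root of `X^n + 1` that belongs to slot `j`. -/
def root (j : Fin P.slots) : ℂ :=
  Complex.exp (Complex.I * (Real.pi * 5 ^ (j : ℕ) / P.n : ℝ))

/-- `Encode` at scale `s`: the rounding of the real polynomial that takes the value `s * z j` at
`root j`, for every `j`; an element of `R_{Q_L}`. -/
def encode (s : ℝ) (z : P.Msg) : P.Poly := red P.QL fun k =>
  round (2 / (P.n : ℝ) *
    (∑ j, (s : ℂ) * z j * (starRingEnd ℂ (P.root j)) ^ (k : ℕ)).re)

/-- The real matrix of `Encode ∘ φ ∘ Decode` on coefficients, before rounding, for the linear map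
of matrix `Φ` on the slots. -/
def coeffMatrix (Φ : Matrix (Fin P.slots) (Fin P.slots) ℂ) (k l : Fin P.n) : ℝ :=
  2 / (P.n : ℝ) * (∑ j, (starRingEnd ℂ (P.root j)) ^ (k : ℕ) *
    ∑ i, Φ j i * P.root i ^ (l : ℕ)).re

/-- `Encode ∘ (r · φ) ∘ Decode` on polynomials, in fixed-point arithmetic with `prec` fractional
bits; `r` is the factor that changes the scale. -/
def transform (Φ : Matrix (Fin P.slots) (Fin P.slots) ℂ) (r : ℝ) (v : P.Poly) : P.Poly :=
  fun k => roundDiv (∑ l, round ((2 : ℝ) ^ P.prec * (r * P.coeffMatrix Φ k l)) * v l) (2 ^ P.prec)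

def unifPoly (B : ℕ) : PMF P.Poly := vecDist P.n (unif B)

def ternaryPoly : PMF P.Poly := vecDist P.n ternary

def errPoly : PMF P.Poly := vecDist P.n gaussErr

/-- Digit `t`, in radix `base`, of the coefficients of `v`. -/
def digit (t : ℕ) (v : P.Poly) : P.Poly := fun j => v j / (P.base : ℤ) ^ t % (P.base : ℤ)

end Params

/-- A ciphertext `(c0, c1)` with its (public) level and scale; it encrypts `c0 + s * c1`. -/
structure Ct (P : Params) where
  c0 : P.Poly
  c1 : P.Poly
  lvl : ℕ
  scale : ℝ

/-- The public keys: the collective encryption key, the relinearization key (digit-wise encryptions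
of `s^2`) and, for every `k`, the key for rotations by `k` (digit-wise encryptions of `τ_k(s)`). -/
structure PubKeys (P : Params) where
  pk0 : P.Poly
  pk1 : P.Poly
  rlk : Fin P.digits → P.Poly × P.Poly
  rot : Fin P.slots → Fin P.digits → P.Poly × P.Poly

namespace Ct

variable {P : Params}

/-- `Add`. -/
def add (c d : Ct P) : Ct P where
  c0 := red (P.Q (min c.lvl d.lvl)) (c.c0 + d.c0)
  c1 := red (P.Q (min c.lvl d.lvl)) (c.c1 + d.c1)
  lvl := min c.lvl d.lvl
  scale := max c.scale d.scale

/-- `Sub`. -/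
def sub (c d : Ct P) : Ct P where
  c0 := red (P.Q (min c.lvl d.lvl)) (c.c0 - d.c0)
  c1 := red (P.Q (min c.lvl d.lvl)) (c.c1 - d.c1)
  lvl := min c.lvl d.lvl
  scale := max c.scale d.scale

/-- A plaintext `p` of scale `s`, as a ciphertext without randomness. -/
def ofPlain (p : P.Poly) (s : ℝ) : Ct P where
  c0 := p
  c1 := 0
  lvl := P.L
  scale := s

/-- `Mul_pt`, for a plaintext `p` of scale `s`. -/
def mulPt (c : Ct P) (p : P.Poly) (s : ℝ) : Ct P where
  c0 := red (P.Q c.lvl) (nmul c.c0 p)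
  c1 := red (P.Q c.lvl) (nmul c.c1 p)
  lvl := c.lvl
  scale := c.scale * s

/-- The local key switch `KS`: `v`, whose coefficients lie in `{0, …, Q_L - 1}`, is decomposed into
digits, which are multiplied with the entries of the switching key. -/
def keySwitch (K : Fin P.digits → P.Poly × P.Poly) (v : P.Poly) : P.Poly × P.Poly :=
  (∑ t : Fin P.digits, nmul (P.digit t v) (K t).1,
    ∑ t : Fin P.digits, nmul (P.digit t v) (K t).2)

/-- `Mul_ct`, with relinearization. -/
def mul (K : PubKeys P) (c d : Ct P) : Ct P :=
  let l := min c.lvl d.lvl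
  let r := keySwitch K.rlk (red (P.Q l) (nmul c.c1 d.c1))
  { c0 := red (P.Q l) (nmul c.c0 d.c0 + r.1)
    c1 := red (P.Q l) (nmul c.c0 d.c1 + nmul c.c1 d.c0 + r.2)
    lvl := l
    scale := c.scale * d.scale }

/-- `RotL`: rotation of the slots by `k` to the left (to the right by `k` is to the left by
`slots - k`). -/
def rotL (K : PubKeys P) (k : Fin P.slots) (c : Ct P) : Ct P :=
  let r := keySwitch (K.rot k) (red (P.Q c.lvl) (substPow (5 ^ (k : ℕ)) c.c1))
  { c0 := red (P.Q c.lvl) (substPow (5 ^ (k : ℕ)) c.c0 + r.1)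
    c1 := red (P.Q c.lvl) r.2
    lvl := c.lvl
    scale := c.scale }

/-- `Res`: division by the last prime of the modulus (nothing is done at level `0`). -/
def res (c : Ct P) : Ct P :=
  if c.lvl = 0 then c else
  { c0 := red (P.Q (c.lvl - 1)) fun j => roundDiv (c.c0 j) (P.q c.lvl)
    c1 := red (P.Q (c.lvl - 1)) fun j => roundDiv (c.c1 j) (P.q c.lvl)
    lvl := c.lvl - 1
    scale := c.scale / P.q c.lvl }

/-- `SetScale`: multiplication by an integer and `Res`, so that the scale becomes `s`. -/
def setScale (c : Ct P) (s : ℝ) : Ct P :=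
  let t : ℤ := round (s * P.q c.lvl / c.scale)
  { res { c with c0 := red (P.Q c.lvl) (t • c.c0), c1 := red (P.Q c.lvl) (t • c.c1) } with
    scale := s }

end Ct

/-! ## 3. The security level

CKKS encrypts `m` under the secret `s` as `(-s a + e + m, a)`.  All that is published about a secret
key in this setting (key shares, relinearization and rotation keys, refreshed ciphertexts) has this
form, often with an `m` that depends on `s`.  So semantic security is required for key-dependent
messages (circular security): the adversary adaptively submits classical functions, is handed for
each of them an encryption of the function's value at (secret, answers so far), and tries to tell
these encryptions from uniform pairs.  With the functions that are identically `0` this is the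
decisional RLWE problem. -/

section Security

variable (P : Params)

/-- The message that a query asks to encrypt. -/
def WordFn.poly (f : WordFn) (x : List ℤ) : P.Poly := fun j => (f.eval x).getD j 0

/-- Answers with encryptions under `s`; `tr` holds the answers so far. -/
def encAnswers (s : P.Poly) : List WordFn → List ℤ → PMF (List ℤ)
  | [], tr => pure tr
  | f :: fs, tr => do
      let a ← P.unifPoly P.QL
      let e ← P.errPoly
      let b := red P.QL (-(nmul s a) + e + f.poly P (List.ofFn s ++ tr))
      encAnswers s fs (tr ++ List.ofFn a ++ List.ofFn b)

/-- Answers to `k` queries with uniform pairs. -/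
def unifAnswers : ℕ → List ℤ → PMF (List ℤ)
  | 0, tr => pure tr
  | k + 1, tr => do
      let a ← P.unifPoly P.QL
      let b ← P.unifPoly P.QL
      unifAnswers k (tr ++ List.ofFn a ++ List.ofFn b)

/-- The parameters ensure `lam` bits of post-quantum security: a quantum adversary of total cost `T`
has advantage at most `T / 2 ^ lam`. -/
def SecurityLevel (lam : ℕ) : Prop :=
  ∀ (fs : List WordFn) (D : Distinguisher),
    D.adv (P.ternaryPoly.bind fun s => encAnswers P s fs []) (unifAnswers P fs.length []) ≤
      (((fs.map fun f => f.cost + 2 * P.n).sum + D.cost : ℕ) : ℝ) / 2 ^ lam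

end Security

/-! ## 4. The protocol -/

/-- A plaintext operand: a message of the party's own data (at scale `S`), or a public message at a
public scale. -/
inductive Operand (P : Params) (d : ℕ) where
  | own (t : Fin d)
  | const (z : P.Msg) (s : ℝ)

/-- The instructions of a local gradient computation.  Each of them appends one ciphertext to the
registers; natural numbers are indices of registers.  `boot a Φ B` is the distributed bootstrapping
with the linear transformation `Φ` (`DBootstrapALT`; `Φ = 1` is `DBootstrap`), where `B` is the bound
on the message that determines the size of the masks. -/
inductive Instr (P : Params) (d : ℕ) where
  | add (a b : ℕ)
  | sub (a b : ℕ)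
  | mul (a b : ℕ)
  | addPt (a : ℕ) (p : Operand P d)
  | ptSub (p : Operand P d) (a : ℕ)
  | mulPt (a : ℕ) (p : Operand P d)
  | rotL (a : ℕ) (k : Fin P.slots)
  | res (a : ℕ)
  | setScale (a : ℕ) (s : ℝ)
  | boot (a : ℕ) (Φ : Matrix (Fin P.slots) (Fin P.slots) ℂ) (B : ℕ)

/-- What the parties agree upon: `N` parties with `d` packed data messages each, weights packed in
`nW` messages, `m` global iterations with local batches of `b` samples, learning rate `η`, the
security parameter `lam`; for every iteration and party the program `lgd` that computes the local
gradients from the weights (in the registers `0, …, nW - 1`) and the registers `out` that hold them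
in the end; the bound `B` on messages in the bootstrapping of updated weights. -/
structure Training (P : Params) where
  N : ℕ
  N_pos : 0 < N
  d : ℕ
  nW : ℕ
  m : ℕ
  b : ℕ
  η : ℝ
  lam : ℕ
  lgd : Fin m → Fin N → List (Instr P d)
  out : Fin m → Fin N → Fin nW → ℕ
  B : ℕ

/-- The input of a party: its packed data (samples and labels) and, used for the first party only,
the initial weights. -/
structure Input (P : Params) (d nW : ℕ) where
  data : Fin d → P.Msg
  w0 : Fin nW → P.Msg

/-- What a run leaves behind: the values sent over the network (owner `none`) and the random values
drawn by each party `i` (owner `some i`), in order; and whether every bootstrapped ciphertext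
has respected its bound. -/
structure Trace (P : Params) (N : ℕ) where
  log : List (Option (Fin N) × P.Poly)
  ok : Bool

abbrev Run (P : Params) (N : ℕ) := StateT (Trace P N) PMF

section Protocol

variable {P : Params} {N : ℕ}

/-- Record a value. -/
def note (o : Option (Fin N)) (v : P.Poly) : Run P N Unit :=
  modify fun t => { t with log := t.log ++ [(o, v)] }

/-- Send a ciphertext over the network. -/
def send (c : Ct P) : Run P N Unit := do
  note none c.c0
  note none c.c1

/-- A random value drawn by party `i`. -/
def draw (i : Fin N) (μ : PMF P.Poly) : Run P N P.Poly := do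
  let v ← (StateT.lift μ : Run P N P.Poly)
  note (some i) v
  pure v

/-- A uniform polynomial of the common reference string. -/
def crs : Run P N P.Poly := do
  let a ← (StateT.lift (P.unifPoly P.QL) : Run P N P.Poly)
  note none a
  pure a

/-- A switching key for the collective secret `s`: the encryptions of `base ^ t * msg`. -/
def switchKey (s msg : P.Poly) : Run P N (Fin P.digits → P.Poly × P.Poly) :=
  seqFin fun t => do
    let a ← crs
    let e ← (StateT.lift P.errPoly : Run P N P.Poly)
    let b := red P.QL (-(nmul s a) + e + ((P.base : ℤ) ^ (t : ℕ)) • msg)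
    note none b
    pure (b, a)

/-- Key generation: `SecKeyGen` by every party, `DKeyGen`, and the keys of the local key switch.
Returns the secret shares and the public keys. -/
def keyGen : Run P N ((Fin N → P.Poly) × PubKeys P) := do
  let sk ← seqFin fun i : Fin N => draw i P.ternaryPoly
  let a ← crs
  let shares ← seqFin fun i : Fin N => do
    let e ← draw i P.errPoly
    let p := red P.QL (-(nmul (sk i) a) + e)
    note none p
    pure p
  let s := ∑ i, sk i
  let rlk ← switchKey s (nmul s s)
  let rot ← seqFin fun k : Fin P.slots => switchKey s (substPow (5 ^ (k : ℕ)) s)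
  pure (sk, { pk0 := red P.QL (∑ i, shares i), pk1 := a, rlk := rlk, rot := rot })

/-- Re-randomization by party `i`: a fresh encryption of `0` under the collective key is added. -/
def rerandomize (K : PubKeys P) (i : Fin N) (c : Ct P) : Run P N (Ct P) := do
  let u ← draw i P.ternaryPoly
  let e0 ← draw i P.errPoly
  let e1 ← draw i P.errPoly
  pure { c with
    c0 := red (P.Q c.lvl) (c.c0 + nmul K.pk0 u + e0)
    c1 := red (P.Q c.lvl) (c.c1 + nmul K.pk1 u + e1) }

/-- `Enc` of a message at scale `S` by party `i`. -/
def encrypt (K : PubKeys P) (i : Fin N) (z : P.Msg) : Run P N (Ct P) :=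
  rerandomize K i (Ct.ofPlain (P.encode P.S z) P.S)

/-- Whether `c`, at level `l`, decrypts to a polynomial with coefficients of absolute value at most
`B`. -/
def phaseLE (sk : Fin N → P.Poly) (B : ℕ) (c : Ct P) : Bool :=
  decide (∀ j, |Int.bmod ((c.c0 + nmul (∑ i, sk i) c.c1) j) (P.Q c.lvl)| ≤ (B : ℤ))

/-- Distributed bootstrapping with a linear transformation.  Party `i0`, who holds `c`, re-randomizes
it and sends it to all; every party answers with its two shares.  The result has the initial level
and the initial scale. -/
def bootstrap (sk : Fin N → P.Poly) (K : PubKeys P) (lam : ℕ) (i0 : Fin N)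
    (Φ : Matrix (Fin P.slots) (Fin P.slots) ℂ) (B : ℕ) (c : Ct P) : Run P N (Ct P) := do
  let c ← rerandomize K i0 c
  send c
  modify fun t => { t with ok := t.ok && phaseLE sk B c }
  let a ← crs
  let φ := P.transform Φ (P.S / c.scale)
  let h ← seqFin fun i : Fin N => do
    let M ← draw i (P.unifPoly (B * 2 ^ lam))
    let e0 ← draw i P.errPoly
    let e1 ← draw i P.errPoly
    let h0 := red (P.Q c.lvl) (nmul (sk i) c.c1 + M + e0)
    let h1 := red P.QL (-(nmul (sk i) a) - φ M + e1)
    note none h0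
    note none h1
    pure (h0, h1)
  let z := red (P.Q c.lvl) (c.c0 + ∑ i, (h i).1)
  pure { c0 := red P.QL (φ z + ∑ i, (h i).2), c1 := a, lvl := P.L, scale := P.S }

/-- The plaintext of an operand and its scale. -/
def Operand.plain {d : ℕ} (own : Fin d → P.Msg) : Operand P d → P.Poly × ℝ
  | .own t => (P.encode P.S (own t), P.S)
  | .const z s => (P.encode s z, s)

/-- One instruction of a local gradient computation of party `i`. -/
def step (sk : Fin N → P.Poly) (K : PubKeys P) (lam : ℕ) (i : Fin N) {d : ℕ}
    (own : Fin d → P.Msg) (regs : List (Ct P)) (I : Instr P d) : Run P N (Ct P) :=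
  let r : ℕ → Ct P := fun a => regs.getD a (Ct.ofPlain 0 P.S)
  match I with
  | .add a b => pure ((r a).add (r b))
  | .sub a b => pure ((r a).sub (r b))
  | .mul a b => pure ((r a).mul K (r b))
  | .addPt a p => pure ((r a).add (Ct.ofPlain (p.plain own).1 (p.plain own).2))
  | .ptSub p a => pure ((Ct.ofPlain (p.plain own).1 (p.plain own).2).sub (r a))
  | .mulPt a p => pure ((r a).mulPt (p.plain own).1 (p.plain own).2)
  | .rotL a k => pure ((r a).rotL K k)
  | .res a => pure (r a).res
  | .setScale a s => pure ((r a).setScale s)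
  | .boot a Φ B => bootstrap sk K lam i Φ B (r a)

/-- A local gradient computation of party `i`. -/
def runLocal (sk : Fin N → P.Poly) (K : PubKeys P) (lam : ℕ) (i : Fin N) {d : ℕ}
    (own : Fin d → P.Msg) : List (Instr P d) → List (Ct P) → Run P N (List (Ct P))
  | [], regs => pure regs
  | I :: Is, regs => do
      let c ← step sk K lam i own regs I
      runLocal sk K lam i own Is (regs ++ [c])

end Protocol

namespace Training

variable {P : Params} (T : Training P)

/-- The inputs of all parties. -/
abbrev Inputs := Fin T.N → Input P T.d T.nW

/-- The first party, the root of the network. -/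
def first : Fin T.N := ⟨0, T.N_pos⟩

/-- One global iteration, on the encrypted weights `W`.  Every ciphertext sent is re-randomized. -/
def iteration (sk : Fin T.N → P.Poly) (K : PubKeys P) (x : T.Inputs) (k : Fin T.m)
    (W : Fin T.nW → Ct P) : Run P T.N (Fin T.nW → Ct P) := do
  -- MAP: the first party sends the weights, every party computes its local gradients
  let W ← seqFin fun j => do
    let c ← rerandomize K T.first (W j)
    send c
    pure c
  let G ← seqFin fun i => do
    let regs ← runLocal sk K T.lam i (x i).data (T.lgd k i) (List.ofFn W)
    -- COMBINE: every party sends its encrypted local gradients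
    seqFin fun j : Fin T.nW => do
      let c ← rerandomize K i (regs.getD (T.out k i j) (Ct.ofPlain 0 P.S))
      send c
      pure c
  -- REDUCE: the first party updates and refreshes the weights
  seqFin fun j => do
    let g := (List.ofFn fun i => G i j).foldl Ct.add
      { c0 := 0, c1 := 0, lvl := P.L, scale := 0 }
    -- dividing by `b N / η` only changes the scale
    let g := { g with scale := g.scale * (T.b * T.N / T.η) }
    bootstrap sk K T.lam T.first 1 T.B ((W j).add (g.setScale (W j).scale))

/-- The collective training; returns the encrypted trained weights. -/
def protocol (x : T.Inputs) : Run P T.N (Fin T.nW → Ct P) := do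
  let (sk, K) ← keyGen
  let W ← seqFin fun j => encrypt K T.first ((x T.first).w0 j)
  (List.finRange T.m).foldlM (fun W k => T.iteration sk K x k W) W

/-- The distribution of the trace of a run on the inputs `x`. -/
def trace (x : T.Inputs) : PMF (Trace P T.N) :=
  ((T.protocol x).run { log := [], ok := true }).map Prod.snd

/-! ## 5. Confidentiality -/

/-- The inputs of the parties in `A`, encoded. -/
def inputsOf (A : Finset (Fin T.N)) (x : T.Inputs) : List ℤ :=
  (List.finRange T.N).flatMap fun i =>
    if i ∈ A then
      ((List.finRange T.d).flatMap fun t => List.ofFn (P.encode P.S ((x i).data t))) ++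
        (if i = T.first then
          (List.finRange T.nW).flatMap fun t => List.ofFn (P.encode P.S ((x i).w0 t))
        else [])
    else []

/-- The view of the coalition `A` in a run on the inputs `x`: the inputs of its members, all the
random values they draw, and everything that is sent over the network by anyone. -/
def view (A : Finset (Fin T.N)) (x : T.Inputs) : PMF (List ℤ) :=
  (T.trace x).map fun t =>
    T.inputsOf A x ++ t.log.flatMap fun p =>
      if p.1.elim true (fun i => decide (i ∈ A)) then List.ofFn p.2 else []

/-- The probability that some ciphertext exceeds its bound when it is bootstrapped. -/
def overflow (x : T.Inputs) : ENNReal :=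
  ((T.trace x).map Trace.ok) false

/-! The training on plaintexts: this is what an ideal trusted party would compute. -/

/-- The message of an operand. -/
def _root_.Poseidon.Operand.msg {d : ℕ} (own : Fin d → P.Msg) : Operand P d → P.Msg
  | .own t => own t
  | .const z _ => z

/-- The effect of an instruction on the encrypted messages. -/
def plainStep {d : ℕ} (own : Fin d → P.Msg) (regs : List P.Msg) (I : Instr P d) : P.Msg :=
  let r : ℕ → P.Msg := fun a => regs.getD a 0
  match I with
  | .add a b => r a + r b
  | .sub a b => r a - r b
  | .mul a b => r a * r b
  | .addPt a p => r a + p.msg own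
  | .ptSub p a => p.msg own - r a
  | .mulPt a p => r a * p.msg own
  | .rotL a k => fun j => r a ⟨((j : ℕ) + k) % P.slots, Nat.mod_lt _ (Nat.two_pow_pos _)⟩
  | .res a => r a
  | .setScale a _ => r a
  | .boot a Φ _ => Φ.mulVec (r a)

/-- One global iteration on plaintext weights. -/
def plainIteration (x : T.Inputs) (W : Fin T.nW → P.Msg) (k : Fin T.m) : Fin T.nW → P.Msg :=
  let regs : Fin T.N → List P.Msg := fun i =>
    (T.lgd k i).foldl (fun regs I => regs ++ [plainStep (x i).data regs I]) (List.ofFn W)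
  fun j => W j + ((T.η / (T.b * T.N) : ℝ) : ℂ) • ∑ i, (regs i).getD (T.out k i j) 0

/-- The weights of the trained model. -/
def trainedModel (x : T.Inputs) : Fin T.nW → P.Msg :=
  (List.finRange T.m).foldl (T.plainIteration x) (x T.first).w0

/-- A measure of the size of the protocol. -/
def size : ℕ :=
  T.N + P.n + P.L + Nat.size P.QL + Nat.size P.base + P.prec + T.d + T.nW + T.m + T.lam +
    Nat.size T.B +
    ∑ k, ∑ i, ((T.lgd k i).map fun I => match I with
      | .boot _ _ B => 1 + Nat.size B
      | _ => 1).sum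

end Training

/-- The elementary random choices of a simulator. -/
inductive Coin where
  | unif (B : ℕ)
  | gauss

def Coin.dist : Coin → PMF ℤ
  | .unif B => Poseidon.unif B
  | .gauss => gaussErr

def Coin.cost : Coin → ℕ
  | .unif B => 1 + Nat.size B
  | .gauss => 1

/-- A simulator: a classical program applied to its input and to random coins. -/
structure Simulator where
  coins : List Coin
  fn : WordFn

def Simulator.run (Sim : Simulator) (x : List ℤ) : PMF (List ℤ) :=
  (Sim.coins.mapM Coin.dist).map fun r => Sim.fn.eval (x ++ r)

def Simulator.cost (Sim : Simulator) : ℕ := (Sim.coins.map Coin.cost).sum + Sim.fn.cost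

/-- In the ideal world a trusted party receives all inputs and trains the model, and the coalition
`A` receives nothing.  `T.Simulates A Adm Sim ε secret` says that `Sim`, knowing only the inputs of
`A`, produces the view of `A`, up to the advantage `ε c` for quantum distinguishers of cost `c`, even
jointly with any information about the `secret`, for inputs from any distribution on the
admissible ones. -/
def Training.Simulates {P : Params} (T : Training P) (A : Finset (Fin T.N))
    (Adm : Fin T.N → Set (Input P T.d T.nW)) (Sim : Simulator) (ε : ℕ → ℝ)
    {σ : Type} (secret : T.Inputs → σ) : Prop :=
  ∀ μ : PMF T.Inputs, (∀ x ∈ μ.support, ∀ i, x i ∈ Adm i) →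
    ∀ (aux : σ → List ℤ) (D : Distinguisher),
      D.adv
        (μ.bind fun x => (T.view A x).map fun v => v ++ aux (secret x))
        (μ.bind fun x => (Sim.run (T.inputsOf A x)).map fun v => v ++ aux (secret x)) ≤ ε D.cost

/-- Data confidentiality: the secret is all that the honest parties feed into the training. -/
def Training.DataConfidential {P : Params} (T : Training P) (A : Finset (Fin T.N))
    (Adm : Fin T.N → Set (Input P T.d T.nW)) (Sim : Simulator) (ε : ℕ → ℝ) : Prop :=
  T.Simulates A Adm Sim ε fun (x : T.Inputs) (i : {i // i ∉ A}) => x i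

/-- Model confidentiality: the secret is the trained model. -/
def Training.ModelConfidential {P : Params} (T : Training P) (A : Finset (Fin T.N))
    (Adm : Fin T.N → Set (Input P T.d T.nW)) (Sim : Simulator) (ε : ℕ → ℝ) : Prop :=
  T.Simulates A Adm Sim ε T.trainedModel

end Poseidon

end

/-! Fix a party `h` outside `A`. The collective secret is `s + ∑ i, ρ i`, where `s` is the share of
`h` and `ρ` consists of the other shares, with `0` in place `h`. Everything published that involves
`s` can be brought into the form of a CKKS encryption under `s` of a message that depends on `s` and
on earlier values, corrected by terms that need no knowledge of `s`. For the key share and the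
switching keys this is algebra (`rel_keyPair`, `rel_switchKey`). In a bootstrapping, `h` hides two
shares with the same mask `M`. If `M` is replaced by `M - phase`, where the phase is the message in
the ciphertext, then `s` cancels from the first share, and the second share becomes an encryption of
`-φ (M - phase)`. As the mask is uniform on an interval `2 ^ λ` times as long as the bound on the
phase, this replacement costs `2 ^ (-λ)` per coefficient (`ex_unif_le_shift`, `rel_refresh`). Runs
in which the bound fails are paid for by `overflow`.

Hence the view is close to the outcome of a game `gTotal` in which `s` occurs only inside an
encryption oracle (`ex_view_le`, `near_view`). Circular security replaces all the answers of the
oracle with uniform pairs (`near_kdm`), after which nothing visible depends on `s`. Now the public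
key is a uniform pair, so a re-randomization `(pk0 u + e0, pk1 u + e1)` by an honest party adds two
RLWE samples with secret `u`. By the same assumption with zero messages these may be taken uniform,
and then they hide the ciphertext perfectly. The honest re-randomizations are replaced one at a time
(`near_rer`, `near_ideal`). What remains visible involves the inputs of the coalition and random
coins only, and a simulator can produce it (`exists_simulator`).

All this holds for each fixed input and each fixed list appended to the view. Averaging over the
inputs therefore yields both kinds of confidentiality with the same simulator (`near_view_ideal`,
`exists_simulates`).

The assumption charges for every instruction of an adversary, so each reduction has to be an
explicit word program. This is possible because the course of the game does not depend on random
values: `Prog.Ok` records one list of operations valid on all branches. With the randomness and the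
answers given in advance, the game is a deterministic function `Prog.eval`, which is translated into
straight-line code (`Runs.gTotal`). Costs are measured by exponents of `κ = T.kappa`; since `κ ≥
64`, constant factors are absorbed by raising an exponent. The translation has a parameter `full`.
If it holds, all data are hard-wired, as the reductions need. If it fails, the code uses only the
data of the coalition, which is possible as soon as every honest ciphertext is overwritten by a
uniform pair before it is sent; this gives the simulator. -/

noncomputable section

namespace Poseidon

open scoped ENNReal

/-! ## Expectations -/

section Expectation

variable {α β γ : Type}

/-- The expectation of a nonnegative function. -/
def ex (μ : PMF α) (F : α → ℝ≥0∞) : ℝ≥0∞ := ∑' a, μ a * F a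

theorem ex_pure (a : α) (F : α → ℝ≥0∞) : ex (PMF.pure a) F = F a := by
  unfold ex
  rw [tsum_eq_single a]
  · simp
  · intro b hb
    simp [PMF.pure_apply, hb]

theorem ex_bind (μ : PMF α) (f : α → PMF β) (F : β → ℝ≥0∞) :
    ex (μ.bind f) F = ex μ fun a => ex (f a) F := by
  unfold ex
  simp only [PMF.bind_apply, ← ENNReal.tsum_mul_right, ← ENNReal.tsum_mul_left]
  rw [ENNReal.tsum_comm]
  simp only [mul_assoc]

theorem ex_pure' (a : α) (F : α → ℝ≥0∞) : ex (pure a) F = F a := ex_pure a F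

theorem ex_bind' (μ : PMF α) (f : α → PMF β) (F : β → ℝ≥0∞) :
    ex (μ >>= f) F = ex μ fun a => ex (f a) F := ex_bind μ f F

theorem ex_map (μ : PMF α) (f : α → β) (F : β → ℝ≥0∞) :
    ex (μ.map f) F = ex μ fun a => F (f a) := by
  rw [PMF.map, ex_bind]
  simp [ex_pure]

theorem ex_comm (μ : PMF α) (ν : PMF β) (F : α → β → ℝ≥0∞) :
    (ex μ fun a => ex ν fun b => F a b) = ex ν fun b => ex μ fun a => F a b := by
  unfold ex
  simp only [← ENNReal.tsum_mul_left]
  rw [ENNReal.tsum_comm]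
  refine tsum_congr fun b => tsum_congr fun a => ?_
  ring

theorem ex_mono_support {μ : PMF α} {F G : α → ℝ≥0∞} (h : ∀ a ∈ μ.support, F a ≤ G a) :
    ex μ F ≤ ex μ G := by
  refine ENNReal.tsum_le_tsum fun a => ?_
  by_cases ha : μ a = 0
  · simp [ha]
  · gcongr
    exact h a ((PMF.mem_support_iff _ _).2 ha)

theorem ex_mono {μ : PMF α} {F G : α → ℝ≥0∞} (h : ∀ a, F a ≤ G a) : ex μ F ≤ ex μ G :=
  ex_mono_support fun a _ => h a

theorem ex_congr_support {μ : PMF α} {F G : α → ℝ≥0∞} (h : ∀ a ∈ μ.support, F a = G a) :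
    ex μ F = ex μ G :=
  le_antisymm (ex_mono_support fun a ha => (h a ha).le)
    (ex_mono_support fun a ha => (h a ha).ge)

theorem ex_congr {μ : PMF α} {F G : α → ℝ≥0∞} (h : ∀ a, F a = G a) : ex μ F = ex μ G :=
  ex_congr_support fun a _ => h a

theorem ex_add (μ : PMF α) (F G : α → ℝ≥0∞) :
    (ex μ fun a => F a + G a) = ex μ F + ex μ G := by
  unfold ex
  simp only [mul_add]
  exact ENNReal.tsum_add

theorem ex_const (μ : PMF α) (c : ℝ≥0∞) : (ex μ fun _ => c) = c := by
  unfold ex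
  rw [ENNReal.tsum_mul_right, μ.tsum_coe, one_mul]

theorem ex_le {μ : PMF α} {F : α → ℝ≥0∞} {c : ℝ≥0∞} (h : ∀ a, F a ≤ c) : ex μ F ≤ c :=
  (ex_mono h).trans_eq (ex_const μ c)

theorem ex_zero (μ : PMF α) : (ex μ fun _ => 0) = 0 := ex_const μ 0

theorem ex_le_add {μ : PMF α} {F G : α → ℝ≥0∞} {c : ℝ≥0∞}
    (h : ∀ a ∈ μ.support, F a ≤ G a + c) : ex μ F ≤ ex μ G + c := by
  refine (ex_mono_support h).trans_eq ?_
  rw [ex_add, ex_const]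

theorem ex_compl {μ : PMF α} {F : α → ℝ≥0∞} (h : ∀ a, F a ≤ 1) :
    ex μ F + (ex μ fun a => 1 - F a) = 1 := by
  rw [← ex_add]
  simp only [fun a => add_tsub_cancel_of_le (h a), ex_const]

end Expectation

/-! ## Sequences of independent samples -/

section SeqFin

variable {α β : Type}

theorem ex_seqFin_zero (f : Fin 0 → PMF α) (F : (Fin 0 → α) → ℝ≥0∞) :
    ex (seqFin f) F = F Fin.elim0 := ex_pure _ _

theorem ex_seqFin_succ {k : ℕ} (f : Fin (k + 1) → PMF α) (F : (Fin (k + 1) → α) → ℝ≥0∞) :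
    ex (seqFin f) F =
      ex (f 0) fun x => ex (seqFin fun i => f i.succ) fun xs => F (Fin.cons x xs) := by
  rw [seqFin]
  simp only [ex_bind', ex_pure']

/-- By independence, coordinate `h` may be forgotten and drawn afresh. This separates the mask and
the errors of the honest party from those of the others. -/
theorem ex_seqFin_update {k : ℕ} (f : Fin k → PMF α) (h : Fin k) (F : (Fin k → α) → ℝ≥0∞) :
    ex (seqFin f) F =
      ex (seqFin f) fun v => ex (f h) fun w => F (Function.update v h w) := by
  induction k with
  | zero => exact h.elim0
  | succ k ih =>
    rw [ex_seqFin_succ, ex_seqFin_succ]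
    refine Fin.cases ?_ (fun j => ?_) h
    · simp only [Fin.update_cons_zero, ex_const]
      rw [ex_comm]
    · refine ex_congr fun x => ?_
      rw [ih _ j]
      simp only [Fin.cons_update]

theorem ex_seqFin_map {k : ℕ} (f : Fin k → PMF α) (g : Fin k → α → β)
    (F : (Fin k → β) → ℝ≥0∞) :
    (ex (seqFin f) fun v => F fun i => g i (v i)) =
      ex (seqFin fun i => (f i).map (g i)) F := by
  induction k with
  | zero =>
    rw [ex_seqFin_zero, ex_seqFin_zero]
    congr 1
    exact Subsingleton.elim _ _
  | succ k ih =>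
    rw [ex_seqFin_succ, ex_seqFin_succ, ex_map]
    refine ex_congr fun x => ?_
    rw [← ih]
    refine ex_congr fun xs => ?_
    congr 1
    funext i
    refine Fin.cases ?_ (fun j => ?_) i <;> simp

theorem mem_support_seqFin {k : ℕ} {f : Fin k → PMF α} {v : Fin k → α}
    (h : v ∈ (seqFin f).support) (i : Fin k) : v i ∈ (f i).support := by
  induction k with
  | zero => exact i.elim0
  | succ k ih =>
    rw [seqFin] at h
    obtain ⟨x, hx, h⟩ := (PMF.mem_support_bind_iff _ _ _).1 h
    obtain ⟨xs, hxs, h⟩ := (PMF.mem_support_bind_iff _ _ _).1 h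
    have h : v = Fin.cons x xs := (PMF.mem_support_pure_iff _ _).1 h
    subst h
    refine Fin.cases ?_ (fun j => ?_) i
    · simpa using hx
    · simpa using ih hxs j

/-- Exchanging the coordinates of a vector of independent samples one by one. -/
theorem ex_seqFin_le {k : ℕ} {f : Fin k → PMF α} (g : Fin k → α → α) {c : ℝ≥0∞}
    (h : ∀ i (G : α → ℝ≥0∞), (∀ a, G a ≤ 1) → ex (f i) G ≤ (ex (f i) fun a => G (g i a)) + c)
    (F : (Fin k → α) → ℝ≥0∞) (hF : ∀ v, F v ≤ 1) :
    ex (seqFin f) F ≤ (ex (seqFin f) fun v => F fun i => g i (v i)) + k * c := by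
  induction k with
  | zero =>
    rw [ex_seqFin_zero, ex_seqFin_zero]
    refine le_add_right (le_of_eq ?_)
    congr 1
    exact Subsingleton.elim _ _
  | succ k ih =>
    rw [ex_seqFin_succ, ex_seqFin_succ]
    have h1 := fun x => ih (f := fun i => f i.succ) (fun i => g i.succ) (fun i => h i.succ)
      (fun xs => F (Fin.cons x xs)) fun _ => hF _
    -- The first coordinate is exchanged while the others are averaged over; the average is still at
    -- most `1`, as `h 0` requires.
    refine (h 0 _ fun a => ex_le fun v => hF _).trans ?_
    have h2 : (ex (f 0) fun a => ex (seqFin fun i => f i.succ) fun xs => F (Fin.cons (g 0 a) xs)) ≤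
        (ex (f 0) fun a => ex (seqFin fun i => f i.succ) fun xs =>
          F (Fin.cons (g 0 a) fun i => g i.succ (xs i))) + k * c :=
      ex_le_add fun a _ => h1 _
    have h3 : ∀ a (xs : Fin k → α), (fun i => g i ((Fin.cons a xs : Fin (k + 1) → α) i)) =
        Fin.cons (g 0 a) fun i => g i.succ (xs i) := by
      intro a xs
      funext i
      refine Fin.cases ?_ (fun j => ?_) i <;> simp
    simp only [h3]
    calc _ ≤ _ + k * c + c := by gcongr
      _ = _ := by push_cast; ring

end SeqFin

/-! ## The elementary distributions -/

theorem unif_eq_map {B : ℕ} (hB : 0 < B) :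
    unif B = (PMF.uniformOfFinset (Finset.range B) (Finset.nonempty_range_iff.2 hB.ne')).map
      (fun t : ℕ => (t : ℤ)) := by
  rw [unif, dif_pos hB]
  exact PMF.map_id _

theorem ex_unif {B : ℕ} (hB : 0 < B) (F : ℤ → ℝ≥0∞) :
    ex (unif B) F = (B : ℝ≥0∞)⁻¹ * ∑ t ∈ Finset.range B, F t := by
  rw [unif_eq_map hB, ex_map, ex, tsum_eq_sum (s := Finset.range B), Finset.mul_sum]
  · refine Finset.sum_congr rfl fun t ht => ?_
    rw [PMF.uniformOfFinset_apply_of_mem _ ht]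
    simp
  · intro t ht
    rw [PMF.uniformOfFinset_apply_of_notMem _ ht]
    simp

theorem ex_unif_int {B : ℕ} (hB : 0 < B) (F : ℤ → ℝ≥0∞) :
    ex (unif B) F = (B : ℝ≥0∞)⁻¹ * ∑ t ∈ Finset.Ico (0 : ℤ) B, F t := by
  rw [ex_unif hB]
  congr 1
  refine Finset.sum_bij (fun t _ => (t : ℤ)) ?_ ?_ ?_ ?_
  · intro t ht; simpa using ht
  · intro a _ b _ h; exact_mod_cast h
  · intro b hb
    rw [Finset.mem_Ico] at hb
    exact ⟨b.toNat, by simp; omega, by simp; omega⟩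
  · intros; rfl

/-- The upper bound is not strict because `unif 0` is the point mass at `0`. -/
theorem mem_support_unif {B : ℕ} {z : ℤ} (h : z ∈ (unif B).support) : 0 ≤ z ∧ z ≤ B := by
  by_cases hB : 0 < B
  · rw [unif_eq_map hB] at h
    obtain ⟨t, ht, rfl⟩ := (PMF.mem_support_map_iff _ _ _).1 h
    rw [PMF.mem_support_uniformOfFinset_iff, Finset.mem_range] at ht
    omega
  · rw [unif, dif_neg hB] at h
    have h : z = 0 := (PMF.mem_support_pure_iff _ _).1 h
    omega

theorem mem_support_unif_lt {B : ℕ} (hB : 0 < B) {z : ℤ} (h : z ∈ (unif B).support) :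
    0 ≤ z ∧ z < B := by
  rw [unif_eq_map hB] at h
  obtain ⟨t, ht, rfl⟩ := (PMF.mem_support_map_iff _ _ _).1 h
  rw [PMF.mem_support_uniformOfFinset_iff, Finset.mem_range] at ht
  omega

theorem mem_support_ternary {z : ℤ} (h : z ∈ ternary.support) : |z| ≤ 1 := by
  obtain ⟨t, ht, rfl⟩ := (PMF.mem_support_map_iff _ _ _).1 h
  have := mem_support_unif_lt (by norm_num) ht
  rw [abs_le]
  push_cast at this
  omega

theorem mem_support_gaussErr {z : ℤ} (h : z ∈ gaussErr.support) : |z| ≤ 19 := by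
  obtain ⟨t, ht, rfl⟩ := (PMF.mem_support_map_iff _ _ _).1 h
  obtain ⟨s, -, hs⟩ := (PMF.mem_support_bind_iff _ _ _).1 ht
  have hs : t = s := (PMF.mem_support_pure_iff _ _).1 hs
  rw [abs_le]
  have := s.isLt
  omega

/-- The uniform distribution modulo `Q` is invariant under translations and reflections. -/
theorem unif_map_mod {Q : ℕ} (hQ : 0 < Q) (v ε : ℤ) (hε : ε = 1 ∨ ε = -1) (F : ℤ → ℝ≥0∞) :
    (ex (unif Q) fun t => F ((v + ε * t) % Q)) = ex (unif Q) F := by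
  rw [ex_unif_int hQ, ex_unif_int hQ]
  congr 1
  have hQ' : (0 : ℤ) < Q := by exact_mod_cast hQ
  have hεε : ε * ε = 1 := by rcases hε with rfl | rfl <;> norm_num
  -- Modulo `Q` the map `t ↦ v + ε t` has the inverse `t ↦ ε (t - v)`, because `ε * ε = 1`.
  refine Finset.sum_bij' (fun t _ => (v + ε * t) % Q) (fun t _ => (ε * (t - v)) % Q)
    ?_ ?_ ?_ ?_ ?_
  · intro t _
    exact Finset.mem_Ico.2 ⟨Int.emod_nonneg _ hQ'.ne', Int.emod_lt_of_pos _ hQ'⟩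
  · intro t _
    exact Finset.mem_Ico.2 ⟨Int.emod_nonneg _ hQ'.ne', Int.emod_lt_of_pos _ hQ'⟩
  · intro t ht
    rw [Finset.mem_Ico] at ht
    have h1 : (ε * ((v + ε * t) % Q - v)) ≡ t [ZMOD Q] := by
      have h2 : (v + ε * t) % Q ≡ v + ε * t [ZMOD Q] := Int.mod_modEq _ _
      calc _ ≡ ε * (v + ε * t - v) [ZMOD Q] := (h2.sub_right v).mul_left ε
        _ = t := by linear_combination t * hεε
    exact h1.trans (by rfl) |>.eq.trans (Int.emod_eq_of_lt ht.1 ht.2)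
  · intro t ht
    rw [Finset.mem_Ico] at ht
    have h1 : (v + ε * ((ε * (t - v)) % Q)) ≡ t [ZMOD Q] := by
      have h2 : (ε * (t - v)) % Q ≡ ε * (t - v) [ZMOD Q] := Int.mod_modEq _ _
      calc _ ≡ v + ε * (ε * (t - v)) [ZMOD Q] := (h2.mul_left ε).add_left v
        _ = t := by linear_combination (t - v) * hεε
    exact h1.eq.trans (Int.emod_eq_of_lt ht.1 ht.2)
  · intros; rfl

theorem ex_unifVec_mod {n Q : ℕ} (hQ : 0 < Q) (v : Vec n) (ε : ℤ) (hε : ε = 1 ∨ ε = -1)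
    (F : Vec n → ℝ≥0∞) :
    (ex (vecDist n (unif Q)) fun w => F (red Q (v + ε • w))) = ex (vecDist n (unif Q)) F := by
  have h : ∀ i : Fin n, (unif Q).map (fun t => (v i + ε * t) % (Q : ℤ)) = unif Q := by
    intro i
    ext z
    have := unif_map_mod hQ (v i) ε hε fun t => if t = z then 1 else 0
    rw [← ex_map (unif Q) (fun t => (v i + ε * t) % (Q : ℤ)) fun t => if t = z then 1 else 0]
      at this
    simpa [ex] using this
  have := ex_seqFin_map (fun _ : Fin n => unif Q) (fun i t => (v i + ε * t) % (Q : ℤ)) F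
  simp only [h] at this
  exact this

/-- Noise flooding. -/
theorem ex_unif_le_shift {R : ℕ} (m : ℤ) (c : ℝ≥0∞) (hc : (m.natAbs : ℝ≥0∞) ≤ R * c)
    (G : ℤ → ℝ≥0∞) (hG : ∀ t, G t ≤ 1) :
    ex (unif R) G ≤ (ex (unif R) fun t => G (t - m)) + c := by
  -- An empty range forces `m = 0`; this covers masks for the bound `B = 0`.
  rcases Nat.eq_zero_or_pos R with rfl | hR
  · have : m = 0 := by simpa using hc
    subst this
    simp
  rw [ex_unif_int hR, ex_unif_int hR]
  have h1 : ∑ t ∈ Finset.Ico (0 : ℤ) R, G (t - m) = ∑ t ∈ Finset.Ico (-m) (R - m), G t := by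
    refine Finset.sum_bij' (fun t _ => t - m) (fun t _ => t + m) ?_ ?_ ?_ ?_ ?_ <;>
      intro t ht <;> simp only [Finset.mem_Ico] at * <;> omega
  -- The part of `[0, R)` outside the translated window lies in an interval of length `|m|` at one
  -- end.
  have hcard : (Finset.Ico (0 : ℤ) R \ Finset.Ico (-m) (R - m)).card ≤ m.natAbs := by
    rcases le_total 0 m with hm | hm
    · calc _ ≤ (Finset.Ico ((R : ℤ) - m) R).card := by
            refine Finset.card_le_card fun t ht => ?_
            simp only [Finset.mem_sdiff, Finset.mem_Ico] at *
            omega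
        _ ≤ _ := by rw [Int.card_Ico]; omega
    · calc _ ≤ (Finset.Ico (0 : ℤ) (-m)).card := by
            refine Finset.card_le_card fun t ht => ?_
            simp only [Finset.mem_sdiff, Finset.mem_Ico] at *
            omega
        _ ≤ _ := by rw [Int.card_Ico]; omega
  have h2 : ∑ t ∈ Finset.Ico (0 : ℤ) R, G t ≤
      ∑ t ∈ Finset.Ico (-m) (R - m), G t + R * c := by
    calc _ ≤ ∑ t ∈ Finset.Ico (-m) (R - m) ∪ (Finset.Ico (0 : ℤ) R \ Finset.Ico (-m) (R - m)),
          G t := Finset.sum_le_sum_of_subset (by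
            intro t ht
            by_cases h : t ∈ Finset.Ico (-m) (R - m) <;> simp_all)
      _ ≤ _ + ∑ t ∈ Finset.Ico (0 : ℤ) R \ Finset.Ico (-m) (R - m), G t := by
          rw [Finset.sum_union Finset.disjoint_sdiff]
      _ ≤ _ := by
          gcongr
          refine (Finset.sum_le_sum fun t _ => hG t).trans ?_
          rw [Finset.sum_const, nsmul_eq_mul, mul_one]
          exact (Nat.cast_le.2 hcard).trans hc
  calc _ ≤ (R : ℝ≥0∞)⁻¹ * (∑ t ∈ Finset.Ico (-m) (R - m), G t + R * c) := by gcongr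
    _ = _ := by
      rw [h1, mul_add, ← mul_assoc, ENNReal.inv_mul_cancel, one_mul]
      · exact_mod_cast hR.ne'
      · simp

/-! ## Runs of the protocol -/

section Runs

variable {P : Params} {N : ℕ} {α β : Type}

theorem ex_run_pure (a : α) (t : Trace P N) (F : α × Trace P N → ℝ≥0∞) :
    ex ((pure a : Run P N α).run t) F = F (a, t) := ex_pure _ _

theorem ex_run_bind (m : Run P N α) (k : α → Run P N β) (t : Trace P N)
    (F : β × Trace P N → ℝ≥0∞) :
    ex ((m >>= k).run t) F = ex (m.run t) fun p => ex ((k p.1).run p.2) F := by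
  rw [StateT.run_bind, ex_bind']

theorem ex_run_lift (μ : PMF α) (t : Trace P N) (F : α × Trace P N → ℝ≥0∞) :
    ex ((StateT.lift μ : Run P N α).run t) F = ex μ fun a => F (a, t) := by
  rw [StateT.run_lift, ex_bind']
  simp only [ex_pure']

theorem ex_run_note (o : Option (Fin N)) (v : P.Poly) (t : Trace P N)
    (F : Unit × Trace P N → ℝ≥0∞) :
    ex ((note o v).run t) F = F ((), { t with log := t.log ++ [(o, v)] }) := ex_pure _ _

/-- The samples of a sequence of computations may be drawn in advance. -/
theorem ex_run_seqFin {k : ℕ} {f : Fin k → Run P N β} {μ : Fin k → PMF α}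
    {g : Fin k → α → Run P N β}
    (h : ∀ i t F, ex ((f i).run t) F = ex (μ i) fun v => ex ((g i v).run t) F)
    (t : Trace P N) (F : (Fin k → β) × Trace P N → ℝ≥0∞) :
    ex ((seqFin f).run t) F =
      ex (seqFin μ) fun v => ex ((seqFin fun i => g i (v i)).run t) F := by
  induction k generalizing t with
  | zero => rw [ex_seqFin_zero]; rfl
  | succ k ih =>
    rw [ex_seqFin_succ]
    simp only [seqFin, ex_run_bind, ex_run_pure, h]
    refine ex_congr fun v => ?_
    have := fun t => ih (f := fun i => f i.succ) (fun i => h i.succ) t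
    simp only [this, Fin.cons_zero, Fin.cons_succ]
    rw [ex_comm]

/-- Once its samples are fixed, each computation only appends to the log, so the logs are
concatenated. -/
theorem ex_run_seqFin_det {k : ℕ} {f : Fin k → Run P N β} {v : Fin k → β}
    {l : Fin k → List (Option (Fin N) × P.Poly)}
    (h : ∀ i t F, ex ((f i).run t) F = F (v i, { t with log := t.log ++ l i }))
    (t : Trace P N) (F : (Fin k → β) × Trace P N → ℝ≥0∞) :
    ex ((seqFin f).run t) F = F (v, { t with log := t.log ++ (List.ofFn l).flatten }) := by
  induction k generalizing t with
  | zero =>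
    simp only [seqFin, ex_run_pure, List.ofFn_zero, List.flatten_nil, List.append_nil]
    congr 2
    exact Subsingleton.elim _ _
  | succ k ih =>
    have := fun t F => ih (f := fun i => f i.succ) (fun i => h i.succ) t F
    simp only [seqFin, ex_run_bind, ex_run_pure, h, this, List.ofFn_succ, List.flatten_cons,
      List.append_assoc]
    congr 2
    funext i
    refine Fin.cases ?_ (fun j => ?_) i <;> simp

end Runs

/-! ## Arithmetic modulo `Q` -/

theorem Params.Q_pos (P : Params) {l : ℕ} (hl : l ≤ P.L) : 0 < P.Q l :=
  Finset.prod_pos fun i hi => (P.q_prime i (by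
    have := Finset.mem_range.1 hi
    omega)).pos

theorem Params.QL_pos (P : Params) : 0 < P.QL := P.Q_pos le_rfl

theorem Params.Q_dvd (P : Params) {l : ℕ} (hl : l ≤ P.L) : P.Q l ∣ P.QL :=
  Finset.prod_dvd_prod_of_subset _ _ _ (Finset.range_mono (by omega))

theorem red_congr {n Q : ℕ} {v w : Vec n} (h : ∀ j, v j ≡ w j [ZMOD Q]) : red Q v = red Q w :=
  funext fun j => h j

theorem red_modEq {n Q : ℕ} (v : Vec n) (j : Fin n) : red Q v j ≡ v j [ZMOD Q] :=
  Int.mod_modEq _ _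

theorem red_modEq_of_dvd {n Q Q' : ℕ} (h : Q' ∣ Q) (v : Vec n) (j : Fin n) :
    red Q v j ≡ v j [ZMOD Q'] :=
  (red_modEq v j).of_dvd (by exact_mod_cast h)

theorem red_nonneg {n Q : ℕ} (hQ : 0 < Q) (v : Vec n) (j : Fin n) : 0 ≤ red Q v j :=
  Int.emod_nonneg _ (by exact_mod_cast hQ.ne')

theorem red_lt {n Q : ℕ} (hQ : 0 < Q) (v : Vec n) (j : Fin n) : red Q v j < Q :=
  Int.emod_lt_of_pos _ (by exact_mod_cast hQ)

theorem nmul_add {n : ℕ} (u v w : Vec n) : nmul u (v + w) = nmul u v + nmul u w := by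
  funext j
  simp only [nmul, Pi.add_apply, ← Finset.sum_add_distrib]
  refine Finset.sum_congr rfl fun i _ => Finset.sum_congr rfl fun k _ => ?_
  split_ifs <;> ring

theorem nmul_comm {n : ℕ} (u v : Vec n) : nmul u v = nmul v u := by
  funext j
  simp only [nmul]
  rw [Finset.sum_comm]
  refine Finset.sum_congr rfl fun i _ => Finset.sum_congr rfl fun k _ => ?_
  rw [add_comm (k : ℕ), mul_comm]

theorem add_nmul {n : ℕ} (u v w : Vec n) : nmul (u + v) w = nmul u w + nmul v w := by
  rw [nmul_comm, nmul_add, nmul_comm w u, nmul_comm w v]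

theorem nmul_neg {n : ℕ} (u v : Vec n) : nmul u (-v) = -nmul u v := by
  funext j
  simp only [nmul, Pi.neg_apply, ← Finset.sum_neg_distrib]
  refine Finset.sum_congr rfl fun i _ => Finset.sum_congr rfl fun k _ => ?_
  split_ifs <;> ring

theorem nmul_modEq {n Q : ℕ} {u v w : Vec n} (h : ∀ j, v j ≡ w j [ZMOD Q]) (j : Fin n) :
    nmul u v j ≡ nmul u w j [ZMOD Q] := by
  refine Int.ModEq.sum fun i _ => Int.ModEq.sum fun k _ => ?_
  split_ifs
  · exact (h k).mul_left _
  · exact ((h k).mul_left _).neg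
  · rfl

/-! ## Non-adaptive randomized computations with encryption queries -/

/-- The distributions from which the coefficients of random polynomials are drawn. -/
inductive Kind where
  | tern
  | err
  | unif (B : ℕ)

def Kind.dist : Kind → PMF ℤ
  | .tern => ternary
  | .err => gaussErr
  | .unif B => Poseidon.unif B

def Kind.poly (P : Params) (κ : Kind) : PMF P.Poly := vecDist P.n κ.dist

/-- Computations that draw random polynomials (`coin`), ask for encryptions of key-dependent
messages (`query`), re-randomize ciphertexts under the public key `(pk0, pk1)` (`rer`), and make
values visible (`emit`). -/
inductive Prog (P : Params) (α : Type) : Type where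
  | ret (a : α)
  | coin (κ : Kind) (k : P.Poly → Prog P α)
  | query (msg : P.Poly → P.Poly) (k : P.Poly → P.Poly → Prog P α)
  | rer (pk0 pk1 : P.Poly) (c : Ct P) (k : Ct P → Prog P α)
  | emit (l : List ℤ) (k : Prog P α)

/-- The kinds of operations of a computation. -/
inductive Node where
  | coin (κ : Kind)
  | query
  | rer

/-- Three ways to re-randomize a ciphertext: with a fresh encryption of `0`, with a given pair, or
by replacing it with a given pair. -/
inductive Mode where
  | real
  | shift
  | ideal

/-- The random values used by a `coin` or a `rer`. -/
structure Item (P : Params) where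
  mode : Mode
  v0 : P.Poly
  v1 : P.Poly
  v2 : P.Poly

/-- The kinds of items. -/
inductive INode where
  | coin (κ : Kind)
  | rer (m : Mode)

variable {P : Params} {α β : Type}

def Item.act (pk0 pk1 : P.Poly) (t : Item P) (c : Ct P) : Ct P :=
  match t.mode with
  | .real => { c with
      c0 := red (P.Q c.lvl) (c.c0 + nmul pk0 t.v0 + t.v1)
      c1 := red (P.Q c.lvl) (c.c1 + nmul pk1 t.v0 + t.v2) }
  | .shift => { c with
      c0 := red (P.Q c.lvl) (c.c0 + t.v0)
      c1 := red (P.Q c.lvl) (c.c1 + t.v1) }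
  | .ideal => { c with
      c0 := red (P.Q c.lvl) t.v0
      c1 := red (P.Q c.lvl) t.v1 }

theorem Item.act_lvl (pk0 pk1 : P.Poly) (t : Item P) (c : Ct P) :
    (t.act pk0 pk1 c).lvl = c.lvl := by
  unfold Item.act
  split <;> rfl

/-- The value read when the list of items is exhausted; it makes evaluation total. -/
def Item.zero (P : Params) : Item P := ⟨.ideal, 0, 0, 0⟩

def INode.dist (P : Params) : INode → PMF (Item P)
  | .coin κ => (κ.poly P).map fun v => ⟨.ideal, v, 0, 0⟩
  | .rer .real => (Kind.tern.poly P).bind fun u => (Kind.err.poly P).bind fun e0 =>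
      (Kind.err.poly P).map fun e1 => ⟨.real, u, e0, e1⟩
  | .rer m => ((Kind.unif P.QL).poly P).bind fun b0 =>
      ((Kind.unif P.QL).poly P).map fun b1 => ⟨m, b0, b1, 0⟩

def itemsDist (P : Params) : List INode → PMF (List (Item P))
  | [] => PMF.pure []
  | ν :: νs => (ν.dist P).bind fun t => (itemsDist P νs).map fun ts => t :: ts

def ansDist (P : Params) : ℕ → PMF (List (P.Poly × P.Poly))
  | 0 => PMF.pure []
  | k + 1 => ((Kind.unif P.QL).poly P).bind fun a => ((Kind.unif P.QL).poly P).bind fun b =>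
      (ansDist P k).map fun ans => (a, b) :: ans

/-- The items that a computation needs, with genuine re-randomizations. -/
def itemNodes : List Node → List INode
  | [] => []
  | .coin κ :: ns => .coin κ :: itemNodes ns
  | .query :: ns => itemNodes ns
  | .rer :: ns => .rer .real :: itemNodes ns

/-- The number of queries. -/
def queries : List Node → ℕ
  | [] => 0
  | .query :: ns => queries ns + 1
  | .coin _ :: ns => queries ns
  | .rer :: ns => queries ns

namespace Prog

def bind : Prog P α → (α → Prog P β) → Prog P β
  | .ret a, f => f a
  | .coin κ k, f => .coin κ fun v => (k v).bind f
  | .query msg k, f => .query msg fun a b => (k a b).bind f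
  | .rer pk0 pk1 c k, f => .rer pk0 pk1 c fun c' => (k c').bind f
  | .emit l k, f => .emit l (k.bind f)

instance : Monad (Prog P) where
  pure := Prog.ret
  bind := Prog.bind

/-- `Ok R I ns p`: the operations of `p` are of the kinds `ns`, whatever the random values are;
every result satisfies `I`; every public key that is used satisfies `R`. -/
inductive Ok (R : P.Poly → P.Poly → Prop) (I : α → Prop) : List Node → Prog P α → Prop
  | ret {a : α} : I a → Ok R I [] (.ret a)
  | coin {κ : Kind} {k : P.Poly → Prog P α} {ns : List Node} :
      (∀ v, Ok R I ns (k v)) → Ok R I (.coin κ :: ns) (.coin κ k)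
  | query {msg : P.Poly → P.Poly} {k : P.Poly → P.Poly → Prog P α} {ns : List Node} :
      (∀ a b, Ok R I ns (k a b)) → Ok R I (.query :: ns) (.query msg k)
  | rer {pk0 pk1 : P.Poly} {c : Ct P} {k : Ct P → Prog P α} {ns : List Node} :
      R pk0 pk1 → c.lvl ≤ P.L → (∀ c', c'.lvl = c.lvl → Ok R I ns (k c')) →
        Ok R I (.rer :: ns) (.rer pk0 pk1 c k)
  | emit {l : List ℤ} {k : Prog P α} {ns : List Node} :
      Ok R I ns k → Ok R I ns (.emit l k)

variable {R R' : P.Poly → P.Poly → Prop} {I : α → Prop} {J : β → Prop}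

theorem Ok.bind {ns ns' : List Node} {p : Prog P α} {f : α → Prog P β} (hp : Ok R I ns p)
    (hf : ∀ a, I a → Ok R J ns' (f a)) : Ok R J (ns ++ ns') (p >>= f) := by
  induction hp with
  | ret h => exact hf _ h
  | coin _ ih => exact .coin ih
  | query _ ih => exact .query ih
  | rer h1 h2 _ ih => exact .rer h1 h2 ih
  | emit _ ih => exact .emit ih

theorem Ok.mono {I' : α → Prop} {ns : List Node} {p : Prog P α} (hp : Ok R I ns p)
    (hR : ∀ u v, R u v → R' u v) (hI : ∀ a, I a → I' a) : Ok R' I' ns p := by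
  induction hp with
  | ret h => exact .ret (hI _ h)
  | coin _ ih => exact .coin ih
  | query _ ih => exact .query ih
  | rer h1 h2 _ ih => exact .rer (hR _ _ h1) h2 ih
  | emit _ ih => exact .emit ih

/-- The pair that answers a query under the secret `s`. -/
def encKernel (s : P.Poly) (msg : P.Poly → P.Poly) : PMF (P.Poly × P.Poly) :=
  (P.unifPoly P.QL).bind fun a => P.errPoly.map fun e =>
    (a, red P.QL (-(nmul s a) + e + msg s))

/-- A uniform pair. -/
def unifKernel (_ : P.Poly → P.Poly) : PMF (P.Poly × P.Poly) :=
  (P.unifPoly P.QL).bind fun a => (P.unifPoly P.QL).map fun b => (a, b)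

variable (K : (P.Poly → P.Poly) → PMF (P.Poly × P.Poly))

/-- The expectation of `F`, applied to the result and the visible values, when queries are answered
according to `K` and re-randomizations are genuine. -/
def wp : Prog P α → (α → List ℤ → ℝ≥0∞) → List ℤ → ℝ≥0∞
  | .ret a, F, l => F a l
  | .coin κ k, F, l => ex (κ.poly P) fun v => (k v).wp F l
  | .query msg k, F, l => ex (K msg) fun p => (k p.1 p.2).wp F l
  | .rer pk0 pk1 c k, F, l => ex ((INode.rer .real).dist P) fun t => (k (t.act pk0 pk1 c)).wp F l
  | .emit l' k, F, l => k.wp F (l ++ l')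

/-- The same expectation for given items. -/
def wpI : Prog P α → List (Item P) → (α → List ℤ → ℝ≥0∞) → List ℤ → ℝ≥0∞
  | .ret a, _, F, l => F a l
  | .coin _ k, r, F, l => (k (r.headD (Item.zero P)).v0).wpI r.tail F l
  | .query msg k, r, F, l => ex (K msg) fun p => (k p.1 p.2).wpI r F l
  | .rer pk0 pk1 c k, r, F, l => (k ((r.headD (Item.zero P)).act pk0 pk1 c)).wpI r.tail F l
  | .emit l' k, r, F, l => k.wpI r F (l ++ l')

variable {K}

theorem wp_bind (p : Prog P α) (f : α → Prog P β) (F : β → List ℤ → ℝ≥0∞) (l : List ℤ) :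
    wp K (p >>= f) F l = wp K p (fun a => wp K (f a) F) l := by
  induction p generalizing l with
  | ret a => rfl
  | coin κ k ih => exact ex_congr fun v => ih v l
  | query msg k ih => exact ex_congr fun p => ih _ _ l
  | rer pk0 pk1 c k ih => exact ex_congr fun t => ih _ l
  | emit l' k ih => exact ih _

theorem wp_pure (a : α) (F : α → List ℤ → ℝ≥0∞) (l : List ℤ) :
    wp K (pure a : Prog P α) F l = F a l := rfl

theorem wp_seqFin {k : ℕ} (f : Fin k → Kind) (F : (Fin k → P.Poly) → List ℤ → ℝ≥0∞) (l : List ℤ) :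
    wp K (seqFin fun i => (Prog.coin (f i) Prog.ret : Prog P P.Poly)) F l =
      ex (seqFin fun i => (f i).poly P) fun v => F v l := by
  induction k generalizing l with
  | zero => rw [ex_seqFin_zero]; rfl
  | succ k ih =>
    rw [ex_seqFin_succ]
    refine ex_congr fun v => ?_
    have := ih (fun i => f i.succ) (fun xs l => F (Fin.cons v xs) l) l
    exact (wp_bind (seqFin fun i : Fin k => (Prog.coin (f i.succ) Prog.ret : Prog P P.Poly))
      (fun xs => pure (Fin.cons v xs)) F l).trans this

/-- The list `ns` is the same on all branches, so the coins and the randomness of the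
re-randomizations can be drawn before the computation starts. This is where non-adaptivity is used.
-/
theorem wp_eq_ex_wpI {ns : List Node} {p : Prog P α} (hp : Ok R I ns p)
    (F : α → List ℤ → ℝ≥0∞) (l : List ℤ) :
    wp K p F l = ex (itemsDist P (itemNodes ns)) fun r => wpI K p r F l := by
  induction hp generalizing l with
  | ret _ => exact (ex_const _ _).symm
  | coin _ ih =>
    simp only [wp, itemNodes, itemsDist, INode.dist, ex_bind, ex_map, wpI, List.headD_cons,
      List.tail_cons, ih]
  | query _ ih =>
    simp only [wp, itemNodes, wpI, ih]
    rw [ex_comm]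
  | rer _ _ _ ih =>
    simp only [wp, itemNodes, itemsDist, ex_bind, ex_map, wpI, List.headD_cons, List.tail_cons]
    exact ex_congr fun t => ih _ (t.act_lvl _ _ _) l
  | emit _ ih => exact ih _

end Prog

/-! ### Deterministic evaluation -/

/-- The state of a deterministic evaluation: the remaining items and answers to queries, the visible
values and the messages of the queries so far. -/
structure Ev (P : Params) where
  items : List (Item P)
  ans : List (P.Poly × P.Poly)
  log : List ℤ
  msgs : List P.Poly

namespace Prog

variable {R : P.Poly → P.Poly → Prop} {I : α → Prop}

/-- Evaluation for given items and answers; `s` is used for the messages of queries only. -/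
def eval (s : P.Poly) : Prog P α → Ev P → α × Ev P
  | .ret a, σ => (a, σ)
  | .coin _ k, σ => (k (σ.items.headD (Item.zero P)).v0).eval s { σ with items := σ.items.tail }
  | .query msg k, σ => (k (σ.ans.headD (0, 0)).1 (σ.ans.headD (0, 0)).2).eval s
      { σ with ans := σ.ans.tail, msgs := σ.msgs ++ [msg s] }
  | .rer pk0 pk1 c k, σ => (k ((σ.items.headD (Item.zero P)).act pk0 pk1 c)).eval s
      { σ with items := σ.items.tail }
  | .emit l k, σ => k.eval s { σ with log := σ.log ++ l }

theorem eval_bind (s : P.Poly) (p : Prog P α) (f : α → Prog P β) (σ : Ev P) :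
    (p >>= f).eval s σ = (f (p.eval s σ).1).eval s (p.eval s σ).2 := by
  induction p generalizing σ with
  | ret a => rfl
  | coin κ k ih => exact ih _ _
  | query msg k ih => exact ih _ _ _
  | rer pk0 pk1 c k ih => exact ih _ _
  | emit l k ih => exact ih _

/-- Recorded messages are never read again, so earlier ones can be split off. -/
theorem eval_msgs (s : P.Poly) (p : Prog P α) (r : List (Item P)) (ans : List (P.Poly × P.Poly))
    (l : List ℤ) (m m' : List P.Poly) :
    p.eval s ⟨r, ans, l, m ++ m'⟩ =
      ((p.eval s ⟨r, ans, l, m'⟩).1,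
        { (p.eval s ⟨r, ans, l, m'⟩).2 with msgs := m ++ (p.eval s ⟨r, ans, l, m'⟩).2.msgs }) := by
  induction p generalizing r ans l m' with
  | ret a => rfl
  | coin κ k ih => exact ih _ _ _ _ _
  | query msg k ih =>
    simp only [eval, List.append_assoc]
    exact ih _ _ _ _ _ _
  | rer pk0 pk1 c k ih => exact ih _ _ _ _ _
  | emit l k ih => exact ih _ _ _ _

/-- Uniform answers ignore the messages. They too can be drawn in advance, and any `s` whatsoever
may be used in the evaluation. -/
theorem wpI_unifKernel {ns : List Node} {p : Prog P α} (hp : Ok R I ns p) (s : P.Poly)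
    (r : List (Item P)) (F : α → List ℤ → ℝ≥0∞) (l : List ℤ) (m : List P.Poly) :
    wpI unifKernel p r F l = ex (ansDist P (queries ns)) fun ans =>
      F (p.eval s ⟨r, ans, l, m⟩).1 (p.eval s ⟨r, ans, l, m⟩).2.log := by
  induction hp generalizing r l m with
  | ret _ => exact (ex_const _ _).symm
  | coin _ ih => exact ih _ _ _ _
  | query _ ih =>
    simp only [wpI, unifKernel, ex_bind, ex_map, queries, ansDist, eval, List.headD_cons,
      List.tail_cons]
    exact ex_congr fun a => ex_congr fun b => ih _ _ _ _ _
  | rer _ _ _ ih => exact ih _ (Item.act_lvl _ _ _ _) _ _ _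
  | emit _ ih => exact ih _ _ _

end Prog

/-- The answers to queries, as an adversary receives them. -/
def flatAns (ans : List (P.Poly × P.Poly)) : List ℤ :=
  ans.flatMap fun p => List.ofFn p.1 ++ List.ofFn p.2

theorem ex_unifAnswers (k : ℕ) (tr : List ℤ) (G : List ℤ → ℝ≥0∞) :
    ex (unifAnswers P k tr) G = ex (ansDist P k) fun ans => G (tr ++ flatAns ans) := by
  induction k generalizing tr with
  | zero =>
    simp only [unifAnswers, ansDist, ex_pure, ex_pure', flatAns, List.flatMap_nil,
      List.append_nil]
  | succ k ih =>
    simp only [unifAnswers, ansDist, ex_bind, ex_bind', ex_map, ih, flatAns, List.flatMap_cons,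
      List.append_assoc]
    rfl

/-- The coefficients of all the answers lie in `{0, …, Q_L - 1}`. -/
def ValidAns (ans : List (P.Poly × P.Poly)) : Prop :=
  ∀ p ∈ ans, ∀ j, (0 ≤ p.1 j ∧ p.1 j < P.QL) ∧ 0 ≤ p.2 j ∧ p.2 j < P.QL

theorem mem_support_unifPoly {v : P.Poly} (h : v ∈ ((Kind.unif P.QL).poly P).support)
    (j : Fin P.n) : 0 ≤ v j ∧ v j < P.QL :=
  mem_support_unif_lt P.QL_pos (mem_support_seqFin h j)

theorem validAns_of_mem_support {k : ℕ} {ans : List (P.Poly × P.Poly)}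
    (h : ans ∈ (ansDist P k).support) : ans.length = k ∧ ValidAns ans := by
  induction k generalizing ans with
  | zero =>
    obtain rfl : ans = [] := (PMF.mem_support_pure_iff _ _).1 h
    exact ⟨rfl, fun p hp => absurd hp List.not_mem_nil⟩
  | succ k ih =>
    obtain ⟨a, ha, h⟩ := (PMF.mem_support_bind_iff _ _ _).1 h
    obtain ⟨b, hb, h⟩ := (PMF.mem_support_bind_iff _ _ _).1 h
    obtain ⟨ans', h', rfl⟩ := (PMF.mem_support_map_iff _ _ _).1 h
    refine ⟨by simp [(ih h').1], fun p hp j => ?_⟩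
    rcases List.mem_cons.1 hp with rfl | hp
    · exact ⟨mem_support_unifPoly ha j, mem_support_unifPoly hb j⟩
    · exact (ih h').2 p hp j

/-! ### The security game as an oracle, and the three modes of re-randomization -/

namespace Prog

variable {R : P.Poly → P.Poly → Prop} {I : α → Prop}

/-- Queries with key-dependent messages are answered by the adversarial game of the security
level, if the classical functions `fs` compute the messages. -/
theorem ex_encAnswers {ns : List Node} {p : Prog P α} (hp : Ok R I ns p) (s : P.Poly)
    (r : List (Item P)) (F : α → List ℤ → ℝ≥0∞) (l : List ℤ) (fs : List WordFn)
    (hlen : fs.length = queries ns) (tr : List ℤ)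
    (hmsg : ∀ (ans : List (P.Poly × P.Poly)) (f : WordFn), ValidAns ans →
      fs[ans.length]? = some f →
      f.poly P (List.ofFn s ++ (tr ++ flatAns ans)) =
        (p.eval s ⟨r, ans, l, []⟩).2.msgs.getD ans.length 0)
    (G : List ℤ → ℝ≥0∞)
    (hG : ∀ ans : List (P.Poly × P.Poly), ValidAns ans → ans.length = fs.length →
      G (tr ++ flatAns ans) =
        F (p.eval s ⟨r, ans, l, []⟩).1 (p.eval s ⟨r, ans, l, []⟩).2.log) :
    ex (encAnswers P s fs tr) G = wpI (encKernel s) p r F l := by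
  induction hp generalizing r l fs tr with
  | ret _ =>
    obtain rfl : fs = [] := List.length_eq_zero_iff.1 hlen
    have := hG [] (fun p hp => absurd hp List.not_mem_nil) rfl
    simp only [flatAns, List.flatMap_nil, List.append_nil] at this
    simp only [encAnswers, ex_pure', this]
    rfl
  | coin _ ih => exact ih _ _ _ fs hlen tr hmsg hG
  | @query msg k ns _ ih =>
    obtain ⟨f, fs, rfl⟩ : ∃ f fs', fs = f :: fs' :=
      List.exists_cons_of_length_eq_add_one (n := queries ns) hlen
    -- Without any answers the evaluation goes on with the default pair `(0, 0)`, but the first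
    -- message is recorded before the first answer is read.
    have hf := hmsg [] f (fun p hp => absurd hp List.not_mem_nil) rfl
    have hf' : f.poly P (List.ofFn s ++ tr) = msg s := by
      simp only [flatAns, List.flatMap_nil, List.append_nil, eval, List.nil_append] at hf
      rw [hf]
      have := eval_msgs s (k ((([] : List (P.Poly × P.Poly)).headD (0, 0)).1)
        ((([] : List (P.Poly × P.Poly)).headD (0, 0)).2)) r [] l [msg s] []
      rw [List.append_nil] at this
      rw [List.tail_nil, this]
      rfl
    simp only [encAnswers, ex_bind', wpI, encKernel, ex_bind, ex_map, hf']
    refine ex_congr_support fun a ha => ex_congr fun e => ?_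
    set b := red P.QL (-(nmul s a) + e + msg s)
    have hab : ∀ ans, ValidAns ans → ValidAns ((a, b) :: ans) := by
      intro ans h q hq j
      rcases List.mem_cons.1 hq with rfl | hq
      · exact ⟨mem_support_unifPoly ha j, red_nonneg P.QL_pos _ j, red_lt P.QL_pos _ j⟩
      · exact h q hq j
    -- After `(a, b)` has been received, the remaining messages are those of the whole computation
    -- without the first; so the hypotheses at `(a, b) :: ans` are what the induction needs.
    have hev : ∀ ans, (Prog.query msg k).eval s ⟨r, (a, b) :: ans, l, []⟩ =
        (((k a b).eval s ⟨r, ans, l, []⟩).1,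
        { ((k a b).eval s ⟨r, ans, l, []⟩).2 with
          msgs := [msg s] ++ ((k a b).eval s ⟨r, ans, l, []⟩).2.msgs }) := by
      intro ans
      have := eval_msgs s (k a b) r ans l [msg s] []
      rw [List.append_nil] at this
      exact this
    refine ih a b r l fs (by simpa [queries] using hlen) _ (fun ans f h hf => ?_)
      (fun ans h hl => ?_)
    · have := hmsg ((a, b) :: ans) f (hab ans h) (by simpa using hf)
      rw [hev] at this
      simpa [flatAns] using this
    · have := hG ((a, b) :: ans) (hab ans h) (by simpa using hl)
      rw [hev] at this
      simpa [flatAns] using this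
  | rer _ _ _ ih => exact ih _ (Item.act_lvl _ _ _ _) _ _ fs hlen tr hmsg hG
  | emit _ ih => exact ih _ _ fs hlen tr hmsg hG

/-- A genuine re-randomization is the addition of a pair of RLWE samples. -/
theorem eval_real_eq_shift {ns : List Node} {p : Prog P α} (hp : Ok R I ns p) (s : P.Poly)
    (r r' : List (Item P)) (ans : List (P.Poly × P.Poly)) (l : List ℤ) (m : List P.Poly)
    (hpos : (itemNodes ns)[r.length]? = some (.rer .real)) (u e0 e1 b0 b1 : P.Poly)
    (hR : ∀ pk0 pk1, R pk0 pk1 → ∀ j, b0 j ≡ nmul pk0 u j + e0 j [ZMOD P.QL] ∧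
      b1 j ≡ nmul pk1 u j + e1 j [ZMOD P.QL]) :
    p.eval s ⟨r ++ ⟨.real, u, e0, e1⟩ :: r', ans, l, m⟩ =
      p.eval s ⟨r ++ ⟨.shift, b0, b1, 0⟩ :: r', ans, l, m⟩ := by
  induction hp generalizing r ans l m with
  | ret _ => simp [itemNodes] at hpos
  | coin _ ih =>
    cases r with
    | nil => simp [itemNodes] at hpos
    | cons t r => exact ih _ r _ _ _ (by simpa [itemNodes] using hpos)
  | query _ ih => exact ih _ _ _ _ _ _ hpos
  | @rer pk0 pk1 c k ns hpk hc _ ih =>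
    cases r with
    | nil =>
      -- The congruences hold modulo `Q_L`, whereas the ciphertext lives modulo its own `Q l`, a
      -- divisor.
      have hQ := P.Q_dvd hc
      have h := hR pk0 pk1 hpk
      have : Item.act pk0 pk1 ⟨.real, u, e0, e1⟩ c = Item.act pk0 pk1 ⟨.shift, b0, b1, 0⟩ c := by
        simp only [Item.act]
        congr 1
        · refine red_congr fun j => ?_
          have := ((h j).1.of_dvd (by exact_mod_cast hQ : (P.Q c.lvl : ℤ) ∣ P.QL)).symm.add_left
            (c.c0 j)
          simpa [add_assoc] using this
        · refine red_congr fun j => ?_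
          have := ((h j).2.of_dvd (by exact_mod_cast hQ : (P.Q c.lvl : ℤ) ∣ P.QL)).symm.add_left
            (c.c1 j)
          simpa [add_assoc] using this
      simp only [eval, List.nil_append, List.headD_cons, this, List.tail_cons]
    | cons t r =>
      exact ih _ (Item.act_lvl _ _ _ _) r _ _ _ (by simpa [itemNodes] using hpos)
  | emit _ ih => exact ih _ _ _ _ hpos

/-- Translation by `v` preserves the uniform distribution modulo `Q_L`, and `Q l` divides `Q_L`. -/
theorem ex_unifPoly_shift {l : ℕ} (hl : l ≤ P.L) (v : P.Poly) (F : P.Poly → ℝ≥0∞) :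
    (ex ((Kind.unif P.QL).poly P) fun b => F (red (P.Q l) (v + b))) =
      ex ((Kind.unif P.QL).poly P) fun b => F (red (P.Q l) b) := by
  refine Eq.trans (ex_congr fun b => ?_)
    (ex_unifVec_mod P.QL_pos v 1 (Or.inl rfl) fun b => F (red (P.Q l) b))
  congr 1
  refine red_congr fun j => ?_
  rw [one_smul]
  exact (red_modEq_of_dvd (P.Q_dvd hl) _ _).symm

/-- The addition of a uniform pair replaces the ciphertext with a uniform pair. -/
theorem ex_eval_shift_eq_ideal {ns : List Node} {p : Prog P α} (hp : Ok R I ns p) (s : P.Poly)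
    (r r' : List (Item P)) (ans : List (P.Poly × P.Poly)) (l : List ℤ) (m : List P.Poly)
    (F : α → List ℤ → ℝ≥0∞) :
    (ex ((Kind.unif P.QL).poly P) fun b0 => ex ((Kind.unif P.QL).poly P) fun b1 =>
        F (p.eval s ⟨r ++ ⟨.shift, b0, b1, 0⟩ :: r', ans, l, m⟩).1
          (p.eval s ⟨r ++ ⟨.shift, b0, b1, 0⟩ :: r', ans, l, m⟩).2.log) =
      ex ((Kind.unif P.QL).poly P) fun b0 => ex ((Kind.unif P.QL).poly P) fun b1 =>
        F (p.eval s ⟨r ++ ⟨.ideal, b0, b1, 0⟩ :: r', ans, l, m⟩).1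
          (p.eval s ⟨r ++ ⟨.ideal, b0, b1, 0⟩ :: r', ans, l, m⟩).2.log := by
  induction hp generalizing r ans l m with
  | ret _ => rfl
  | coin _ ih =>
    cases r with
    | nil => rfl
    | cons t r => exact ih t.v0 r ans l m
  | @query msg k _ _ ih =>
    exact ih (ans.headD (0, 0)).1 (ans.headD (0, 0)).2 r ans.tail l (m ++ [msg s])
  | @rer pk0 pk1 c k ns hpk hc _ ih =>
    cases r with
    | nil =>
      simp only [eval, Item.act, List.nil_append, List.headD_cons, List.tail_cons]
      let G : P.Poly → P.Poly → ℝ≥0∞ := fun c0' c1' =>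
        F ((k { c with c0 := c0', c1 := c1' }).eval s ⟨r', ans, l, m⟩).1
          ((k { c with c0 := c0', c1 := c1' }).eval s ⟨r', ans, l, m⟩).2.log
      refine (ex_unifPoly_shift hc c.c0 fun c0' => ex ((Kind.unif P.QL).poly P) fun b1 =>
        G c0' (red (P.Q c.lvl) (c.c1 + b1))).trans (ex_congr fun b0 => ?_)
      exact ex_unifPoly_shift hc c.c1 (G (red (P.Q c.lvl) b0))
    | cons t r => exact ih _ (Item.act_lvl pk0 pk1 t c) r ans l m
  | @emit l' k _ _ ih => exact ih r ans (l ++ l') m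

end Prog

variable {P : Params} {N : ℕ} {α β : Type}

/-! ## The protocol with the secret of one honest party behind an encryption oracle -/

/-- The part of a log that the coalition `A` sees. -/
def vis (A : Finset (Fin N)) (l : List (Option (Fin N) × P.Poly)) : List ℤ :=
  l.flatMap fun p => if p.1.elim true (fun i => decide (i ∈ A)) then List.ofFn p.2 else []

theorem vis_append (A : Finset (Fin N)) (l l' : List (Option (Fin N) × P.Poly)) :
    vis A (l ++ l') = vis A l ++ vis A l' := List.flatMap_append

theorem vis_hidden {A : Finset (Fin N)} {i : Fin N} (hi : i ∉ A) (v : P.Poly)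
    (l : List (Option (Fin N) × P.Poly)) : vis A ((some i, v) :: l) = vis A l := by
  simp [vis, hi]

namespace Prog

def coin' (κ : Kind) : Prog P P.Poly := .coin κ .ret

def emit' (l : List ℤ) : Prog P Unit := .emit l (.ret ())

def query' (msg : P.Poly → P.Poly) : Prog P (P.Poly × P.Poly) := .query msg fun a b => .ret (a, b)

end Prog

open Prog

section Protocol

variable (A : Finset (Fin N)) (h : Fin N) (ρ : Fin N → P.Poly) (K : PubKeys P) (lam : ℕ)

/-- Re-randomization by party `i`. -/
def gRer (i : Fin N) (c : Ct P) : Prog P (Ct P) :=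
  -- The randomness of a corrupted party belongs to the view, so its re-randomizations stay genuine
  -- throughout. Only those of honest parties become `rer` operations, which can be replaced.
  if i ∈ A then do
    let u ← coin' .tern
    let e0 ← coin' .err
    let e1 ← coin' .err
    emit' (vis A [(some i, u), (some i, e0), (some i, e1)])
    pure (Item.act K.pk0 K.pk1 ⟨.real, u, e0, e1⟩ c)
  else .rer K.pk0 K.pk1 c .ret

def gSend (c : Ct P) : Prog P Unit := emit' (vis A [(none, c.c0), (none, c.c1)])

/-- A switching key; `msg` is the message as a function of the hidden secret. -/
def gSwitch (msg : P.Poly → P.Poly) : Prog P (Fin P.digits → P.Poly × P.Poly) :=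
  seqFin fun t => do
    let p ← query' fun s => red P.QL (((P.base : ℤ) ^ (t : ℕ)) • msg s)
    let b := red P.QL (p.2 - nmul (∑ i, ρ i) p.1)
    emit' (vis A [(none, p.1), (none, b)])
    pure (b, p.1)

/-- The share of party `i` in the encryption key; `p` answers the query. -/
def pkShare (p : P.Poly × P.Poly) (e : Fin N → P.Poly) (i : Fin N) : P.Poly :=
  if i = h then p.2 else red P.QL (-(nmul (ρ i) p.1) + e i)

/-- The generation of the encryption key: its second half and the shares of its first half. -/
def gKeyPair : Prog P (P.Poly × (Fin N → P.Poly)) := do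
  let p ← query' fun _ => 0
  -- Coordinate `h` is a dummy: the error of `h` is contained in the answer of the oracle.
  let e ← seqFin fun _ : Fin N => coin' .err
  emit' (vis A ((none, p.1) :: (List.ofFn fun i =>
    [(some i, e i), (none, pkShare h ρ p e i)]).flatten))
  pure (p.1, pkShare h ρ p e)

def gKeys : Prog P (PubKeys P) := do
  let p ← gKeyPair A h ρ
  let rlk ← gSwitch A ρ fun s => nmul (s + ∑ i, ρ i) (s + ∑ i, ρ i)
  let rot ← seqFin fun k : Fin P.slots => gSwitch A ρ fun s =>
    substPow (5 ^ (k : ℕ)) (s + ∑ i, ρ i)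
  pure { pk0 := red P.QL (∑ i, p.2 i), pk1 := p.1, rlk := rlk, rot := rot }

/-- The message in `c` under the collective secret, if the hidden share is `s`. -/
def phase (c : Ct P) (s : P.Poly) : P.Poly := fun j =>
  Int.bmod ((c.c0 + nmul (s + ∑ i, ρ i) c.c1) j) (P.Q c.lvl)

/-- The first share of party `i` in a bootstrapping. -/
def bootShare0 (c : Ct P) (M e0 : Fin N → P.Poly) (i : Fin N) : P.Poly :=
  -- This is the genuine share with the mask `M - phase`: since the phase is congruent to `c0 + (s +
  -- ∑ ρ) c1`, the product `s c1` cancels.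
  if i = h then red (P.Q c.lvl) (M i + e0 i - c.c0 - nmul (∑ i, ρ i) c.c1)
  else red (P.Q c.lvl) (nmul (ρ i) c.c1 + M i + e0 i)

/-- The second share of party `i` in a bootstrapping. -/
def bootShare1 (φ : P.Poly → P.Poly) (p : P.Poly × P.Poly) (M e1 : Fin N → P.Poly) (i : Fin N) :
    P.Poly :=
  if i = h then p.2 else red P.QL (-(nmul (ρ i) p.1) - φ (M i) + e1 i)

/-- The shares of a bootstrapping, and its result. -/
def gRefresh (Φ : Matrix (Fin P.slots) (Fin P.slots) ℂ) (B : ℕ) (c : Ct P) : Prog P (Ct P) := do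
  let M ← seqFin fun _ : Fin N => coin' (.unif (B * 2 ^ lam))
  let e0 ← seqFin fun _ : Fin N => coin' .err
  let e1 ← seqFin fun _ : Fin N => coin' .err
  -- The shifted mask also enters the second share of `h`, which thereby becomes an encryption of a
  -- message that depends on `s` through the phase.
  let p ← query' fun s => red P.QL (-(P.transform Φ (P.S / c.scale) (M h - phase ρ c s)))
  emit' (vis A ((none, p.1) :: (List.ofFn fun i =>
    [(some i, M i), (some i, e0 i), (some i, e1 i), (none, bootShare0 h ρ c M e0 i),
      (none, bootShare1 h ρ (P.transform Φ (P.S / c.scale)) p M e1 i)]).flatten))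
  pure
    { c0 := red P.QL (P.transform Φ (P.S / c.scale)
        (red (P.Q c.lvl) (c.c0 + ∑ i, bootShare0 h ρ c M e0 i)) +
          ∑ i, bootShare1 h ρ (P.transform Φ (P.S / c.scale)) p M e1 i)
      c1 := p.1
      lvl := P.L
      scale := P.S }

def gBoot (i0 : Fin N) (Φ : Matrix (Fin P.slots) (Fin P.slots) ℂ) (B : ℕ) (c : Ct P) :
    Prog P (Ct P) := do
  let c ← gRer A K i0 c
  gSend A c
  gRefresh A h ρ lam Φ B c

def gStep (i : Fin N) {d : ℕ} (own : Fin d → P.Msg) (regs : List (Ct P)) (I : Instr P d) :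
    Prog P (Ct P) :=
  let r : ℕ → Ct P := fun a => regs.getD a (Ct.ofPlain 0 P.S)
  match I with
  | .add a b => pure ((r a).add (r b))
  | .sub a b => pure ((r a).sub (r b))
  | .mul a b => pure ((r a).mul K (r b))
  | .addPt a p => pure ((r a).add (Ct.ofPlain (p.plain own).1 (p.plain own).2))
  | .ptSub p a => pure ((Ct.ofPlain (p.plain own).1 (p.plain own).2).sub (r a))
  | .mulPt a p => pure ((r a).mulPt (p.plain own).1 (p.plain own).2)
  | .rotL a k => pure ((r a).rotL K k)
  | .res a => pure (r a).res
  | .setScale a s => pure ((r a).setScale s)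
  | .boot a Φ B => gBoot A h ρ K lam i Φ B (r a)

def gLocal (i : Fin N) {d : ℕ} (own : Fin d → P.Msg) :
    List (Instr P d) → List (Ct P) → Prog P (List (Ct P))
  | [], regs => pure regs
  | I :: Is, regs => do
      let c ← gStep A h ρ K lam i own regs I
      gLocal i own Is (regs ++ [c])

end Protocol

section Training

variable (T : Training P) (A : Finset (Fin T.N)) (h : Fin T.N) (ρ : Fin T.N → P.Poly)
  (K : PubKeys P) (x : T.Inputs)

/-- The update of the weights `W` with the gradients `G`, before the bootstrapping. -/
def Training.updated (W : Fin T.nW → Ct P) (G : Fin T.N → Fin T.nW → Ct P) (j : Fin T.nW) : Ct P :=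
  let g := (List.ofFn fun i => G i j).foldl Ct.add { c0 := 0, c1 := 0, lvl := P.L, scale := 0 }
  let g := { g with scale := g.scale * (T.b * T.N / T.η) }
  (W j).add (g.setScale (W j).scale)

def gIteration (k : Fin T.m) (W : Fin T.nW → Ct P) : Prog P (Fin T.nW → Ct P) := do
  let W ← seqFin fun j => do
    let c ← gRer A K T.first (W j)
    gSend A c
    pure c
  let G ← seqFin fun i => do
    let regs ← gLocal A h ρ K T.lam i (x i).data (T.lgd k i) (List.ofFn W)
    seqFin fun j : Fin T.nW => do
      let c ← gRer A K i (regs.getD (T.out k i j) (Ct.ofPlain 0 P.S))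
      gSend A c
      pure c
  seqFin fun j => gBoot A h ρ K T.lam T.first 1 T.B (T.updated W G j)

/-- The part of the protocol that follows the key generation. -/
def gMain : Prog P (Fin T.nW → Ct P) := do
  let W ← seqFin fun j => gRer A K T.first (Ct.ofPlain (P.encode P.S ((x T.first).w0 j)) P.S)
  (List.finRange T.m).foldlM (fun W k => gIteration T A h ρ K x k W) W

/-- The protocol, after the secret keys have been drawn. -/
def gTotal : Prog P (Fin T.nW → Ct P) := do
  emit' (vis A (List.ofFn fun i => (some i, ρ i)))
  let K ← gKeys A h ρ
  gMain T A h ρ K x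

end Training

/-! ### The operations used -/

section Nodes

variable (A : Finset (Fin N)) (lam : ℕ)

def rerNodes (i : Fin N) : List Node :=
  if i ∈ A then [.coin .tern, .coin .err, .coin .err] else [.rer]

def switchNodes (P : Params) : List Node := (List.ofFn fun _ : Fin P.digits => [Node.query]).flatten

def coinNodes (N : ℕ) (κ : Kind) : List Node := (List.ofFn fun _ : Fin N => [Node.coin κ]).flatten

def keyNodes (P : Params) (N : ℕ) : List Node :=
  ([Node.query] ++ coinNodes N .err) ++
    ((switchNodes P ++ (List.ofFn fun _ : Fin P.slots => switchNodes P).flatten))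

def refreshNodes (N : ℕ) (B : ℕ) : List Node :=
  coinNodes N (.unif (B * 2 ^ lam)) ++ (coinNodes N .err ++ (coinNodes N .err ++ [.query]))

def bootNodes (i : Fin N) (B : ℕ) : List Node := rerNodes A i ++ refreshNodes lam N B

def stepNodes (i : Fin N) {d : ℕ} : Instr P d → List Node
  | .boot _ _ B => bootNodes A lam i B
  | _ => []

def localNodes (i : Fin N) {d : ℕ} (Is : List (Instr P d)) : List Node :=
  (Is.map (stepNodes A lam i)).flatten

end Nodes

section TrainingNodes

variable (T : Training P) (A : Finset (Fin T.N))

def iterationNodes (k : Fin T.m) : List Node :=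
  (List.ofFn fun _ : Fin T.nW => rerNodes A T.first).flatten ++
    ((List.ofFn fun i => localNodes A T.lam i (T.lgd k i) ++
      (List.ofFn fun _ : Fin T.nW => rerNodes A i).flatten).flatten ++
    (List.ofFn fun _ : Fin T.nW => bootNodes A T.lam T.first T.B).flatten)

def mainNodes : List Node :=
  (List.ofFn fun _ : Fin T.nW => rerNodes A T.first).flatten ++
    ((List.finRange T.m).map (iterationNodes T A)).flatten

def totalNodes : List Node := keyNodes P T.N ++ mainNodes T A

end TrainingNodes

/-! ### Comparison with the real protocol -/

/-- The loss in one bootstrapping. -/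
def flood (P : Params) (lam : ℕ) : ℝ≥0∞ := P.n * (2 ^ lam)⁻¹

theorem Prog.wp_le {K : (P.Poly → P.Poly) → PMF (P.Poly × P.Poly)} (p : Prog P α)
    {F : α → List ℤ → ℝ≥0∞} {c : ℝ≥0∞} (hF : ∀ a l, F a l ≤ c) (l : List ℤ) : wp K p F l ≤ c := by
  induction p generalizing l with
  | ret a => exact hF _ _
  | coin κ k ih => exact ex_le fun v => ih v l
  | query msg k ih => exact ex_le fun p => ih _ _ l
  | rer pk0 pk1 c k ih => exact ex_le fun t => ih _ l
  | emit l' k ih => exact ih _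

/-- What is visible in `m`, unless a bootstrapped ciphertext exceeds its bound, is visible in `p`
with almost the same probability. -/
structure Rel (A : Finset (Fin N)) (lam : ℕ) (s : P.Poly) (R : P.Poly → P.Poly → Prop)
    (I : α → Prop) (ns : List Node) (m : Run P N α) (p : Prog P α) : Prop where
  ok : Ok R I ns p
  inv : ∀ t, ∀ q ∈ (m.run t).support, I q.1
  -- Traces that have violated a bound count for nothing. The length of `ns` is a crude bound on the
  -- number of bootstrappings, chosen because it is additive under composition.
  le : ∀ F : α → List ℤ → ℝ≥0∞, (∀ a l, F a l ≤ 1) → ∀ t : Trace P N,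
    ex (m.run t) (fun q => if q.2.ok then F q.1 (vis A q.2.log) else 0) ≤
      if t.ok then wp (encKernel s) p F (vis A t.log) + ns.length * flood P lam else 0

section Rel

variable {A : Finset (Fin N)} {lam : ℕ} {s : P.Poly} {R R' : P.Poly → P.Poly → Prop}
  {I I' : α → Prop} {J : β → Prop} {ns ns' : List Node}

theorem mem_support_run_bind {m : Run P N α} {f : α → Run P N β} {t : Trace P N}
    {q : β × Trace P N} (hq : q ∈ ((m >>= f).run t).support) :
    ∃ q' ∈ (m.run t).support, q ∈ ((f q'.1).run q'.2).support :=
  (PMF.mem_support_bind_iff _ _ _).1 hq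

theorem eq_of_mem_support_run_pure {a : α} {t : Trace P N} {q : α × Trace P N}
    (hq : q ∈ ((pure a : Run P N α).run t).support) : q = (a, t) :=
  (PMF.mem_support_pure_iff _ _).1 hq

theorem Rel.pure {a : α} (ha : I a) :
    Rel A lam s R I [] (Pure.pure a : Run P N α) (Pure.pure a) := by
  refine ⟨.ret ha, fun t q hq => ?_, fun F _ t => ?_⟩
  · rw [eq_of_mem_support_run_pure hq]
    exact ha
  · rw [ex_run_pure, Prog.wp_pure]
    simp

theorem Rel.bind {m : Run P N α} {p : Prog P α} {f : α → Run P N β} {g : α → Prog P β}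
    (hm : Rel A lam s R I ns m p) (hf : ∀ a, I a → Rel A lam s R J ns' (f a) (g a)) :
    Rel A lam s R J (ns ++ ns') (m >>= f) (p >>= g) := by
  refine ⟨hm.ok.bind fun a ha => (hf a ha).ok, fun t q hq => ?_, fun F hF t => ?_⟩
  · obtain ⟨q', hq', hq⟩ := mem_support_run_bind hq
    exact (hf _ (hm.inv t q' hq')).inv _ q hq
  rw [ex_run_bind, Prog.wp_bind]
  have h1 := fun q hq => (hf q.1 (hm.inv t q hq)).le F hF q.2
  refine (ex_mono_support h1).trans ?_
  by_cases ht : t.ok = true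
  · rw [if_pos ht]
    calc _ ≤ (ex (m.run t) fun q =>
          (if q.2.ok then wp (encKernel s) (g q.1) F (vis A q.2.log) else 0) +
            ns'.length * flood P lam) := ex_mono fun q => by split_ifs <;> simp
      _ = (ex (m.run t) fun q =>
          (if q.2.ok then wp (encKernel s) (g q.1) F (vis A q.2.log) else 0)) +
            ns'.length * flood P lam := by rw [ex_add, ex_const]
      _ ≤ _ := by
        have := hm.le (fun a l => wp (encKernel s) (g a) F l) (fun a l => Prog.wp_le _ hF l) t
        rw [if_pos ht] at this
        refine (add_le_add_left this _).trans_eq ?_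
        rw [List.length_append]
        push_cast
        ring
  -- For a trace that is already spoilt, the bound for the constant function `1` says that it
  -- remains spoilt almost surely.
  · have := hm.le (fun _ _ => 1) (fun _ _ => le_rfl) t
    rw [if_neg ht] at this ⊢
    have h0 := ENNReal.tsum_eq_zero.1 (le_antisymm this zero_le)
    refine le_of_eq (ENNReal.tsum_eq_zero.2 fun q => ?_)
    have := h0 q
    by_cases hq : q.2.ok = true
    · simp only [hq, if_true, mul_one] at this
      rw [this, zero_mul]
    · simp [hq]

theorem Rel.mono {m : Run P N α} {p : Prog P α} (hm : Rel A lam s R I ns m p)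
    (hR : ∀ u v, R u v → R' u v) (hI : ∀ a, I a → I' a) : Rel A lam s R' I' ns m p :=
  ⟨hm.ok.mono hR hI, fun t q hq => hI _ (hm.inv t q hq), hm.le⟩

theorem Rel.bind_pure {m : Run P N α} {p : Prog P α} {f : α → β}
    (hm : Rel A lam s R I ns m p) (hf : ∀ a, I a → J (f a)) :
    Rel A lam s R J ns (m >>= fun a => Pure.pure (f a)) (p >>= fun a => Pure.pure (f a)) := by
  rw [← List.append_nil ns]
  exact hm.bind fun a ha => .pure (hf a ha)

theorem Rel.seqFin {k : ℕ} {I : Fin k → α → Prop} {ns : Fin k → List Node}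
    {m : Fin k → Run P N α} {p : Fin k → Prog P α} (hm : ∀ i, Rel A lam s R (I i) (ns i) (m i)
      (p i)) :
    Rel A lam s R (fun v => ∀ i, I i (v i)) (List.ofFn ns).flatten (seqFin m) (seqFin p) := by
  induction k with
  | zero => exact .pure fun i => i.elim0
  | succ k ih =>
    rw [List.ofFn_succ, List.flatten_cons]
    refine (hm 0).bind fun a ha => ?_
    refine (ih fun i => hm i.succ).bind_pure fun v hv i => ?_
    refine Fin.cases ?_ (fun j => ?_) i
    · simpa using ha
    · simpa using hv j

theorem Rel.foldlM {γ : Type} {ns : γ → List Node} {m : α → γ → Run P N α} {p : α → γ → Prog P α}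
    (hm : ∀ a c, I a → Rel A lam s R I (ns c) (m a c) (p a c)) (l : List γ) {a : α} (ha : I a) :
    Rel A lam s R I (l.map ns).flatten (l.foldlM m a) (l.foldlM p a) := by
  induction l generalizing a with
  | nil => exact .pure ha
  | cons c l ih =>
    rw [List.map_cons, List.flatten_cons, List.foldlM_cons, List.foldlM_cons]
    exact (hm a c ha).bind fun b hb => ih hb

end Rel

theorem Prog.Ok.seqFin {R : P.Poly → P.Poly → Prop} {k : ℕ} {I : Fin k → α → Prop}
    {ns : Fin k → List Node} {p : Fin k → Prog P α} (hp : ∀ i, Ok R (I i) (ns i) (p i)) :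
    Ok R (fun v => ∀ i, I i (v i)) (List.ofFn ns).flatten (Poseidon.seqFin p) := by
  induction k with
  | zero => exact .ret fun i => i.elim0
  | succ k ih =>
    rw [List.ofFn_succ, List.flatten_cons]
    refine (hp 0).bind fun a ha => ?_
    rw [← List.append_nil (List.ofFn _).flatten]
    refine (ih fun i => hp i.succ).bind fun v hv => .ret fun i => ?_
    refine Fin.cases ?_ (fun j => ?_) i
    · simpa using ha
    · simpa using hv j

/-- Ciphertexts of a level that exists. -/
def LvlOk (c : Ct P) : Prop := c.lvl ≤ P.L

/-! ### The steps of the protocol compared with those of the game -/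

section Steps

variable {A : Finset (Fin N)} {h : Fin N} {lam : ℕ} {sk ρ : Fin N → P.Poly}
  {R : P.Poly → P.Poly → Prop} {s : P.Poly}

/-- There is no loss: for a corrupted party both sides draw the same visible coins, and for an
honest one the coins are hidden from the coalition. -/
theorem rel_rerandomize (K : PubKeys P) (hR : R K.pk0 K.pk1) (i : Fin N) {c : Ct P}
    (hc : LvlOk c) :
    Rel A lam s R LvlOk (rerNodes A i) (rerandomize K i c) (gRer A K i c) := by
  have hrun : ∀ t F, ex ((rerandomize K i c).run t) F =
      ex ((INode.rer .real).dist P) fun it => F (it.act K.pk0 K.pk1 c,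
        { t with log := t.log ++ [(some i, it.v0), (some i, it.v1), (some i, it.v2)] }) := by
    intro t F
    simp only [rerandomize, draw, ex_run_bind, ex_run_lift, ex_run_note, ex_run_pure, INode.dist,
      ex_bind, ex_map, List.append_assoc, List.cons_append, List.nil_append, Item.act]
    rfl
  have hinv : ∀ t, ∀ q ∈ ((rerandomize K i c).run t).support, LvlOk q.1 := by
    intro t q hq
    obtain ⟨u, _, hq⟩ := mem_support_run_bind hq
    obtain ⟨e0, _, hq⟩ := mem_support_run_bind hq
    obtain ⟨e1, _, hq⟩ := mem_support_run_bind hq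
    rw [eq_of_mem_support_run_pure hq]
    exact hc
  by_cases hi : i ∈ A
  · refine ⟨?_, hinv, fun F hF t => ?_⟩
    · rw [gRer, rerNodes, if_pos hi, if_pos hi]
      exact .coin fun u => .coin fun e0 => .coin fun e1 => .emit (.ret hc)
    · rw [hrun, gRer, if_pos hi]
      by_cases ht : t.ok = true
      · rw [if_pos ht]
        refine le_add_right (le_of_eq ?_)
        simp only [ht, if_true, INode.dist, ex_bind, ex_map, vis_append]
        rfl
      · simp [ht, ex_zero]
  · refine ⟨?_, hinv, fun F hF t => ?_⟩
    · rw [gRer, rerNodes, if_neg hi, if_neg hi]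
      exact .rer hR hc fun c' hc' => .ret (hc'.le.trans hc)
    · rw [hrun, gRer, if_neg hi]
      by_cases ht : t.ok = true
      · rw [if_pos ht]
        refine le_add_right (le_of_eq ?_)
        simp only [ht, if_true, vis_append, vis_hidden hi]
        simp only [vis, List.flatMap_nil, List.append_nil]
        rfl
      · simp [ht, ex_zero]

theorem rel_send (c : Ct P) :
    Rel A lam s R (fun _ => True) [] (send c : Run P N Unit) (gSend A c) := by
  refine ⟨.emit (.ret trivial), fun _ _ _ => trivial, fun F hF t => ?_⟩
  simp only [send, ex_run_bind, ex_run_note, gSend]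
  split_ifs
  · refine le_add_right (le_of_eq ?_)
    rw [List.append_assoc, vis_append]
    rfl
  · exact le_rfl

theorem sum_update_zero (sk : Fin N → P.Poly) (h : Fin N) :
    ∑ i, sk i = sk h + ∑ i, Function.update sk h 0 i := by
  rw [← Finset.add_sum_erase _ _ (Finset.mem_univ h),
    ← Finset.add_sum_erase _ (Function.update sk h 0) (Finset.mem_univ h), Function.update_self,
    zero_add]
  congr 1
  refine Finset.sum_congr rfl fun i hi => ?_
  rw [Function.update_of_ne (Finset.ne_of_mem_erase hi)]

/-- An encryption under the collective secret is an encryption under the share of `h`, minus the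
product of `a` with the sum of the other shares. The subtraction needs no oracle. -/
theorem rel_switchKey (h : Fin N) (msg : P.Poly → P.Poly) :
    Rel A lam (sk h) R (fun _ => True) (switchNodes P)
      (switchKey (∑ i, sk i) (msg (sk h)) : Run P N _)
      (gSwitch A (Function.update sk h 0) msg) := by
  refine (Rel.seqFin (I := fun _ _ => True) fun t => ?_).mono (fun _ _ h => h) fun _ _ => trivial
  refine ⟨.query fun a b => .emit (.ret trivial), fun _ _ _ => trivial, fun F hF t' => ?_⟩
  simp only [crs, ex_run_bind, ex_run_lift, ex_run_note, ex_run_pure]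
  by_cases ht : t'.ok = true
  · simp only [ht, if_true]
    refine le_add_right (le_of_eq ?_)
    have hb : ∀ a e : P.Poly, red P.QL (-(nmul (∑ i, sk i) a) + e + (P.base : ℤ) ^ (t : ℕ) •
        msg (sk h)) = red P.QL (red P.QL (-(nmul (sk h) a) + e +
          red P.QL ((P.base : ℤ) ^ (t : ℕ) • msg (sk h))) -
            nmul (∑ i, Function.update sk h 0 i) a) := by
      intro a e
      rw [sum_update_zero sk h, add_nmul]
      refine red_congr fun j => ?_
      have h1 := red_modEq (Q := P.QL) ((P.base : ℤ) ^ (t : ℕ) • msg (sk h)) j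
      have h2 := red_modEq (Q := P.QL) (-(nmul (sk h) a) + e +
          red P.QL ((P.base : ℤ) ^ (t : ℕ) • msg (sk h))) j
      have h3 := ((h2.trans (h1.add_left _)).sub_right
        (nmul (∑ i, Function.update sk h 0 i) a j)).symm
      refine Eq.trans (congrArg (· % (P.QL : ℤ)) ?_) h3
      simp only [Pi.add_apply, Pi.neg_apply]
      ring
    simp only [query', emit', Bind.bind, Prog.bind, Pure.pure, wp, encKernel, ex_bind, ex_map, hb,
      List.append_assoc, List.cons_append, List.nil_append, vis_append]
  · simp [ht, ex_zero]

theorem vis_flatten_ofFn {k : ℕ} {f g : Fin k → List (Option (Fin N) × P.Poly)}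
    (H : ∀ i, vis A (f i) = vis A (g i)) :
    vis A (List.ofFn f).flatten = vis A (List.ofFn g).flatten := by
  induction k with
  | zero => rfl
  | succ k ih =>
    rw [List.ofFn_succ, List.ofFn_succ, List.flatten_cons, List.flatten_cons, vis_append,
      vis_append, H, ih fun i => H i.succ]

theorem vis_cons (p : Option (Fin N) × P.Poly) (l : List (Option (Fin N) × P.Poly)) :
    vis A (p :: l) = vis A [p] ++ vis A l := vis_append A [p] l

theorem ok_coins (κ : Kind) :
    Ok R (fun _ => True) (coinNodes N κ) (seqFin fun _ : Fin N => (coin' κ : Prog P P.Poly)) :=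
  (Ok.seqFin (I := fun _ _ => True) fun _ => .coin fun _ => .ret trivial).mono
    (fun _ _ h => h) fun _ _ => trivial

theorem wp_coins {K : (P.Poly → P.Poly) → PMF (P.Poly × P.Poly)} (κ : Kind)
    (f : (Fin N → P.Poly) → Prog P β) (F : β → List ℤ → ℝ≥0∞) (l : List ℤ) :
    wp K ((seqFin fun _ : Fin N => (coin' κ : Prog P P.Poly)) >>= f) F l =
      ex (seqFin fun _ : Fin N => κ.poly P) fun v => wp K (f v) F l := by
  rw [wp_bind]
  exact wp_seqFin (fun _ => κ) _ l

/-- The generation of the encryption key. -/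
def keyPair (sk : Fin N → P.Poly) : Run P N (P.Poly × (Fin N → P.Poly)) := do
  let a ← crs
  let shares ← seqFin fun i : Fin N => do
    let e ← draw i P.errPoly
    let p := red P.QL (-(nmul (sk i) a) + e)
    note none p
    pure p
  pure (a, shares)

theorem ex_run_keyPair (t : Trace P N) (F : (P.Poly × (Fin N → P.Poly)) × Trace P N → ℝ≥0∞) :
    ex ((keyPair sk).run t) F = ex (P.unifPoly P.QL) fun a =>
      ex (seqFin fun _ : Fin N => P.errPoly) fun e =>
        F ((a, fun i => red P.QL (-(nmul (sk i) a) + e i)), { t with log := t.log ++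
          ((none, a) :: (List.ofFn fun i =>
            [(some i, e i), (none, red P.QL (-(nmul (sk i) a) + e i))]).flatten) }) := by
  simp only [keyPair, crs, ex_run_bind, ex_run_lift, ex_run_note, ex_run_pure]
  refine ex_congr fun a => ?_
  rw [ex_run_seqFin (μ := fun _ => P.errPoly) (g := fun i e => do
    note (some i) e
    note none (red P.QL (-(nmul (sk i) a) + e))
    pure (red P.QL (-(nmul (sk i) a) + e)))]
  · refine ex_congr fun e => ?_
    rw [ex_run_seqFin_det (v := fun i => red P.QL (-(nmul (sk i) a) + e i)) (l := fun i =>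
      [(some i, e i), (none, red P.QL (-(nmul (sk i) a) + e i))])]
    · simp only [List.append_assoc, List.cons_append, List.nil_append]
    · intro i t F
      simp only [ex_run_bind, ex_run_note, ex_run_pure, List.append_assoc, List.cons_append,
        List.nil_append]
  · intro i t F
    simp only [draw, ex_run_bind, ex_run_lift, ex_run_note, ex_run_pure]

theorem rel_keyPair (hh : h ∉ A) :
    Rel A lam (sk h) R (fun _ => True) ([.query] ++ coinNodes N .err) (keyPair sk)
      (gKeyPair A h (Function.update sk h 0)) := by
  refine ⟨?_, fun _ _ _ => trivial, fun F hF t => ?_⟩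
  · refine .query fun a b => ?_
    rw [← List.append_nil (coinNodes N .err)]
    exact (ok_coins .err).bind fun _ _ => .emit (.ret trivial)
  rw [ex_run_keyPair]
  by_cases ht : t.ok = true
  swap
  · simp [ht, ex_zero]
  simp only [ht, if_true]
  refine le_add_right (le_of_eq ?_)
  rw [gKeyPair, query', wp_bind]
  simp only [wp, encKernel, ex_bind, ex_map, wp_coins]
  refine ex_congr fun a => ?_
  -- In the protocol the error of `h` is redrawn as `w`, to be matched with the error inside the
  -- answer of the oracle; in the game coordinate `h` of `v` remains unused.
  rw [ex_seqFin_update _ h, ex_comm]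
  refine ex_congr fun w => ex_congr fun v => ?_
  have h1 : (fun i => red P.QL (-(nmul (sk i) a) + Function.update v h w i)) =
      pkShare h (Function.update sk h 0) (a, red P.QL (-(nmul (sk h) a) + w + 0)) v := by
    funext i
    by_cases hi : i = h
    · subst hi
      simp [pkShare]
    · simp [pkShare, hi]
  have h2 : vis A (t.log ++ ((none, a) :: (List.ofFn fun i => [(some i, Function.update v h w i),
      (none, red P.QL (-(nmul (sk i) a) + Function.update v h w i))]).flatten)) =
      vis A t.log ++ vis A ((none, a) :: (List.ofFn fun i => [(some i, v i),
        (none, pkShare h (Function.update sk h 0)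
          (a, red P.QL (-(nmul (sk h) a) + w + 0)) v i)]).flatten) := by
    rw [vis_append, vis_cons _ (List.flatten _), vis_cons _ (List.flatten _)]
    congr 2
    refine vis_flatten_ofFn fun i => ?_
    rw [congrFun h1 i]
    by_cases hi : i = h
    · subst hi
      rw [vis_hidden hh, vis_hidden hh]
    · rw [Function.update_of_ne hi]
  rw [h1, h2]
  rfl

/-- The key generation, after the secret keys have been drawn. -/
def keyRest (sk : Fin N → P.Poly) : Run P N (PubKeys P) := do
  let p ← keyPair sk
  let rlk ← switchKey (∑ i, sk i) (nmul (∑ i, sk i) (∑ i, sk i))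
  let rot ← seqFin fun k : Fin P.slots =>
    switchKey (∑ i, sk i) (substPow (5 ^ (k : ℕ)) (∑ i, sk i))
  pure { pk0 := red P.QL (∑ i, p.2 i), pk1 := p.1, rlk := rlk, rot := rot }

theorem rel_keyRest (hh : h ∉ A) :
    Rel A lam (sk h) R (fun _ => True) (keyNodes P N) (keyRest sk)
      (gKeys A h (Function.update sk h 0)) := by
  refine (rel_keyPair hh).bind fun p _ => ?_
  refine Rel.bind (I := fun _ => True) ?_ fun rlk _ => ?_
  · have := rel_switchKey (A := A) (lam := lam) (R := R) (sk := sk) h fun s =>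
      nmul (s + ∑ i, Function.update sk h 0 i) (s + ∑ i, Function.update sk h 0 i)
    rwa [← sum_update_zero] at this
  · refine Rel.bind_pure (I := fun _ => True) ?_ fun _ _ => trivial
    refine (Rel.seqFin (I := fun _ _ => True) fun k => ?_).mono (fun _ _ h => h) fun _ _ => trivial
    have := rel_switchKey (A := A) (lam := lam) (R := R) (sk := sk) h fun s =>
      substPow (5 ^ (k : ℕ)) (s + ∑ i, Function.update sk h 0 i)
    rwa [← sum_update_zero] at this

/-- The bootstrapping of a ciphertext that has been sent. -/
def refresh (sk : Fin N → P.Poly) (lam : ℕ) (Φ : Matrix (Fin P.slots) (Fin P.slots) ℂ) (B : ℕ)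
    (c : Ct P) : Run P N (Ct P) := do
  modify fun t => { t with ok := t.ok && phaseLE sk B c }
  let a ← crs
  let φ := P.transform Φ (P.S / c.scale)
  let h ← seqFin fun i : Fin N => do
    let M ← draw i (P.unifPoly (B * 2 ^ lam))
    let e0 ← draw i P.errPoly
    let e1 ← draw i P.errPoly
    let h0 := red (P.Q c.lvl) (nmul (sk i) c.c1 + M + e0)
    let h1 := red P.QL (-(nmul (sk i) a) - φ M + e1)
    note none h0
    note none h1
    pure (h0, h1)
  let z := red (P.Q c.lvl) (c.c0 + ∑ i, (h i).1)
  pure { c0 := red P.QL (φ z + ∑ i, (h i).2), c1 := a, lvl := P.L, scale := P.S }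

/-- The result of a bootstrapping. -/
def refreshed (φ : P.Poly → P.Poly) (c : Ct P) (a : P.Poly) (h0 h1 : Fin N → P.Poly) : Ct P where
  c0 := red P.QL (φ (red (P.Q c.lvl) (c.c0 + ∑ i, h0 i)) + ∑ i, h1 i)
  c1 := a
  lvl := P.L
  scale := P.S

/-- The log of a bootstrapping. -/
def refreshLog (a : P.Poly) (M e0 e1 h0 h1 : Fin N → P.Poly) :
    List (Option (Fin N) × P.Poly) :=
  (none, a) :: (List.ofFn fun i => [(some i, M i), (some i, e0 i), (some i, e1 i), (none, h0 i),
    (none, h1 i)]).flatten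

/-- The samples of the parties are independent of the log and of one another, so all masks and then
all errors may be drawn before any share is formed. -/
theorem ex_run_refresh (Φ : Matrix (Fin P.slots) (Fin P.slots) ℂ) (B : ℕ) (c : Ct P)
    (t : Trace P N) (F : Ct P × Trace P N → ℝ≥0∞) :
    ex ((refresh sk lam Φ B c).run t) F = ex (P.unifPoly P.QL) fun a =>
      ex (seqFin fun _ : Fin N => P.unifPoly (B * 2 ^ lam)) fun M =>
      ex (seqFin fun _ : Fin N => P.errPoly) fun e0 =>
      ex (seqFin fun _ : Fin N => P.errPoly) fun e1 =>
        F (refreshed (P.transform Φ (P.S / c.scale)) c a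
            (fun i => red (P.Q c.lvl) (nmul (sk i) c.c1 + M i + e0 i))
            (fun i => red P.QL (-(nmul (sk i) a) - P.transform Φ (P.S / c.scale) (M i) + e1 i)),
          { log := t.log ++ refreshLog a M e0 e1
              (fun i => red (P.Q c.lvl) (nmul (sk i) c.c1 + M i + e0 i))
              (fun i => red P.QL (-(nmul (sk i) a) - P.transform Φ (P.S / c.scale) (M i) + e1 i))
            ok := t.ok && phaseLE sk B c }) := by
  have hmod : ∀ (t : Trace P N) (F : Unit × Trace P N → ℝ≥0∞),
      ex ((modify fun t => { t with ok := t.ok && phaseLE sk B c } : Run P N Unit).run t) F =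
        F ((), { t with ok := t.ok && phaseLE sk B c }) := fun t F => ex_pure _ _
  simp only [refresh, crs, ex_run_bind, hmod, ex_run_lift, ex_run_note, ex_run_pure]
  refine ex_congr fun a => ?_
  set φ := P.transform Φ (P.S / c.scale)
  let fin : Fin N → P.Poly → P.Poly → P.Poly → Run P N (P.Poly × P.Poly) := fun i M e0 e1 => do
    note (some i) M
    note (some i) e0
    note (some i) e1
    note none (red (P.Q c.lvl) (nmul (sk i) c.c1 + M + e0))
    note none (red P.QL (-(nmul (sk i) a) - φ M + e1))
    pure (red (P.Q c.lvl) (nmul (sk i) c.c1 + M + e0), red P.QL (-(nmul (sk i) a) - φ M + e1))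
  rw [ex_run_seqFin (μ := fun _ => P.unifPoly (B * 2 ^ lam)) (g := fun i M => do
    let e0 ← StateT.lift P.errPoly
    let e1 ← StateT.lift P.errPoly
    fin i M e0 e1)]
  swap
  · intro i t F
    simp only [draw, ex_run_bind, ex_run_lift, ex_run_note, ex_run_pure, fin]
  refine ex_congr fun M => ?_
  rw [ex_run_seqFin (μ := fun _ => P.errPoly) (g := fun i e0 => do
    let e1 ← StateT.lift P.errPoly
    fin i (M i) e0 e1)]
  swap
  · intro i t F
    simp only [ex_run_bind, ex_run_lift]
  refine ex_congr fun e0 => ?_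
  rw [ex_run_seqFin (μ := fun _ => P.errPoly) (g := fun i e1 => fin i (M i) (e0 i) e1)]
  swap
  · intro i t F
    simp only [ex_run_bind, ex_run_lift]
  refine ex_congr fun e1 => ?_
  rw [ex_run_seqFin_det
    (v := fun i => (red (P.Q c.lvl) (nmul (sk i) c.c1 + M i + e0 i),
      red P.QL (-(nmul (sk i) a) - φ (M i) + e1 i)))
    (l := fun i => [(some i, M i), (some i, e0 i), (some i, e1 i),
      (none, red (P.Q c.lvl) (nmul (sk i) c.c1 + M i + e0 i)),
      (none, red P.QL (-(nmul (sk i) a) - φ (M i) + e1 i))])]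
  · simp only [List.append_assoc, List.cons_append, List.nil_append, refreshed, refreshLog]
  · intro i t F
    simp only [ex_run_bind, ex_run_note, ex_run_pure, List.append_assoc, List.cons_append,
      List.nil_append, fin]

/-- The only lossy step of the comparison. The mask of `h` is translated by the phase; thereafter
protocol and game agree exactly, the error in the second share of `h` being the one in the answer of
the oracle. -/
theorem rel_refresh (hh : h ∉ A) (Φ : Matrix (Fin P.slots) (Fin P.slots) ℂ) (B : ℕ) (c : Ct P) :
    Rel A lam (sk h) R LvlOk (refreshNodes lam N B) (refresh sk lam Φ B c)
      (gRefresh A h (Function.update sk h 0) lam Φ B c) := by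
  refine ⟨?_, fun t q hq => ?_, fun F hF t => ?_⟩
  · exact (ok_coins _).bind fun _ _ => (ok_coins _).bind fun _ _ => (ok_coins _).bind fun _ _ =>
      .query fun a b => .emit (.ret (le_refl P.L))
  · obtain ⟨_, _, hq⟩ := mem_support_run_bind hq
    obtain ⟨_, _, hq⟩ := mem_support_run_bind hq
    obtain ⟨_, _, hq⟩ := mem_support_run_bind hq
    rw [eq_of_mem_support_run_pure hq]
    exact le_refl P.L
  rw [ex_run_refresh]
  set φ := P.transform Φ (P.S / c.scale) with hφ
  set ρ := Function.update sk h 0 with hρ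
  by_cases ht : (t.ok && phaseLE sk B c) = true
  swap
  · simp [ht, ex_zero]
  rw [if_pos (Bool.and_eq_true _ _ ▸ ht).1]
  simp only [ht, if_true]
  -- The flag `ok` guarantees this bound; without it the mask would not flood the phase.
  have hB : ∀ j, |phase ρ c (sk h) j| ≤ B := by
    have := of_decide_eq_true (Bool.and_eq_true _ _ ▸ ht).2
    intro j
    have := this j
    rwa [sum_update_zero sk h] at this
  -- the expectation with the mask of the honest party shifted
  let G : P.Poly → (Fin N → P.Poly) → (Fin N → P.Poly) → (Fin N → P.Poly) → ℝ≥0∞ :=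
    fun a M e0 e1 =>
      F (refreshed φ c a (fun i => red (P.Q c.lvl) (nmul (sk i) c.c1 + M i + e0 i))
            (fun i => red P.QL (-(nmul (sk i) a) - φ (M i) + e1 i)))
        (vis A (t.log ++ refreshLog a M e0 e1
              (fun i => red (P.Q c.lvl) (nmul (sk i) c.c1 + M i + e0 i))
              (fun i => red P.QL (-(nmul (sk i) a) - φ (M i) + e1 i))))
  let G' : (Fin N → P.Poly) → ℝ≥0∞ := fun M =>
    ex (seqFin fun _ : Fin N => P.errPoly) fun e0 =>
      ex (seqFin fun _ : Fin N => P.errPoly) fun e1 => ex (P.unifPoly P.QL) fun a => G a M e0 e1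
  have hG' : ∀ M, G' M ≤ 1 := fun M => ex_le fun _ => ex_le fun _ => ex_le fun _ => hF _ _
  have hL : (ex (P.unifPoly P.QL) fun a =>
      ex (seqFin fun _ : Fin N => P.unifPoly (B * 2 ^ lam)) fun M =>
      ex (seqFin fun _ : Fin N => P.errPoly) fun e0 =>
      ex (seqFin fun _ : Fin N => P.errPoly) fun e1 => G a M e0 e1) =
      ex (seqFin fun _ : Fin N => P.unifPoly (B * 2 ^ lam)) G' := by
    rw [ex_comm]
    refine ex_congr fun M => ?_
    rw [ex_comm]
    refine ex_congr fun e0 => ?_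
    rw [ex_comm]
  refine hL.trans_le ?_
  rw [ex_seqFin_update _ h]
  -- Coefficient by coefficient: a translation by at most `B` of a uniform value below `B * 2 ^ lam`
  -- costs `2 ^ (-lam)`, and there are `n` coefficients.
  have hflood : ∀ M : Fin N → P.Poly, (ex (P.unifPoly (B * 2 ^ lam)) fun w =>
      G' (Function.update M h w)) ≤ (ex (P.unifPoly (B * 2 ^ lam)) fun w =>
        G' (Function.update M h (w - phase ρ c (sk h)))) + flood P lam := by
    intro M
    refine ex_seqFin_le (fun j z => z - phase ρ c (sk h) j) (fun j G hG => ?_) _ fun _ => hG' _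
    refine ex_unif_le_shift _ _ ?_ G hG
    have h1 : (phase ρ c (sk h) j).natAbs ≤ B := by
      have := hB j
      rw [Int.abs_eq_natAbs] at this
      exact_mod_cast this
    push_cast
    rw [mul_assoc, ENNReal.mul_inv_cancel (by simp) (by simp), mul_one]
    exact_mod_cast h1
  refine (ex_le_add fun M _ => hflood M).trans ?_
  -- One unit of loss is available because the list of operations contains a query.
  have hlen : flood P lam ≤ (refreshNodes lam N B).length * flood P lam := by
    refine le_mul_of_one_le_left zero_le ?_
    simp only [refreshNodes, List.length_append, List.length_cons, List.length_nil]
    push_cast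
    exact le_add_left (le_add_left (le_add_left (by simp)))
  refine add_le_add (le_of_eq ?_) hlen
  simp only [gRefresh, wp_coins]
  refine Eq.trans ?_ (ex_seqFin_update (fun _ : Fin N => P.unifPoly (B * 2 ^ lam)) h _).symm
  refine ex_congr fun M => ex_congr fun w => ex_congr fun e0 => ?_
  -- The error of `h` in its second share is redrawn, to be identified with the error of the
  -- encryption.
  refine (ex_seqFin_update (fun _ : Fin N => P.errPoly) h _).trans ?_
  refine ex_congr fun e1 => ?_
  rw [ex_comm, query', wp_bind]
  simp only [wp, encKernel, ex_bind, ex_map]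
  refine ex_congr fun a => ex_congr fun e => ?_
  set M' := Function.update M h (w - phase ρ c (sk h)) with hM'
  set M₁ := Function.update M h w with hM₁
  set b := red P.QL (-(nmul (sk h) a) + e +
    red P.QL (-(φ (M₁ h - phase ρ c (sk h))))) with hb
  have h0 : (fun i => red (P.Q c.lvl) (nmul (sk i) c.c1 + M' i + e0 i)) =
      bootShare0 h ρ c M₁ e0 := by
    funext i
    by_cases hi : i = h
    · subst hi
      rw [bootShare0, if_pos rfl, hM', hM₁, Function.update_self, Function.update_self]
      refine red_congr fun j => ?_
      -- The phase is a centred residue, but the share is reduced modulo `Q` anyway, so only its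
      -- class matters.
      have h1 : phase ρ c (sk i) j ≡
          c.c0 j + (nmul (sk i) c.c1 j + nmul (∑ i, ρ i) c.c1 j) [ZMOD P.Q c.lvl] := by
        have : phase ρ c (sk i) j ≡ (c.c0 + nmul (sk i + ∑ i, ρ i) c.c1) j [ZMOD P.Q c.lvl] :=
          Int.bmod_emod
        rwa [add_nmul] at this
      have h2 := (h1.sub_left (nmul (sk i) c.c1 j + w j + e0 i j))
      refine Eq.trans (congrArg (· % (P.Q c.lvl : ℤ)) ?_)
        (Eq.trans h2 (congrArg (· % (P.Q c.lvl : ℤ)) ?_))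
      · simp only [Pi.add_apply, Pi.sub_apply]
        ring
      · simp only [Pi.add_apply, Pi.sub_apply]
        ring
    · rw [bootShare0, if_neg hi, hM', hM₁, hρ, Function.update_of_ne hi, Function.update_of_ne hi,
        Function.update_of_ne hi]
  have h1 : (fun i => red P.QL (-(nmul (sk i) a) - φ (M' i) + Function.update e1 h e i)) =
      bootShare1 h ρ φ (a, b) M₁ e1 := by
    funext i
    by_cases hi : i = h
    · subst hi
      rw [bootShare1, if_pos rfl, hM', Function.update_self, Function.update_self]
      refine red_congr fun j => ?_
      simp only [hM₁, Function.update_self]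
      have h2 := (red_modEq (Q := P.QL) (-(φ (w - phase ρ c (sk i)))) j).symm.add_left
        ((-(nmul (sk i) a) + e) j)
      refine Eq.trans (congrArg (· % (P.QL : ℤ)) ?_) h2
      simp only [Pi.add_apply, Pi.sub_apply, Pi.neg_apply]
      ring
    · rw [bootShare1, if_neg hi, hM', hM₁, hρ, Function.update_of_ne hi, Function.update_of_ne hi,
        Function.update_of_ne hi, Function.update_of_ne hi]
  have h2 : vis A (t.log ++ refreshLog a M' e0 (Function.update e1 h e)
      (bootShare0 h ρ c M₁ e0) (bootShare1 h ρ φ (a, b) M₁ e1)) =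
      vis A t.log ++ vis A (refreshLog a M₁ e0 e1
        (bootShare0 h ρ c M₁ e0) (bootShare1 h ρ φ (a, b) M₁ e1)) := by
    rw [vis_append, refreshLog, refreshLog, vis_cons _ (List.flatten _),
      vis_cons _ (List.flatten _)]
    congr 2
    refine vis_flatten_ofFn fun i => ?_
    by_cases hi : i = h
    · subst hi
      simp only [vis_hidden hh]
    · rw [hM', hM₁, Function.update_of_ne hi, Function.update_of_ne hi, Function.update_of_ne hi]
  show G a M' e0 (Function.update e1 h e) = _
  simp only [G]
  rw [h0, h1, h2]
  rfl

theorem rel_bootstrap (hh : h ∉ A) (K : PubKeys P) (hR : R K.pk0 K.pk1) (i : Fin N)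
    (Φ : Matrix (Fin P.slots) (Fin P.slots) ℂ) (B : ℕ) {c : Ct P} (hc : LvlOk c) :
    Rel A lam (sk h) R LvlOk (bootNodes A lam i B) (bootstrap sk K lam i Φ B c)
      (gBoot A h (Function.update sk h 0) K lam i Φ B c) := by
  refine (rel_rerandomize K hR i hc).bind fun c hc => ?_
  rw [← List.nil_append (refreshNodes lam N B)]
  exact (rel_send c).bind fun _ _ => rel_refresh hh Φ B c

theorem lvlOk_getD {regs : List (Ct P)} (hr : ∀ c ∈ regs, LvlOk c) (a : ℕ) :
    LvlOk (regs.getD a (Ct.ofPlain 0 P.S)) := by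
  rw [List.getD_eq_getElem?_getD]
  cases h : regs[a]? with
  | none => exact le_refl P.L
  | some c => exact hr c (List.mem_of_getElem? h)

theorem lvlOk_res {c : Ct P} (hc : LvlOk c) : LvlOk c.res := by
  unfold Ct.res
  split_ifs
  · exact hc
  · exact (Nat.sub_le _ _).trans hc

theorem lvlOk_setScale {c : Ct P} (hc : LvlOk c) (s : ℝ) : LvlOk (c.setScale s) :=
  lvlOk_res (c := { c with c0 := _, c1 := _ }) hc

/-- Apart from the bootstrapping, the instructions are deterministic and local, and identical on
both sides; only the levels have to be watched. -/
theorem rel_step (hh : h ∉ A) (K : PubKeys P) (hR : R K.pk0 K.pk1) (i : Fin N) {d : ℕ}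
    (own : Fin d → P.Msg) {regs : List (Ct P)} (hr : ∀ c ∈ regs, LvlOk c) (I : Instr P d) :
    Rel A lam (sk h) R LvlOk (stepNodes A lam i I) (step sk K lam i own regs I)
      (gStep A h (Function.update sk h 0) K lam i own regs I) := by
  have hg := lvlOk_getD hr
  cases I with
  | add a b => exact .pure ((min_le_left _ _).trans (hg a))
  | sub a b => exact .pure ((min_le_left _ _).trans (hg a))
  | mul a b => exact .pure ((min_le_left _ _).trans (hg a))
  | addPt a p => exact .pure ((min_le_left _ _).trans (hg a))
  | ptSub p a => exact .pure ((min_le_right _ _).trans (hg a))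
  | mulPt a p => exact .pure (hg a)
  | rotL a k => exact .pure (hg a)
  | res a => exact .pure (lvlOk_res (hg a))
  | setScale a s => exact .pure (lvlOk_setScale (hg a) s)
  | boot a Φ B => exact rel_bootstrap hh K hR i Φ B (hg a)

theorem rel_local (hh : h ∉ A) (K : PubKeys P) (hR : R K.pk0 K.pk1) (i : Fin N) {d : ℕ}
    (own : Fin d → P.Msg) (Is : List (Instr P d)) {regs : List (Ct P)}
    (hr : ∀ c ∈ regs, LvlOk c) :
    Rel A lam (sk h) R (fun regs => ∀ c ∈ regs, LvlOk c) (localNodes A lam i Is)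
      (runLocal sk K lam i own Is regs)
      (gLocal A h (Function.update sk h 0) K lam i own Is regs) := by
  induction Is generalizing regs with
  | nil => exact .pure hr
  | cons I Is ih =>
    rw [localNodes, List.map_cons, List.flatten_cons]
    refine (rel_step hh K hR i own hr I).bind fun c hc => ih fun c' hc' => ?_
    rcases List.mem_append.1 hc' with h | h
    · exact hr _ h
    · rw [List.mem_singleton.1 h]
      exact hc

end Steps

/-! ### The whole protocol compared with the game -/

section Training

variable {T : Training P} {A : Finset (Fin T.N)} {h : Fin T.N} {sk : Fin T.N → P.Poly}
  {R : P.Poly → P.Poly → Prop}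

theorem lvlOk_updated {W : Fin T.nW → Ct P} (hW : ∀ j, LvlOk (W j))
    (G : Fin T.N → Fin T.nW → Ct P) (j : Fin T.nW) : LvlOk (T.updated W G j) :=
  (min_le_left _ _).trans (hW j)

theorem rel_rerandomize_send (K : PubKeys P) (hR : R K.pk0 K.pk1) (i : Fin T.N) {c : Ct P}
    (hc : LvlOk c) (s : P.Poly) :
    Rel A T.lam s R LvlOk (rerNodes A i)
      (do let c ← rerandomize K i c; send c; pure c : Run P T.N (Ct P))
      (do let c ← gRer A K i c; gSend A c; pure c) := by
  rw [← List.append_nil (rerNodes A i)]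
  refine (rel_rerandomize K hR i hc).bind fun c hc => ?_
  exact (rel_send c).bind_pure fun _ _ => hc

theorem rel_iteration (hh : h ∉ A) (K : PubKeys P) (hR : R K.pk0 K.pk1) (x : T.Inputs)
    (k : Fin T.m) {W : Fin T.nW → Ct P} (hW : ∀ j, LvlOk (W j)) :
    Rel A T.lam (sk h) R (fun W => ∀ j, LvlOk (W j)) (iterationNodes T A k)
      (T.iteration sk K x k W) (gIteration T A h (Function.update sk h 0) K x k W) := by
  refine Rel.bind (I := fun W => ∀ j, LvlOk (W j)) (Rel.seqFin (I := fun _ => LvlOk) fun j =>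
    rel_rerandomize_send K hR _ (hW j) _) fun W hW => ?_
  refine Rel.bind (I := fun G => ∀ i j, LvlOk (G i j))
    (Rel.seqFin (I := fun _ (g : Fin T.nW → Ct P) => ∀ j, LvlOk (g j)) fun i => ?_) fun G hG => ?_
  · refine (rel_local hh K hR i _ _ fun c hc => ?_).bind fun regs hr =>
      Rel.seqFin (I := fun _ => LvlOk) fun j => rel_rerandomize_send K hR i (lvlOk_getD hr _) _
    obtain ⟨j, rfl⟩ := List.mem_ofFn.1 hc
    exact hW j
  · exact Rel.seqFin (I := fun _ => LvlOk) fun j =>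
      rel_bootstrap hh K hR _ 1 T.B (lvlOk_updated hW G j)

/-- The part of the protocol that follows the key generation. -/
def mainPart (T : Training P) (sk : Fin T.N → P.Poly) (K : PubKeys P) (x : T.Inputs) :
    Run P T.N (Fin T.nW → Ct P) := do
  let W ← seqFin fun j => encrypt K T.first ((x T.first).w0 j)
  (List.finRange T.m).foldlM (fun W k => T.iteration sk K x k W) W

theorem rel_mainPart (hh : h ∉ A) (K : PubKeys P) (hR : R K.pk0 K.pk1) (x : T.Inputs) :
    Rel A T.lam (sk h) R (fun _ => True) (mainNodes T A) (mainPart T sk K x)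
      (gMain T A h (Function.update sk h 0) K x) := by
  refine Rel.bind (I := fun W => ∀ j, LvlOk (W j)) (Rel.seqFin (I := fun _ => LvlOk) fun j =>
    rel_rerandomize K hR _ (c := Ct.ofPlain _ _) (le_refl P.L)) fun W hW => ?_
  exact (Rel.foldlM (I := fun W => ∀ j, LvlOk (W j))
    (fun W k hW => rel_iteration (W := W) hh K hR x k hW) _ hW).mono (fun _ _ h => h) fun _ _ =>
      trivial

/-- The protocol, after the secret keys have been drawn. -/
def protocolRest (T : Training P) (sk : Fin T.N → P.Poly) (x : T.Inputs) :
    Run P T.N (Fin T.nW → Ct P) := keyRest sk >>= fun K => mainPart T sk K x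

theorem rel_protocolRest (hh : h ∉ A) (x : T.Inputs) :
    Rel A T.lam (sk h) (fun _ _ => True) (fun _ => True) (totalNodes T A) (protocolRest T sk x)
      (gKeys A h (Function.update sk h 0) >>= fun K =>
        gMain T A h (Function.update sk h 0) K x) :=
  (rel_keyRest hh).bind fun K _ => rel_mainPart hh K trivial x

theorem flatten_ofFn_singleton {k : ℕ} (f : Fin k → α) :
    (List.ofFn fun i => [f i]).flatten = List.ofFn f := by
  induction k with
  | zero => rfl
  | succ k ih => rw [List.ofFn_succ, List.flatten_cons, ih, List.ofFn_succ, List.singleton_append]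

theorem ex_run_keyGen {N : ℕ} (t : Trace P N)
    (F : ((Fin N → P.Poly) × PubKeys P) × Trace P N → ℝ≥0∞) :
    ex (keyGen.run t) F = ex (seqFin fun _ : Fin N => P.ternaryPoly) fun sk =>
      ex ((keyRest sk).run { t with log := t.log ++ (List.ofFn fun i => (some i, sk i)) })
        fun q => F ((sk, q.1), q.2) := by
  simp only [keyGen, keyRest, keyPair, ex_run_bind, ex_run_pure]
  rw [ex_run_seqFin (μ := fun _ => P.ternaryPoly) (g := fun i v => do
    note (some i) v
    pure v)]
  · refine ex_congr fun sk => ?_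
    rw [ex_run_seqFin_det (v := sk) (l := fun i => [(some i, sk i)])]
    · rw [flatten_ofFn_singleton]
    · intro i t F
      simp only [ex_run_bind, ex_run_note, ex_run_pure]
  · intro i t F
    simp only [draw, ex_run_bind, ex_run_lift, ex_run_note, ex_run_pure]

theorem ex_run_protocol (x : T.Inputs) (t : Trace P T.N)
    (F : (Fin T.nW → Ct P) × Trace P T.N → ℝ≥0∞) :
    ex ((T.protocol x).run t) F = ex (seqFin fun _ : Fin T.N => P.ternaryPoly) fun sk =>
      ex ((protocolRest T sk x).run { t with
        log := t.log ++ (List.ofFn fun i => (some i, sk i)) }) F := by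
  rw [Training.protocol, ex_run_bind, ex_run_keyGen]
  simp only [protocolRest, mainPart, ex_run_bind]

theorem ok_gTotal (hh : h ∉ A) (x : T.Inputs) :
    Ok (fun _ _ => True) (fun _ => True) (totalNodes T A)
      (gTotal T A h (Function.update sk h 0) x) :=
  .emit (rel_protocolRest hh x).ok

theorem vis_ofFn_update (hh : h ∉ A) :
    vis A (List.ofFn fun i => (some i, Function.update sk h 0 i)) =
      vis A (List.ofFn fun i => (some i, sk i)) := by
  rw [← flatten_ofFn_singleton fun i => (some i, Function.update sk h 0 i),
    ← flatten_ofFn_singleton fun i => (some i, sk i)]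
  refine vis_flatten_ofFn fun i => ?_
  by_cases hi : i = h
  · subst hi
    rw [vis_hidden hh, vis_hidden hh]
  · rw [Function.update_of_ne hi]

/-- The view of the coalition in the real protocol and with the secret of the honest party `h`
behind an encryption oracle. -/
theorem ex_view_le (hh : h ∉ A) (x : T.Inputs) (F : List ℤ → ℝ≥0∞) (hF : ∀ l, F l ≤ 1) :
    ex (T.view A x) F ≤ (ex (seqFin fun _ : Fin T.N => P.ternaryPoly) fun sk =>
      wp (encKernel (sk h)) (gTotal T A h (Function.update sk h 0) x)
        (fun _ l => F (T.inputsOf A x ++ l)) []) +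
      ((totalNodes T A).length * flood P T.lam + T.overflow x) := by
  have hover : T.overflow x = ex (T.trace x) fun t => if t.ok then 0 else 1 := by
    rw [Training.overflow, PMF.map_apply, ex]
    refine tsum_congr fun t => ?_
    cases t.ok <;> simp
  have hview : ex (T.view A x) F = ex (T.trace x) fun t => F (T.inputsOf A x ++ vis A t.log) := by
    rw [Training.view, ex_map]
    rfl
  -- A run that violates a bound contributes at most `1`, which is charged to `overflow`.
  have hsplit : ex (T.view A x) F ≤ (ex (T.trace x) fun t =>
      if t.ok then F (T.inputsOf A x ++ vis A t.log) else 0) + T.overflow x := by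
    rw [hview, hover, ← ex_add]
    refine ex_mono fun t => ?_
    cases t.ok
    · simpa using hF _
    · simp
  refine hsplit.trans ?_
  rw [← add_assoc]
  gcongr
  rw [Training.trace, ex_map, ex_run_protocol]
  refine ex_le_add fun sk _ => ?_
  have := (rel_protocolRest (T := T) (sk := sk) hh x).le
    (fun _ l => F (T.inputsOf A x ++ l)) (fun _ _ => hF _)
    { log := [] ++ (List.ofFn fun i => (some i, sk i)), ok := true }
  refine this.trans_eq ?_
  rw [if_pos rfl, List.nil_append, ← vis_ofFn_update hh]
  rfl

end Training

/-! ## Straight-line programs for families of values -/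

theorem execWords_append (p q : List WordInstr) (mem : List ℤ) :
    execWords (p ++ q) mem = execWords q (execWords p mem) := by
  induction p generalizing mem with
  | nil => rfl
  | cons I p ih => exact ih _

theorem length_execWords (p : List WordInstr) (mem : List ℤ) :
    (execWords p mem).length = mem.length + p.length := by
  induction p generalizing mem with
  | nil => rfl
  | cons I p ih =>
    rw [execWords, ih, List.length_append, List.length_cons, List.length_cons, List.length_nil]
    omega

theorem wrap_eq {w : ℕ} {z : ℤ} (h : |z| < 2 ^ w) : wrap (w + 1) z = z := by
  rw [abs_lt] at h
  rw [wrap]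
  refine Int.bmod_eq_of_le ?_ ?_ <;> push_cast <;> rw [pow_succ] <;> omega

/-- A representation of the elements of `X` by lists of integers of a fixed length; the parameter
`κ` determines the sizes of words. -/
structure Enc (X : Type) where
  inp : X → List ℤ
  len : ℕ
  length_inp : ∀ x, (inp x).length = len
  κ : ℕ
  le_κ : 64 ≤ κ

section Gen

variable {X : Type} (E : Enc X)

/-- The length of words. -/
def Enc.W : ℕ := 40 * E.κ + 1

/-- The bound `2 ^ (κ b)`. -/
def Enc.bd (b : ℕ) : ℤ := 2 ^ (E.κ * b)

/-- Some program with at most `k` instructions computes all the members of `S`. -/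
def Gen (k : ℕ) (S : Set (X → ℤ)) : Prop :=
  ∃ prog : List WordInstr, prog.length ≤ k ∧ (∀ I ∈ prog, I.w = E.W) ∧
    ∀ v ∈ S, ∃ t < E.len + prog.length, ∀ x, (execWords prog (E.inp x)).getD t 0 = v x

variable {E}

theorem Gen.mono {k k' : ℕ} {S S' : Set (X → ℤ)} (h : Gen E k S) (hk : k ≤ k') (hS : S' ⊆ S) :
    Gen E k' S' := by
  obtain ⟨prog, h1, h2, h3⟩ := h
  exact ⟨prog, h1.trans hk, h2, fun v hv => h3 v (hS hv)⟩

/-- Appending an instruction leaves the older cells in place; the new value sits in cell `E.len +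
prog.length`, the same for all inputs because their encodings have a fixed length. -/
theorem Gen.insert_instr {k : ℕ} {S : Set (X → ℤ)} (h : Gen E k S) {v : X → ℤ} (op : WordOp)
    (u w : X → ℤ) (hop : (u ∈ S ∧ w ∈ S) ∨ ∃ z, op = .const z)
    (hv : ∀ x, wrap E.W (op.eval (wrap E.W (u x)) (wrap E.W (w x))) = v x) :
    Gen E (k + 1) (insert v S) := by
  obtain ⟨prog, h1, h2, h3⟩ := h
  have hex : ∃ i j, ∀ x, op.eval (wrap E.W ((execWords prog (E.inp x)).getD i 0))
      (wrap E.W ((execWords prog (E.inp x)).getD j 0)) =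
        op.eval (wrap E.W (u x)) (wrap E.W (w x)) := by
    rcases hop with ⟨hu, hw⟩ | ⟨z, rfl⟩
    · obtain ⟨i, -, hi⟩ := h3 u hu
      obtain ⟨j, -, hj⟩ := h3 w hw
      exact ⟨i, j, fun x => by rw [hi, hj]⟩
    · exact ⟨0, 0, fun x => rfl⟩
  obtain ⟨i, j, hij⟩ := hex
  refine ⟨prog ++ [⟨op, i, j, E.W⟩], by simp [h1], ?_, ?_⟩
  · intro I hI
    rcases List.mem_append.1 hI with hI | hI
    · exact h2 I hI
    · rw [List.mem_singleton.1 hI]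
  · have hlen : ∀ x, (execWords prog (E.inp x)).length = E.len + prog.length := fun x => by
      rw [length_execWords, E.length_inp]
    intro v' hv'
    rcases hv' with rfl | hv'
    · refine ⟨E.len + prog.length, by simp, fun x => ?_⟩
      rw [execWords_append, ← hlen x]
      simp only [execWords]
      rw [List.getD_append_right _ _ _ _ le_rfl, Nat.sub_self, List.getD_cons_zero, hij, hv]
    · obtain ⟨t, ht, h⟩ := h3 v' hv'
      refine ⟨t, by simp; omega, fun x => ?_⟩
      rw [execWords_append]
      simp only [execWords]
      rw [List.getD_append _ _ _ _ (by rw [hlen]; exact ht), h]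

variable (E) in
/-- From the members of `S`, values that satisfy `Q` are computed by `k` further instructions. -/
def Has (S : Set (X → ℤ)) (k : ℕ) (Q : Set (X → ℤ) → Prop) : Prop :=
  -- The instructions can be appended to any program that provides at least `S`. This quantifier
  -- over `S'` is what lets pieces of code be composed.
  ∃ S₁, S ⊆ S₁ ∧ (∀ k₀ S', S ⊆ S' → Gen E k₀ S' → Gen E (k₀ + k) (S' ∪ S₁)) ∧ Q S₁

/-- Properties that are inherited by larger sets. -/
def Inherited (Q : Set (X → ℤ) → Prop) : Prop := ∀ S S', S ⊆ S' → Q S → Q S'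

theorem Has.intro {S : Set (X → ℤ)} {Q : Set (X → ℤ) → Prop} (h : Q S) : Has E S 0 Q :=
  ⟨S, subset_rfl, fun _ _ hS hG => by rwa [Set.union_eq_self_of_subset_right hS], h⟩

theorem Has.bind {S : Set (X → ℤ)} {k₁ k₂ : ℕ} {Q₁ Q₂ : Set (X → ℤ) → Prop}
    (h₁ : Has E S k₁ Q₁) (h₂ : ∀ S₁, S ⊆ S₁ → Q₁ S₁ → Has E S₁ k₂ Q₂) : Has E S (k₁ + k₂) Q₂ := by
  obtain ⟨S₁, hS₁, hG₁, hQ₁⟩ := h₁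
  obtain ⟨S₂, hS₂, hG₂, hQ₂⟩ := h₂ S₁ hS₁ hQ₁
  refine ⟨S₂, hS₁.trans hS₂, fun k₀ S' hS' hG => ?_, hQ₂⟩
  have := hG₂ _ _ Set.subset_union_right (hG₁ _ _ hS' hG)
  rw [← add_assoc]
  exact this.mono le_rfl (Set.union_subset_union_left _ Set.subset_union_left)

theorem Has.weaken {S : Set (X → ℤ)} {k k' : ℕ} {Q Q' : Set (X → ℤ) → Prop} (h : Has E S k Q)
    (hk : k ≤ k') (hQ : ∀ S₁, S ⊆ S₁ → Q S₁ → Q' S₁) : Has E S k' Q' := by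
  obtain ⟨S₁, hS₁, hG, hQ₁⟩ := h
  exact ⟨S₁, hS₁, fun k₀ S' hS' h => (hG k₀ S' hS' h).mono (by omega) subset_rfl, hQ S₁ hS₁ hQ₁⟩

theorem Has.mono {S S' : Set (X → ℤ)} {k : ℕ} {Q : Set (X → ℤ) → Prop} (h : Has E S k Q)
    (hS : S ⊆ S') (hQ : Inherited Q) : Has E S' k Q := by
  obtain ⟨S₁, hS₁, hG, hQ₁⟩ := h
  refine ⟨S' ∪ S₁, Set.subset_union_left, fun k₀ S'' hS'' h => ?_,
    hQ _ _ Set.subset_union_right hQ₁⟩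
  refine (hG k₀ S'' (hS.trans hS'') h).mono le_rfl ?_
  rw [← Set.union_assoc, Set.union_eq_self_of_subset_right hS'']

theorem Has.and {S : Set (X → ℤ)} {k₁ k₂ : ℕ} {Q₁ Q₂ : Set (X → ℤ) → Prop}
    (h₁ : Has E S k₁ Q₁) (h₂ : Has E S k₂ Q₂) (hQ₁ : Inherited Q₁) (hQ₂ : Inherited Q₂) :
    Has E S (k₁ + k₂) fun S' => Q₁ S' ∧ Q₂ S' :=
  h₁.bind fun _ hS₁ q₁ => (h₂.mono hS₁ hQ₂).weaken le_rfl fun _ hS₂ q₂ => ⟨hQ₁ _ _ hS₂ q₁, q₂⟩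

theorem Has.fin {S : Set (X → ℤ)} {n k : ℕ} {Q : Fin n → Set (X → ℤ) → Prop}
    (h : ∀ i, Has E S k (Q i)) (hQ : ∀ i, Inherited (Q i)) :
    Has E S (n * k) fun S' => ∀ i, Q i S' := by
  induction n with
  | zero =>
    rw [zero_mul]
    exact .intro fun i => i.elim0
  | succ n ih =>
    have := (ih (fun i => h i.castSucc) fun i => hQ _).and (h (Fin.last n))
      (fun S S' hS h i => hQ _ S S' hS (h i)) (hQ _)
    rw [Nat.succ_mul]
    refine this.weaken le_rfl fun S₁ _ hS i => ?_
    exact Fin.lastCases hS.2 hS.1 i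

/-! ### Bounded values -/

variable (E) in
/-- `v` is available and of absolute value at most `2 ^ (κ b)`. -/
def AvE (S : Set (X → ℤ)) (b : ℕ) (v : X → ℤ) : Prop := v ∈ S ∧ ∀ x, |v x| ≤ E.bd b

variable (E) in
/-- `v` is computable with `κ ^ e` instructions, and bounded. -/
def HasE (S : Set (X → ℤ)) (e b : ℕ) (v : X → ℤ) : Prop := Has E S (E.κ ^ e) fun S' => AvE E S' b v

theorem inherited_avE (b : ℕ) (v : X → ℤ) : Inherited fun S => AvE E S b v :=
  fun _ _ hS h => ⟨hS h.1, h.2⟩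

theorem Enc.κ_pos (E : Enc X) : 0 < E.κ := lt_of_lt_of_le (by norm_num) E.le_κ

theorem Enc.bd_pos (E : Enc X) (b : ℕ) : 0 < E.bd b := by
  unfold Enc.bd
  positivity

theorem Enc.bd_mono (E : Enc X) {b b' : ℕ} (h : b ≤ b') : E.bd b ≤ E.bd b' :=
  pow_le_pow_right₀ (by norm_num) (Nat.mul_le_mul_left _ h)

theorem Enc.bd_add (E : Enc X) (b b' : ℕ) : E.bd (b + b') = E.bd b * E.bd b' := by
  rw [Enc.bd, mul_add, pow_add]
  rfl

theorem Enc.κ_le_bd (E : Enc X) : (E.κ : ℤ) ≤ E.bd 1 := by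
  rw [Enc.bd, mul_one]
  exact_mod_cast Nat.lt_two_pow_self.le

theorem Enc.le_bd_one (E : Enc X) : 64 ≤ E.bd 1 :=
  le_trans (by exact_mod_cast E.le_κ) E.κ_le_bd

theorem Enc.two_bd (E : Enc X) (b : ℕ) : 64 * E.bd b ≤ E.bd (b + 1) := by
  rw [E.bd_add, mul_comm]
  exact mul_le_mul_of_nonneg_left E.le_bd_one (E.bd_pos b).le

/-- Words have `40 κ + 1` bits, so numbers bounded by `2 ^ (κ b)` with `b < 40` never overflow. All
size exponents are kept below `40` for this reason. -/
theorem Enc.wrap_eq {z : ℤ} {b : ℕ} (hz : |z| ≤ E.bd b) (hb : b < 40) : wrap E.W z = z := by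
  refine Poseidon.wrap_eq (hz.trans_lt ?_)
  rw [Enc.bd, mul_comm]
  exact pow_lt_pow_right₀ (by norm_num) (Nat.mul_lt_mul_of_pos_right hb E.κ_pos)

theorem Enc.pow_mono (E : Enc X) {e e' : ℕ} (h : e ≤ e') : E.κ ^ e ≤ E.κ ^ e' :=
  Nat.pow_le_pow_right E.κ_pos h

/-- As `κ ≥ 64`, a constant factor up to `64` is absorbed by one more power of `κ`. Thus costs can
be tracked by exponents alone. -/
theorem Enc.mul_pow_le (E : Enc X) {c e e' : ℕ} (hc : c ≤ 64) (h : e < e') :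
    c * E.κ ^ e ≤ E.κ ^ e' := by
  calc c * E.κ ^ e ≤ E.κ * E.κ ^ e := Nat.mul_le_mul_right _ (hc.trans E.le_κ)
    _ = E.κ ^ (e + 1) := by rw [pow_succ, mul_comm]
    _ ≤ _ := E.pow_mono h

theorem Enc.one_le_pow (E : Enc X) (e : ℕ) : 1 ≤ E.κ ^ e := Nat.one_le_pow _ _ E.κ_pos

theorem Enc.add_pow_le (E : Enc X) {a b k₁ k₂ : ℕ} (h₁ : k₁ ≤ E.κ ^ a) (h₂ : k₂ ≤ E.κ ^ b) :
    k₁ + k₂ + 1 ≤ E.κ ^ (max a b + 1) := by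
  have := E.mul_pow_le (c := 3) (e := max a b) (by norm_num) (Nat.lt_succ_self _)
  have h1 := h₁.trans (E.pow_mono (le_max_left a b))
  have h2 := h₂.trans (E.pow_mono (le_max_right a b))
  have h3 := E.one_le_pow (max a b)
  rw [Nat.succ_eq_add_one] at this
  omega

theorem HasE.weaken {S : Set (X → ℤ)} {e b e' b' : ℕ} {v : X → ℤ} (h : HasE E S e b v)
    (he : e ≤ e') (hb : b ≤ b') : HasE E S e' b' v :=
  Has.weaken h (E.pow_mono he) fun _ _ h => ⟨h.1, fun x => (h.2 x).trans (E.bd_mono hb)⟩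

theorem HasE.mono {S S' : Set (X → ℤ)} {e b : ℕ} {v : X → ℤ} (h : HasE E S e b v) (hS : S ⊆ S') :
    HasE E S' e b v := Has.mono h hS (inherited_avE b v)

theorem AvE.hasE {S : Set (X → ℤ)} {b : ℕ} {v : X → ℤ} (h : AvE E S b v) : HasE E S 0 b v :=
  (Has.intro h).weaken (Nat.zero_le _) fun _ _ h => h

theorem Has.instr {S : Set (X → ℤ)} {b : ℕ} {v : X → ℤ} (op : WordOp)
    (u w : X → ℤ) (hop : (u ∈ S ∧ w ∈ S) ∨ ∃ z, op = .const z)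
    (hu : ∀ x, |u x| ≤ E.bd 39) (hw : ∀ x, |w x| ≤ E.bd 39)
    (hv : ∀ x, op.eval (u x) (w x) = v x) (hb : b < 40) (hvb : ∀ x, |v x| ≤ E.bd b) :
    Has E S 1 fun S' => AvE E S' b v := by
  refine ⟨insert v S, Set.subset_insert _ _, fun k₀ S' hS' hG => ?_, Set.mem_insert _ _, hvb⟩
  refine (hG.insert_instr op u w (hop.imp (fun h => ⟨hS' h.1, hS' h.2⟩) id) (v := v)
    fun x => ?_).mono le_rfl ?_
  · rw [E.wrap_eq (hu x) (by norm_num), E.wrap_eq (hw x) (by norm_num), hv, E.wrap_eq (hvb x) hb]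
  · rw [Set.union_insert, Set.union_eq_self_of_subset_right hS']

theorem HasE.op {S : Set (X → ℤ)} {e₁ b₁ e₂ b₂ b : ℕ} {u w v : X → ℤ} (op : WordOp)
    (hu : HasE E S e₁ b₁ u) (hw : HasE E S e₂ b₂ w) (hb₁ : b₁ < 40) (hb₂ : b₂ < 40)
    (hv : ∀ x, op.eval (u x) (w x) = v x) (hb : b < 40)
    (hvb : (∀ x, |u x| ≤ E.bd b₁) → (∀ x, |w x| ≤ E.bd b₂) → ∀ x, |v x| ≤ E.bd b) :
    HasE E S (max e₁ e₂ + 1) b v := by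
  refine ((Has.and hu hw (inherited_avE _ _) (inherited_avE _ _)).bind fun S₁ _ h =>
    Has.instr op u w (Or.inl ⟨h.1.1, h.2.1⟩) (fun x => ?_) (fun x => ?_) hv hb
      (hvb h.1.2 h.2.2)).weaken (E.add_pow_le le_rfl le_rfl) fun _ _ h => h
  · exact (h.1.2 x).trans (E.bd_mono (by omega))
  · exact (h.2.2 x).trans (E.bd_mono (by omega))

theorem HasE.const {S : Set (X → ℤ)} {b : ℕ} (z : ℤ) (hz : |z| ≤ E.bd b) (hb : b < 40) :
    HasE E S 0 b fun _ => z := by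
  refine (Has.instr (.const z) (fun _ => 0) (fun _ => 0) (Or.inr ⟨z, rfl⟩) (fun x => ?_)
    (fun x => ?_) (fun x => rfl) hb fun _ => hz).weaken (by simp) fun _ _ h => h
  all_goals
    rw [abs_zero]
    exact (E.bd_pos _).le

theorem HasE.zero {S : Set (X → ℤ)} : HasE E S 0 0 fun _ => 0 :=
  HasE.const 0 (by rw [abs_zero]; exact (E.bd_pos _).le) (by norm_num)

theorem Enc.bd_max (E : Enc X) {a b : ℤ} {b₁ b₂ : ℕ} (h₁ : |a| ≤ E.bd b₁) (h₂ : |b| ≤ E.bd b₂) :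
    |a| + |b| ≤ E.bd (max b₁ b₂ + 1) := by
  have h := E.two_bd (max b₁ b₂)
  have h1 := h₁.trans (E.bd_mono (le_max_left b₁ b₂))
  have h2 := h₂.trans (E.bd_mono (le_max_right b₁ b₂))
  have h3 := E.bd_pos (max b₁ b₂)
  omega

theorem HasE.add {S : Set (X → ℤ)} {e₁ b₁ e₂ b₂ : ℕ} {u w : X → ℤ}
    (hu : HasE E S e₁ b₁ u) (hw : HasE E S e₂ b₂ w) (hb : max b₁ b₂ < 39) :
    HasE E S (max e₁ e₂ + 1) (max b₁ b₂ + 1) fun x => u x + w x :=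
  HasE.op .add hu hw (by omega) (by omega) (fun _ => rfl) (by omega) fun h₁ h₂ x =>
    (abs_add_le _ _).trans (E.bd_max (h₁ x) (h₂ x))

theorem HasE.sub {S : Set (X → ℤ)} {e₁ b₁ e₂ b₂ : ℕ} {u w : X → ℤ}
    (hu : HasE E S e₁ b₁ u) (hw : HasE E S e₂ b₂ w) (hb : max b₁ b₂ < 39) :
    HasE E S (max e₁ e₂ + 1) (max b₁ b₂ + 1) fun x => u x - w x :=
  HasE.op .sub hu hw (by omega) (by omega) (fun _ => rfl) (by omega) fun h₁ h₂ x =>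
    (abs_sub _ _).trans (E.bd_max (h₁ x) (h₂ x))

theorem HasE.mul {S : Set (X → ℤ)} {e₁ b₁ e₂ b₂ : ℕ} {u w : X → ℤ}
    (hu : HasE E S e₁ b₁ u) (hw : HasE E S e₂ b₂ w) (hb : b₁ + b₂ < 40) :
    HasE E S (max e₁ e₂ + 1) (b₁ + b₂) fun x => u x * w x :=
  HasE.op .mul hu hw (by omega) (by omega) (fun _ => rfl) (by omega) fun h₁ h₂ x => by
    rw [abs_mul, E.bd_add]
    exact mul_le_mul (h₁ x) (h₂ x) (abs_nonneg _) (E.bd_pos _).le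

theorem HasE.neg {S : Set (X → ℤ)} {e b : ℕ} {u : X → ℤ} (hu : HasE E S e b u) (hb : b < 40) :
    HasE E S (e + 1) b fun x => -u x := by
  refine (HasE.op .sub HasE.zero hu (by omega) hb (fun _ => zero_sub _) hb fun _ h₂ x => ?_).weaken
    (by simp) le_rfl
  rw [abs_neg]
  exact h₂ x

theorem HasE.ediv {S : Set (X → ℤ)} {e b : ℕ} {u : X → ℤ} (hu : HasE E S e b u) (m : ℤ)
    (hm : |m| ≤ E.bd 39) (hb : b < 40) : HasE E S (e + 1) b fun x => u x / m :=
  (HasE.op .div hu (HasE.const m hm (by norm_num)) hb (by norm_num) (fun _ => rfl) hb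
    fun h _ x => (Int.abs_ediv_le_abs _ _).trans (h x)).weaken (by simp) le_rfl

theorem HasE.emod {S : Set (X → ℤ)} {e b b' : ℕ} {u : X → ℤ} (hu : HasE E S e b u) {m : ℤ}
    (hm : m ≠ 0) (hmb : |m| ≤ E.bd b') (hb' : b' < 40) (hb : b < 40) :
    HasE E S (e + 1) b' fun x => u x % m :=
  (HasE.op .mod hu (HasE.const m hmb hb') hb hb' (fun _ => rfl) hb'
    fun _ _ x => by
      change |u x % m| ≤ _
      rw [abs_of_nonneg (Int.emod_nonneg _ hm)]
      exact (Int.emod_lt_abs _ hm).le.trans hmb).weaken (by simp) le_rfl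

theorem HasE.sum {S : Set (X → ℤ)} {e b n : ℕ} (hn : n ≤ E.κ) {f : Fin n → X → ℤ}
    (hf : ∀ i, HasE E S e b (f i)) (hb : b < 39) :
    HasE E S (e + 2) (b + 1) fun x => ∑ i, f i x := by
  -- The partial sums are bounded by `k` times the bound of a term, and `k ≤ κ`. So the whole sum
  -- raises the size exponent by one, instead of one for each addition.
  have key : ∀ k (hk : k ≤ n), Has E S (k * (E.κ ^ e + 1) + 1) fun S' =>
      (fun x => ∑ i : Fin k, f (Fin.castLE hk i) x) ∈ S' ∧
        ∀ x, |∑ i : Fin k, f (Fin.castLE hk i) x| ≤ k * E.bd b := by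
    intro k
    induction k with
    | zero =>
      intro _
      refine Has.weaken (HasE.zero (E := E) (S := S)) (by simp) fun S₁ _ h => ?_
      simpa using h.1
    | succ k ih =>
      intro hk
      have hstep := (ih (by omega)).and (hf (Fin.castLE hk (Fin.last k)))
        (fun _ _ hS h => ⟨hS h.1, h.2⟩) (inherited_avE _ _)
      have hbd : ∀ m : ℕ, m ≤ n → (m : ℤ) * E.bd b ≤ E.bd (b + 1) := by
        intro m hm
        rw [add_comm b 1, E.bd_add]
        have h1 : (m : ℤ) ≤ E.bd 1 := le_trans (by exact_mod_cast hm.trans hn) E.κ_le_bd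
        exact mul_le_mul_of_nonneg_right h1 (E.bd_pos b).le
      have heq : ∀ x, ∑ i : Fin (k + 1), f (Fin.castLE hk i) x =
          ∑ i : Fin k, f (Fin.castLE (by omega : k ≤ n) i) x +
            f (Fin.castLE hk (Fin.last k)) x := fun x => by
        rw [Fin.sum_univ_castSucc]
        rfl
      refine (hstep.bind fun S₁ _ h => (Has.instr (b := b + 1)
        (v := fun x => ∑ i : Fin k, f (Fin.castLE (by omega : k ≤ n) i) x +
            f (Fin.castLE hk (Fin.last k)) x) .add _ _
        (Or.inl ⟨h.1.1, h.2.1⟩) (fun x => ?_) (fun x => ?_) (fun x => rfl) (by omega)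
          fun x => ?_).weaken (Q' := fun S' => _ ∧ _) le_rfl fun S₂ _ h' =>
            ⟨?_, fun x => ?_⟩).weaken ?_ fun _ _ h => h
      · exact (h.1.2 x).trans ((hbd k (by omega)).trans (E.bd_mono (by omega)))
      · exact (h.2.2 x).trans (E.bd_mono (by omega))
      · refine (abs_add_le _ _).trans ((add_le_add (h.1.2 x) (h.2.2 x)).trans ?_)
        have := hbd (k + 1) hk
        push_cast at this
        linarith
      · simpa only [heq] using h'.1
      · rw [heq]
        refine (abs_add_le _ _).trans ((add_le_add (h.1.2 x) (h.2.2 x)).trans ?_)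
        push_cast
        linarith
      · rw [Nat.succ_mul]
        omega
  refine (key n le_rfl).weaken ?_ fun S₁ _ h => ⟨h.1, fun x => (h.2 x).trans ?_⟩
  · have h1 := E.one_le_pow e
    have h2 : n * (E.κ ^ e + 1) ≤ E.κ * (2 * E.κ ^ e) := Nat.mul_le_mul hn (by omega)
    have h3 : E.κ * (2 * E.κ ^ e) = 2 * E.κ ^ (e + 1) := by ring
    have h4 := E.mul_pow_le (c := 3) (e := e + 1) (e' := e + 2) (by norm_num) (by omega)
    have h5 := E.one_le_pow (e + 1)
    omega
  · rw [add_comm b 1, E.bd_add]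
    have h1 : (n : ℤ) ≤ E.bd 1 := le_trans (by exact_mod_cast hn) E.κ_le_bd
    exact mul_le_mul_of_nonneg_right h1 (E.bd_pos b).le

end Gen

/-! ## The operations of CKKS as programs -/

section Vectors

variable {X : Type} {E : Enc X} {S : Set (X → ℤ)} {n : ℕ}

variable (E) in
def AvV (S : Set (X → ℤ)) (b : ℕ) (v : X → Vec n) : Prop := ∀ j, AvE E S b fun x => v x j

variable (E) in
def HasV (S : Set (X → ℤ)) (e b : ℕ) (v : X → Vec n) : Prop := ∀ j, HasE E S e b fun x => v x j

theorem inherited_avV (b : ℕ) (v : X → Vec n) : Inherited fun S => AvV E S b v :=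
  fun S S' hS h j => inherited_avE _ _ S S' hS (h j)

theorem AvV.mono {S S' : Set (X → ℤ)} {b : ℕ} {v : X → Vec n} (h : AvV E S b v) (hS : S ⊆ S') :
    AvV E S' b v := inherited_avV _ _ _ _ hS h

theorem AvV.hasV {b : ℕ} {v : X → Vec n} (h : AvV E S b v) : HasV E S 0 b v := fun j => (h j).hasE

theorem HasV.weaken {e b e' b' : ℕ} {v : X → Vec n} (h : HasV E S e b v) (he : e ≤ e')
    (hb : b ≤ b') : HasV E S e' b' v := fun j => (h j).weaken he hb

/-- `HasV` charges the whole computation at each use, `AvV` refers to stored cells. Saving a vector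
before it is used repeatedly prevents costs from multiplying. -/
theorem HasV.save {e b : ℕ} {v : X → Vec n} (hn : n ≤ E.κ) (h : HasV E S e b v) :
    Has E S (E.κ ^ (e + 1)) fun S' => AvV E S' b v := by
  refine (Has.fin h fun j => inherited_avE _ _).weaken ?_ fun _ _ h => h
  rw [pow_succ, mul_comm]
  exact Nat.mul_le_mul_left _ hn

theorem HasV.const {b : ℕ} (v : Vec n) (hv : ∀ j, |v j| ≤ E.bd b) (hb : b < 40) :
    HasV E S 0 b fun _ => v := fun j => HasE.const _ (hv j) hb

theorem HasV.zero : HasV E S 0 0 fun _ => (0 : Vec n) := fun _ => HasE.zero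

theorem HasV.add {e₁ b₁ e₂ b₂ : ℕ} {u w : X → Vec n} (hu : HasV E S e₁ b₁ u)
    (hw : HasV E S e₂ b₂ w) (hb : max b₁ b₂ < 39) :
    HasV E S (max e₁ e₂ + 1) (max b₁ b₂ + 1) fun x => u x + w x := fun j => (hu j).add (hw j) hb

theorem HasV.sub {e₁ b₁ e₂ b₂ : ℕ} {u w : X → Vec n} (hu : HasV E S e₁ b₁ u)
    (hw : HasV E S e₂ b₂ w) (hb : max b₁ b₂ < 39) :
    HasV E S (max e₁ e₂ + 1) (max b₁ b₂ + 1) fun x => u x - w x := fun j => (hu j).sub (hw j) hb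

theorem HasV.neg {e b : ℕ} {u : X → Vec n} (hu : HasV E S e b u) (hb : b < 40) :
    HasV E S (e + 1) b fun x => -u x := fun j => (hu j).neg hb

theorem HasV.smul {e b b' : ℕ} {u : X → Vec n} (hu : HasV E S e b u) (z : ℤ) (hz : |z| ≤ E.bd b')
    (hb : b' + b < 40) : HasV E S (e + 1) (b' + b) fun x => z • u x := fun j =>
  ((HasE.const z hz (by omega)).mul (hu j) hb).weaken (by simp) le_rfl

theorem HasV.red {e b Q : ℕ} {u : X → Vec n} (hu : HasV E S e b u) (hQ : 0 < Q)
    (hQb : (Q : ℤ) ≤ E.bd 1) (hb : b < 40) : HasV E S (e + 1) 1 fun x => Poseidon.red Q (u x) :=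
  fun j => (hu j).emod (by exact_mod_cast hQ.ne') (by rwa [Nat.abs_cast]) (by norm_num) hb

theorem HasV.sum {e b k : ℕ} (hk : k ≤ E.κ) {f : Fin k → X → Vec n}
    (hf : ∀ i, HasV E S e b (f i)) (hb : b < 39) :
    HasV E S (e + 2) (b + 1) fun x => ∑ i, f i x := fun j => by
  simp only [Finset.sum_apply]
  exact HasE.sum hk (fun i => hf i j) hb

/-- Which products occur, and with which sign, depends on the indices only, so the code has no
branches. -/
theorem HasV.nmul {e₁ b₁ e₂ b₂ : ℕ} (hn : n ≤ E.κ) {u w : X → Vec n} (hu : HasV E S e₁ b₁ u)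
    (hw : HasV E S e₂ b₂ w) (hb : b₁ + b₂ < 38) :
    HasV E S (max e₁ e₂ + 6) (b₁ + b₂ + 2) fun x => Poseidon.nmul (u x) (w x) := fun j => by
  refine HasE.sum (e := max e₁ e₂ + 4) hn (fun i => HasE.sum (e := max e₁ e₂ + 2) (b := b₁ + b₂) hn
    (fun k => ?_) (by omega)) (by omega)
  split_ifs
  · exact ((hu i).mul (hw k) (by omega)).weaken (by omega) le_rfl
  · exact ((hu i).mul (hw k) (by omega)).neg (by omega)
  · exact HasE.zero.weaken (by omega) (by omega)

theorem HasV.substPow {e b : ℕ} (hn : n ≤ E.κ) {u : X → Vec n} (g : ℕ) (hu : HasV E S e b u)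
    (hb : b < 39) : HasV E S (e + 3) (b + 1) fun x => Poseidon.substPow g (u x) := fun j => by
  refine HasE.sum (e := e + 1) hn (fun i => ?_) hb
  split_ifs
  · exact (hu i).weaken (by omega) le_rfl
  · exact (hu i).neg (by omega)
  · exact HasE.zero.weaken (by omega) (by omega)

theorem HasE.roundDiv {e b : ℕ} {u : X → ℤ} (hu : HasE E S e b u) {m : ℕ}
    (hm : (2 * m : ℤ) ≤ E.bd 2) (hb : b < 30) :
    HasE E S (e + 3) (max b 1 + 2) fun x => Poseidon.roundDiv (u x) m := by
  have h2 : |(2 : ℤ)| ≤ E.bd 1 := le_trans (by norm_num) E.le_bd_one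
  have hm' : |(m : ℤ)| ≤ E.bd 2 := by rw [Nat.abs_cast]; omega
  have hm2 : |(2 * m : ℤ)| ≤ E.bd 39 := by
    rw [abs_of_nonneg (by positivity)]
    exact hm.trans (E.bd_mono (by norm_num))
  exact ((((HasE.const 2 h2 (by norm_num)).mul hu (by omega)).add
    (HasE.const (m : ℤ) hm' (by norm_num)) (by omega)).ediv _ hm2 (by omega)).weaken
      (by omega) (by omega)

/-- The word machine only has the nonnegative remainder by a modulus; shifting by `Q / 2` before and
after yields the centred one. -/
theorem bmod_eq {Q : ℕ} (x : ℤ) (hQ : 0 < Q) :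
    Int.bmod x Q = (x + (Q : ℤ) / 2) % Q - (Q : ℤ) / 2 := by
  have h1 := Int.emod_nonneg x (by exact_mod_cast hQ.ne' : (Q : ℤ) ≠ 0)
  have h2 := Int.emod_lt_of_pos x (by exact_mod_cast hQ : (0 : ℤ) < Q)
  have h3 : (x + (Q : ℤ) / 2) % Q = (x % Q + (Q : ℤ) / 2) % Q := by
    rw [Int.emod_add_emod]
  rw [h3, Int.bmod_def]
  generalize x % (Q : ℤ) = r at *
  split_ifs with h
  · rw [Int.emod_eq_of_lt (by omega) (by omega)]
    omega
  · have : r + (Q : ℤ) / 2 = (r + (Q : ℤ) / 2 - Q) + Q := by ring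
    rw [this, Int.add_emod_right, Int.emod_eq_of_lt (by omega) (by omega)]
    omega

theorem HasE.bmod {e b Q : ℕ} {u : X → ℤ} (hu : HasE E S e b u) (hQ : 0 < Q)
    (hQb : (Q : ℤ) ≤ E.bd 1) (hb : b < 30) :
    HasE E S (e + 3) 2 fun x => Int.bmod (u x) Q := by
  simp only [bmod_eq _ hQ]
  have h2 : |(Q : ℤ) / 2| ≤ E.bd 1 := by
    rw [abs_of_nonneg (by positivity)]
    omega
  exact (((hu.add (HasE.const _ h2 (by norm_num)) (by omega)).emod (by exact_mod_cast hQ.ne')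
    (by rwa [Nat.abs_cast]) (b' := 1) (by norm_num) (by omega)).sub
      (HasE.const _ h2 (by norm_num)) (by norm_num)).weaken (by omega) (by norm_num)

end Vectors

/-! ### Ciphertexts -/

/-- The parameters are small compared with the words of `E`. -/
structure Fits (P : Params) {X : Type} (E : Enc X) : Prop where
  n_le : P.n ≤ E.κ
  digits_le : P.digits ≤ E.κ
  QL_le : (P.QL : ℤ) ≤ E.bd 1
  base_le : (P.base : ℤ) ≤ E.bd 1
  prec_le : (2 : ℤ) ^ (P.prec + 1) ≤ E.bd 1

section Ciphertexts

variable {X : Type} {E : Enc X} {S : Set (X → ℤ)} {P : Params}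

theorem Fits.Q_le (hP : Fits P E) {l : ℕ} (hl : l ≤ P.L) : (P.Q l : ℤ) ≤ E.bd 1 :=
  le_trans (by exact_mod_cast Nat.le_of_dvd P.QL_pos (P.Q_dvd hl)) hP.QL_le

theorem Fits.q_le (hP : Fits P E) {l : ℕ} (hl : l ≤ P.L) : (P.q l : ℤ) ≤ E.bd 1 := by
  have : P.q l ∣ P.Q l := Finset.dvd_prod_of_mem _ (Finset.self_mem_range_succ l)
  exact le_trans (by exact_mod_cast Nat.le_of_dvd (P.Q_pos hl) this) (hP.Q_le hl)

theorem Fits.base_pow_le (hP : Fits P E) (t : Fin P.digits) :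
    (P.base : ℤ) ^ (t : ℕ) ≤ E.bd 1 := by
  have : P.base ^ (t : ℕ) < P.QL := (Nat.lt_clog_iff_pow_lt P.two_le_base).1 t.isLt
  exact le_trans (by exact_mod_cast this.le) hP.QL_le

theorem HasV.redQ {e b l : ℕ} {u : X → P.Poly} (hP : Fits P E) (hl : l ≤ P.L)
    (hu : HasV E S e b u) (hb : b < 40) : HasV E S (e + 1) 1 fun x => Poseidon.red (P.Q l) (u x) :=
  HasV.red hu (P.Q_pos hl) (hP.Q_le hl) hb

theorem HasV.redQL {e b : ℕ} {u : X → P.Poly} (hP : Fits P E)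
    (hu : HasV E S e b u) (hb : b < 40) : HasV E S (e + 1) 1 fun x => Poseidon.red P.QL (u x) :=
  HasV.red hu P.QL_pos hP.QL_le hb

theorem HasV.redConst {l : ℕ} (hP : Fits P E) (hl : l ≤ P.L) (v : P.Poly) :
    HasV E S 0 1 fun _ => Poseidon.red (P.Q l) v :=
  HasV.const _ (fun j => by
    rw [abs_of_nonneg (red_nonneg (P.Q_pos hl) _ _)]
    exact (red_lt (P.Q_pos hl) _ _).le.trans (hP.Q_le hl)) (by norm_num)

theorem HasV.digit {e b : ℕ} {u : X → P.Poly} (hP : Fits P E) (hu : HasV E S e b u)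
    (t : Fin P.digits) (hb : b < 40) : HasV E S (e + 2) 1 fun x => P.digit t (u x) := fun j => by
  have hbase : (0 : ℤ) < P.base := by exact_mod_cast (zero_lt_two.trans_le P.two_le_base)
  refine ((hu j).ediv _ ?_ hb).emod hbase.ne' ?_ (by norm_num) hb
  · rw [abs_of_nonneg (by positivity)]
    exact (hP.base_pow_le t).trans (E.bd_mono (by norm_num))
  · rw [abs_of_nonneg hbase.le]
    exact hP.base_le

variable (E) in
/-- A switching key that is available. -/
def AvKey (S : Set (X → ℤ)) (K : X → Fin P.digits → P.Poly × P.Poly) : Prop :=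
  ∀ t, (AvV E S 1 fun x => (K x t).1) ∧ AvV E S 1 fun x => (K x t).2

variable (E) in
/-- Public keys that are available. -/
structure AvPub (S : Set (X → ℤ)) (K : X → PubKeys P) : Prop where
  pk0 : AvV E S 1 fun x => (K x).pk0
  pk1 : AvV E S 1 fun x => (K x).pk1
  rlk : AvKey E S fun x => (K x).rlk
  rot : ∀ k, AvKey E S fun x => (K x).rot k

theorem inherited_avKey (K : X → Fin P.digits → P.Poly × P.Poly) : Inherited fun S => AvKey E S K :=
  fun _ _ hS h t => ⟨(h t).1.mono hS, (h t).2.mono hS⟩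

theorem AvPub.mono {S S' : Set (X → ℤ)} {K : X → PubKeys P} (h : AvPub E S K) (hS : S ⊆ S') :
    AvPub E S' K :=
  ⟨h.pk0.mono hS, h.pk1.mono hS, inherited_avKey _ _ _ hS h.rlk,
    fun k => inherited_avKey _ _ _ hS (h.rot k)⟩

theorem hasV_keySwitch (hP : Fits P E) {K : X → Fin P.digits → P.Poly × P.Poly}
    (hK : AvKey E S K) {e : ℕ} {v : X → P.Poly} (hv : HasV E S e 1 v) :
    (HasV E S (e + 10) 5 fun x => (Ct.keySwitch (K x) (v x)).1) ∧
      HasV E S (e + 10) 5 fun x => (Ct.keySwitch (K x) (v x)).2 := by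
  constructor
  · exact (HasV.sum hP.digits_le (f := fun t x => nmul (P.digit t (v x)) (K x t).1)
      (fun t => (hv.digit hP t (by norm_num)).nmul hP.n_le (hK t).1.hasV (by norm_num))
        (by norm_num)).weaken (by simp) (by norm_num)
  · exact (HasV.sum hP.digits_le (f := fun t x => nmul (P.digit t (v x)) (K x t).2)
      (fun t => (hv.digit hP t (by norm_num)).nmul hP.n_le (hK t).2.hasV (by norm_num))
        (by norm_num)).weaken (by simp) (by norm_num)

/-- The level and the scale of a family of ciphertexts are constant. -/
def Shape (c : X → Ct P) (l : ℕ) (s : ℝ) : Prop := l ≤ P.L ∧ ∀ x, (c x).lvl = l ∧ (c x).scale = s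

variable (E) in
/-- Ciphertexts of constant level and scale, computable if `full` holds. -/
def HasCt (S : Set (X → ℤ)) (full : Prop) (e : ℕ) (c : X → Ct P) : Prop :=
  (∃ l s, Shape c l s) ∧
    (full → (HasV E S e 1 fun x => (c x).c0) ∧ HasV E S e 1 fun x => (c x).c1)

variable (E) in
/-- Ciphertexts of constant level and scale, available if `full` holds. -/
def AvCt (S : Set (X → ℤ)) (full : Prop) (c : X → Ct P) : Prop :=
  (∃ l s, Shape c l s) ∧
    (full → (AvV E S 1 fun x => (c x).c0) ∧ AvV E S 1 fun x => (c x).c1)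

variable {full : Prop}

theorem AvCt.hasCt {c : X → Ct P} (h : AvCt E S full c) : HasCt E S full 0 c :=
  ⟨h.1, fun hf => ⟨(h.2 hf).1.hasV, (h.2 hf).2.hasV⟩⟩

theorem inherited_avCt (c : X → Ct P) : Inherited fun S => AvCt E S full c :=
  fun _ _ hS h => ⟨h.1, fun hf => ⟨(h.2 hf).1.mono hS, (h.2 hf).2.mono hS⟩⟩

theorem AvCt.mono {S S' : Set (X → ℤ)} {c : X → Ct P} (h : AvCt E S full c) (hS : S ⊆ S') :
    AvCt E S' full c := inherited_avCt _ _ _ hS h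

theorem AvCt.imp {full' : Prop} {c : X → Ct P} (h : AvCt E S full c) (hf : full' → full) :
    AvCt E S full' c := ⟨h.1, fun h' => h.2 (hf h')⟩

theorem HasCt.weaken {e e' : ℕ} {c : X → Ct P} (h : HasCt E S full e c) (he : e ≤ e') :
    HasCt E S full e' c :=
  ⟨h.1, fun hf => ⟨(h.2 hf).1.weaken he le_rfl, (h.2 hf).2.weaken he le_rfl⟩⟩

theorem HasCt.save (hP : Fits P E) {e : ℕ} {c : X → Ct P} (h : HasCt E S full e c) :
    Has E S (E.κ ^ (e + 2)) fun S' => AvCt E S' full c := by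
  by_cases hf : full
  · refine (((h.2 hf).1.save hP.n_le).and ((h.2 hf).2.save hP.n_le) (inherited_avV _ _)
      (inherited_avV _ _)).weaken ?_ fun _ _ h' => ⟨h.1, fun _ => h'⟩
    have h1 := E.add_pow_le (le_refl (E.κ ^ (e + 1))) (le_refl (E.κ ^ (e + 1)))
    rw [max_self] at h1
    exact (Nat.le_succ _).trans h1
  · exact (Has.intro ⟨h.1, fun hf' => absurd hf' hf⟩).weaken (Nat.zero_le _) fun _ _ h => h

theorem HasCt.ofPlain {e : ℕ} {p : X → P.Poly} (s : ℝ)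
    (hp : full → HasV E S e 1 p) : HasCt E S full e fun x => Ct.ofPlain (p x) s :=
  ⟨⟨P.L, s, le_rfl, fun _ => ⟨rfl, rfl⟩⟩, fun hf =>
    ⟨hp hf, HasV.zero.weaken (Nat.zero_le _) (by norm_num)⟩⟩

theorem HasCt.zero (s : ℝ) : HasCt E S full 0 fun _ => (Ct.ofPlain 0 s : Ct P) :=
  HasCt.ofPlain s fun _ => HasV.zero.weaken le_rfl (by norm_num)

theorem HasCt.add (hP : Fits P E) {e₁ e₂ : ℕ} {c d : X → Ct P} (hc : HasCt E S full e₁ c)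
    (hd : HasCt E S full e₂ d) : HasCt E S full (max e₁ e₂ + 2) fun x => (c x).add (d x) := by
  obtain ⟨⟨l, s, hl, hs⟩, hc⟩ := hc
  obtain ⟨⟨l', s', hl', hs'⟩, hd⟩ := hd
  have hm : min l l' ≤ P.L := (min_le_left _ _).trans hl
  refine ⟨⟨min l l', max s s', hm, fun x => ?_⟩, fun hf => ⟨?_, ?_⟩⟩
  · simp [Ct.add, hs x, hs' x]
  · simp only [Ct.add, (hs _).1, (hs' _).1]
    exact (((hc hf).1.add (hd hf).1 (by norm_num)).redQ hP hm (by norm_num))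
  · simp only [Ct.add, (hs _).1, (hs' _).1]
    exact (((hc hf).2.add (hd hf).2 (by norm_num)).redQ hP hm (by norm_num))

theorem HasCt.sub (hP : Fits P E) {e₁ e₂ : ℕ} {c d : X → Ct P} (hc : HasCt E S full e₁ c)
    (hd : HasCt E S full e₂ d) : HasCt E S full (max e₁ e₂ + 2) fun x => (c x).sub (d x) := by
  obtain ⟨⟨l, s, hl, hs⟩, hc⟩ := hc
  obtain ⟨⟨l', s', hl', hs'⟩, hd⟩ := hd
  have hm : min l l' ≤ P.L := (min_le_left _ _).trans hl
  refine ⟨⟨min l l', max s s', hm, fun x => ?_⟩, fun hf => ⟨?_, ?_⟩⟩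
  · simp [Ct.sub, hs x, hs' x]
  · simp only [Ct.sub, (hs _).1, (hs' _).1]
    exact (((hc hf).1.sub (hd hf).1 (by norm_num)).redQ hP hm (by norm_num))
  · simp only [Ct.sub, (hs _).1, (hs' _).1]
    exact (((hc hf).2.sub (hd hf).2 (by norm_num)).redQ hP hm (by norm_num))

theorem HasCt.mulPt (hP : Fits P E) {e₁ e₂ : ℕ} {c : X → Ct P} {p : X → P.Poly} (t : ℝ)
    (hc : HasCt E S full e₁ c) (hp : full → HasV E S e₂ 1 p) :
    HasCt E S full (max e₁ e₂ + 7) fun x => (c x).mulPt (p x) t := by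
  obtain ⟨⟨l, s, hl, hs⟩, hc⟩ := hc
  refine ⟨⟨l, s * t, hl, fun x => ?_⟩, fun hf => ⟨?_, ?_⟩⟩
  · simp [Ct.mulPt, hs x]
  · simp only [Ct.mulPt, (hs _).1]
    exact ((hc hf).1.nmul hP.n_le (hp hf) (by norm_num)).redQ hP hl (by norm_num)
  · simp only [Ct.mulPt, (hs _).1]
    exact ((hc hf).2.nmul hP.n_le (hp hf) (by norm_num)).redQ hP hl (by norm_num)

theorem HasCt.mul (hP : Fits P E) {e : ℕ} {K : X → PubKeys P} (hK : AvPub E S K)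
    {c d : X → Ct P} (hc : HasCt E S full e c) (hd : HasCt E S full e d) :
    HasCt E S full (e + 20) fun x => (c x).mul (K x) (d x) := by
  obtain ⟨⟨l, s, hl, hs⟩, hc⟩ := hc
  obtain ⟨⟨l', s', hl', hs'⟩, hd⟩ := hd
  have hm : min l l' ≤ P.L := (min_le_left _ _).trans hl
  have hr : full → _ := fun hf => hasV_keySwitch hP hK.rlk
    (((hc hf).2.nmul hP.n_le (hd hf).2 (by norm_num)).redQ hP hm (by norm_num))
  refine ⟨⟨min l l', s * s', hm, fun x => ?_⟩, fun hf => ⟨?_, ?_⟩⟩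
  · simp [Ct.mul, hs x, hs' x]
  · simp only [Ct.mul, (hs _).1, (hs' _).1]
    exact ((((hc hf).1.nmul hP.n_le (hd hf).1 (by norm_num)).add (hr hf).1 (by norm_num)).redQ hP hm
      (by norm_num)).weaken (by simp only [max_self]; omega) le_rfl
  · simp only [Ct.mul, (hs _).1, (hs' _).1]
    exact (((((hc hf).1.nmul hP.n_le (hd hf).2 (by norm_num)).add
      ((hc hf).2.nmul hP.n_le (hd hf).1 (by norm_num)) (by norm_num)).add (hr hf).2
        (by norm_num)).redQ hP hm (by norm_num)).weaken (by simp only [max_self]; omega) le_rfl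

theorem HasCt.rotL (hP : Fits P E) {e : ℕ} {K : X → PubKeys P} (hK : AvPub E S K)
    {c : X → Ct P} (hc : HasCt E S full e c) (k : Fin P.slots) :
    HasCt E S full (e + 20) fun x => (c x).rotL (K x) k := by
  obtain ⟨⟨l, s, hl, hs⟩, hc⟩ := hc
  have hr : full → _ := fun hf => hasV_keySwitch hP (hK.rot k)
    (((hc hf).2.substPow hP.n_le (5 ^ (k : ℕ)) (by norm_num)).redQ hP hl (by norm_num))
  refine ⟨⟨l, s, hl, fun x => ?_⟩, fun hf => ⟨?_, ?_⟩⟩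
  · simp [Ct.rotL, hs x]
  · simp only [Ct.rotL, (hs _).1]
    exact ((((hc hf).1.substPow hP.n_le (5 ^ (k : ℕ)) (by norm_num)).add (hr hf).1
      (by norm_num)).redQ hP hl (by norm_num)).weaken (by omega) le_rfl
  · simp only [Ct.rotL, (hs _).1]
    exact ((hr hf).2.redQ hP hl (by norm_num)).weaken (by omega) le_rfl

theorem HasCt.res (hP : Fits P E) {e : ℕ} {c : X → Ct P} (hc : HasCt E S full e c) :
    HasCt E S full (e + 4) fun x => (c x).res := by
  obtain ⟨⟨l, s, hl, hs⟩, hc⟩ := hc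
  by_cases h0 : l = 0
  · have : (fun x => (c x).res) = c := by
      funext x
      rw [Ct.res, if_pos ((hs x).1.trans h0)]
    rw [this]
    exact HasCt.weaken (e := e) ⟨⟨l, s, hl, hs⟩, hc⟩ (by omega)
  · have hne : ∀ x, (c x).lvl ≠ 0 := fun x => by rw [(hs x).1]; exact h0
    have hl' : l - 1 ≤ P.L := (Nat.sub_le _ _).trans hl
    have hq : (2 * P.q l : ℤ) ≤ E.bd 2 := by
      have h1 := hP.q_le hl
      have h2 : 64 * E.bd 1 ≤ E.bd 2 := E.two_bd 1
      omega
    refine ⟨⟨l - 1, s / P.q l, hl', fun x => ?_⟩, fun hf => ⟨?_, ?_⟩⟩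
    · simp [Ct.res, hs x, h0]
    · simp only [Ct.res, (hs _).1, if_neg h0]
      exact HasV.redQ (e := e + 3) hP hl' (fun j => ((hc hf).1 j).roundDiv hq (by norm_num))
        (by norm_num)
    · simp only [Ct.res, (hs _).1, if_neg h0]
      exact HasV.redQ (e := e + 3) hP hl' (fun j => ((hc hf).2 j).roundDiv hq (by norm_num))
        (by norm_num)

/-- The multiplier in `setScale` is the rounding of an arbitrary real and might not fit into a word.
Only its residue matters. -/
theorem red_smul_emod {n Q : ℕ} (z : ℤ) (v : Vec n) : red Q (z • v) = red Q ((z % Q) • v) :=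
  red_congr fun j => ((Int.mod_modEq z Q).mul_right (v j)).symm

theorem HasCt.setScale (hP : Fits P E) {e : ℕ} {c : X → Ct P} (hc : HasCt E S full e c) (t : ℝ) :
    HasCt E S full (e + 6) fun x => (c x).setScale t := by
  obtain ⟨⟨l, s, hl, hs⟩, hc⟩ := hc
  have hQ := P.Q_pos hl
  set z : ℤ := round (t * P.q l / s) % P.Q l with hz
  have hzb : |z| ≤ E.bd 1 := by
    rw [abs_of_nonneg (Int.emod_nonneg _ (by exact_mod_cast hQ.ne'))]
    exact (Int.emod_lt_of_pos _ (by exact_mod_cast hQ)).le.trans (hP.Q_le hl)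
  have hd : HasCt E S full (e + 2) fun x => { c x with
      c0 := red (P.Q l) (z • (c x).c0), c1 := red (P.Q l) (z • (c x).c1) } := by
    refine ⟨⟨l, s, hl, hs⟩, fun hf => ⟨?_, ?_⟩⟩
    · exact ((hc hf).1.smul z hzb (by norm_num)).redQ hP hl (by norm_num)
    · exact ((hc hf).2.smul z hzb (by norm_num)).redQ hP hl (by norm_num)
  have heq : (fun x => (c x).setScale t) = fun x => { ({ c x with
      c0 := red (P.Q l) (z • (c x).c0), c1 := red (P.Q l) (z • (c x).c1) } : Ct P).res with
        scale := t } := by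
    funext x
    simp only [Ct.setScale, (hs x).1, (hs x).2, red_smul_emod (round (t * P.q l / s)), ← hz]
  rw [heq]
  obtain ⟨⟨l', s', hl', hs'⟩, hd⟩ := hd.res hP
  exact ⟨⟨l', t, hl', fun x => ⟨(hs' x).1, rfl⟩⟩, hd⟩

/-- A re-randomization in mode `ideal` uses nothing of the old ciphertext but its level and scale.
So the result is computable even if the ciphertext was not, and the simulator can go on without the
data of honest parties. -/
theorem HasCt.act (hP : Fits P E) {e : ℕ} {pk0 pk1 v0 v1 v2 : X → P.Poly} {m : Mode}
    (h0 : AvV E S 1 pk0) (h1 : AvV E S 1 pk1) (hv0 : AvV E S 1 v0) (hv1 : AvV E S 1 v1)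
    (hv2 : AvV E S 1 v2) {c : X → Ct P} (hc : HasCt E S full e c) (hm : m = .ideal ∨ full) :
    HasCt E S True (e + 9) fun x => Item.act (pk0 x) (pk1 x) ⟨m, v0 x, v1 x, v2 x⟩ (c x) := by
  obtain ⟨⟨l, s, hl, hs⟩, hc⟩ := hc
  refine ⟨⟨l, s, hl, fun x => ?_⟩, fun _ => ?_⟩
  · cases m <;> simp [Item.act, hs x]
  cases m with
  | ideal =>
    simp only [Item.act, (hs _).1]
    exact ⟨(hv0.hasV.redQ hP hl (by norm_num)).weaken (by omega) le_rfl,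
      (hv1.hasV.redQ hP hl (by norm_num)).weaken (by omega) le_rfl⟩
  | shift =>
    have hf := hm.resolve_left (by simp)
    simp only [Item.act, (hs _).1]
    exact ⟨(((hc hf).1.add hv0.hasV (by norm_num)).redQ hP hl (by norm_num)).weaken
      (by simp) le_rfl, (((hc hf).2.add hv1.hasV (by norm_num)).redQ hP hl (by norm_num)).weaken
      (by simp) le_rfl⟩
  | real =>
    have hf := hm.resolve_left (by simp)
    simp only [Item.act, (hs _).1]
    exact ⟨((((hc hf).1.add (h0.hasV.nmul hP.n_le hv0.hasV (by norm_num)) (by norm_num)).add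
        hv1.hasV
      (by norm_num)).redQ hP hl (by norm_num)).weaken (by omega) le_rfl,
      ((((hc hf).2.add (h1.hasV.nmul hP.n_le hv0.hasV (by norm_num)) (by norm_num)).add hv2.hasV
      (by norm_num)).redQ hP hl (by norm_num)).weaken (by omega) le_rfl⟩

/-! ### Linear transformations -/

/-- The linear transformation with its coefficients reduced. -/
def transformRed (P : Params) (Φ : Matrix (Fin P.slots) (Fin P.slots) ℂ) (r : ℝ) (v : P.Poly) :
    P.Poly := fun k =>
  roundDiv (∑ l, (round ((2 : ℝ) ^ P.prec * (r * P.coeffMatrix Φ k l)) %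
    ((2 ^ P.prec * P.QL : ℕ) : ℤ)) * v l) (2 ^ P.prec)

/-- The entries of the matrix are arbitrary reals, without any bound on their size. Changing a
rounded entry by a multiple of `2 ^ prec * Q_L` changes the rounded quotient by a multiple of `Q_L`,
which is invisible in a ciphertext. -/
theorem transform_modEq (Φ : Matrix (Fin P.slots) (Fin P.slots) ℂ) (r : ℝ) (v : P.Poly)
    (k : Fin P.n) : P.transform Φ r v k ≡ transformRed P Φ r v k [ZMOD P.QL] := by
  unfold Params.transform transformRed
  set C : Fin P.n → ℤ := fun l => round ((2 : ℝ) ^ P.prec * (r * P.coeffMatrix Φ k l))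
  have h1 : (∑ l, C l * v l) ≡ ∑ l, (C l % ((2 ^ P.prec * P.QL : ℕ) : ℤ)) * v l
      [ZMOD ((2 ^ P.prec * P.QL : ℕ) : ℤ)] :=
    Int.ModEq.sum fun l _ => ((Int.mod_modEq _ _).symm.mul_right _)
  obtain ⟨t, ht⟩ := h1.dvd
  have ht' : (∑ l, (C l % ((2 ^ P.prec * P.QL : ℕ) : ℤ)) * v l) =
      (∑ l, C l * v l) + ((2 ^ P.prec * P.QL : ℕ) : ℤ) * t := by linarith
  rw [ht', roundDiv, roundDiv]
  have hpos : (0 : ℤ) < 2 * ((2 ^ P.prec : ℕ) : ℤ) := by positivity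
  have h2 : 2 * ((∑ l, C l * v l) + ((2 ^ P.prec * P.QL : ℕ) : ℤ) * t) + ((2 ^ P.prec : ℕ) : ℤ) =
      (2 * (∑ l, C l * v l) + ((2 ^ P.prec : ℕ) : ℤ)) + (2 * ((2 ^ P.prec : ℕ) : ℤ)) *
        (P.QL * t) := by
    push_cast
    ring
  rw [h2, Int.add_mul_ediv_left _ _ hpos.ne']
  exact (Int.modEq_iff_dvd.2 ⟨t, by ring⟩)

theorem HasV.transformRed (hP : Fits P E) (Φ : Matrix (Fin P.slots) (Fin P.slots) ℂ) (r : ℝ)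
    {e b : ℕ} {v : X → P.Poly} (hv : HasV E S e b v) (hb : b ≤ 3) :
    HasV E S (e + 6) 8 fun x => Poseidon.transformRed P Φ r (v x) := fun k => by
  have hprec : ((2 ^ P.prec : ℕ) : ℤ) ≤ E.bd 1 := by
    refine le_trans ?_ hP.prec_le
    push_cast
    exact pow_le_pow_right₀ (by norm_num) (Nat.le_succ _)
  have hpos : (0 : ℤ) < ((2 ^ P.prec * P.QL : ℕ) : ℤ) := by
    have := P.QL_pos
    positivity
  have hM : ((2 ^ P.prec * P.QL : ℕ) : ℤ) ≤ E.bd 2 := by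
    rw [show (2 : ℕ) = 1 + 1 from rfl, E.bd_add, Nat.cast_mul]
    exact mul_le_mul hprec hP.QL_le (by positivity) (E.bd_pos _).le
  have hm : (2 * ((2 ^ P.prec : ℕ) : ℤ)) ≤ E.bd 2 := by
    have h2 : 64 * E.bd 1 ≤ E.bd 2 := E.two_bd 1
    have h3 := E.bd_pos 1
    linarith
  refine (HasE.roundDiv (e := e + 3) (b := b + 3) ?_ hm (by omega)).weaken le_rfl (by omega)
  refine (HasE.sum hP.n_le (e := e + 1) (b := 2 + b) (fun l => ?_) (by omega)).weaken le_rfl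
      (by omega)
  refine ((HasE.const _ ?_ (by norm_num)).mul (hv l) (by omega)).weaken (by simp) le_rfl
  rw [abs_of_nonneg (Int.emod_nonneg _ hpos.ne')]
  exact (Int.emod_lt_of_pos _ hpos).le.trans hM

end Ciphertexts

/-! ## The operations of the protocol as programs -/

section Lists

variable {X γ : Type}

/-- A family of lists of a fixed length, all of whose members satisfy `A`. -/
def ListAv (A : (X → γ) → Prop) (l : X → List γ) : Prop :=
  ∃ ls : List (X → γ), (∀ f ∈ ls, A f) ∧ ∀ x, l x = ls.map fun f => f x

variable {A A' : (X → γ) → Prop} {l l' : X → List γ}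

theorem ListAv.imp (h : ListAv A l) (hA : ∀ f, A f → A' f) : ListAv A' l := by
  obtain ⟨ls, h1, h2⟩ := h
  exact ⟨ls, fun f hf => hA f (h1 f hf), h2⟩

theorem ListAv.nil : ListAv A fun _ => [] := ⟨[], by simp, fun _ => rfl⟩

theorem ListAv.cons {f : X → γ} (hf : A f) (h : ListAv A l) : ListAv A fun x => f x :: l x := by
  obtain ⟨ls, h1, h2⟩ := h
  exact ⟨f :: ls, by simpa [hf] using h1, fun x => by simp only [h2, List.map_cons]⟩

theorem ListAv.append (h : ListAv A l) (h' : ListAv A l') : ListAv A fun x => l x ++ l' x := by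
  obtain ⟨ls, h1, h2⟩ := h
  obtain ⟨ls', h1', h2'⟩ := h'
  refine ⟨ls ++ ls', fun f hf => ?_, fun x => by simp only [h2, h2', List.map_append]⟩
  exact (List.mem_append.1 hf).elim (h1 f) (h1' f)

theorem ListAv.tail (h : ListAv A l) : ListAv A fun x => (l x).tail := by
  obtain ⟨ls, h1, h2⟩ := h
  exact ⟨ls.tail, fun f hf => h1 f (List.mem_of_mem_tail hf), fun x => by
    simp only [h2, List.map_tail]⟩

theorem ListAv.getD (h : ListAv A l) {d : X → γ} (hd : A d) (i : ℕ) :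
    A fun x => (l x).getD i (d x) := by
  obtain ⟨ls, h1, h2⟩ := h
  by_cases hi : i < ls.length
  · convert h1 ls[i] (List.getElem_mem hi) using 2 with x
    rw [h2, List.getD_eq_getElem _ _ (by simpa using hi), List.getElem_map]
  · convert hd using 2 with x
    rw [h2, List.getD_eq_default _ _ (by simpa using hi)]

theorem ListAv.headD (h : ListAv A l) {d : X → γ} (hd : A d) : A fun x => (l x).headD (d x) := by
  convert h.getD hd 0 using 2 with x
  cases l x <;> rfl

theorem ListAv.ofFn {n : ℕ} {f : X → Fin n → γ} (h : ∀ i, A fun x => f x i) :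
    ListAv A fun x => List.ofFn (f x) := by
  refine ⟨List.ofFn fun i x => f x i, fun g hg => ?_, fun x => ?_⟩
  · obtain ⟨i, rfl⟩ := List.mem_ofFn.1 hg
    exact h i
  · rw [List.map_ofFn]
    rfl

end Lists

/-! ### A calculus for translating computations into straight-line code -/

section Judgement

open Prog

variable {X : Type} {P : Params} {α β : Type}

/-- The items that are available: the mode is constant. -/
def ItemAv (E : Enc X) (full : Prop) (S : Set (X → ℤ)) (f : X → Item P) : Prop :=
  ∃ (m : Mode) (v0 v1 v2 : X → P.Poly), (m = .ideal ∨ full) ∧ AvV E S 1 v0 ∧ AvV E S 1 v1 ∧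
    AvV E S 1 v2 ∧ f = fun x => ⟨m, v0 x, v1 x, v2 x⟩

def PairAv (E : Enc X) (S : Set (X → ℤ)) (f : X → P.Poly × P.Poly) : Prop :=
  (AvV E S 1 fun x => (f x).1) ∧ AvV E S 1 fun x => (f x).2

/-- The states of evaluations all of whose parts are available. -/
structure EvAv (E : Enc X) (full : Prop) (S : Set (X → ℤ)) (σ : X → Ev P) : Prop where
  items : ListAv (ItemAv E full S) fun x => (σ x).items
  ans : ListAv (PairAv E S) fun x => (σ x).ans
  log : ListAv (· ∈ S) fun x => (σ x).log
  msgs : ListAv (AvV E S 1) fun x => (σ x).msgs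
  zero : (fun _ => 0) ∈ S

variable {E : Enc X} {full : Prop} {S S' : Set (X → ℤ)}

theorem ItemAv.mono {f : X → Item P} (h : ItemAv E full S f) (hS : S ⊆ S') :
    ItemAv E full S' f := by
  obtain ⟨m, v0, v1, v2, hm, h0, h1, h2, rfl⟩ := h
  exact ⟨m, v0, v1, v2, hm, h0.mono hS, h1.mono hS, h2.mono hS, rfl⟩

theorem PairAv.mono {f : X → P.Poly × P.Poly} (h : PairAv E S f) (hS : S ⊆ S') :
    PairAv E S' f := ⟨h.1.mono hS, h.2.mono hS⟩

theorem EvAv.mono {σ : X → Ev P} (h : EvAv E full S σ) (hS : S ⊆ S') : EvAv E full S' σ :=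
  ⟨h.items.imp fun _ h => h.mono hS, h.ans.imp fun _ h => h.mono hS, h.log.imp fun _ h => hS h,
    h.msgs.imp fun _ h => h.mono hS, hS h.zero⟩

theorem EvAv.avV_zero {σ : X → Ev P} (h : EvAv E full S σ) : AvV E S 1 fun _ => (0 : P.Poly) :=
  fun _ => ⟨h.zero, fun _ => by simpa using (E.bd_pos 1).le⟩

theorem EvAv.item {σ : X → Ev P} (h : EvAv E full S σ) :
    ItemAv E full S fun x => (σ x).items.headD (Item.zero P) :=
  h.items.headD ⟨.ideal, fun _ => 0, fun _ => 0, fun _ => 0, Or.inl rfl, h.avV_zero, h.avV_zero,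
    h.avV_zero, rfl⟩

/-- With `k` instructions the computations `p`, whose data lie in `S₀`, are evaluated for given
items and answers; the results satisfy `Q`. -/
def Runs (E : Enc X) (full : Prop) (s : X → P.Poly) (S₀ : Set (X → ℤ)) (k : ℕ) (p : X → Prog P α)
    (Q : Set (X → ℤ) → (X → α) → Prop) : Prop :=
  ∀ S, S₀ ⊆ S → ∀ σ : X → Ev P, EvAv E full S σ → Has E S k fun S' =>
    EvAv E full S' (fun x => (eval (s x) (p x) (σ x)).2) ∧
      Q S' fun x => (eval (s x) (p x) (σ x)).1

variable {s : X → P.Poly} {S₀ : Set (X → ℤ)} {k k₁ k₂ : ℕ} {p : X → Prog P α}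
  {Q Q₁ : Set (X → ℤ) → (X → α) → Prop} {Q₂ : Set (X → ℤ) → (X → β) → Prop}

theorem Runs.weaken {k' : ℕ} {Q' : Set (X → ℤ) → (X → α) → Prop} (h : Runs E full s S₀ k p Q)
    (hk : k ≤ k') (hQ : ∀ S a, S₀ ⊆ S → Q S a → Q' S a) : Runs E full s S₀ k' p Q' :=
  fun S hS σ hσ => (h S hS σ hσ).weaken hk fun _ hS₁ h' => ⟨h'.1, hQ _ _ (hS.trans hS₁) h'.2⟩

theorem Runs.le {k' : ℕ} (h : Runs E full s S₀ k p Q) (hk : k ≤ k') : Runs E full s S₀ k' p Q :=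
  h.weaken hk fun _ _ _ h => h

theorem Runs.ret {a : X → α} (h : Has E S₀ k fun S => Q S a) (hQ : Inherited fun S => Q S a) :
    Runs E full s S₀ k (fun x => pure (a x)) Q := fun S hS σ hσ => by
  refine (h.mono hS hQ).weaken le_rfl fun _ hS₁ q => ⟨?_, q⟩
  exact hσ.mono hS₁

theorem Runs.bind {f : X → α → Prog P β} (h₁ : Runs E full s S₀ k₁ p Q₁)
    (h₂ : ∀ S₁, S₀ ⊆ S₁ → ∀ a : X → α, Q₁ S₁ a →
      Runs E full s S₁ k₂ (fun x => f x (a x)) Q₂) :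
    Runs E full s S₀ (k₁ + k₂) (fun x => p x >>= f x) Q₂ := fun S hS σ hσ => by
  refine (h₁ S hS σ hσ).bind fun S₁ hS₁ h => ?_
  have := h₂ S₁ (hS.trans hS₁) _ h.2 S₁ subset_rfl _ h.1
  simpa only [eval_bind] using this

theorem Runs.save {R : Set (X → ℤ) → Prop} (h₁ : Has E S₀ k₁ R) (hR : Inherited R)
    (h₂ : ∀ S₁, S₀ ⊆ S₁ → R S₁ → Runs E full s S₁ k₂ p Q) : Runs E full s S₀ (k₁ + k₂) p Q :=
  fun _ hS σ hσ => (h₁.mono hS hR).bind fun S₁ hS₁ h =>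
    h₂ S₁ (hS.trans hS₁) h S₁ subset_rfl σ (hσ.mono hS₁)

theorem Enc.add_le (E : Enc X) {a b c : ℕ} (h : max a b < c) : E.κ ^ a + E.κ ^ b ≤ E.κ ^ c :=
  (Nat.le_succ _).trans ((E.add_pow_le le_rfl le_rfl).trans (E.pow_mono h))

theorem Runs.bindE {a b : ℕ} (c : ℕ) {f : X → α → Prog P β} (h₁ : Runs E full s S₀ (E.κ ^ a) p Q₁)
    (h₂ : ∀ S₁, S₀ ⊆ S₁ → ∀ a : X → α, Q₁ S₁ a →
      Runs E full s S₁ (E.κ ^ b) (fun x => f x (a x)) Q₂) (hc : max a b < c) :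
    Runs E full s S₀ (E.κ ^ c) (fun x => p x >>= f x) Q₂ := (h₁.bind h₂).le (E.add_le hc)

theorem Runs.saveE {a b : ℕ} (c : ℕ) {R : Set (X → ℤ) → Prop} (h₁ : Has E S₀ (E.κ ^ a) R)
    (hR : Inherited R) (h₂ : ∀ S₁, S₀ ⊆ S₁ → R S₁ → Runs E full s S₁ (E.κ ^ b) p Q)
    (hc : max a b < c) : Runs E full s S₀ (E.κ ^ c) p Q := (Runs.save h₁ hR h₂).le (E.add_le hc)

theorem Runs.powE {a : ℕ} (c : ℕ) (h : Runs E full s S₀ (E.κ ^ a) p Q) (hc : a ≤ c) :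
    Runs E full s S₀ (E.κ ^ c) p Q := h.le (E.pow_mono hc)

theorem Runs.seqFin {n : ℕ} {p : X → Fin n → Prog P α}
    {Q : Fin n → Set (X → ℤ) → (X → α) → Prop} (hQ : ∀ i a, Inherited fun S => Q i S a)
    (h : ∀ i, Runs E full s S₀ k (fun x => p x i) (Q i)) :
    Runs E full s S₀ (n * k) (fun x => Poseidon.seqFin (p x))
      fun S v => ∀ i, Q i S fun x => v x i := by
  induction n generalizing S₀ with
  | zero =>
    rw [zero_mul]
    exact Runs.ret (a := fun _ => Fin.elim0) (Has.intro fun i => i.elim0)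
      fun _ _ _ _ i => i.elim0
  | succ n ih =>
    refine Runs.le (k := k + (n * k + 0)) ?_ (by rw [Nat.succ_mul]; omega)
    refine (h 0).bind fun S₁ hS₁ a ha => ?_
    refine (ih (S₀ := S₁) (fun i => hQ i.succ) fun i S hS => h i.succ S (hS₁.trans hS)).bind
      fun S₂ hS₂ v hv => ?_
    refine Runs.ret (a := fun x => (Fin.cons (a x) (v x) : Fin (n + 1) → α))
      (Has.intro fun i => ?_) fun S S' hS hq i => hQ i _ S S' hS (hq i)
    refine Fin.cases ?_ (fun j => ?_) i
    · exact hQ 0 _ _ _ hS₂ ha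
    · exact hv j

theorem Runs.seqFinE {n a : ℕ} (c : ℕ) (hn : n ≤ E.κ) {p : X → Fin n → Prog P α}
    {Q : Fin n → Set (X → ℤ) → (X → α) → Prop} (hQ : ∀ i a, Inherited fun S => Q i S a)
    (h : ∀ i, Runs E full s S₀ (E.κ ^ a) (fun x => p x i) (Q i)) (hc : a < c) :
    Runs E full s S₀ (E.κ ^ c) (fun x => Poseidon.seqFin (p x))
      fun S v => ∀ i, Q i S fun x => v x i := by
  refine (Runs.seqFin hQ h).le (le_trans ?_ (E.pow_mono hc))
  rw [Nat.succ_eq_add_one, pow_succ, mul_comm]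
  exact Nat.mul_le_mul_left _ hn

/-- No instruction is needed: the next item is stored already, and its place does not depend on
random values. -/
theorem Runs.coin (κ : Kind) :
    Runs E full s S₀ 0 (fun _ => coin' κ) fun S v => AvV E S 1 v := fun S _ σ hσ => by
  obtain ⟨m, v0, v1, v2, -, h0, -, -, heq⟩ := hσ.item
  refine .intro ⟨⟨hσ.items.tail, hσ.ans, hσ.log, hσ.msgs, hσ.zero⟩, ?_⟩
  convert h0 using 2 with x
  exact congrArg Item.v0 (congrFun heq x)

/-- The cost is that of the message, which the evaluation records; the answer is stored already. -/
theorem Runs.query {msg : X → P.Poly → P.Poly}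
    (h : Has E S₀ k fun S => AvV E S 1 fun x => msg x (s x)) :
    Runs E full s S₀ k (fun x => query' (msg x)) fun S q => PairAv E S q := fun S hS σ hσ => by
  refine (h.mono hS (inherited_avV _ _)).weaken le_rfl fun S₁ hS₁ hm => ?_
  have hσ := hσ.mono hS₁
  refine ⟨⟨hσ.items, hσ.ans.tail, hσ.log, hσ.msgs.append (.cons hm .nil), hσ.zero⟩, ?_⟩
  exact hσ.ans.headD (d := fun _ => (0, 0)) ⟨hσ.avV_zero, hσ.avV_zero⟩

theorem Runs.emit {l : X → List ℤ} (h : ListAv (· ∈ S₀) l) :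
    Runs E full s S₀ 0 (fun x => (emit' (l x) : Prog P Unit)) fun _ _ => True :=
  fun _ hS _ hσ => .intro ⟨⟨hσ.items, hσ.ans, hσ.log.append (h.imp fun _ hf => hS hf), hσ.msgs,
    hσ.zero⟩, trivial⟩

theorem Runs.rer (hP : Fits P E) {pk0 pk1 : X → P.Poly} {c : X → Ct P} (h0 : AvV E S₀ 1 pk0)
    (h1 : AvV E S₀ 1 pk1) (hc : AvCt E S₀ full c) :
    Runs E full s S₀ (E.κ ^ 11) (fun x => Prog.rer (pk0 x) (pk1 x) (c x) .ret)
      fun S c' => AvCt E S True c' := fun S hS σ hσ => by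
  obtain ⟨m, v0, v1, v2, hm, hv0, hv1, hv2, heq⟩ := hσ.item
  refine ((HasCt.act hP (h0.mono hS) (h1.mono hS) hv0 hv1 hv2 (hc.mono hS).hasCt hm).save
    hP).weaken (E.pow_mono (by norm_num)) fun S₁ hS₁ h => ⟨?_, ?_⟩
  · have hσ := hσ.mono hS₁
    exact ⟨hσ.items.tail, hσ.ans, hσ.log, hσ.msgs, hσ.zero⟩
  · convert h using 2 with x
    exact congrArg (fun t => Item.act (pk0 x) (pk1 x) t (c x)) (congrFun heq x)

end Judgement

/-! ### The steps of the protocol -/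

section Steps

open Prog

variable {X : Type} {P : Params} {N : ℕ} {E : Enc X} {full : Prop} {S₀ S : Set (X → ℤ)}
  {s : X → P.Poly}

/-- The visible part of the values in a list is available. -/
def VisAv (A : Finset (Fin N)) (S : Set (X → ℤ)) (L : X → List (Option (Fin N) × P.Poly)) : Prop :=
  ListAv (· ∈ S) fun x => vis A (L x)

variable {A : Finset (Fin N)}

theorem VisAv.nil : VisAv (P := P) A S fun _ => [] := ListAv.nil

theorem VisAv.cons {b : ℕ} {L : X → List (Option (Fin N) × P.Poly)} {v : X → P.Poly}
    (o : Option (Fin N)) (hv : AvV E S b v) (h : VisAv A S L) :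
    VisAv A S fun x => (o, v x) :: L x := by
  unfold VisAv vis
  simp only [List.flatMap_cons]
  refine ListAv.append ?_ h
  split_ifs
  · exact .ofFn fun i => (hv i).1
  · exact .nil

theorem VisAv.flatten_ofFn {n : ℕ} {f : X → Fin n → List (Option (Fin N) × P.Poly)}
    (h : ∀ i, VisAv A S fun x => f x i) : VisAv A S fun x => (List.ofFn (f x)).flatten := by
  induction n with
  | zero => simpa using VisAv.nil
  | succ n ih =>
    simp only [List.ofFn_succ, List.flatten_cons, VisAv, vis_append]
    exact (h 0).append (ih fun i => h i.succ)

theorem Has.finE {n a : ℕ} (c : ℕ) (hn : n ≤ E.κ) {Q : Fin n → Set (X → ℤ) → Prop}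
    (h : ∀ i, Has E S (E.κ ^ a) (Q i)) (hQ : ∀ i, Inherited (Q i)) (hc : a < c) :
    Has E S (E.κ ^ c) fun S' => ∀ i, Q i S' := by
  refine (Has.fin h hQ).weaken (le_trans ?_ (E.pow_mono hc)) fun _ _ h => h
  rw [Nat.succ_eq_add_one, pow_succ, mul_comm]
  exact Nat.mul_le_mul_left _ hn

theorem Has.andE {a b : ℕ} (c : ℕ) {Q₁ Q₂ : Set (X → ℤ) → Prop} (h₁ : Has E S (E.κ ^ a) Q₁)
    (h₂ : Has E S (E.κ ^ b) Q₂) (hQ₁ : Inherited Q₁) (hQ₂ : Inherited Q₂) (hc : max a b < c) :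
    Has E S (E.κ ^ c) fun S' => Q₁ S' ∧ Q₂ S' :=
  (h₁.and h₂ hQ₁ hQ₂).weaken (E.add_le hc) fun _ _ h => h

variable {K : X → PubKeys P}

/-- For a corrupted party the ciphertext is at hand and the genuine formula is used. For an honest
one either `full` holds or the item is in mode `ideal`. In all cases the result is available, hence
can be sent. -/
theorem Runs.gRer (hP : Fits P E) (hK : AvPub E S₀ K) (i : Fin N) {c : X → Ct P}
    (hc : AvCt E S₀ (i ∈ A ∨ full) c) :
    Runs E full s S₀ (E.κ ^ 12) (fun x => Poseidon.gRer A (K x) i (c x))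
      fun S c' => AvCt E S True c' := by
  unfold Poseidon.gRer
  split_ifs with hi
  · refine ((Runs.coin _).bind fun S₁ hS₁ u hu => (Runs.coin _).bind fun S₂ hS₂ e0 he0 =>
      (Runs.coin _).bind fun S₃ hS₃ e1 he1 => (Runs.emit ?_).bind fun S₄ hS₄ _ _ =>
      Runs.ret (k := E.κ ^ 11) (a := fun x => Item.act (K x).pk0 (K x).pk1
        ⟨.real, u x, e0 x, e1 x⟩ (c x)) ?_ (inherited_avCt _)).le ?_
    · exact VisAv.cons _ (hu.mono (hS₂.trans hS₃)) (.cons _ (he0.mono hS₃) (.cons _ he1 .nil))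
    · have h04 := hS₁.trans (hS₂.trans (hS₃.trans hS₄))
      exact (HasCt.act (full := True) hP (hK.pk0.mono h04) (hK.pk1.mono h04)
        (hu.mono (hS₂.trans (hS₃.trans hS₄))) (he0.mono (hS₃.trans hS₄)) (he1.mono hS₄)
        ((hc.mono h04).imp fun _ => Or.inl hi).hasCt (Or.inr trivial)).save hP
    · simpa using E.pow_mono (by norm_num)
  · exact (Runs.rer hP hK.pk0 hK.pk1 (hc.imp Or.inr)).powE _ (by norm_num)

theorem Runs.gSend {c : X → Ct P} (hc : AvCt E S₀ True c) :
    Runs E full s S₀ 0 (fun x => Poseidon.gSend A (c x)) fun _ _ => True :=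
  Runs.emit (VisAv.cons _ (hc.2 trivial).1 (.cons _ (hc.2 trivial).2 .nil))

/-- The family of a constant number of values is available. -/
def AvRow {k : ℕ} (E : Enc X) (S : Set (X → ℤ)) (v : X → Fin k → P.Poly) : Prop :=
  ∀ i, AvV E S 1 fun x => v x i

theorem AvRow.mono {k : ℕ} {v : X → Fin k → P.Poly} (h : AvRow E S₀ v) (hS : S₀ ⊆ S) :
    AvRow E S v := fun i => (h i).mono hS

theorem AvRow.sum {k : ℕ} (hk : k ≤ E.κ) {v : X → Fin k → P.Poly} (h : AvRow E S₀ v) :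
    HasV E S₀ 2 2 fun x => ∑ i, v x i := HasV.sum hk (fun i => (h i).hasV) (by norm_num)

theorem Runs.gSwitch (hP : Fits P E) (hN : N ≤ E.κ) {ρ : X → Fin N → P.Poly} (hρ : AvRow E S₀ ρ)
    {e b : ℕ} (hb : b ≤ 10) {msg : X → P.Poly → P.Poly}
    (hmsg : HasV E S₀ e b fun x => msg x (s x)) (c : ℕ) (hc : max (e + 5) 15 < c) :
    Runs E full s S₀ (E.κ ^ c) (fun x => Poseidon.gSwitch A (ρ x) (msg x))
      fun S K => AvKey E S K := by
  refine (Runs.seqFinE (Q := fun _ S q => PairAv E S q) c hP.digits_le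
    (fun _ q _ _ hS h => h.mono hS) (fun t => ?_) hc).weaken le_rfl fun _ _ _ h => h
  have hbase : |(P.base : ℤ) ^ (t : ℕ)| ≤ E.bd 1 := by
    rw [abs_of_nonneg (by positivity)]
    exact hP.base_pow_le t
  have hm := (((hmsg.smul _ hbase (by omega)).redQL hP (by omega)).save
    hP.n_le)
  have hq := Runs.query (full := full) (msg := fun x s => red P.QL
      (((P.base : ℤ) ^ (t : ℕ)) • msg x s)) hm
  refine Runs.bindE (b := 14) _ hq (fun S₁ hS₁ p hp => ?_) (by omega)
  have hbv : HasV E S₁ 10 1 fun x => red P.QL ((p x).2 - nmul (∑ i, ρ x i) (p x).1) :=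
    ((hp.2.hasV.sub (((hρ.mono hS₁).sum hN).nmul hP.n_le hp.1.hasV (by norm_num))
      (by norm_num)).redQL hP (by norm_num)).weaken (by norm_num) le_rfl
  refine Runs.saveE (b := 12) _ (hbv.save hP.n_le) (inherited_avV _ _) (fun S₂ hS₂ hb => ?_)
      (by norm_num)
  refine ((Runs.emit ?_).bind fun S₃ hS₃ _ _ => Runs.ret (a := fun x => (_, (p x).1))
    (Has.intro ⟨hb.mono hS₃, hp.1.mono (hS₂.trans hS₃)⟩) fun _ _ hS h => h.mono hS).le
      (Nat.zero_le _)
  exact VisAv.cons _ (hp.1.mono hS₂) (.cons _ hb .nil)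

theorem Runs.coins (hN : N ≤ E.κ) (κ : Kind) :
    Runs E full s S₀ (E.κ ^ 1) (fun _ => Poseidon.seqFin fun _ : Fin N => (coin' κ : Prog P P.Poly))
      fun S v => AvRow E S v :=
  (Runs.seqFinE (Q := fun _ S v => AvV E S 1 v) 1 hN (fun _ _ => inherited_avV _ _)
    (fun _ => (Runs.coin κ).le (Nat.zero_le (E.κ ^ 0))) (by norm_num)).weaken le_rfl
      fun _ _ _ h => h

variable {ρ : X → Fin N → P.Poly} {h : Fin N}

theorem AvRow.inherited {k : ℕ} (v : X → Fin k → P.Poly) : Inherited fun S => AvRow E S v :=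
  fun _ _ hS h => h.mono hS

theorem hasV_pkShare (hP : Fits P E) (hρ : AvRow E S ρ) {p : X → P.Poly × P.Poly}
    {e : X → Fin N → P.Poly} (hp : PairAv E S p) (he : AvRow E S e) (i : Fin N) :
    HasV E S 10 1 fun x => pkShare h (ρ x) (p x) (e x) i := by
  unfold pkShare
  split_ifs
  · exact hp.2.hasV.weaken (by norm_num) le_rfl
  · exact (((((hρ i).hasV.nmul hP.n_le hp.1.hasV (by norm_num)).neg (by norm_num)).add
      (he i).hasV (by norm_num)).redQL hP (by norm_num)).weaken (by norm_num) le_rfl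

theorem Runs.gKeyPair (hP : Fits P E) (hN : N ≤ E.κ) (hρ : AvRow E S₀ ρ) :
    Runs E full s S₀ (E.κ ^ 15) (fun x => Poseidon.gKeyPair A h (ρ x)) fun S q =>
      (AvV E S 1 fun x => (q x).1) ∧ AvRow E S fun x => (q x).2 := by
  refine Runs.bindE (a := 1) (b := 14) _ (Runs.query ((HasV.zero (E := E)).weaken le_rfl
    (Nat.zero_le 1) |>.save hP.n_le)) (fun S₁ hS₁ p hp => ?_) (by norm_num)
  refine Runs.bindE (b := 13) _ (Runs.coins hN _) (fun S₂ hS₂ e he => ?_) (by norm_num)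
  have hp := hp.mono hS₂
  have hρ := hρ.mono (hS₁.trans hS₂)
  refine Runs.saveE (b := 0) (R := fun S => AvRow E S fun x => pkShare h (ρ x) (p x) (e x)) _
    (Has.finE 12 hN (fun i => (hasV_pkShare hP hρ hp he i).save hP.n_le)
      (fun _ => inherited_avV _ _) (by norm_num)) (AvRow.inherited _)
      (fun S₃ hS₃ hsh => ?_) (by norm_num)
  refine ((Runs.emit ?_).bind fun S₄ hS₄ _ _ => Runs.ret
    (a := fun x => ((p x).1, pkShare h (ρ x) (p x) (e x)))
    (Has.intro ⟨hp.1.mono (hS₃.trans hS₄), hsh.mono hS₄⟩)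
    fun _ _ hS h => ⟨h.1.mono hS, h.2.mono hS⟩).le (Nat.zero_le _)
  exact VisAv.cons _ (hp.1.mono hS₃) (VisAv.flatten_ofFn fun i =>
    .cons _ ((he i).mono hS₃) (.cons _ (hsh i) .nil))

theorem Params.slots_le (P : Params) : P.slots ≤ P.n :=
  Nat.pow_le_pow_right (by norm_num) (Nat.le_succ _)

theorem Runs.gKeys (hP : Fits P E) (hN : N ≤ E.κ) (hs : AvV E S₀ 1 s) (hρ : AvRow E S₀ ρ) :
    Runs E full s S₀ (E.κ ^ 20) (fun x => Poseidon.gKeys A h (ρ x)) fun S K => AvPub E S K := by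
  refine Runs.bindE (b := 19) _ (Runs.gKeyPair hP hN hρ) (fun S₁ hS₁ p hp => ?_) (by norm_num)
  have hs := hs.mono hS₁
  have hρ := hρ.mono hS₁
  have hsum : HasV E S₁ 3 3 fun x => s x + ∑ i, ρ x i :=
    (hs.hasV.add (hρ.sum hN) (by norm_num)).weaken (by norm_num) (by norm_num)
  refine Runs.bindE (b := 18) _ (Runs.gSwitch hP hN hρ (msg := fun x s =>
    nmul (s + ∑ i, ρ x i) (s + ∑ i, ρ x i)) (by norm_num)
    (hsum.nmul hP.n_le hsum (by norm_num)) 16 (by norm_num)) (fun S₂ hS₂ rlk hrlk => ?_)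
    (by norm_num)
  refine Runs.bindE (a := 17) (b := 5) _ (Runs.seqFinE (a := 16)
    (Q := fun _ S K => AvKey E S K) _ (P.slots_le.trans hP.n_le)
    (fun _ _ => inherited_avKey _) (fun k => Runs.gSwitch hP hN (hρ.mono hS₂) (msg := fun x s =>
      Poseidon.substPow (5 ^ (k : ℕ)) (s + ∑ i, ρ x i)) (by norm_num)
      (HasV.substPow hP.n_le (5 ^ (k : ℕ)) (fun j => (hsum j).mono hS₂) (by norm_num)) _
        (by norm_num))
      (by norm_num)) (fun S₃ hS₃ rot hrot => ?_) (by norm_num)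
  have hp1 := hp.1.mono (hS₂.trans hS₃)
  have hp2 := hp.2.mono (hS₂.trans hS₃)
  refine Runs.ret (a := fun x => PubKeys.mk (red P.QL (∑ i, (p x).2 i)) (p x).1 (rlk x)
    (rot x)) ?_ fun _ _ hS h => h.mono hS
  refine ((((hp2.sum hN).redQL hP (by norm_num)).save hP.n_le).weaken (E.pow_mono (by norm_num))
    fun S₄ hS₄ h => ?_)
  exact ⟨h, hp1.mono hS₄, inherited_avKey _ _ _ (hS₃.trans hS₄) hrlk,
    fun k => inherited_avKey _ _ _ hS₄ (hrot k)⟩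

/-- Transformations occur only under a reduction modulo `Q_L`, so `transformRed`, whose coefficients
fit into words, may take their place. -/
theorem hasV_red_transform (hP : Fits P E) (Φ : Matrix (Fin P.slots) (Fin P.slots) ℂ) (r : ℝ)
    {z : ℤ} (hz : |z| ≤ 1) {e e' b b' : ℕ} {w u : X → P.Poly} (hw : HasV E S e b w) (hb : b ≤ 3)
    (hu : HasV E S e' b' u) (hb' : b' ≤ 20) :
    HasV E S (max e e' + 10) 1 fun x => red P.QL (u x + z • P.transform Φ r (w x)) := by
  have heq : (fun x => red P.QL (u x + z • P.transform Φ r (w x))) =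
      fun x => red P.QL (u x + z • transformRed P Φ r (w x)) :=
    funext fun x => red_congr fun j => ((transform_modEq Φ r (w x) j).mul_left z).add_left _
  rw [heq]
  exact ((hu.add ((hw.transformRed hP Φ r hb).smul z (b' := 1)
    (hz.trans (le_trans (by norm_num) E.le_bd_one)) (by norm_num)) (by omega)).redQL hP
      (by omega)).weaken (by omega) le_rfl

theorem hasV_phase (hP : Fits P E) (hN : N ≤ E.κ) (hs : AvV E S 1 s) (hρ : AvRow E S ρ)
    {c : X → Ct P} (hc : AvCt E S True c) : HasV E S 15 2 fun x => phase (ρ x) (c x) (s x) := by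
  obtain ⟨⟨l, sc, hl, hsh⟩, hc⟩ := hc
  obtain ⟨hc0, hc1⟩ := hc trivial
  intro j
  simp only [phase, (hsh _).1]
  exact HasE.weaken (e := 15) (HasE.bmod (e := 12)
    (((hc0.hasV.add ((hs.hasV.add (hρ.sum hN) (by norm_num)).nmul hP.n_le hc1.hasV (by norm_num))
      (by norm_num)).weaken (by norm_num) le_rfl) j) (P.Q_pos hl) (hP.Q_le hl) (by norm_num))
      le_rfl le_rfl

theorem hasV_bootShare0 (hP : Fits P E) (hN : N ≤ E.κ) (hρ : AvRow E S ρ)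
    {c : X → Ct P} (hc : AvCt E S True c) {M e0 : X → Fin N → P.Poly} (hM : AvRow E S M)
    (he : AvRow E S e0) (i : Fin N) :
    HasV E S 15 1 fun x => bootShare0 h (ρ x) (c x) (M x) (e0 x) i := by
  obtain ⟨⟨l, sc, hl, hsh⟩, hc⟩ := hc
  obtain ⟨hc0, hc1⟩ := hc trivial
  unfold bootShare0
  simp only [(hsh _).1]
  split_ifs
  · exact ((((((hM i).hasV.add (he i).hasV (by norm_num)).sub hc0.hasV (by norm_num)).sub
      ((hρ.sum hN).nmul hP.n_le hc1.hasV (by norm_num)) (by norm_num))).redQ hP hl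
        (by norm_num)).weaken (by norm_num) le_rfl
  · exact (((((hρ i).hasV.nmul hP.n_le hc1.hasV (by norm_num)).add (hM i).hasV
      (by norm_num)).add (he i).hasV (by norm_num)).redQ hP hl (by norm_num)).weaken
        (by norm_num) le_rfl

theorem hasV_bootShare1 (hP : Fits P E) (hρ : AvRow E S ρ)
    (Φ : Matrix (Fin P.slots) (Fin P.slots) ℂ) (r : ℝ) {p : X → P.Poly × P.Poly}
    (hp : PairAv E S p) {M e1 : X → Fin N → P.Poly} (hM : AvRow E S M)
    (he : AvRow E S e1) (i : Fin N) :
    HasV E S 20 1 fun x => bootShare1 h (ρ x) (P.transform Φ r) (p x) (M x) (e1 x) i := by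
  unfold bootShare1
  split_ifs
  · exact hp.2.hasV.weaken (by norm_num) le_rfl
  · have heq : ∀ x, -(nmul (ρ x i) (p x).1) - P.transform Φ r (M x i) + e1 x i =
        (-(nmul (ρ x i) (p x).1) + e1 x i) + (-1 : ℤ) • P.transform Φ r (M x i) := fun x => by
      module
    simp only [heq]
    exact (hasV_red_transform hP Φ r (by norm_num) (hM i).hasV (by norm_num)
      ((((hρ i).hasV.nmul hP.n_le hp.1.hasV (by norm_num)).neg (by norm_num)).add (he i).hasV
        (by norm_num)) (by norm_num)).weaken (by norm_num) le_rfl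

theorem Runs.gRefresh (hP : Fits P E) (hN : N ≤ E.κ) (hs : AvV E S₀ 1 s) (hρ : AvRow E S₀ ρ)
    (lam : ℕ) (Φ : Matrix (Fin P.slots) (Fin P.slots) ℂ) (B : ℕ) {c : X → Ct P}
    (hc : AvCt E S₀ True c) :
    Runs E full s S₀ (E.κ ^ 40) (fun x => Poseidon.gRefresh A h (ρ x) lam Φ B (c x))
      fun S c' => AvCt E S True c' := by
  obtain ⟨l, sc, hl, hsh⟩ := hc.1
  unfold Poseidon.gRefresh
  simp only [(hsh _).2]
  refine Runs.bindE (b := 39) _ (Runs.coins hN _) (fun S₁ hS₁ M hM => ?_) (by norm_num)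
  refine Runs.bindE (b := 38) _ (Runs.coins hN _) (fun S₂ hS₂ e0 he0 => ?_) (by norm_num)
  refine Runs.bindE (b := 37) _ (Runs.coins hN _) (fun S₃ hS₃ e1 he1 => ?_) (by norm_num)
  have h03 := hS₁.trans (hS₂.trans hS₃)
  have hmsg : HasV E S₃ 30 1 fun x => red P.QL (-(P.transform Φ (P.S / sc)
      (M x h - phase (ρ x) (c x) (s x)))) := by
    have heq : ∀ v : P.Poly, -(P.transform Φ (P.S / sc) v) =
        0 + (-1 : ℤ) • P.transform Φ (P.S / sc) v := fun v => by module
    simp only [heq]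
    exact (hasV_red_transform hP Φ _ (by norm_num)
      ((((hM.mono (hS₂.trans hS₃)) h).hasV.sub (hasV_phase hP hN (hs.mono h03) (hρ.mono h03)
        (hc.mono h03)) (by norm_num))) (by norm_num) HasV.zero (by norm_num)).weaken
          (by norm_num) le_rfl
  refine Runs.bindE (a := 31) (b := 36) _ (Runs.query (msg := fun x s =>
    red P.QL (-(P.transform Φ (P.S / sc) (M x h - phase (ρ x) (c x) s)))) (hmsg.save hP.n_le))
    (fun S₄ hS₄ p hp => ?_) (by norm_num)
  have hM := hM.mono (hS₂.trans (hS₃.trans hS₄))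
  have he0 := he0.mono (hS₃.trans hS₄)
  have he1 := he1.mono hS₄
  have hρ := hρ.mono (h03.trans hS₄)
  have hc := hc.mono (h03.trans hS₄)
  refine Runs.saveE (a := 22) (b := 35)
    (R := fun S => AvRow E S fun x => bootShare0 h (ρ x) (c x) (M x) (e0 x)) _
    (Has.finE _ hN (fun i => (hasV_bootShare0 hP hN hρ hc hM he0 i).save hP.n_le)
      (fun _ => inherited_avV _ _) (by norm_num)) (AvRow.inherited _)
      (fun S₅ hS₅ h0 => ?_) (by norm_num)
  have hM := hM.mono hS₅
  have hp := hp.mono hS₅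
  have he1 := he1.mono hS₅
  refine Runs.saveE (a := 22) (b := 34)
    (R := fun S => AvRow E S fun x =>
      bootShare1 h (ρ x) (P.transform Φ (P.S / sc)) (p x) (M x) (e1 x)) _
    (Has.finE _ hN (fun i => (hasV_bootShare1 hP (hρ.mono hS₅) Φ _ hp hM he1 i).save hP.n_le)
      (fun _ => inherited_avV _ _) (by norm_num)) (AvRow.inherited _)
      (fun S₆ hS₆ h1 => ?_) (by norm_num)
  have hp := hp.mono hS₆
  have h0 := h0.mono hS₆
  have hc := hc.mono (hS₅.trans hS₆)
  have hc0 := (hc.2 trivial).1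
  refine Runs.bindE (a := 0) (b := 33) _ ((Runs.emit (VisAv.cons _ hp.1
    (VisAv.flatten_ofFn fun i => .cons _ (hM.mono hS₆ i) (.cons _ (he0.mono (hS₅.trans hS₆) i)
      (.cons _ (he1.mono hS₆ i) (.cons _ (h0 i) (.cons _ (h1 i) .nil))))))).le
        (Nat.zero_le _)) (fun S₇ hS₇ _ _ => ?_) (by norm_num)
  refine Runs.ret (a := fun x => Ct.mk (red P.QL (P.transform Φ (P.S / sc)
        (red (P.Q (c x).lvl) ((c x).c0 + ∑ i, bootShare0 h (ρ x) (c x) (M x) (e0 x) i)) +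
          ∑ i, bootShare1 h (ρ x) (P.transform Φ (P.S / sc)) (p x) (M x) (e1 x) i))
            (p x).1 P.L P.S) ?_ (inherited_avCt _)
  refine (HasCt.save hP (e := 30) ⟨⟨P.L, P.S, le_rfl, fun _ => ⟨rfl, rfl⟩⟩, fun _ =>
      ⟨?_, ?_⟩⟩).weaken
    (E.pow_mono (by norm_num)) fun _ _ h => h
  · simp only [(hsh _).1]
    have heq : ∀ u v : P.Poly, P.transform Φ (P.S / sc) u + v =
        v + (1 : ℤ) • P.transform Φ (P.S / sc) u := fun u v => by module
    simp only [heq]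
    have h0 := h0.mono hS₇
    have h1 := h1.mono hS₇
    have hc0 := hc0.mono hS₇
    exact (hasV_red_transform hP Φ _ (by norm_num)
      ((hc0.hasV.add (h0.sum hN) (by norm_num)).redQ hP hl (by norm_num)) (by norm_num)
      (h1.sum hN) (by norm_num)).weaken (by norm_num) le_rfl
  · exact (hp.1.mono hS₇).hasV.weaken (by norm_num) le_rfl

variable {K : X → PubKeys P}

theorem Runs.gBoot (hP : Fits P E) (hN : N ≤ E.κ) (hs : AvV E S₀ 1 s) (hρ : AvRow E S₀ ρ)
    (hK : AvPub E S₀ K) (lam : ℕ) (i : Fin N) (Φ : Matrix (Fin P.slots) (Fin P.slots) ℂ) (B : ℕ)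
    {c : X → Ct P} (hc : AvCt E S₀ (i ∈ A ∨ full) c) :
    Runs E full s S₀ (E.κ ^ 42) (fun x => Poseidon.gBoot A h (ρ x) (K x) lam i Φ B (c x))
      fun S c' => AvCt E S True c' := by
  refine Runs.bindE (b := 41) _ (Runs.gRer hP hK i hc) (fun S₁ hS₁ c' hc' => ?_) (by norm_num)
  refine Runs.bindE (a := 0) (b := 40) _ ((Runs.gSend hc').le (Nat.zero_le _))
      (fun S₂ hS₂ _ _ => ?_)
    (by norm_num)
  exact Runs.gRefresh hP hN (hs.mono (hS₁.trans hS₂)) (hρ.mono (hS₁.trans hS₂)) lam Φ B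
    (hc'.mono hS₂)

/-- The data of party `i` are available, if `full` holds or `i` is corrupted. -/
def OwnAv (E : Enc X) (S : Set (X → ℤ)) (full : Prop) {d : ℕ} (own : X → Fin d → P.Msg) : Prop :=
  full → ∀ t, AvV E S 1 fun x => P.encode P.S (own x t)

theorem hasV_plain (hP : Fits P E) {f : Prop} {d : ℕ} {own : X → Fin d → P.Msg}
    (ho : OwnAv E S f own) (o : Operand P d) : f → HasV E S 0 1 fun x => (o.plain (own x)).1 := by
  cases o with
  | own t => exact fun hf => (ho hf t).hasV
  | const z sc => exact fun _ => HasV.redConst hP le_rfl _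

theorem plain_scale {d : ℕ} (own : X → Fin d → P.Msg) (o : Operand P d) :
    ∃ sc, ∀ x, (o.plain (own x)).2 = sc := by
  cases o with
  | own t => exact ⟨_, fun _ => rfl⟩
  | const z sc => exact ⟨_, fun _ => rfl⟩

theorem Runs.gStep (hP : Fits P E) (hN : N ≤ E.κ) (hs : AvV E S₀ 1 s) (hρ : AvRow E S₀ ρ)
    (hK : AvPub E S₀ K) (lam : ℕ) (i : Fin N) {d : ℕ} {own : X → Fin d → P.Msg}
    (ho : OwnAv E S₀ (i ∈ A ∨ full) own) {regs : X → List (Ct P)}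
    (hr : ListAv (AvCt E S₀ (i ∈ A ∨ full)) regs)
    (hz : AvCt E S₀ (i ∈ A ∨ full) fun _ => (Ct.ofPlain 0 P.S : Ct P)) (I : Instr P d) :
    Runs E full s S₀ (E.κ ^ 42) (fun x => Poseidon.gStep A h (ρ x) (K x) lam i (own x) (regs x) I)
      fun S c => AvCt E S (i ∈ A ∨ full) c := by
  have hreg : ∀ a, HasCt E S₀ (i ∈ A ∨ full) 0 fun x => (regs x).getD a (Ct.ofPlain 0 P.S) :=
    fun a => (hr.getD hz a).hasCt
  have hret : ∀ {c : X → Ct P}, HasCt E S₀ (i ∈ A ∨ full) 40 c →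
      Runs E full s S₀ (E.κ ^ 42) (fun x => pure (c x)) fun S c => AvCt E S (i ∈ A ∨ full) c :=
    fun hc => Runs.ret (hc.save hP) (inherited_avCt _)
  have hpl : ∀ o : Operand P d, HasCt E S₀ (i ∈ A ∨ full) 0 fun x =>
      Ct.ofPlain (o.plain (own x)).1 (o.plain (own x)).2 := fun o => by
    obtain ⟨sc, hsc⟩ := plain_scale own o
    simp only [hsc]
    exact HasCt.ofPlain _ (hasV_plain hP ho o)
  cases I with
  | add a b => exact hret (((hreg a).add hP (hreg b)).weaken (by norm_num))
  | sub a b => exact hret (((hreg a).sub hP (hreg b)).weaken (by norm_num))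
  | mul a b => exact hret (((hreg a).mul hP hK (hreg b)).weaken (by norm_num))
  | addPt a o => exact hret (((hreg a).add hP (hpl o)).weaken (by norm_num))
  | ptSub o a => exact hret (((hpl o).sub hP (hreg a)).weaken (by norm_num))
  | mulPt a o =>
    obtain ⟨sc, hsc⟩ := plain_scale own o
    refine hret ?_
    simp only [hsc]
    exact ((hreg a).mulPt hP sc (hasV_plain hP ho o)).weaken (by norm_num)
  | rotL a k => exact hret (((hreg a).rotL hP hK k).weaken (by norm_num))
  | res a => exact hret (((hreg a).res hP).weaken (by norm_num))
  | setScale a t => exact hret (((hreg a).setScale hP t).weaken (by norm_num))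
  | boot a Φ B =>
    exact (Runs.gBoot hP hN hs hρ hK lam i Φ B (hr.getD hz a)).weaken le_rfl
      fun _ _ _ h => h.imp fun _ => trivial

theorem Runs.gLocal (hP : Fits P E) (hN : N ≤ E.κ) (hs : AvV E S₀ 1 s) (hρ : AvRow E S₀ ρ)
    (hK : AvPub E S₀ K) (lam : ℕ) (i : Fin N) {d : ℕ} {own : X → Fin d → P.Msg}
    (ho : OwnAv E S₀ (i ∈ A ∨ full) own) (Is : List (Instr P d)) {regs : X → List (Ct P)}
    (hr : ListAv (AvCt E S₀ (i ∈ A ∨ full)) regs)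
    (hz : AvCt E S₀ (i ∈ A ∨ full) fun _ => (Ct.ofPlain 0 P.S : Ct P)) :
    Runs E full s S₀ (Is.length * E.κ ^ 42)
      (fun x => Poseidon.gLocal A h (ρ x) (K x) lam i (own x) Is (regs x))
      fun S regs => ListAv (AvCt E S (i ∈ A ∨ full)) regs := by
  induction Is generalizing S₀ regs with
  | nil =>
    refine Runs.ret (a := regs) (Has.weaken (Q := fun S => ListAv (AvCt E S (i ∈ A ∨ full)) regs)
      (Has.intro hr) (Nat.zero_le _) fun _ _ h => h) fun _ _ hS h => h.imp fun _ h => h.mono hS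
  | cons I Is ih =>
    rw [List.length_cons, Nat.succ_mul, add_comm]
    refine (Runs.gStep hP hN hs hρ hK lam i ho hr hz I).bind fun S₁ hS₁ c hc => ?_
    exact ih (hs.mono hS₁) (hρ.mono hS₁) (hK.mono hS₁) (fun hf t => (ho hf t).mono hS₁)
      ((hr.imp fun _ h => h.mono hS₁).append (.cons hc .nil)) (hz.mono hS₁)

theorem Runs.foldlM {α γ : Type} {k : ℕ} {f : X → α → γ → Prog P α}
    {Q : Set (X → ℤ) → (X → α) → Prop} (hQ : ∀ a, Inherited fun S => Q S a)
    (hf : ∀ S, S₀ ⊆ S → ∀ c, ∀ a : X → α, Q S a → Runs E full s S k (fun x => f x (a x) c) Q)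
    (l : List γ) {a : X → α} (ha : Q S₀ a) :
    Runs E full s S₀ (l.length * k) (fun x => l.foldlM (f x) (a x)) Q := by
  induction l generalizing S₀ a with
  | nil => exact Runs.ret ((Has.intro (Q := fun S => Q S a) ha).weaken (Nat.zero_le _)
      fun _ _ h => h) (hQ a)
  | cons c l ih =>
    rw [List.length_cons, Nat.succ_mul, add_comm]
    simp only [List.foldlM_cons]
    exact (hf _ subset_rfl c a ha).bind fun S₁ hS₁ b hb =>
      ih (fun S hS => hf S (hS₁.trans hS)) hb

end Steps

/-! ### Straight-line code for the whole training -/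

section Training

open Prog

variable {X : Type} {P : Params} {E : Enc X} {full : Prop} {S₀ : Set (X → ℤ)}
  {s : X → P.Poly} {T : Training P} {A : Finset (Fin T.N)} {h : Fin T.N}
  {ρ : X → Fin T.N → P.Poly} {K : X → PubKeys P} {inp : X → T.Inputs}

/-- The training is small compared with the words of `E`. -/
structure Training.Fits (T : Training P) (E : Enc X) : Prop where
  params : Poseidon.Fits P E
  N_le : T.N ≤ E.κ
  nW_le : T.nW ≤ E.κ
  m_le : T.m ≤ E.κ
  lgd_le : ∀ k i, (T.lgd k i).length ≤ E.κ

/-- The inputs of corrupted parties, and all inputs if `full` holds, are available. -/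
structure InpAv (E : Enc X) (S : Set (X → ℤ)) (full : Prop) (A : Finset (Fin T.N))
    (inp : X → T.Inputs) : Prop where
  data : ∀ i, OwnAv E S (i ∈ A ∨ full) fun x => (inp x i).data
  w0 : OwnAv E S (T.first ∈ A ∨ full) fun x => (inp x T.first).w0

theorem InpAv.mono {S : Set (X → ℤ)} (hi : InpAv E S₀ full A inp) (hS : S₀ ⊆ S) :
    InpAv E S full A inp :=
  ⟨fun i hf t => (hi.data i hf t).mono hS, fun hf t => (hi.w0 hf t).mono hS⟩

/-- Available ciphertexts. -/
def AvCts (E : Enc X) (S : Set (X → ℤ)) (full : Prop) {k : ℕ} (W : X → Fin k → Ct P) : Prop :=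
  ∀ j, AvCt E S full fun x => W x j

theorem AvCts.inherited {k : ℕ} (W : X → Fin k → Ct P) : Inherited fun S => AvCts E S full W :=
  fun _ _ hS h j => (h j).mono hS

theorem Has.updated (hT : T.Fits E) {W : X → Fin T.nW → Ct P}
    {G : X → Fin T.N → Fin T.nW → Ct P} (hW : AvCts E S₀ True W)
    (hG : ∀ i, AvCts E S₀ True fun x => G x i) (j : Fin T.nW) :
    Has E S₀ (E.κ ^ 14) fun S => AvCt E S True fun x => T.updated (W x) (G x) j := by
  have hP := hT.params
  have key : ∀ {n : ℕ} (c : X → Fin n → Ct P) (z : X → Ct P) (S), S₀ ⊆ S → AvCts E S True c →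
      AvCt E S True z → Has E S (n * E.κ ^ 4) fun S => AvCt E S True fun x =>
        (List.ofFn (c x)).foldl Ct.add (z x) := by
    intro n
    induction n with
    | zero =>
      intro c z S _ _ hz
      simp only [List.ofFn_zero, List.foldl_nil]
      exact (Has.intro (Q := fun S => AvCt E S True z) hz).weaken (Nat.zero_le _) fun _ _ h => h
    | succ n ih =>
      intro c z S hS hc hz
      simp only [List.ofFn_succ, List.foldl_cons]
      rw [Nat.succ_mul, add_comm]
      refine ((hz.hasCt.add hP (hc 0).hasCt).save hP).bind fun S₁ hS₁ h1 => ?_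
      exact ih (fun x j => c x j.succ) _ S₁ (hS.trans hS₁) (fun j => (hc j.succ).mono hS₁) h1
  -- `Ct.ofPlain 0 0` is the ciphertext from which the summation of the gradients starts.
  have hz : Has E S₀ (E.κ ^ 2) fun S => AvCt E S True fun _ => (Ct.ofPlain 0 0 : Ct P) :=
    (HasCt.zero 0).save hP
  have hsum : Has E S₀ (E.κ ^ 6) fun S => AvCt E S True fun x =>
      (List.ofFn fun i => G x i j).foldl Ct.add (Ct.ofPlain 0 0) := by
    refine (hz.bind fun S₁ hS₁ hz => key (fun x i => G x i j) _ S₁ hS₁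
      (fun i => (hG i j).mono hS₁) hz).weaken ((Nat.add_le_add_left ?_ _).trans
        (E.add_le (a := 2) (b := 5) (by norm_num))) fun _ _ h => h
    rw [pow_succ, mul_comm]
    exact Nat.mul_le_mul_left _ hT.N_le
  refine (hsum.bind (k₂ := E.κ ^ 10) fun S₁ hS₁ hg => ?_).weaken (E.add_le (by norm_num))
    fun _ _ h => h
  obtain ⟨⟨l, sc, hl, hsh⟩, hg⟩ := hg
  obtain ⟨lw, scw, hlw, hshw⟩ := (hW j).1
  have hg' : HasCt E S₁ True 0 fun x => { (List.ofFn fun i => G x i j).foldl Ct.add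
      (Ct.ofPlain 0 0) with scale := ((List.ofFn fun i => G x i j).foldl Ct.add
        (Ct.ofPlain 0 0)).scale * (T.b * T.N / T.η) } :=
    AvCt.hasCt ⟨⟨l, sc * (T.b * T.N / T.η), hl, fun x => ⟨(hsh x).1, by simp only [(hsh x).2]⟩⟩, hg⟩
  have := (((((hW j).mono hS₁).hasCt).add hP (hg'.setScale hP scw)).save hP)
  unfold Training.updated
  simp only [(hshw _).2]
  exact this

theorem Runs.gIteration (hT : T.Fits E) (hs : AvV E S₀ 1 s) (hρ : AvRow E S₀ ρ)
    (hK : AvPub E S₀ K) (hi : InpAv E S₀ full A inp) (k : Fin T.m)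
    {W : X → Fin T.nW → Ct P} (hW : AvCts E S₀ True W) :
    Runs E full s S₀ (E.κ ^ 50) (fun x => Poseidon.gIteration T A h (ρ x) (K x) (inp x) k (W x))
      fun S W => AvCts E S True W := by
  have hP := hT.params
  have hsend : ∀ (S : Set (X → ℤ)) (i : Fin T.N) (c : X → Ct P), S₀ ⊆ S →
      AvCt E S (i ∈ A ∨ full) c → Runs E full s S (E.κ ^ 14)
        (fun x => do
          let c ← Poseidon.gRer A (K x) i (c x)
          Poseidon.gSend A c
          pure c) fun S c => AvCt E S True c := fun S i c hS hc =>
    Runs.bindE (b := 2) _ (Runs.gRer hP (hK.mono hS) i hc) (fun S₁ hS₁ c' hc' =>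
      Runs.bindE (a := 0) (b := 1) _ ((Runs.gSend hc').le (Nat.zero_le _)) (fun S₂ hS₂ _ _ =>
        Runs.ret (a := c') ((Has.intro (Q := fun S => AvCt E S True c') (hc'.mono hS₂)).weaken
          (Nat.zero_le _) fun _ _ h => h) (inherited_avCt _)) (by norm_num)) (by norm_num)
  refine Runs.bindE (a := 15) (b := 49) _ (Runs.seqFinE (Q := fun _ S c => AvCt E S True c) _
    hT.nW_le (fun _ _ => inherited_avCt _) (fun j => hsend S₀ T.first (fun x => W x j) subset_rfl
      ((hW j).imp fun _ => trivial)) (by norm_num)) (fun S₁ hS₁ W hW => ?_) (by norm_num)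
  refine Runs.saveE (a := 2) (b := 48) _ (R := fun S => AvCt E S True fun _ =>
    (Ct.ofPlain 0 P.S : Ct P)) ((HasCt.zero P.S).save hP) (inherited_avCt _)
    (fun S₂ hS₂ hz => ?_) (by norm_num)
  refine Runs.bindE (a := 46) (b := 47) _ (Runs.seqFinE (a := 45)
    (Q := fun _ S (G : X → Fin T.nW → Ct P) => AvCts E S True G) _ hT.N_le
    (fun _ _ => AvCts.inherited _) (fun i => ?_) (by norm_num))
    (fun S₃ hS₃ G hG => ?_) (by norm_num)
  · have h02 := hS₁.trans hS₂
    refine Runs.bindE (a := 43) (b := 15) _ ((Runs.gLocal (full := full) hP hT.N_le (hs.mono h02)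
      (hρ.mono h02) (hK.mono h02) T.lam i ((hi.mono h02).data i) (T.lgd k i)
      (ListAv.ofFn fun j => ((hW j).mono hS₂).imp fun _ => trivial)
      (hz.imp fun _ => trivial)).le ?_) (fun S₃ hS₃ regs hregs => ?_) (by norm_num)
    · rw [pow_succ _ 42, mul_comm]
      exact Nat.mul_le_mul_left _ (hT.lgd_le k i)
    · exact Runs.seqFinE (Q := fun _ S c => AvCt E S True c) _
        hT.nW_le (fun _ _ => inherited_avCt _) (fun j => hsend S₃ i _ (h02.trans hS₃)
          (hregs.getD ((hz.mono hS₃).imp fun _ => trivial) _)) (by norm_num)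
  · have h03 := hS₁.trans (hS₂.trans hS₃)
    refine Runs.seqFinE (a := 45) (Q := fun _ S c => AvCt E S True c) _
      hT.nW_le (fun _ _ => inherited_avCt _) (fun j => ?_) (by norm_num)
    refine Runs.saveE (a := 14) (b := 42) _ (Has.updated hT (fun j => (hW j).mono (hS₂.trans hS₃))
        hG j)
      (inherited_avCt _) (fun S₄ hS₄ hU => ?_) (by norm_num)
    have h04 := h03.trans hS₄
    exact Runs.gBoot hP hT.N_le (hs.mono h04) (hρ.mono h04) (hK.mono h04) T.lam T.first 1 T.B
      (hU.imp fun _ => trivial)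

theorem Runs.gMain (hT : T.Fits E) (hs : AvV E S₀ 1 s) (hρ : AvRow E S₀ ρ)
    (hK : AvPub E S₀ K) (hi : InpAv E S₀ full A inp) :
    Runs E full s S₀ (E.κ ^ 52) (fun x => Poseidon.gMain T A h (ρ x) (K x) (inp x))
      fun S W => AvCts E S True W := by
  have hP := hT.params
  refine Runs.bindE (a := 14) (b := 51) _ (Runs.seqFinE (a := 13)
    (Q := fun _ S c => AvCt E S True c) _ hT.nW_le (fun _ _ => inherited_avCt _) (fun j => ?_)
    (by norm_num)) (fun S₁ hS₁ W hW => ?_) (by norm_num)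
  · refine Runs.saveE (a := 2) (b := 12) _ ((HasCt.ofPlain P.S fun hf =>
      (hi.w0 hf j).hasV).save hP) (inherited_avCt _) (fun S₁ hS₁ hc => ?_) (by norm_num)
    exact Runs.gRer hP (hK.mono hS₁) T.first hc
  · refine (Runs.foldlM (Q := fun S W => AvCts E S True W) (f := fun x W k =>
      Poseidon.gIteration T A h (ρ x) (K x) (inp x) k W) (fun _ => AvCts.inherited _)
      (fun S hS k W hW => Runs.gIteration hT (hs.mono (hS₁.trans hS)) (hρ.mono (hS₁.trans hS))
        (hK.mono (hS₁.trans hS)) (hi.mono (hS₁.trans hS)) k hW) _ hW).le ?_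
    rw [List.length_finRange, pow_succ _ 50, mul_comm]
    exact Nat.mul_le_mul_left _ hT.m_le

theorem Runs.gTotal (hT : T.Fits E) (hs : AvV E S₀ 1 s) (hρ : AvRow E S₀ ρ)
    (hi : InpAv E S₀ full A inp) :
    Runs E full s S₀ (E.κ ^ 54) (fun x => Poseidon.gTotal T A h (ρ x) (inp x))
      fun S W => AvCts E S True W := by
  have hP := hT.params
  refine Runs.bindE (a := 0) (b := 53) _ ((Runs.emit (l := fun x => vis A (List.ofFn fun i =>
    (some i, ρ x i))) ?_).le (Nat.zero_le _)) (fun S₁ hS₁ _ _ => ?_) (by norm_num)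
  · have := VisAv.flatten_ofFn (A := A) (S := S₀) (f := fun x i => [(some i, ρ x i)])
      fun i => VisAv.cons _ (hρ i) .nil
    rwa [show (fun x => (List.ofFn fun i => [(some i, ρ x i)]).flatten) =
      fun x => List.ofFn fun i => (some i, ρ x i) from
        funext fun x => flatten_ofFn_singleton _] at this
  · exact Runs.bindE (b := 52) _ (Runs.gKeys hP hT.N_le (hs.mono hS₁) (hρ.mono hS₁))
      (fun S₂ hS₂ K hK => Runs.gMain hT (hs.mono (hS₁.trans hS₂)) (hρ.mono (hS₁.trans hS₂)) hK
        (hi.mono (hS₁.trans hS₂))) (by norm_num)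

end Training

/-! ## Distinguishers -/

section Norm

variable {k : ℕ}

/-- The squared norm of a state vector. -/
def normSq (ψ : (Fin k → Bool) → ℂ) : ℝ := ∑ x, ‖ψ x‖ ^ 2

theorem norm_sq_add_norm_sq_sub (a b : ℂ) :
    ‖((1 / Real.sqrt 2 : ℝ) : ℂ) * (a + b)‖ ^ 2 + ‖((1 / Real.sqrt 2 : ℝ) : ℂ) * (a - b)‖ ^ 2 =
      ‖a‖ ^ 2 + ‖b‖ ^ 2 := by
  have h := parallelogram_law_with_norm ℝ a b
  have hc : ‖((1 / Real.sqrt 2 : ℝ) : ℂ)‖ ^ 2 = 1 / 2 := by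
    rw [Complex.norm_real, Real.norm_eq_abs, sq_abs, div_pow, Real.sq_sqrt (by norm_num), one_pow]
  rw [norm_mul, norm_mul, mul_pow, mul_pow, hc]
  nlinarith [h]

/-- The gates are unitary. For the Hadamard gate, basis states that differ in bit `i` are paired,
and the parallelogram law applies to each pair. The point is that acceptance probabilities are at
most `1`. -/
theorem normSq_apply (g : Gate k) (ψ : (Fin k → Bool) → ℂ) : normSq (g.apply ψ) = normSq ψ := by
  cases g with
  | had i =>
    have hinv : Function.Involutive fun x : Fin k → Bool => Function.update x i (!x i) := by
      intro x
      simp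
    have h : ∀ f : (Fin k → Bool) → ℝ, ∑ x, f x = ∑ x, f (Function.update x i (!x i)) := fun f =>
      (Equiv.sum_comp hinv.toPerm f).symm
    have h2 : ∀ f g : (Fin k → Bool) → ℝ,
        (∀ x, f x + f (Function.update x i (!x i)) = g x + g (Function.update x i (!x i))) →
          ∑ x, f x = ∑ x, g x := by
      intro f g hfg
      have h3 := Finset.sum_congr rfl fun x (_ : x ∈ Finset.univ) => hfg x
      rw [Finset.sum_add_distrib, Finset.sum_add_distrib, ← h f, ← h g] at h3
      linarith
    refine h2 _ _ fun x => ?_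
    have hx : ∀ b, x i = b → Function.update x i b = x := by
      rintro _ rfl
      exact Function.update_eq_self i x
    simp only [Gate.apply, Function.update_idem, Function.update_self]
    cases hb : x i with
    | false =>
      simp only [hx false hb, Bool.not_false, Bool.false_eq_true, if_false, one_mul, if_true]
      rw [← norm_sq_add_norm_sq_sub (ψ x), neg_one_mul, sub_eq_add_neg]
    | true =>
      simp only [hx true hb, Bool.not_true, Bool.false_eq_true, if_false, one_mul, if_true]
      rw [add_comm (‖ψ x‖ ^ 2), ← norm_sq_add_norm_sq_sub _ (ψ x), neg_one_mul, sub_eq_add_neg]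
      ring
  | tee i =>
    refine Finset.sum_congr rfl fun x _ => ?_
    simp only [Gate.apply]
    split_ifs
    · rw [norm_mul, mul_comm Complex.I, Complex.norm_exp_ofReal_mul_I, one_mul]
    · rfl
  | cnot i j =>
    simp only [normSq, Gate.apply]
    split_ifs with hij
    · rfl
    have hinv : Function.Involutive fun x : Fin k → Bool =>
        Function.update x j (xor (x j) (x i)) := by
      intro x
      simp [Function.update_of_ne hij]
    exact Equiv.sum_comp hinv.toPerm fun x => ‖ψ x‖ ^ 2

theorem Distinguisher.normSq_state (D : Distinguisher) (x : List ℤ) : normSq (D.state x) = 1 := by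
  have h : ∀ (gs : List (Gate (D.k + 1))) (ψ : (Fin (D.k + 1) → Bool) → ℂ),
      normSq (gs.foldl (fun ψ g => g.apply ψ) ψ) = normSq ψ := by
    intro gs
    induction gs with
    | nil => exact fun _ => rfl
    | cons g gs ih => exact fun ψ => (ih _).trans (normSq_apply g ψ)
  rw [Distinguisher.state, h, normSq]
  rw [Finset.sum_eq_single fun t => decide ((execWords D.prog x).getD (D.wire t) 0 % 2 = 1)]
  · simp
  · intro y _ hy
    rw [if_neg fun h => hy (funext h)]
    simp
  · simp

theorem Distinguisher.prob_le_one (D : Distinguisher) (x : List ℤ) : D.prob x ≤ 1 := by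
  rw [← D.normSq_state x]
  refine Finset.sum_le_sum fun y _ => ?_
  split_ifs
  · exact le_rfl
  · positivity

end Norm

/-- The probability of acceptance. -/
def Distinguisher.pr (D : Distinguisher) (x : List ℤ) : ℝ≥0∞ := ENNReal.ofReal (D.prob x)

theorem Distinguisher.pr_le_one (D : Distinguisher) (x : List ℤ) : D.pr x ≤ 1 :=
  ENNReal.ofReal_le_one.2 (D.prob_le_one x)

theorem Distinguisher.accept_eq (D : Distinguisher) (μ : PMF (List ℤ)) :
    D.accept μ = (ex μ D.pr).toReal := rfl

theorem Distinguisher.ex_pr_le_one (D : Distinguisher) (μ : PMF (List ℤ)) : ex μ D.pr ≤ 1 :=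
  ex_le D.pr_le_one

/-- An upper bound on the advantage bounds the difference of probabilities. -/
theorem Distinguisher.adv_le_iff (D : Distinguisher) (μ ν : PMF (List ℤ)) {ε : ℝ} (hε : 0 ≤ ε) :
    D.adv μ ν ≤ ε ↔ ex μ D.pr ≤ ex ν D.pr + ENNReal.ofReal ε ∧
      ex ν D.pr ≤ ex μ D.pr + ENNReal.ofReal ε := by
  have hμ := ne_top_of_le_ne_top ENNReal.one_ne_top (D.ex_pr_le_one μ)
  have hν := ne_top_of_le_ne_top ENNReal.one_ne_top (D.ex_pr_le_one ν)
  rw [adv, accept_eq, accept_eq, abs_sub_le_iff, sub_le_iff_le_add', sub_le_iff_le_add']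
  have key : ∀ a b : ℝ≥0∞, a ≠ ⊤ → b ≠ ⊤ →
      (a.toReal ≤ b.toReal + ε ↔ a ≤ b + ENNReal.ofReal ε) := by
    intro a b ha hb
    rw [← ENNReal.toReal_le_toReal ha (ENNReal.add_ne_top.2 ⟨hb, ENNReal.ofReal_ne_top⟩),
      ENNReal.toReal_add hb ENNReal.ofReal_ne_top, ENNReal.toReal_ofReal hε]
  rw [key _ _ hμ hν, key _ _ hν hμ]

/-! ### Relocation -/

/-- The source of a value: a cell or a constant. -/
inductive Src where
  | cell (t : ℕ)
  | const (z : ℤ)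

def Src.val (mem : List ℤ) : Src → ℤ
  | .cell t => mem.getD t 0
  | .const z => z

def Src.Below (n : ℕ) : Src → Prop
  | .cell t => t < n
  | .const _ => True

theorem Src.val_append {mem : List ℤ} {r : Src} (h : r.Below mem.length) (mem' : List ℤ) :
    r.val (mem ++ mem') = r.val mem := by
  cases r with
  | cell t => exact List.getD_append _ _ _ _ h
  | const z => rfl

theorem Src.Below.mono {r : Src} {n n' : ℕ} (h : r.Below n) (hn : n ≤ n') : r.Below n' := by
  cases r with
  | cell t => exact lt_of_lt_of_le h hn
  | const z => trivial

theorem wrap_wrap (w : ℕ) (z : ℤ) : wrap w (wrap w z) = wrap w z := Int.bmod_bmod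

/-- The instruction that loads a constant source, and the cell which then holds the source. -/
def Src.load (r : Src) (w n : ℕ) : WordInstr × ℕ :=
  match r with
  -- A cell needs no loading; the dummy instruction makes every load one instruction long.
  | .cell t => (⟨.const 0, 0, 0, w⟩, t)
  | .const z => (⟨.const z, 0, 0, w⟩, n)

theorem execWords_singleton (I : WordInstr) (mem : List ℤ) :
    execWords [I] mem = mem ++ [wrap I.w (I.op.eval (wrap I.w (mem.getD I.i 0))
      (wrap I.w (mem.getD I.j 0)))] := rfl

/-- A constant is wrapped when it is loaded and again when it is used, on the same word length; this
does no harm as `wrap` is idempotent. -/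
theorem Src.load_spec (r : Src) (w : ℕ) (mem : List ℤ) (h : r.Below mem.length) :
    wrap w ((execWords [(r.load w mem.length).1] mem).getD (r.load w mem.length).2 0) =
      wrap w (r.val mem) := by
  rw [execWords_singleton]
  cases r with
  | cell t =>
    simp only [Src.load]
    rw [List.getD_append _ _ _ _ h]
    rfl
  | const z =>
    simp only [Src.load]
    rw [List.getD_append_right _ _ _ _ le_rfl, Nat.sub_self, List.getD_cons_zero]
    exact wrap_wrap w z

theorem Src.load_lt (r : Src) (w n : ℕ) (h : r.Below n) : (r.load w n).2 < n + 1 := by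
  cases r with
  | cell t => exact Nat.lt_succ_of_lt h
  | const z => exact Nat.lt_succ_self n

theorem Src.load_w (r : Src) (w n : ℕ) : (r.load w n).1.w = w := by
  cases r <;> rfl

/-- A program can be run on values that are stored elsewhere or are constants. -/
theorem exists_relocated (prog : List WordInstr) (len n : ℕ) (src : ℕ → Src)
    (hsrc : ∀ i, (src i).Below n) :
    ∃ (prog' : List WordInstr) (src' : ℕ → Src), costWords prog' ≤ 3 * costWords prog ∧
      (∀ i, (src' i).Below (n + prog'.length)) ∧
      ∀ u mem : List ℤ, u.length = len → mem.length = n → (∀ i, u.getD i 0 = (src i).val mem) →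
        ∀ i, (execWords prog u).getD i 0 = (src' i).val (execWords prog' mem) := by
  induction prog generalizing len n src with
  | nil => exact ⟨[], src, le_rfl, hsrc, fun u mem _ _ h => h⟩
  | cons I prog ih =>
    -- One instruction becomes three of the same word length, two loads and the operation, whose
    -- result lies in cell `n + 2`. This is the factor `3`.
    set a := (src I.i).load I.w n
    set b := (src I.j).load I.w (n + 1)
    set J : WordInstr := ⟨I.op, a.2, b.2, I.w⟩
    obtain ⟨prog', src', hcost, hbelow, h⟩ := ih (len + 1) (n + 3)
      (Function.update src len (.cell (n + 2))) fun i => by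
        by_cases hi : i = len
        · subst hi
          rw [Function.update_self]
          exact Nat.lt_succ_self _
        · rw [Function.update_of_ne hi]
          exact (hsrc i).mono (by omega)
    refine ⟨a.1 :: b.1 :: J :: prog', src', ?_, fun i => ?_, fun u mem hu hmem hval i => ?_⟩
    · have ha : a.1.w = I.w := Src.load_w _ _ _
      have hb : b.1.w = I.w := Src.load_w _ _ _
      simp only [costWords, List.map_cons, List.sum_cons] at hcost ⊢
      rw [ha, hb]
      change I.w + 1 + (I.w + 1 + (I.w + 1 + _)) ≤ _
      omega
    · convert hbelow i using 1
      simp only [List.length_cons]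
      omega
    · set mem₁ := execWords [a.1] mem with hmem₁
      set mem₂ := execWords [b.1] mem₁ with hmem₂
      have hl₁ : mem₁.length = n + 1 := by rw [hmem₁, length_execWords, hmem]; rfl
      have hl₂ : mem₂.length = n + 2 := by rw [hmem₂, length_execWords, hl₁]; rfl
      have ha : wrap I.w (mem₂.getD a.2 0) = wrap I.w (u.getD I.i 0) := by
        rw [hval, hmem₂, execWords_singleton, List.getD_append _ _ _ _
          (by rw [hl₁]; exact Src.load_lt _ _ _ (hsrc _)), hmem₁]
        have := (src I.i).load_spec I.w mem (by rw [hmem]; exact hsrc _)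
        rwa [hmem] at this
      have hb : wrap I.w (mem₂.getD b.2 0) = wrap I.w (u.getD I.j 0) := by
        have := (src I.j).load_spec I.w mem₁ (by rw [hl₁]; exact (hsrc _).mono (Nat.le_succ _))
        rw [hl₁] at this
        rw [hval, ← Src.val_append (mem' := [wrap a.1.w (a.1.op.eval (wrap a.1.w
          (mem.getD a.1.i 0)) (wrap a.1.w (mem.getD a.1.j 0)))]) (by rw [hmem]; exact hsrc _)]
        exact this
      set v := wrap I.w (I.op.eval (wrap I.w (u.getD I.i 0)) (wrap I.w (u.getD I.j 0))) with hv
      have hJ : execWords [J] mem₂ = mem₂ ++ [v] := by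
        rw [execWords_singleton]
        simp only [J, ha, hb, hv]
      have := h (u ++ [v]) (mem₂ ++ [v]) (by simp [hu]) (by simp [hl₂]) (fun i => ?_) i
      · change (execWords prog (u ++ [v])).getD i 0 = _
        rw [this]
        change _ = (src' i).val (execWords prog' (execWords [J] mem₂))
        rw [hJ]
      · by_cases hi : i = len
        · subst hi
          rw [Function.update_self, List.getD_append_right _ _ _ _ hu.le]
          simp [Src.val, hu, hl₂]
        · have hu' : (u ++ [v]).getD i 0 = u.getD i 0 := by
            rcases lt_or_gt_of_ne hi with hi | hi
            · exact List.getD_append _ _ _ _ (by omega)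
            · rw [List.getD_eq_default _ _ (by simp; omega), List.getD_eq_default _ _ (by omega)]
          rw [Function.update_of_ne hi, hu', hval, hmem₂, hmem₁, execWords_singleton,
            execWords_singleton, List.append_assoc, List.append_assoc,
            Src.val_append (by rw [hmem]; exact hsrc _)]

theorem wrap_two_emod (z : ℤ) : wrap 2 z % 2 = z % 2 := by
  have h : wrap 2 z ≡ z [ZMOD 4] := by
    unfold wrap
    exact Int.bmod_emod
  exact h.of_dvd (by norm_num)

theorem execWords_getD (p : List WordInstr) {mem : List ℤ} {t : ℕ} (ht : t < mem.length) :
    (execWords p mem).getD t 0 = mem.getD t 0 := by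
  induction p generalizing mem with
  | nil => rfl
  | cons I p ih =>
    rw [execWords, ih (by simp; omega), List.getD_append _ _ _ _ ht]

/-- The program that loads the parities of sources. -/
theorem exists_loaded {k : ℕ} (n : ℕ) (src : Fin k → Src) (hsrc : ∀ t, (src t).Below n) :
    ∃ (prog : List WordInstr) (wire : Fin k → ℕ), costWords prog ≤ 3 * k ∧
      ∀ mem : List ℤ, mem.length = n →
        ∀ t, (execWords prog mem).getD (wire t) 0 % 2 = (src t).val mem % 2 := by
  induction k generalizing n with
  | zero => exact ⟨[], Fin.elim0, le_rfl, fun _ _ t => t.elim0⟩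
  | succ k ih =>
    obtain ⟨prog, wire, hcost, h⟩ := ih (n + 1) (fun t => src t.succ)
      fun t => (hsrc _).mono (Nat.le_succ _)
    -- Qubits depend on parities only, so words of two bits suffice, at cost `3` for each load.
    refine ⟨((src 0).load 2 n).1 :: prog, Fin.cons ((src 0).load 2 n).2 wire, ?_,
      fun mem hmem t => ?_⟩
    · have := (src 0).load_w 2 n
      simp only [costWords, List.map_cons, List.sum_cons] at hcost ⊢
      omega
    · set mem₁ := execWords [((src 0).load 2 n).1] mem with hmem₁
      have hl₁ : mem₁.length = n + 1 := by rw [hmem₁, length_execWords, hmem]; rfl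
      change (execWords prog mem₁).getD _ 0 % 2 = _
      refine Fin.cases ?_ (fun t => ?_) t
      · rw [Fin.cons_zero, execWords_getD _ (by rw [hl₁]; exact Src.load_lt _ _ _ (hsrc _)),
          ← wrap_two_emod, ← wrap_two_emod ((src 0).val mem)]
        have := (src 0).load_spec 2 mem (by rw [hmem]; exact hsrc _)
        rw [hmem] at this
        rw [hmem₁, this]
      · rw [Fin.cons_succ, h mem₁ hl₁, hmem₁, execWords_singleton,
          Src.val_append (by rw [hmem]; exact hsrc _)]

/-! ### Distinguishers and functions applied to computed values -/

variable {X : Type} {E : Enc X} {S : Set (X → ℤ)} {k : ℕ}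

theorem costWords_append (p q : List WordInstr) :
    costWords (p ++ q) = costWords p + costWords q := by
  simp [costWords]

theorem costWords_le {prog : List WordInstr} (h : ∀ I ∈ prog, I.w = E.W) (hk : prog.length ≤ k) :
    costWords prog ≤ k * (E.W + 1) := by
  refine le_trans ?_ (Nat.mul_le_mul_right _ hk)
  have := List.sum_le_card_nsmul (prog.map fun I => I.w + 1) (E.W + 1) fun c hc => by
    obtain ⟨I, hI, rfl⟩ := List.mem_map.1 hc
    rw [h I hI]
  simpa [costWords] using this

/-- A distinguisher for values that are computed from the input. -/
theorem Gen.relocate (hG : Gen E k S) (D : Distinguisher) (y : X → List ℤ) (len : ℕ)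
    (hy : ∀ x, (y x).length = len)
    (hcell : ∀ i < len, (fun x => (y x).getD i 0) ∈ S ∨ ∃ z, ∀ x, (y x).getD i 0 = z) :
    ∃ D' : Distinguisher, D'.cost ≤ k * (E.W + 1) + 4 * D.cost ∧
      ∀ x, D'.prob (E.inp x) = D.prob (y x) := by
  obtain ⟨prog, h1, h2, h3⟩ := hG
  have hex : ∀ i, ∃ r : Src, r.Below (E.len + prog.length) ∧
      ∀ x, (y x).getD i 0 = r.val (execWords prog (E.inp x)) := by
    intro i
    by_cases hi : i < len
    · rcases hcell i hi with h | ⟨z, hz⟩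
      · obtain ⟨t, ht, h⟩ := h3 _ h
        exact ⟨.cell t, ht, fun x => (h x).symm⟩
      · exact ⟨.const z, trivial, hz⟩
    · exact ⟨.const 0, trivial, fun x => List.getD_eq_default _ _ (by rw [hy]; omega)⟩
  choose src hsrc hval using hex
  obtain ⟨prog', src', hcost', hsrc', h'⟩ := exists_relocated D.prog len _ src hsrc
  obtain ⟨prog'', wire, hcost'', h''⟩ := exists_loaded (E.len + prog.length + prog'.length)
    (fun t => src' (D.wire t)) fun t => hsrc' _
  -- In addition to the computation of the values, there are three times the cost of the program of
  -- `D`, a load of cost `3` for each qubit, and the qubits and gates themselves: at most `4 *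
  -- D.cost` together.
  refine ⟨⟨prog ++ (prog' ++ prog''), D.k, wire, D.gates⟩, ?_, fun x => ?_⟩
  · have := costWords_le h2 h1
    simp only [Distinguisher.cost, costWords_append]
    omega
  · have hpar : ∀ t, (execWords (prog ++ (prog' ++ prog'')) (E.inp x)).getD (wire t) 0 % 2 =
        (execWords D.prog (y x)).getD (D.wire t) 0 % 2 := fun t => by
      have hl : (execWords prog (E.inp x)).length = E.len + prog.length := by
        rw [length_execWords, E.length_inp]
      rw [execWords_append, execWords_append, h'' _ (by rw [length_execWords, hl]),
        h' (y x) _ (hy x) hl (fun i => hval i x)]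
    simp only [Distinguisher.prob, Distinguisher.state, hpar]

/-- The function that computes a list of values. -/
theorem Gen.wordFn (hG : Gen E k S) {len : ℕ} (y : X → List ℤ) (hy : ListAv (· ∈ S) y)
    (hlen : ∀ x, (y x).length = len) [Nonempty X] :
    ∃ f : WordFn, f.cost ≤ k * (E.W + 1) + len ∧ ∀ x, f.eval (E.inp x) = y x := by
  obtain ⟨prog, h1, h2, h3⟩ := hG
  obtain ⟨ls, hls, hy⟩ := hy
  have hex : ∀ v ∈ ls, ∃ t, ∀ x, (execWords prog (E.inp x)).getD t 0 = v x := fun v hv =>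
    (h3 v (hls v hv)).imp fun t h => h.2
  choose! out hout using hex
  refine ⟨⟨prog, ls.map out⟩, ?_, fun x => ?_⟩
  · obtain ⟨x⟩ := ‹Nonempty X›
    have := costWords_le h2 h1
    have hl := hlen x
    rw [hy, List.length_map] at hl
    simp only [WordFn.cost, List.length_map]
    omega
  · rw [hy, WordFn.eval, List.map_map]
    exact List.map_congr_left fun v hv => hout v hv x

theorem Enc.gen (E : Enc X) :
    Gen E 0 {v | ∃ t < E.len, v = fun x => (E.inp x).getD t 0} := by
  refine ⟨[], le_rfl, fun I hI => absurd hI List.not_mem_nil, ?_⟩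
  rintro _ ⟨t, ht, rfl⟩
  exact ⟨t, by simpa using ht, fun _ => rfl⟩

/-! ## The size of the protocol -/

section Size

variable {P : Params} (T : Training P)

/-- The parameter that determines the word lengths. -/
def Training.kappa : ℕ := T.size + 64

theorem Training.lt_two_pow_kappa {m : ℕ} (h : Nat.size m ≤ T.kappa) : m < 2 ^ T.kappa :=
  (Nat.lt_size_self m).trans_le (Nat.pow_le_pow_right (by norm_num) h)

/-- The contribution of an instruction to the size. -/
def Instr.weight {d : ℕ} : Instr P d → ℕ
  | .boot _ _ B => 1 + Nat.size B
  | _ => 1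

theorem Training.size_eq : T.size =
    T.N + P.n + P.L + Nat.size P.QL + Nat.size P.base + P.prec + T.d + T.nW + T.m + T.lam +
      Nat.size T.B + ∑ k, ∑ i, ((T.lgd k i).map Instr.weight).sum := by
  unfold Training.size
  congr 1
  refine Finset.sum_congr rfl fun k _ => Finset.sum_congr rfl fun i _ => ?_
  congr 2
  funext I
  cases I <;> rfl

theorem weight_le_sum (k : Fin T.m) (i : Fin T.N) (I : Instr P T.d) (hI : I ∈ T.lgd k i) :
    I.weight ≤ ((T.lgd k i).map Instr.weight).sum :=
  List.single_le_sum (fun _ _ => Nat.zero_le _) _ (List.mem_map_of_mem hI)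

theorem length_lgd_le (k : Fin T.m) (i : Fin T.N) :
    (T.lgd k i).length ≤ ((T.lgd k i).map Instr.weight).sum := by
  generalize T.lgd k i = l
  induction l with
  | nil => simp
  | cons I l ih =>
    have : 1 ≤ I.weight := by cases I <;> simp only [Instr.weight] <;> omega
    simp only [List.map_cons, List.sum_cons, List.length_cons]
    omega

theorem sum_lgd_le (k : Fin T.m) (i : Fin T.N) :
    ((T.lgd k i).map Instr.weight).sum + (T.N + P.n + P.L + Nat.size P.QL + Nat.size P.base +
      P.prec + T.d + T.nW + T.m + T.lam + Nat.size T.B) ≤ T.size := by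
  have h1 := Finset.single_le_sum (f := fun i => ((T.lgd k i).map Instr.weight).sum)
    (fun _ _ => Nat.zero_le _) (Finset.mem_univ i)
  have h2 := Finset.single_le_sum (f := fun k => ∑ i, ((T.lgd k i).map Instr.weight).sum)
    (fun _ _ => Nat.zero_le _) (Finset.mem_univ k)
  rw [Training.size_eq]
  omega

theorem Training.fits {X : Type} (E : Enc X) (hE : E.κ = T.kappa) : T.Fits E := by
  have hbd : ∀ m : ℕ, Nat.size m ≤ T.kappa → (m : ℤ) ≤ E.bd 1 := fun m h => by
    rw [Enc.bd, mul_one, hE]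
    exact_mod_cast (T.lt_two_pow_kappa h).le
  have hsz : T.N + P.n + P.L + Nat.size P.QL + Nat.size P.base + P.prec + T.d + T.nW +
      T.m + T.lam + Nat.size T.B ≤ T.size := Nat.le_add_right _ _
  have hκ : T.kappa = T.size + 64 := rfl
  refine ⟨⟨by omega, ?_, hbd _ (by omega), hbd _ (by omega), ?_⟩, by omega, by omega, by omega,
    fun k i => ?_⟩
  · have h1 : P.digits ≤ Nat.size P.QL := by
      refine (Nat.clog_le_iff_le_pow P.two_le_base).2 ?_
      exact (Nat.lt_size_self _).le.trans (Nat.pow_le_pow_left P.two_le_base _)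
    omega
  · rw [Enc.bd, mul_one]
    exact pow_le_pow_right₀ (by norm_num) (by omega)
  · have h1 := length_lgd_le T k i
    have h2 := sum_lgd_le T k i
    omega

theorem boot_bound_le {b : ℕ} (h : Nat.size b + T.lam ≤ T.kappa) : b * 2 ^ T.lam ≤ 2 ^ T.kappa := by
  calc b * 2 ^ T.lam ≤ 2 ^ Nat.size b * 2 ^ T.lam :=
        Nat.mul_le_mul_right _ (Nat.lt_size_self b).le
    _ = 2 ^ (Nat.size b + T.lam) := (pow_add _ _ _).symm
    _ ≤ _ := Nat.pow_le_pow_right (by norm_num) h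

/-- Uniform values are bounded by `2 ^ κ`. -/
def Node.Fits (κ : ℕ) : Node → Prop
  | .coin (.unif B) => B ≤ 2 ^ κ
  | _ => True

theorem forall_mem_flatten_ofFn {γ : Type} {p : γ → Prop} {k : ℕ} {f : Fin k → List γ}
    (h : ∀ i, ∀ a ∈ f i, p a) : ∀ a ∈ (List.ofFn f).flatten, p a := by
  intro a ha
  obtain ⟨l, hl, ha⟩ := List.mem_flatten.1 ha
  obtain ⟨i, rfl⟩ := List.mem_ofFn.1 hl
  exact h i a ha

variable (A : Finset (Fin T.N))

theorem fits_rerNodes (κ : ℕ) (i : Fin T.N) : ∀ ν ∈ rerNodes A i, ν.Fits κ := by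
  intro ν hν
  unfold rerNodes at hν
  split_ifs at hν <;> simp at hν
  · rcases hν with rfl | rfl | rfl <;> trivial
  · subst hν
    trivial

theorem fits_coinNodes {N κ : ℕ} {k : Kind} (h : (Node.coin k).Fits κ) :
    ∀ ν ∈ coinNodes N k, ν.Fits κ :=
  forall_mem_flatten_ofFn fun i ν hν => by
    rw [List.mem_singleton.1 hν]
    exact h

theorem fits_bootNodes (i : Fin T.N) {B : ℕ} (h : Nat.size B + T.lam ≤ T.kappa) :
    ∀ ν ∈ bootNodes A T.lam i B, ν.Fits T.kappa := by
  unfold bootNodes refreshNodes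
  simp only [List.forall_mem_append]
  refine ⟨fits_rerNodes T A _ i, fits_coinNodes (boot_bound_le T h), fits_coinNodes trivial,
    fits_coinNodes trivial, fun ν hν => ?_⟩
  rw [List.mem_singleton.1 hν]
  trivial

theorem fits_totalNodes : ∀ ν ∈ totalNodes T A, ν.Fits T.kappa := by
  have hswitch : ∀ ν ∈ switchNodes P, ν.Fits T.kappa := forall_mem_flatten_ofFn fun i ν hν => by
    rw [List.mem_singleton.1 hν]
    trivial
  have hrer := fits_rerNodes T A T.kappa
  unfold totalNodes keyNodes mainNodes
  simp only [List.forall_mem_append]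
  refine ⟨⟨⟨fun ν hν => ?_, fits_coinNodes trivial⟩, hswitch,
    forall_mem_flatten_ofFn fun _ => hswitch⟩, forall_mem_flatten_ofFn fun _ => hrer _, ?_⟩
  · rw [List.mem_singleton.1 hν]
    trivial
  intro ν hν
  obtain ⟨l, hl, hν'⟩ := List.mem_flatten.1 hν
  clear hν
  obtain ⟨k, -, rfl⟩ := List.mem_map.1 hl
  revert ν
  unfold iterationNodes localNodes
  simp only [List.forall_mem_append]
  refine ⟨forall_mem_flatten_ofFn fun _ => hrer _, forall_mem_flatten_ofFn fun i => ?_,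
    forall_mem_flatten_ofFn fun _ => fits_bootNodes T A _ ?_⟩
  · rw [List.forall_mem_append]
    refine ⟨fun ν hν => ?_, forall_mem_flatten_ofFn fun _ => hrer _⟩
    obtain ⟨l, hl, hν⟩ := List.mem_flatten.1 hν
    obtain ⟨I, hI, rfl⟩ := List.mem_map.1 hl
    have h1 := weight_le_sum T k i I hI
    have h2 := sum_lgd_le T k i
    have h3 : T.kappa = T.size + 64 := rfl
    cases I with
    | boot a Φ B =>
      simp only [Instr.weight] at h1
      exact fits_bootNodes T A i (by omega) ν hν
    | _ => simp [stepNodes] at hν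
  · have : T.N + P.n + P.L + Nat.size P.QL + Nat.size P.base + P.prec + T.d + T.nW +
      T.m + T.lam + Nat.size T.B ≤ T.size := Nat.le_add_right _ _
    have h3 : T.kappa = T.size + 64 := rfl
    omega

theorem length_flatten_ofFn_le {γ : Type} {k c : ℕ} {f : Fin k → List γ}
    (h : ∀ i, (f i).length ≤ c) : (List.ofFn f).flatten.length ≤ k * c := by
  induction k with
  | zero => simp
  | succ k ih =>
    rw [List.ofFn_succ, List.flatten_cons, List.length_append, Nat.succ_mul]
    have := ih fun i => h i.succ
    have := h 0
    omega

theorem length_flatten_map_le {γ δ : Type} {c : ℕ} {f : δ → List γ} (l : List δ)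
    (h : ∀ a ∈ l, (f a).length ≤ c) : (l.map f).flatten.length ≤ l.length * c := by
  induction l with
  | nil => simp
  | cons a l ih =>
    rw [List.map_cons, List.flatten_cons, List.length_append, List.length_cons, Nat.succ_mul]
    have := ih fun b hb => h b (List.mem_cons_of_mem _ hb)
    have := h a (by simp)
    omega

theorem length_rerNodes_le {N : ℕ} (A : Finset (Fin N)) (i : Fin N) :
    (rerNodes A i).length ≤ 3 := by
  unfold rerNodes
  split_ifs <;> simp

theorem length_coinNodes_le (N : ℕ) (k : Kind) : (coinNodes N k).length ≤ N * 1 :=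
  length_flatten_ofFn_le fun _ => le_rfl

theorem length_bootNodes_le {N : ℕ} (A : Finset (Fin N)) (lam : ℕ) (i : Fin N) (B : ℕ) :
    (bootNodes A lam i B).length ≤ 3 * N + 4 := by
  have h1 := length_rerNodes_le A i
  have h2 := length_coinNodes_le N
  unfold bootNodes refreshNodes
  simp only [List.length_append, List.length_singleton]
  have := h2 (.unif (B * 2 ^ lam))
  have := h2 .err
  omega

/-- The dominant contribution, iterations times parties times instructions times the operations of a
bootstrapping, is of order `κ ^ 4`; the exponent is generous. -/
theorem length_totalNodes_le : (totalNodes T A).length ≤ T.kappa ^ 8 := by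
  have h3 : T.kappa = T.size + 64 := rfl
  have hsz : T.N + P.n + P.L + Nat.size P.QL + Nat.size P.base + P.prec + T.d + T.nW +
      T.m + T.lam + Nat.size T.B ≤ T.size := Nat.le_add_right _ _
  have hd : P.digits ≤ T.kappa := by
    have h1 : P.digits ≤ Nat.size P.QL := by
      refine (Nat.clog_le_iff_le_pow P.two_le_base).2 ?_
      exact (Nat.lt_size_self _).le.trans (Nat.pow_le_pow_left P.two_le_base _)
    omega
  have hl : ∀ k i, (T.lgd k i).length ≤ T.kappa := fun k i => by
    have h1 := length_lgd_le T k i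
    have h2 := sum_lgd_le T k i
    omega
  have hsl : P.slots ≤ T.kappa := P.slots_le.trans (by omega)
  have hN : T.N ≤ T.kappa := by omega
  have hm : T.m ≤ T.kappa := by omega
  have hW : T.nW ≤ T.kappa := by omega
  have h64 : 64 ≤ T.kappa := by omega
  set κ := T.kappa
  clear_value κ
  have hsw : (switchNodes P).length ≤ P.digits * 1 := length_flatten_ofFn_le fun _ => le_rfl
  have hkey : (keyNodes P T.N).length ≤ 1 + κ + (κ + κ * κ) := by
    unfold keyNodes
    simp only [List.length_append, List.length_singleton]
    have h1 := length_coinNodes_le T.N .err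
    have h2 : (List.ofFn fun _ : Fin P.slots => switchNodes P).flatten.length ≤ P.slots * κ :=
      length_flatten_ofFn_le fun _ => by omega
    have h3 := Nat.mul_le_mul_right κ hsl
    omega
  have hboot : ∀ i B, (bootNodes A T.lam i B).length ≤ 4 * κ := fun i B => by
    have := length_bootNodes_le A T.lam i B
    omega
  have hrer : ∀ i, (List.ofFn fun _ : Fin T.nW => rerNodes A i).flatten.length ≤ κ * κ := fun i =>
    (length_flatten_ofFn_le (c := κ) fun _ => (length_rerNodes_le A i).trans (by omega)).trans
      (Nat.mul_le_mul_right _ hW)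
  have hiter : ∀ k, (iterationNodes T A k).length ≤
      κ * κ + (κ * (κ * (4 * κ) + κ * κ) + κ * (4 * κ)) := fun k => by
    unfold iterationNodes
    simp only [List.length_append]
    refine Nat.add_le_add (hrer _) (Nat.add_le_add ?_ ?_)
    · refine (length_flatten_ofFn_le (c := κ * (4 * κ) + κ * κ) fun i => ?_).trans
        (Nat.mul_le_mul_right _ hN)
      rw [List.length_append]
      refine Nat.add_le_add ?_ (hrer i)
      refine (length_flatten_map_le (c := 4 * κ) _ fun I _ => ?_).trans
        (Nat.mul_le_mul_right _ (hl k i))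
      cases I with
      | boot a Φ B => exact hboot _ _
      | _ => simp [stepNodes]
    · exact (length_flatten_ofFn_le (c := 4 * κ) fun _ => hboot _ _).trans
        (Nat.mul_le_mul_right _ hW)
  have hmain : (mainNodes T A).length ≤ κ * κ + κ * (κ * κ +
      (κ * (κ * (4 * κ) + κ * κ) + κ * (4 * κ))) := by
    unfold mainNodes
    simp only [List.length_append]
    refine Nat.add_le_add (hrer _) ?_
    refine (length_flatten_map_le _ fun k _ => hiter k).trans (Nat.mul_le_mul_right _ ?_)
    rwa [List.length_finRange]
  have htot : (totalNodes T A).length ≤ 1 + κ + (κ + κ * κ) +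
      (κ * κ + κ * (κ * κ + (κ * (κ * (4 * κ) + κ * κ) + κ * (4 * κ)))) := by
    unfold totalNodes
    rw [List.length_append]
    exact Nat.add_le_add hkey hmain
  refine htot.trans ?_
  have e1 : 1 ≤ κ ^ 4 := Nat.one_le_pow _ _ (by omega)
  have e2 : κ ≤ κ ^ 4 := Nat.le_self_pow (by norm_num) κ
  have e3 : κ ^ 2 ≤ κ ^ 4 := Nat.pow_le_pow_right (by omega) (by norm_num)
  have e4 : κ ^ 3 ≤ κ ^ 4 := Nat.pow_le_pow_right (by omega) (by norm_num)
  have e5 : 64 * κ ^ 4 ≤ κ ^ 5 := by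
    rw [pow_succ _ 4, mul_comm]
    exact Nat.mul_le_mul_left _ h64
  have e6 : κ ^ 5 ≤ κ ^ 8 := Nat.pow_le_pow_right (by omega) (by norm_num)
  calc _ = 1 + 2 * κ + 2 * κ ^ 2 + 5 * κ ^ 3 + 5 * κ ^ 4 := by ring
    _ ≤ 64 * κ ^ 4 := by omega
    _ ≤ _ := e5.trans e6

end Size

/-! ### Bounded random values -/

section Small

variable {P : Params} {κ : ℕ}

/-- The coefficients are bounded by `2 ^ κ`. -/
def SmallV (κ : ℕ) {n : ℕ} (v : Vec n) : Prop := ∀ j, |v j| ≤ 2 ^ κ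

def Item.Small (κ : ℕ) (t : Item P) : Prop := SmallV κ t.v0 ∧ SmallV κ t.v1 ∧ SmallV κ t.v2

def INode.Fits (κ : ℕ) : INode → Prop
  | .coin (.unif B) => B ≤ 2 ^ κ
  | _ => True

theorem SmallV.zero {n : ℕ} : SmallV κ (0 : Vec n) := fun j => by simp

theorem smallV_of_nonneg {n Q : ℕ} {v : Vec n} (hQ : Q ≤ 2 ^ κ) (h : ∀ j, 0 ≤ v j ∧ v j ≤ Q) :
    SmallV κ v := fun j => by
  rw [abs_of_nonneg (h j).1]
  exact (h j).2.trans (by exact_mod_cast hQ)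

theorem two_pow_le {κ : ℕ} (hκ : 64 ≤ κ) {z : ℤ} (hz : z ≤ 64) : z ≤ 2 ^ κ :=
  hz.trans (le_trans (by norm_num) (pow_le_pow_right₀ (by norm_num : (1 : ℤ) ≤ 2)
    (le_trans (by norm_num : 6 ≤ 64) hκ)))

theorem smallV_of_mem_support {k : Kind} (hκ : 64 ≤ κ) (hk : (INode.coin k).Fits κ) {v : P.Poly}
    (h : v ∈ (k.poly P).support) : SmallV κ v := fun j => by
  have hj : v j ∈ k.dist.support := mem_support_seqFin h j
  cases k with
  | tern => exact two_pow_le hκ ((mem_support_ternary hj).trans (by norm_num))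
  | err => exact two_pow_le hκ ((mem_support_gaussErr hj).trans (by norm_num))
  | unif B =>
    have h1 := mem_support_unif hj
    rw [abs_of_nonneg h1.1]
    exact h1.2.trans (by exact_mod_cast hk)

theorem INode.small_of_mem_support (hκ : 64 ≤ κ) (hQ : P.QL ≤ 2 ^ κ) {ν : INode} (hν : ν.Fits κ)
    {t : Item P} (h : t ∈ (ν.dist P).support) : t.Small κ := by
  have hpair : ∀ m, t ∈ ((((Kind.unif P.QL).poly P).bind fun b0 =>
      ((Kind.unif P.QL).poly P).map fun b1 => (⟨m, b0, b1, 0⟩ : Item P)).support) → t.Small κ := by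
    intro m h
    obtain ⟨b0, h0, h⟩ := (PMF.mem_support_bind_iff _ _ _).1 h
    obtain ⟨b1, h1, rfl⟩ := (PMF.mem_support_map_iff _ _ _).1 h
    exact ⟨smallV_of_mem_support (k := .unif _) hκ hQ h0,
      smallV_of_mem_support (k := .unif _) hκ hQ h1, .zero⟩
  cases ν with
  | coin k =>
    obtain ⟨v, hv, rfl⟩ := (PMF.mem_support_map_iff _ _ _).1 h
    exact ⟨smallV_of_mem_support hκ hν hv, .zero, .zero⟩
  | rer m =>
    cases m with
    | real =>
      obtain ⟨u, hu, h⟩ := (PMF.mem_support_bind_iff _ _ _).1 h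
      obtain ⟨e0, h0, h⟩ := (PMF.mem_support_bind_iff _ _ _).1 h
      obtain ⟨e1, h1, rfl⟩ := (PMF.mem_support_map_iff _ _ _).1 h
      exact ⟨smallV_of_mem_support (k := .tern) hκ trivial hu,
        smallV_of_mem_support (k := .err) hκ trivial h0,
        smallV_of_mem_support (k := .err) hκ trivial h1⟩
    | shift => exact hpair _ h
    | ideal => exact hpair _ h

theorem small_of_mem_support_itemsDist (hκ : 64 ≤ κ) (hQ : P.QL ≤ 2 ^ κ) {ns : List INode}
    (hns : ∀ ν ∈ ns, ν.Fits κ) {r : List (Item P)} (h : r ∈ (itemsDist P ns).support) :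
    r.length = ns.length ∧ ∀ t ∈ r, t.Small κ := by
  induction ns generalizing r with
  | nil =>
    obtain rfl : r = [] := (PMF.mem_support_pure_iff _ _).1 h
    simp
  | cons ν ns ih =>
    obtain ⟨t, ht, h⟩ := (PMF.mem_support_bind_iff _ _ _).1 h
    obtain ⟨r, hr, rfl⟩ := (PMF.mem_support_map_iff _ _ _).1 h
    obtain ⟨h1, h2⟩ := ih (fun ν hν => hns ν (List.mem_cons_of_mem _ hν)) hr
    refine ⟨by simp [h1], fun t' ht' => ?_⟩
    rcases List.mem_cons.1 ht' with rfl | ht'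
    · exact INode.small_of_mem_support hκ hQ (hns ν (by simp)) ht
    · exact h2 t' ht'

theorem fits_itemNodes {ns : List Node} (h : ∀ ν ∈ ns, ν.Fits κ) :
    ∀ ν ∈ itemNodes ns, ν.Fits κ := by
  induction ns with
  | nil => simp [itemNodes]
  | cons ν ns ih =>
    have h1 := ih fun ν hν => h ν (List.mem_cons_of_mem _ hν)
    have h2 := h ν (by simp)
    cases ν with
    | coin k =>
      simp only [itemNodes, List.forall_mem_cons]
      refine ⟨?_, h1⟩
      cases k <;> exact h2
    | query => exact h1
    | rer =>
      simp only [itemNodes, List.forall_mem_cons]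
      exact ⟨trivial, h1⟩

theorem length_itemNodes_add_queries (ns : List Node) :
    (itemNodes ns).length + queries ns = ns.length := by
  induction ns with
  | nil => rfl
  | cons ν ns ih =>
    cases ν <;> simp only [itemNodes, queries, List.length_cons] <;> omega

end Small

/-! ## Differences of probabilities -/

/-- `a` and `b` differ by at most `ε`. -/
def Near (ε a b : ℝ≥0∞) : Prop := a ≤ b + ε ∧ b ≤ a + ε

section Near

variable {α : Type} {ε ε' a b c : ℝ≥0∞}

theorem Near.refl (ε a : ℝ≥0∞) : Near ε a a := ⟨le_self_add, le_self_add⟩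

theorem Near.mono (h : Near ε a b) (hε : ε ≤ ε') : Near ε' a b :=
  ⟨h.1.trans (by gcongr), h.2.trans (by gcongr)⟩

theorem Near.trans (h : Near ε a b) (h' : Near ε' b c) : Near (ε + ε') a c := by
  refine ⟨h.1.trans ?_, h'.2.trans ?_⟩
  · rw [add_comm ε, ← add_assoc]
    exact add_le_add_left h'.1 _
  · rw [← add_assoc]
    exact add_le_add_left h.2 _

theorem Near.ex {μ : PMF α} {F G : α → ℝ≥0∞} (h : ∀ a ∈ μ.support, Near ε (F a) (G a)) :
    Near ε (ex μ F) (ex μ G) :=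
  ⟨ex_le_add fun a ha => (h a ha).1, ex_le_add fun a ha => (h a ha).2⟩

/-- The advantage that the security level allows to an adversary of cost `1`. -/
def tick (lam : ℕ) : ℝ≥0∞ := (2 ^ lam)⁻¹

theorem ofReal_div_two_pow (m lam : ℕ) : ENNReal.ofReal ((m : ℝ) / 2 ^ lam) = m * tick lam := by
  rw [ENNReal.ofReal_div_of_pos (by positivity), ENNReal.ofReal_natCast, div_eq_mul_inv, tick,
    ENNReal.ofReal_pow (by norm_num), ENNReal.ofReal_ofNat]

theorem Distinguisher.adv_le_iff_near (D : Distinguisher) (μ ν : PMF (List ℤ)) (m lam : ℕ) :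
    D.adv μ ν ≤ (m : ℝ) / 2 ^ lam ↔ Near (m * tick lam) (Poseidon.ex μ D.pr)
      (Poseidon.ex ν D.pr) := by
  rw [D.adv_le_iff μ ν (by positivity), ofReal_div_two_pow]
  rfl

end Near

/-! ### Available constants and inputs -/

section Constants

variable {X γ : Type} {E : Enc X} {S : Set (X → ℤ)} {P : Params} {n : ℕ}

theorem Enc.bd_one (E : Enc X) : E.bd 1 = 2 ^ E.κ := by rw [Enc.bd, mul_one]

theorem Has.zero : Has E S (E.κ ^ 0) fun S => (fun _ => 0) ∈ S :=
  Has.weaken HasE.zero le_rfl fun _ _ h => h.1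

theorem Has.list {A : Set (X → ℤ) → (X → γ) → Prop} (hA : ∀ f, Inherited fun S => A S f) {a c : ℕ}
    (ls : List (X → γ)) (hl : ls.length ≤ E.κ ^ c)
    (h : ∀ f ∈ ls, Has E S (E.κ ^ a) fun S => A S f) :
    Has E S (E.κ ^ (a + c)) fun S => ∀ f ∈ ls, A S f := by
  refine (Has.fin (Q := fun (i : Fin ls.length) S => A S ls[i])
    (fun i => h _ (List.getElem_mem i.2)) fun i => hA _).weaken ?_ fun S _ h f hf => ?_
  · rw [pow_add, mul_comm]
    exact Nat.mul_le_mul_left _ hl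
  · obtain ⟨i, hi, rfl⟩ := List.getElem_of_mem hf
    exact h ⟨i, hi⟩

theorem Has.constList {A : Set (X → ℤ) → (X → γ) → Prop} (hA : ∀ f, Inherited fun S => A S f)
    {a c : ℕ} (l : List γ) (hl : l.length ≤ E.κ ^ c)
    (h : ∀ z ∈ l, Has E S (E.κ ^ a) fun S => A S fun _ => z) :
    Has E S (E.κ ^ (a + c)) fun S => ListAv (A S) fun _ => l := by
  refine (Has.list hA (l.map fun z _ => z) (by rwa [List.length_map]) fun f hf => ?_).weaken le_rfl
    fun S _ h => ⟨_, h, fun x => by simp [Function.comp_def]⟩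
  obtain ⟨z, hz, rfl⟩ := List.mem_map.1 hf
  exact h z hz

/-- Adversaries are non-uniform, so whatever a reduction keeps fixed is hard-wired, provided that it
fits into words. -/
theorem Has.constV (hn : n ≤ E.κ) {v : Vec n} (hv : SmallV E.κ v) :
    Has E S (E.κ ^ 1) fun S => AvV E S 1 fun _ => v :=
  (HasV.const v (fun j => by rw [E.bd_one]; exact hv j) (by norm_num)).save hn

theorem Has.constPair (hP : Fits P E) {p : P.Poly × P.Poly} (h1 : SmallV E.κ p.1)
    (h2 : SmallV E.κ p.2) : Has E S (E.κ ^ 2) fun S => PairAv E S fun _ => p :=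
  Has.andE _ (Has.constV hP.n_le h1) (Has.constV hP.n_le h2) (inherited_avV _ _)
    (inherited_avV _ _) (by norm_num)

theorem Has.constItem (hP : Fits P E) {t : Item P} (h : t.Small E.κ) :
    Has E S (E.κ ^ 3) fun S => ItemAv E True S fun _ => t :=
  (Has.andE 3 (Has.constV hP.n_le h.1) (Has.andE 2 (Has.constV hP.n_le h.2.1)
    (Has.constV hP.n_le h.2.2) (inherited_avV _ _) (inherited_avV _ _) (by norm_num))
    (inherited_avV _ _) (fun _ _ hS h => ⟨h.1.mono hS, h.2.mono hS⟩) (by norm_num)).weaken le_rfl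
    fun _ _ h => ⟨t.mode, _, _, _, Or.inr trivial, h.1, h.2.1, h.2.2, rfl⟩

theorem Has.constRow (hP : Fits P E) {N : ℕ} (hN : N ≤ E.κ) {ρ : Fin N → P.Poly}
    (hρ : ∀ i, SmallV E.κ (ρ i)) : Has E S (E.κ ^ 2) fun S => AvRow E S fun _ => ρ :=
  Has.finE _ hN (fun i => Has.constV hP.n_le (hρ i)) (fun _ => inherited_avV _ _) (by norm_num)

theorem smallV_encode (hP : Fits P E) (s : ℝ) (z : P.Msg) : SmallV E.κ (P.encode s z) := fun j => by
  rw [← E.bd_one]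
  refine le_trans ?_ hP.QL_le
  unfold Params.encode
  rw [abs_of_nonneg (red_nonneg P.QL_pos _ _)]
  exact (red_lt P.QL_pos _ _).le

/-- Inputs are complex vectors, but the protocol uses them through their encodings only, and these
are reduced modulo `Q_L`. -/
theorem Has.constInp {T : Training P} {A : Finset (Fin T.N)} (hT : T.Fits E) (hd : T.d ≤ E.κ)
    (x : T.Inputs) : Has E S (E.κ ^ 4) fun S => InpAv E S True A fun _ => x := by
  have h : ∀ z : P.Msg, Has E S (E.κ ^ 1) fun S => AvV E S 1 fun _ => P.encode P.S z := fun z =>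
    Has.constV hT.params.n_le (smallV_encode hT.params _ _)
  exact (Has.andE 4 (Has.finE 3 hT.N_le (fun i => Has.finE 2 hd
    (fun t => h ((x i).data t)) (fun _ => inherited_avV _ _) (by norm_num))
      (fun _ _ _ hS h t => (h t).mono hS) (by norm_num))
    (Has.finE 2 hT.nW_le (fun t => h ((x T.first).w0 t)) (fun _ => inherited_avV _ _) (by norm_num))
    (fun _ _ hS h i t => (h i t).mono hS) (fun _ _ hS h t => (h t).mono hS) (by norm_num)).weaken
      le_rfl fun _ _ h => ⟨fun i _ t => h.1 i t, fun _ t => h.2 t⟩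

/-- All the entries of lists are available. -/
def LAv (E : Enc X) (S : Set (X → ℤ)) (l : X → List ℤ) : Prop :=
  ∀ i, AvE E S 1 fun x => (l x).getD i 0

theorem LAv.mono {S' : Set (X → ℤ)} {l : X → List ℤ} (h : LAv E S l) (hS : S ⊆ S') :
    LAv E S' l := fun i => inherited_avE _ _ _ _ hS (h i)

theorem LAv.drop {l : X → List ℤ} (h : LAv E S l) (m : ℕ) : LAv E S fun x => (l x).drop m :=
  fun i => by
    convert h (m + i) using 2 with x
    simp [List.getD_eq_getElem?_getD]

/-- The vector of the first entries of a list. -/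
def vecOf (n : ℕ) (l : List ℤ) : Vec n := fun j => l.getD j 0

theorem LAv.vecOf {l : X → List ℤ} (h : LAv E S l) (n : ℕ) :
    AvV E S 1 fun x => Poseidon.vecOf n (l x) := fun j => h j

theorem vecOf_append (v : Vec n) (l : List ℤ) : vecOf n (List.ofFn v ++ l) = v := by
  funext j
  rw [vecOf, List.getD_append _ _ _ _ (by simp), List.getD_eq_getElem _ _ (by simp)]
  simp

theorem drop_append_ofFn (v : Vec n) (l : List ℤ) : (List.ofFn v ++ l).drop n = l := by
  simp

/-- The list of pairs at the beginning of a list. -/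
def decAns (P : Params) : ℕ → List ℤ → List (P.Poly × P.Poly)
  | 0, _ => []
  | k + 1, l => (vecOf P.n l, vecOf P.n (l.drop P.n)) :: decAns P k ((l.drop P.n).drop P.n)

theorem LAv.decAns {l : X → List ℤ} (h : LAv E S l) (k : ℕ) :
    ListAv (PairAv E S) fun x => decAns P k (l x) := by
  induction k generalizing l with
  | zero => exact .nil
  | succ k ih => exact .cons ⟨h.vecOf _, (h.drop _).vecOf _⟩ (ih ((h.drop _).drop _))

theorem decAns_flatAns (ans : List (P.Poly × P.Poly)) (l : List ℤ) :
    decAns P ans.length (flatAns ans ++ l) = ans := by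
  induction ans with
  | nil => rfl
  | cons p ans ih =>
    rw [flatAns, List.flatMap_cons, List.length_cons, decAns, List.append_assoc, List.append_assoc,
      vecOf_append, drop_append_ofFn, vecOf_append, drop_append_ofFn]
    exact congrArg _ ih

theorem length_flatAns (ans : List (P.Poly × P.Poly)) :
    (flatAns ans).length = ans.length * (P.n + P.n) := by
  induction ans with
  | nil => simp [flatAns]
  | cons p ans ih =>
    rw [flatAns, List.flatMap_cons, List.length_append, List.length_cons, Nat.succ_mul, add_comm,
      ← ih]
    simp [flatAns]

/-- The inputs are available. -/
theorem Enc.exists_gen (E : Enc X) (h : ∀ x, ∀ z ∈ E.inp x, |z| ≤ 2 ^ E.κ) :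
    ∃ S, Gen E (E.κ ^ 0) S ∧ LAv E S E.inp ∧ (fun _ => 0) ∈ S := by
  obtain ⟨S, hS, hG, h0⟩ := Has.zero (E := E)
    (S := {v | ∃ t < E.len, v = fun x => (E.inp x).getD t 0})
  refine ⟨S, ?_, fun i => ⟨?_, fun x => ?_⟩, h0⟩
  · have := hG 0 _ subset_rfl E.gen
    rw [zero_add, Set.union_eq_self_of_subset_left hS] at this
    exact this
  · by_cases hi : i < E.len
    · exact hS ⟨i, hi, rfl⟩
    · convert h0 using 2 with x
      exact List.getD_eq_default _ _ (by rw [E.length_inp]; omega)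
  · rw [E.bd_one]
    change |(E.inp x).getD i 0| ≤ _
    by_cases hi : i < (E.inp x).length
    · rw [List.getD_eq_getElem _ _ hi]
      exact h x _ (List.getElem_mem hi)
    · rw [List.getD_eq_default _ _ (by omega)]
      simp

end Constants

/-! ### Programs for the game and distinguishers for its visible values -/

section Evaluation

open Prog

variable {X : Type} {E : Enc X} {P : Params} {T : Training P} {A : Finset (Fin T.N)}
  {h : Fin T.N} {full : Prop} {S : Set (X → ℤ)} {k k' : ℕ}

/-- The visible values and the messages in the protocol are computed with few instructions. -/
theorem exists_gen_eval (hT : T.Fits E) (hG : Gen E k S) {σ : X → Ev P} {s : X → P.Poly}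
    {ρ : X → Fin T.N → P.Poly} {inp : X → T.Inputs}
    (hav : Has E S k' fun S => EvAv E full S σ ∧ AvV E S 1 s ∧ AvRow E S ρ ∧
      InpAv E S full A inp) :
    ∃ S', S ⊆ S' ∧ Gen E (k + (k' + E.κ ^ 54)) S' ∧ EvAv E full S' fun x =>
      (eval (s x) (gTotal T A h (ρ x) (inp x)) (σ x)).2 := by
  obtain ⟨S', hS, hG', hQ⟩ := hav.bind fun S₁ _ h1 =>
    Runs.gTotal (h := h) hT h1.2.1 h1.2.2.1 h1.2.2.2 S₁ subset_rfl _ h1.1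
  refine ⟨S', hS, ?_, hQ.1⟩
  have := hG' k S subset_rfl hG
  rwa [Set.union_eq_self_of_subset_left hS] at this

/-- Constants, and some values that are available, are the data of an evaluation. -/
theorem Has.evAv {items : X → List (Item P)} {ans : X → List (P.Poly × P.Poly)} {a b c : ℕ}
    (hitems : Has E S (E.κ ^ a) fun S => ListAv (ItemAv E full S) items)
    (hans : Has E S (E.κ ^ b) fun S => ListAv (PairAv E S) ans) (hc : max a b + 1 < c) :
    Has E S (E.κ ^ c) fun S => EvAv E full S fun x => ⟨items x, ans x, [], []⟩ :=
  (Has.andE c (Has.andE (max a b + 1) hitems hans (fun _ _ hS h => h.imp fun _ h => h.mono hS)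
    (fun _ _ hS h => h.imp fun _ h => h.mono hS) (Nat.lt_succ_self _)) Has.zero
    (fun _ _ hS h => ⟨h.1.imp fun _ h => h.mono hS, h.2.imp fun _ h => h.mono hS⟩)
    (fun _ _ hS h => hS h) (by omega)).weaken le_rfl
    fun _ _ h => ⟨h.1.1, h.1.2, .nil, .nil, h.2⟩

/-- A distinguisher for the visible values, given the inputs of an evaluation. -/
theorem Gen.distinguisher (hG : Gen E k S) (D : Distinguisher) (pre post : List ℤ)
    {l : X → List ℤ} (hl : ListAv (· ∈ S) l) :
    ∃ D' : Distinguisher, D'.cost ≤ k * (E.W + 1) + 4 * D.cost ∧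
      ∀ x, D'.prob (E.inp x) = D.prob (pre ++ l x ++ post) := by
  obtain ⟨ls, hls, hl⟩ := hl
  refine hG.relocate D (fun x => pre ++ l x ++ post) (pre.length + ls.length + post.length)
    (fun x => by simp [hl, add_assoc]) fun i hi => ?_
  have hlen : ∀ x, (l x).length = ls.length := fun x => by rw [hl, List.length_map]
  by_cases h1 : i < pre.length
  · refine Or.inr ⟨pre.getD i 0, fun x => ?_⟩
    rw [List.append_assoc, List.getD_append _ _ _ _ h1]
  by_cases h2 : i < pre.length + ls.length
  · refine Or.inl ?_
    have hj : i - pre.length < ls.length := by omega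
    convert hls _ (List.getElem_mem hj) using 1
    funext x
    rw [List.getD_append _ _ _ _ (by rw [List.length_append, hlen]; exact h2),
      List.getD_append_right _ _ _ _ (by omega), hl, List.getD_eq_getElem _ _ (by simpa using hj),
      List.getElem_map]
  · refine Or.inr ⟨post.getD (i - (pre.length + ls.length)) 0, fun x => ?_⟩
    rw [List.getD_append_right _ _ _ _ (by rw [List.length_append, hlen]; omega),
        List.length_append,
      hlen]

/-- An instruction on `40 κ + 1` bits costs at most `κ ^ 2`, as `κ ≥ 64`. -/
theorem Enc.cost_le (E : Enc X) {k a : ℕ} (hk : k ≤ E.κ ^ a) : k * (E.W + 1) ≤ E.κ ^ (a + 2) := by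
  have h1 := E.le_κ
  have h2 : E.W + 1 ≤ E.κ * E.κ := by
    unfold Enc.W
    nlinarith
  calc k * (E.W + 1) ≤ E.κ ^ a * (E.κ * E.κ) := Nat.mul_le_mul hk h2
    _ = _ := by ring

end Evaluation

/-! ## Replacing encryptions of key-dependent messages with uniform pairs -/

section Worlds

open Prog

variable {P : Params} {T : Training P} {A : Finset (Fin T.N)} {h : Fin T.N}

theorem Training.size_ge (T : Training P) : T.N + P.n + P.L + Nat.size P.QL + Nat.size P.base +
    P.prec + T.d + T.nW + T.m + T.lam + Nat.size T.B ≤ T.size := Nat.le_add_right _ _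

theorem Training.d_le (T : Training P) : T.d ≤ T.kappa := by
  have := T.size_ge
  have h3 : T.kappa = T.size + 64 := rfl
  omega

theorem Training.QL_le (T : Training P) : P.QL ≤ 2 ^ T.kappa := by
  refine (T.lt_two_pow_kappa ?_).le
  have := T.size_ge
  have h3 : T.kappa = T.size + 64 := rfl
  omega

/-- The common form of all the translations below: each datum of the evaluation is a stored input, a
constant, or something computed from them with at most `κ ^ 20` instructions. -/
theorem exists_gen_of_inputs {X : Type} {E : Enc X} {full : Prop} (hE : E.κ = T.kappa)
    (hinp : ∀ x, ∀ z ∈ E.inp x, |z| ≤ 2 ^ E.κ) {items : X → List (Item P)}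
    {ans : X → List (P.Poly × P.Poly)} {s : X → P.Poly} {ρ : X → Fin T.N → P.Poly}
    {inp : X → T.Inputs}
    (hav : ∀ S, LAv E S E.inp → (fun _ => 0) ∈ S →
      Has E S (E.κ ^ 20) (fun S => ListAv (ItemAv E full S) items) ∧
      Has E S (E.κ ^ 20) (fun S => ListAv (PairAv E S) ans) ∧
      Has E S (E.κ ^ 20) (fun S => AvV E S 1 s) ∧ Has E S (E.κ ^ 20) (fun S => AvRow E S ρ) ∧
      Has E S (E.κ ^ 20) fun S => InpAv E S full A inp) :
    ∃ S', LAv E S' E.inp ∧ Gen E (E.κ ^ 55) S' ∧ EvAv E full S' fun x =>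
      (eval (s x) (gTotal T A h (ρ x) (inp x)) ⟨items x, ans x, [], []⟩).2 := by
  obtain ⟨S, hG, hl, h0⟩ := E.exists_gen hinp
  obtain ⟨h1, h2, h3, h4, h5⟩ := hav S hl h0
  obtain ⟨S', hS, hG', hev⟩ := exists_gen_eval (h := h) (k' := E.κ ^ 25) (T.fits E hE) hG
    (Has.andE 25 (Has.evAv (c := 22) h1 h2 (by norm_num))
      (Has.andE 24 h3 (Has.andE 23 h4 h5 (AvRow.inherited _) (fun _ _ hS h => h.mono hS)
        (by norm_num)) (inherited_avV _ _) (fun _ _ hS h => ⟨h.1.mono hS, h.2.mono hS⟩)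
        (by norm_num)) (fun _ _ hS h => h.mono hS)
      (fun _ _ hS h => ⟨h.1.mono hS, h.2.1.mono hS, h.2.2.mono hS⟩) (by norm_num))
  refine ⟨S', hl.mono hS, hG'.mono ?_ subset_rfl, hev⟩
  have e1 := E.pow_mono (show 0 ≤ 54 by norm_num)
  have e2 := E.pow_mono (show 25 ≤ 54 by norm_num)
  have e3 : 64 * E.κ ^ 54 ≤ E.κ ^ 55 := E.mul_pow_le (by norm_num) (by norm_num)
  omega

/-- Lists of answers of a given length. -/
def AnsInput (P : Params) (j : ℕ) : Type :=
  {ans : List (P.Poly × P.Poly) // ValidAns ans ∧ ans.length = j}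

/-- Secrets and lists of answers of a given length. -/
def KdmInput (P : Params) (j : ℕ) : Type :=
  {p : P.Poly × List (P.Poly × P.Poly) // SmallV 0 p.1 ∧ ValidAns p.2 ∧ p.2.length = j}

theorem Training.le_kappa (T : Training P) : 64 ≤ T.kappa := Nat.le_add_left _ _

def ansEnc (T : Training P) (j : ℕ) : Enc (AnsInput P j) where
  inp p := flatAns p.1
  len := j * (P.n + P.n)
  length_inp p := by rw [length_flatAns, p.2.2]
  κ := T.kappa
  le_κ := T.le_kappa

def kdmEnc (T : Training P) (j : ℕ) : Enc (KdmInput P j) where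
  inp p := List.ofFn p.1.1 ++ flatAns p.1.2
  len := P.n + j * (P.n + P.n)
  length_inp p := by rw [List.length_append, List.length_ofFn, length_flatAns, p.2.2.2]
  κ := T.kappa
  le_κ := T.le_kappa

theorem ValidAns.small {ans : List (P.Poly × P.Poly)} (h : ValidAns ans) {p : P.Poly × P.Poly}
    (hp : p ∈ ans) : SmallV T.kappa p.1 ∧ SmallV T.kappa p.2 :=
  ⟨smallV_of_nonneg T.QL_le fun j => ⟨(h p hp j).1.1, (h p hp j).1.2.le⟩,
    smallV_of_nonneg T.QL_le fun j => ⟨(h p hp j).2.1, (h p hp j).2.2.le⟩⟩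

theorem ValidAns.flat_small {ans : List (P.Poly × P.Poly)} (h : ValidAns ans) :
    ∀ z ∈ flatAns ans, |z| ≤ 2 ^ T.kappa := by
  intro z hz
  obtain ⟨p, hp, hz⟩ := List.mem_flatMap.1 hz
  rcases List.mem_append.1 hz with hz | hz
  · obtain ⟨j, rfl⟩ := List.mem_ofFn.1 hz
    exact (h.small hp).1 j
  · obtain ⟨j, rfl⟩ := List.mem_ofFn.1 hz
    exact (h.small hp).2 j

theorem SmallV.mono {n κ κ' : ℕ} {v : Vec n} (h : SmallV κ v) (hκ : κ ≤ κ') : SmallV κ' v :=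
  fun j => (h j).trans (pow_le_pow_right₀ (by norm_num) hκ)

/-- The bound is `2 ^ 0 = 1`. -/
theorem smallV_ternary {v : P.Poly} (h : v ∈ P.ternaryPoly.support) : SmallV 0 v := fun j =>
  mem_support_ternary (mem_support_seqFin h j)

/-- Lists of small items. -/
structure SmallItems (T : Training P) (r : List (Item P)) : Prop where
  length_le : r.length ≤ T.kappa ^ 8
  small : ∀ t ∈ r, t.Small T.kappa

theorem SmallItems.has {X : Type} {E : Enc X} {S : Set (X → ℤ)} (hE : E.κ = T.kappa)
    {r : List (Item P)} (hr : SmallItems T r) :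
    Has E S (E.κ ^ 11) fun S => ListAv (ItemAv E True S) fun _ => r :=
  Has.constList (A := fun S f => ItemAv E True S f) (c := 8) (fun _ _ _ hS h => h.mono hS) r
    (by rw [hE]; exact hr.length_le)
    fun t ht => Has.constItem (T.fits E hE).params (by rw [hE]; exact hr.small t ht)

theorem queries_totalNodes_le : queries (totalNodes T A) ≤ T.kappa ^ 8 := by
  have := length_itemNodes_add_queries (totalNodes T A)
  have := length_totalNodes_le T A
  omega

/-- The messages of the queries, as functions of the secret and the previous answers. -/
theorem exists_gen_kdm (j : ℕ) {ρ : Fin T.N → P.Poly} (hρ : ∀ i, SmallV T.kappa (ρ i))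
    {r : List (Item P)} (hr : SmallItems T r) (x : T.Inputs) :
    ∃ S', Gen (kdmEnc T j) (T.kappa ^ 55) S' ∧ EvAv (kdmEnc T j) True S' fun p =>
      (eval p.1.1 (gTotal T A h ρ x) ⟨r, p.1.2, [], []⟩).2 := by
  have hT := T.fits (kdmEnc T j) rfl
  refine (exists_gen_of_inputs (A := A) (h := h) (full := True) (E := kdmEnc T j)
      (items := fun _ => r)
    (ans := fun p => p.1.2) (s := fun p => p.1.1) (ρ := fun _ => ρ) (inp := fun _ => x) rfl
    (fun p z hz => ?_) fun S hl h0 => ⟨?_, ?_, ?_, ?_, ?_⟩).imp fun _ h => h.2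
  · rcases List.mem_append.1 hz with hz | hz
    · obtain ⟨i, rfl⟩ := List.mem_ofFn.1 hz
      exact (p.2.1.mono (Nat.zero_le _)) i
    · exact p.2.2.1.flat_small z hz
  · exact (hr.has rfl).weaken (Enc.pow_mono _ (by norm_num)) fun _ _ h => h
  -- The answers follow the `n` coefficients of the secret in memory; parsing them is a matter of
  -- indices and costs nothing.
  · have := (hl.drop P.n).decAns (P := P) j
    refine (Has.intro (Q := fun S => ListAv (PairAv (kdmEnc T j) S) fun p => p.1.2) ?_).weaken
      (Nat.zero_le _) fun _ _ h => h
    convert this using 2 with p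
    change _ = decAns P j ((List.ofFn p.1.1 ++ flatAns p.1.2).drop P.n)
    rw [drop_append_ofFn]
    have := decAns_flatAns p.1.2 []
    rw [List.append_nil, p.2.2.2] at this
    exact this.symm
  · have := hl.vecOf P.n
    refine (Has.intro (Q := fun S => AvV (kdmEnc T j) S 1 fun p => p.1.1) ?_).weaken
      (Nat.zero_le _) fun _ _ h => h
    convert this using 2 with p
    exact (vecOf_append _ _).symm
  · exact (Has.constRow hT.params hT.N_le hρ).weaken (Enc.pow_mono _ (by norm_num)) fun _ _ h => h
  · exact (Has.constInp hT T.d_le x).weaken (Enc.pow_mono _ (by norm_num)) fun _ _ h => h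

/-- The visible values, as functions of the answers. -/
theorem exists_gen_ans (j : ℕ) {ρ : Fin T.N → P.Poly} (hρ : ∀ i, SmallV T.kappa (ρ i))
    {r : List (Item P)} (hr : SmallItems T r) (x : T.Inputs) :
    ∃ S', Gen (ansEnc T j) (T.kappa ^ 55) S' ∧ EvAv (ansEnc T j) True S' fun p =>
      (eval 0 (gTotal T A h ρ x) ⟨r, p.1, [], []⟩).2 := by
  have hT := T.fits (ansEnc T j) rfl
  refine (exists_gen_of_inputs (A := A) (h := h) (full := True) (E := ansEnc T j)
      (items := fun _ => r)
    (ans := fun p => p.1) (s := fun p => 0) (ρ := fun _ => ρ) (inp := fun _ => x) rfl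
    (fun p z hz => p.2.1.flat_small z hz) fun S hl h0 => ⟨?_, ?_, ?_, ?_, ?_⟩).imp
      fun _ h => h.2
  · exact (hr.has rfl).weaken (Enc.pow_mono _ (by norm_num)) fun _ _ h => h
  · have := hl.decAns (P := P) j
    refine (Has.intro (Q := fun S => ListAv (PairAv (ansEnc T j) S) fun p => p.1) ?_).weaken
      (Nat.zero_le _) fun _ _ h => h
    convert this using 2 with p
    have := decAns_flatAns p.1 []
    rw [List.append_nil, p.2.2] at this
    exact this.symm
  · exact (Has.constV hT.params.n_le .zero).weaken (Enc.pow_mono _ (by norm_num)) fun _ _ h => h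
  · exact (Has.constRow hT.params hT.N_le hρ).weaken (Enc.pow_mono _ (by norm_num)) fun _ _ h => h
  · exact (Has.constInp hT T.d_le x).weaken (Enc.pow_mono _ (by norm_num)) fun _ _ h => h

end Worlds

/-! ### Circular security applied to the game -/

section Kdm

open Prog

variable {P : Params} {T : Training P} {A : Finset (Fin T.N)} {h : Fin T.N} {α : Type}

/-- The secret matters for the messages of the queries only. -/
theorem Prog.eval_secret (s s' : P.Poly) (p : Prog P α) (r : List (Item P))
    (ans : List (P.Poly × P.Poly)) (l : List ℤ) (m m' : List P.Poly) :
    (p.eval s ⟨r, ans, l, m⟩).1 = (p.eval s' ⟨r, ans, l, m'⟩).1 ∧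
      (p.eval s ⟨r, ans, l, m⟩).2.log = (p.eval s' ⟨r, ans, l, m'⟩).2.log := by
  induction p generalizing r ans l m m' with
  | ret a => exact ⟨rfl, rfl⟩
  | coin κ k ih => exact ih _ _ _ _ _ _
  | query msg k ih => exact ih _ _ _ _ _ _ _
  | rer pk0 pk1 c k ih => exact ih _ _ _ _ _ _
  | emit l k ih => exact ih _ _ _ _ _

theorem getD_ofFn {n : ℕ} (v : Vec n) (j : Fin n) : (List.ofFn v).getD j 0 = v j := by
  rw [List.getD_eq_getElem _ _ (by simp)]
  simp

/-- Message `j` is determined by the secret and the `j` answers before it. Evaluating the whole game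
on these answers, with default pairs afterwards, therefore records it in position `j`. -/
theorem exists_kdm_function (j : ℕ) {ρ : Fin T.N → P.Poly} (hρ : ∀ i, SmallV T.kappa (ρ i))
    {r : List (Item P)} (hr : SmallItems T r) (x : T.Inputs) :
    ∃ f : WordFn, f.cost ≤ T.kappa ^ 58 ∧ ∀ s : P.Poly, SmallV 0 s → ∀ ans, ValidAns ans →
      ans.length = j → f.poly P (List.ofFn s ++ flatAns ans) =
        (eval s (gTotal T A h ρ x) ⟨r, ans, [], []⟩).2.msgs.getD j 0 := by
  obtain ⟨S, hG, hev⟩ := exists_gen_kdm (A := A) (h := h) j hρ hr x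
  have hm := hev.msgs.getD hev.avV_zero j
  have : Nonempty (KdmInput P j) :=
    ⟨⟨(0, List.replicate j (0, 0)), .zero, fun p hp i => by
      rw [(List.mem_replicate.1 hp).2]
      have := P.QL_pos
      simpa using this, by simp⟩⟩
  obtain ⟨f, hcost, hf⟩ := hG.wordFn (len := P.n) _ (ListAv.ofFn fun i => (hm i).1)
    fun p => by simp
  refine ⟨f, hcost.trans ?_, fun s hs ans hans hlen => ?_⟩
  · have h1 : T.kappa ^ 55 * ((kdmEnc T j).W + 1) ≤ T.kappa ^ 57 :=
      (kdmEnc T j).cost_le (a := 55) le_rfl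
    have h2 : P.n ≤ T.kappa := (T.fits (kdmEnc T j) rfl).params.n_le
    have h3 : 64 * T.kappa ^ 57 ≤ T.kappa ^ 58 :=
      (kdmEnc T j).mul_pow_le (by norm_num) (by norm_num)
    have h4 : T.kappa ≤ T.kappa ^ 57 := Nat.le_self_pow (by norm_num) _
    omega
  · funext i
    have := hf ⟨(s, ans), hs, hans, hlen⟩
    change f.eval (List.ofFn s ++ flatAns ans) = _ at this
    rw [WordFn.poly, this]
    exact getD_ofFn _ i

/-- With queries answered by uniform pairs, the visible values look the same. -/
theorem near_kdm (hsec : SecurityLevel P T.lam) (hh : h ∉ A) {sk : Fin T.N → P.Poly}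
    (hsk : ∀ i, SmallV T.kappa (sk i)) {r : List (Item P)} (hr : SmallItems T r) (x : T.Inputs)
    (D : Distinguisher) (pre post : List ℤ) :
    Near ((T.kappa ^ 70 + 4 * D.cost : ℕ) * tick T.lam)
      (ex P.ternaryPoly fun s => wpI (encKernel s) (gTotal T A h (Function.update sk h 0) x) r
        (fun _ l => D.pr (pre ++ l ++ post)) [])
      (wpI unifKernel (gTotal T A h (Function.update sk h 0) x) r
        (fun _ l => D.pr (pre ++ l ++ post)) []) := by
  set ρ := Function.update sk h 0 with hρdef
  have hρ : ∀ i, SmallV T.kappa (ρ i) := fun i => by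
    by_cases hi : i = h
    · subst hi
      rw [hρdef, Function.update_self]
      exact .zero
    · rw [hρdef, Function.update_of_ne hi]
      exact hsk i
  have hok := ok_gTotal (sk := sk) hh x
  rw [← hρdef] at hok
  set q := queries (totalNodes T A) with hq
  have hfs : ∀ j : Fin q, ∃ f : WordFn, f.cost ≤ T.kappa ^ 58 ∧ ∀ s : P.Poly, SmallV 0 s →
      ∀ ans, ValidAns ans → ans.length = j → f.poly P (List.ofFn s ++ flatAns ans) =
        (eval s (gTotal T A h ρ x) ⟨r, ans, [], []⟩).2.msgs.getD j 0 := fun j =>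
    exists_kdm_function j hρ hr x
  choose f hcost hf using hfs
  -- After the queries the adversary replays the game on the answers with secret `0`: by
  -- `eval_secret`, the secret affects the recorded messages but nothing visible.
  obtain ⟨S, hG, hev⟩ := exists_gen_ans (A := A) (h := h) q hρ hr x
  obtain ⟨D', hD', hprob⟩ := hG.distinguisher D pre post hev.log
  have hpr : ∀ ans, ValidAns ans → ans.length = q → D'.pr (flatAns ans) =
      D.pr (pre ++ (eval 0 (gTotal T A h ρ x) ⟨r, ans, [], []⟩).2.log ++ post) :=
    fun ans h1 h2 => congrArg ENNReal.ofReal (hprob ⟨ans, h1, h2⟩)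
  have hadv := hsec (List.ofFn f) D'
  rw [D'.adv_le_iff_near, ex_bind, ex_unifAnswers, List.length_ofFn] at hadv
  have h1 : (ex P.ternaryPoly fun s => ex (encAnswers P s (List.ofFn f) []) D'.pr) =
      ex P.ternaryPoly fun s => wpI (encKernel s) (gTotal T A h ρ x) r
        (fun _ l => D.pr (pre ++ l ++ post)) [] := by
    refine ex_congr_support fun s hs => ?_
    refine ex_encAnswers hok s r _ [] (List.ofFn f) (by rw [List.length_ofFn]) []
      (fun ans g hans hg => ?_) _ fun ans hans hlen => ?_
    · obtain ⟨hlt, rfl⟩ := List.getElem?_eq_some_iff.1 hg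
      rw [List.getElem_ofFn, List.nil_append]
      exact hf ⟨ans.length, by simpa using hlt⟩ s (smallV_ternary hs) ans hans rfl
    · rw [List.nil_append, hpr ans hans (by simpa using hlen),
        (eval_secret s 0 _ r ans [] [] []).2]
  have h2 : (ex (ansDist P q) fun ans => D'.pr ([] ++ flatAns ans)) =
      wpI unifKernel (gTotal T A h ρ x) r (fun _ l => D.pr (pre ++ l ++ post)) [] := by
    rw [wpI_unifKernel hok 0 r _ [] []]
    refine ex_congr_support fun ans hans => ?_
    obtain ⟨hl, hv⟩ := validAns_of_mem_support hans
    rw [List.nil_append, hpr ans hv hl]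
  rw [h1, h2] at hadv
  have hn : P.n ≤ T.kappa := (T.fits (ansEnc T 0) rfl).params.n_le
  have hE := fun {c e e' : ℕ} => (ansEnc T 0).mul_pow_le (c := c) (e := e) (e' := e')
  change ∀ {c e e' : ℕ}, c ≤ 64 → e < e' → c * T.kappa ^ e ≤ T.kappa ^ e' at hE
  -- Each query costs at most `κ ^ 58 + 2 n ≤ κ ^ 59`, and there are at most `κ ^ 8` of them.
  have hsum : ((List.ofFn f).map fun f => f.cost + 2 * P.n).sum ≤ q * (T.kappa ^ 59) := by
    have := List.sum_le_card_nsmul ((List.ofFn f).map fun f => f.cost + 2 * P.n) (T.kappa ^ 59)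
      fun c hc => by
        obtain ⟨g, hg, rfl⟩ := List.mem_map.1 hc
        obtain ⟨j, rfl⟩ := List.mem_ofFn.1 hg
        have h1 := hcost j
        have h2 : 64 * T.kappa ^ 58 ≤ T.kappa ^ 59 := hE le_rfl (by norm_num)
        have h4 : T.kappa ≤ T.kappa ^ 58 := Nat.le_self_pow (by norm_num) _
        omega
    simpa using this
  have hq8 : q * T.kappa ^ 59 ≤ T.kappa ^ 67 := by
    have := Nat.mul_le_mul_right (T.kappa ^ 59) (queries_totalNodes_le (T := T) (A := A))
    rwa [← pow_add] at this
  have hD2 : T.kappa ^ 55 * ((ansEnc T q).W + 1) ≤ T.kappa ^ 57 :=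
    (ansEnc T q).cost_le (a := 55) le_rfl
  have h5 : T.kappa ^ 57 ≤ T.kappa ^ 67 := (ansEnc T q).pow_mono (by norm_num)
  have h6 : 64 * T.kappa ^ 67 ≤ T.kappa ^ 70 := hE le_rfl (by norm_num)
  have key : ((List.ofFn f).map fun f => f.cost + 2 * P.n).sum + D'.cost ≤
      T.kappa ^ 70 + 4 * D.cost := by omega
  exact hadv.mono (mul_le_mul' (by exact_mod_cast key) le_rfl)

end Kdm

/-! ## Replacing re-randomized ciphertexts with uniform pairs -/

section Tail

open Prog

variable {P : Params} {T : Training P} {A : Finset (Fin T.N)} {h : Fin T.N}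

theorem Prog.eval_coins {k : ℕ} (κ : Kind) (s : P.Poly) (r : List (Item P))
    (ans : List (P.Poly × P.Poly)) (l : List ℤ) (m : List P.Poly) :
    (seqFin fun _ : Fin k => (coin' κ : Prog P P.Poly)).eval s ⟨r, ans, l, m⟩ =
      (fun i : Fin k => (r.getD i (Item.zero P)).v0, (⟨r.drop k, ans, l, m⟩ : Ev P)) := by
  induction k generalizing r with
  | zero => exact Prod.ext (funext fun i => i.elim0) rfl
  | succ k ih =>
    have h1 : (seqFin fun _ : Fin (k + 1) => (coin' κ : Prog P P.Poly)).eval s ⟨r, ans, l, m⟩ =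
        ((seqFin fun _ : Fin k => (coin' κ : Prog P P.Poly)) >>= fun xs =>
          (pure (Fin.cons (r.headD (Item.zero P)).v0 xs) : Prog P (Fin (k + 1) → P.Poly))).eval s
            ⟨r.tail, ans, l, m⟩ := rfl
    rw [h1, eval_bind, ih]
    refine Prod.ext (funext fun i => ?_) ?_
    · refine Fin.cases ?_ (fun j => ?_) i
      · cases r <;> rfl
      · cases r <;> rfl
    · change Ev.mk _ _ _ _ = Ev.mk _ _ _ _
      rw [List.drop_tail]

/-- The generation of the switching keys. -/
def gKeyRest {N : ℕ} (A : Finset (Fin N)) (ρ : Fin N → P.Poly) (pk0 pk1 : P.Poly) :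
    Prog P (PubKeys P) := do
  let rlk ← gSwitch A ρ fun s => nmul (s + ∑ i, ρ i) (s + ∑ i, ρ i)
  let rot ← seqFin fun k : Fin P.slots => gSwitch A ρ fun s =>
    substPow (5 ^ (k : ℕ)) (s + ∑ i, ρ i)
  pure { pk0 := pk0, pk1 := pk1, rlk := rlk, rot := rot }

/-- The part of the protocol that follows the generation of the encryption key. -/
def gTail (T : Training P) (A : Finset (Fin T.N)) (h : Fin T.N) (ρ : Fin T.N → P.Poly)
    (pk0 pk1 : P.Poly) (x : T.Inputs) : Prog P (Fin T.nW → Ct P) := do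
  let K ← gKeyRest A ρ pk0 pk1
  gMain T A h ρ K x

/-- The first `T.N` items, which are the errors in the key shares, and the first answer determine
the encryption key; the rest of the game depends on them through this key and the log `l` only. As
`l` is the same for all `r` with these errors, evaluations that differ in later items can be
compared. -/
theorem eval_gTotal (s : P.Poly) (ρ : Fin T.N → P.Poly) (x : T.Inputs)
    (p : P.Poly × P.Poly) (ans : List (P.Poly × P.Poly)) (e : Fin T.N → P.Poly) :
    ∃ l, ∀ r : List (Item P), (∀ i : Fin T.N, (r.getD i (Item.zero P)).v0 = e i) →
      eval s (gTotal T A h ρ x) ⟨r, p :: ans, [], []⟩ =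
        eval s (gTail T A h ρ (red P.QL (∑ i, pkShare h ρ p e i)) p.1 x)
          ⟨r.drop T.N, ans, l, [0]⟩ := by
  refine ⟨[] ++ vis A (List.ofFn fun i => (some i, ρ i)) ++ vis A ((none, p.1) ::
    (List.ofFn fun i => [(some i, e i), (none, pkShare h ρ p e i)]).flatten), fun r he => ?_⟩
  obtain rfl : (fun i : Fin T.N => (r.getD i (Item.zero P)).v0) = e := funext he
  set e : Fin T.N → P.Poly := fun i => (r.getD i (Item.zero P)).v0
  have h1 : eval s (gKeyPair A h ρ) ⟨r, p :: ans,
      [] ++ vis A (List.ofFn fun i => (some i, ρ i)), []⟩ =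
      ((p.1, pkShare h ρ p e), ⟨r.drop T.N, ans, [] ++ vis A (List.ofFn fun i => (some i, ρ i)) ++
        vis A ((none, p.1) :: (List.ofFn fun i =>
          [(some i, e i), (none, pkShare h ρ p e i)]).flatten), [0]⟩) := by
    rw [gKeyPair, eval_bind]
    change Prog.eval s ((seqFin fun _ : Fin T.N => (coin' .err : Prog P P.Poly)) >>= _) _ = _
    rw [eval_bind, eval_coins]
    rfl
  have h2 : ∀ σ, eval s (gKeys A h ρ) σ = eval s (gKeyRest A ρ
      (red P.QL (∑ i, (eval s (gKeyPair A h ρ) σ).1.2 i)) (eval s (gKeyPair A h ρ) σ).1.1)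
        (eval s (gKeyPair A h ρ) σ).2 := fun σ => eval_bind _ _ _ _
  rw [gTotal, eval_bind]
  change Prog.eval s (gKeys A h ρ >>= fun K => gMain T A h ρ K x) ⟨r, p :: ans,
      [] ++ vis A (List.ofFn fun i => (some i, ρ i)), []⟩ = _
  rw [eval_bind, h2, h1, gTail, eval_bind]

/-- All re-randomizations use one and the same key, which can thus be chosen to consist of the first
halves of RLWE samples, up to sign. -/
theorem ok_gTail (hh : h ∉ A) (sk : Fin T.N → P.Poly) (pk0 pk1 : P.Poly) (x : T.Inputs) :
    Ok (fun u v => u = pk0 ∧ v = pk1) (fun _ => True)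
      ((switchNodes P ++ (List.ofFn fun _ : Fin P.slots => switchNodes P).flatten) ++ mainNodes T A)
      (gTail T A h (Function.update sk h 0) pk0 pk1 x) := by
  refine Ok.bind (I := fun K => K.pk0 = pk0 ∧ K.pk1 = pk1) ?_ fun K hK =>
    (rel_mainPart hh K hK x).ok
  -- Only the part of `Rel` about operations is used, in which the security parameter of a switching
  -- key does not occur.
  refine Ok.bind (I := fun _ => True) (rel_switchKey (lam := 0) h _).ok fun rlk _ => ?_
  rw [← List.append_nil (List.ofFn fun _ : Fin P.slots => switchNodes P).flatten]
  exact (Ok.seqFin (I := fun _ _ => True) fun k => (rel_switchKey (lam := 0) h fun s =>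
    substPow (5 ^ (k : ℕ)) (s + ∑ i, Function.update sk h 0 i)).ok).bind fun _ _ => .ret ⟨rfl, rfl⟩

theorem itemNodes_append (ns ns' : List Node) :
    itemNodes (ns ++ ns') = itemNodes ns ++ itemNodes ns' := by
  induction ns with
  | nil => rfl
  | cons ν ns ih => cases ν <;> simp only [itemNodes, List.cons_append, ih]

theorem itemNodes_coinNodes (N : ℕ) (κ : Kind) :
    itemNodes (coinNodes N κ) = List.replicate N (.coin κ) := by
  induction N with
  | zero => rfl
  | succ N ih =>
    rw [coinNodes, List.ofFn_succ, List.flatten_cons, itemNodes_append, List.replicate_succ]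
    exact congrArg _ ih

theorem itemNodes_totalNodes (T : Training P) (A : Finset (Fin T.N)) :
    itemNodes (totalNodes T A) = List.replicate T.N (.coin .err) ++ itemNodes
      ((switchNodes P ++ (List.ofFn fun _ : Fin P.slots => switchNodes P).flatten) ++
        mainNodes T A) := by
  rw [totalNodes, keyNodes, List.append_assoc, List.append_assoc, itemNodes_append,
    itemNodes_append, itemNodes_coinNodes]
  rfl

/-- The shares of all the other parties in the encryption key. -/
def otherShares (h : Fin T.N) (ρ : Fin T.N → P.Poly) (a : P.Poly) (e : Fin T.N → P.Poly) : P.Poly :=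
  ∑ i, pkShare h ρ (a, 0) e i

theorem sum_pkShare (ρ : Fin T.N → P.Poly) (a b : P.Poly) (e : Fin T.N → P.Poly) :
    ∑ i, pkShare h ρ (a, b) e i = b + otherShares h ρ a e := by
  rw [otherShares, ← Finset.add_sum_erase _ _ (Finset.mem_univ h),
    ← Finset.add_sum_erase _ (fun i => pkShare h ρ (a, 0) e i) (Finset.mem_univ h), pkShare,
    if_pos rfl, pkShare, if_pos rfl]
  simp only [zero_add]
  congr 1
  refine Finset.sum_congr rfl fun i hi => ?_
  rw [pkShare, pkShare, if_neg (Finset.ne_of_mem_erase hi), if_neg (Finset.ne_of_mem_erase hi)]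

/-- The answer to the first query for which `(-a₁, -a₂)` is the encryption key. -/
def keyAnswer (h : Fin T.N) (ρ : Fin T.N → P.Poly) (e : Fin T.N → P.Poly) (a1 a2 : P.Poly) :
    P.Poly × P.Poly :=
  (red P.QL (-a2), red P.QL (-otherShares h ρ (red P.QL (-a2)) e - a1))

/-- The first half of the answer is a reflection of `a2`; given it, the second half is a translated
reflection of `a1`. Both maps preserve uniformity modulo `Q_L`. -/
theorem ex_keyAnswer (ρ e : Fin T.N → P.Poly) (F : P.Poly × P.Poly → ℝ≥0∞) :
    (ex ((Kind.unif P.QL).poly P) fun a1 => ex ((Kind.unif P.QL).poly P) fun a2 =>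
      F (keyAnswer h ρ e a1 a2)) =
      ex ((Kind.unif P.QL).poly P) fun a => ex ((Kind.unif P.QL).poly P) fun b => F (a, b) := by
  rw [ex_comm]
  have h1 := ex_unifVec_mod (n := P.n) P.QL_pos 0 (-1) (Or.inr rfl) fun a =>
    ex ((Kind.unif P.QL).poly P) fun b => F (a, b)
  refine Eq.trans (ex_congr fun a2 => ?_) h1
  have h2 := ex_unifVec_mod (n := P.n) P.QL_pos
    (-otherShares h ρ (red P.QL (-a2)) e) (-1) (Or.inr rfl) fun b => F (red P.QL (-a2), b)
  have h3 : ∀ v w : P.Poly, v + (-1 : ℤ) • w = v - w := fun v w => by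
    rw [neg_one_smul, sub_eq_add_neg]
  simp only [h3, zero_sub] at h2 ⊢
  exact h2

/-- With the key `keyAnswer`, re-randomization adds a pair of RLWE samples. -/
theorem eval_gTotal_shift (hh : h ∉ A) (sk : Fin T.N → P.Poly) (x : T.Inputs) (s : P.Poly)
    {r r' : List (Item P)} (ans : List (P.Poly × P.Poly))
    (hpos : (itemNodes (totalNodes T A))[r.length]? = some (.rer .real))
    (u e0 e1 a1 a2 : P.Poly) {e : Fin T.N → P.Poly}
    (he : e = fun i : Fin T.N => (r.getD i (Item.zero P)).v0) :
    (eval s (gTotal T A h (Function.update sk h 0) x) ⟨r ++ ⟨.real, u, e0, e1⟩ :: r',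
        keyAnswer h (Function.update sk h 0) e a1 a2 :: ans, [], []⟩) =
      eval s (gTotal T A h (Function.update sk h 0) x)
        ⟨r ++ ⟨.shift, red P.QL (-(nmul u a1) + e0), red P.QL (-(nmul u a2) + e1), 0⟩ :: r',
          keyAnswer h (Function.update sk h 0) e a1 a2 :: ans, [], []⟩ := by
  set ρ := Function.update sk h 0
  rw [itemNodes_totalNodes] at hpos
  -- The errors of the key generation come first among the items, so a re-randomization stands after
  -- all of them and `e` is determined by the prefix `r`.
  have hN : T.N ≤ r.length := by
    by_contra hlt
    rw [List.getElem?_append_left (by simpa using hlt), List.getElem?_replicate] at hpos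
    split_ifs at hpos
    simp at hpos
  rw [List.getElem?_append_right (by simpa using hN), List.length_replicate] at hpos
  have hget : ∀ (t : Item P) (i : Fin T.N),
      ((r ++ t :: r').getD i (Item.zero P)).v0 = e i := fun t i => by
    rw [he, List.getD_append _ _ _ _ (by omega)]
  obtain ⟨l, hl⟩ := eval_gTotal (A := A) s ρ x (keyAnswer h ρ e a1 a2) ans e
  rw [hl _ (hget _), hl _ (hget _), List.drop_append_of_le_length hN,
    List.drop_append_of_le_length hN]
  refine eval_real_eq_shift (ok_gTail hh sk _ _ x) s _ _ _ _ _ (by rwa [List.length_drop]) u e0 e1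
    _ _ ?_
  rintro pk0 pk1 ⟨rfl, rfl⟩ j
  have hpk1 : ∀ j, red P.QL (-a2) j ≡ (-a2) j [ZMOD P.QL] := red_modEq _
  -- The share of `h` was chosen to complete the other shares to `-a1`.
  have hpk0 : ∀ j, red P.QL (∑ i, pkShare h ρ (keyAnswer h ρ e a1 a2) e i) j ≡ (-a1) j
      [ZMOD P.QL] := fun j => by
    refine (red_modEq _ j).trans ?_
    rw [keyAnswer, sum_pkShare, Pi.add_apply]
    refine ((red_modEq _ j).add_right _).trans (congrArg (· % (P.QL : ℤ)) ?_)
    simp only [Pi.sub_apply, Pi.neg_apply]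
    ring
  refine ⟨(red_modEq _ j).trans ?_, (red_modEq _ j).trans ?_⟩
  · have := (nmul_modEq (u := u) hpk0 j).symm.add_right (e0 j)
    rwa [nmul_neg, nmul_comm u (red _ _)] at this
  · have := (nmul_modEq (u := u) hpk1 j).symm.add_right (e1 j)
    rwa [nmul_neg, nmul_comm u (red _ _)] at this

end Tail

/-! ### Honest re-randomizations, one at a time -/

section Hybrid

open Prog

variable {P : Params} {T : Training P} {A : Finset (Fin T.N)} {h : Fin T.N}

/-- Two samples, encryptions of `0`, are indistinguishable from uniform pairs. -/
theorem near_samples (hsec : SecurityLevel P T.lam) (D : Distinguisher) :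
    Near ((4 * P.n + D.cost : ℕ) * tick T.lam)
      (ex P.ternaryPoly fun u => ex ((Kind.unif P.QL).poly P) fun a1 => ex P.errPoly fun e1 =>
        ex ((Kind.unif P.QL).poly P) fun a2 => ex P.errPoly fun e2 =>
          D.pr (flatAns [(a1, red P.QL (-(nmul u a1) + e1)), (a2, red P.QL (-(nmul u a2) + e2))]))
      (ex ((Kind.unif P.QL).poly P) fun a1 => ex ((Kind.unif P.QL).poly P) fun b1 =>
        ex ((Kind.unif P.QL).poly P) fun a2 => ex ((Kind.unif P.QL).poly P) fun b2 =>
          D.pr (flatAns [(a1, b1), (a2, b2)])) := by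
  -- Functions without outputs ask for encryptions of `0`, at a cost of `2 n` for each query.
  have hadv := hsec [⟨[], []⟩, ⟨[], []⟩] D
  rw [D.adv_le_iff_near, ex_bind, ex_unifAnswers] at hadv
  have hz : ∀ l, (⟨[], []⟩ : WordFn).poly P l = 0 := fun l => rfl
  simp only [List.length_cons, List.length_nil, ansDist, encAnswers, ex_bind, ex_bind', ex_map,
    ex_pure, ex_pure', hz, add_zero, List.nil_append, flatAns, List.flatMap_cons,
    List.flatMap_nil, List.append_nil, List.append_assoc] at hadv ⊢
  have hcost : ((([⟨[], []⟩, ⟨[], []⟩] : List WordFn).map fun f => f.cost + 2 * P.n).sum +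
      D.cost : ℕ) = 4 * P.n + D.cost := by
    simp [WordFn.cost, costWords]
    ring
  rw [hcost] at hadv
  exact hadv

/-- The samples are embedded into the game: their first halves determine the key through
`keyAnswer`, their second halves become the item of the re-randomization in question. All else is
hard-wired. -/
theorem exists_gen_samples {ρ e : Fin T.N → P.Poly} (hρ : ∀ i, SmallV T.kappa (ρ i))
    (he : ∀ i, SmallV T.kappa (e i)) {r r' : List (Item P)} (hr : SmallItems T r)
    (hr' : SmallItems T r') {ans : List (P.Poly × P.Poly)} (hans : ValidAns ans)
    (hlen : ans.length ≤ T.kappa ^ 8) (x : T.Inputs) :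
    ∃ S', Gen (ansEnc T 2) (T.kappa ^ 55) S' ∧ EvAv (ansEnc T 2) True S' fun p =>
      (eval 0 (gTotal T A h ρ x) ⟨r ++ ⟨.shift, (p.1.getD 0 (0, 0)).2, (p.1.getD 1 (0, 0)).2, 0⟩ ::
        r',
        keyAnswer h ρ e (p.1.getD 0 (0, 0)).1 (p.1.getD 1 (0, 0)).1 :: ans, [], []⟩).2 := by
  have hT := T.fits (ansEnc T 2) rfl
  have hP := hT.params
  have hnl := hP.n_le
  refine (exists_gen_of_inputs (A := A) (h := h) (full := True) (E := ansEnc T 2)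
    (items := fun p => r ++ ⟨.shift, (p.1.getD 0 (0, 0)).2, (p.1.getD 1 (0, 0)).2, 0⟩ :: r')
    (ans := fun p => keyAnswer h ρ e (p.1.getD 0 (0, 0)).1 (p.1.getD 1 (0, 0)).1 :: ans)
    (s := fun p => 0) (ρ := fun _ => ρ) (inp := fun _ => x) rfl
    (fun p z hz => p.2.1.flat_small z hz) fun S hl h0 => ?_).imp fun _ h => h.2
  have hz : AvV (ansEnc T 2) S 1 fun _ => (0 : P.Poly) :=
    fun _ => ⟨h0, fun _ => by simpa using ((ansEnc T 2).bd_pos 1).le⟩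
  have hdec : ListAv (PairAv (ansEnc T 2) S) fun p : AnsInput P 2 => p.1 := by
    convert hl.decAns (P := P) 2 using 2 with p
    have := decAns_flatAns p.1 []
    rw [List.append_nil, p.2.2] at this
    exact this.symm
  have hget := fun i => hdec.getD (d := fun _ => (0, 0)) ⟨hz, hz⟩ i
  refine ⟨?_, ?_, ?_, ?_, ?_⟩
  · exact (Has.andE 12 (hr.has (E := ansEnc T 2) rfl) (hr'.has (E := ansEnc T 2) rfl)
      (fun _ _ hS h => h.imp fun _ h => h.mono hS) (fun _ _ hS h => h.imp fun _ h => h.mono hS)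
      (by norm_num)).weaken (Enc.pow_mono _ (by norm_num)) fun S₁ hS₁ h =>
        h.1.append (.cons ⟨.shift, _, _, _, Or.inr trivial, (hget 0).2.mono hS₁,
          (hget 1).2.mono hS₁, hz.mono hS₁, rfl⟩ h.2)
  · have h1 : Has (ansEnc T 2) S ((ansEnc T 2).κ ^ 10)
        fun S => ListAv (PairAv (ansEnc T 2) S) fun _ => ans :=
      Has.constList (A := fun S f => PairAv (ansEnc T 2) S f) (a := 2) (c := 8)
        (fun _ _ _ hS h => h.mono hS) ans hlen
        fun p hp => Has.constPair hP (hans.small hp).1 (hans.small hp).2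
    have h2 : HasV (ansEnc T 2) S 2 1 fun p : AnsInput P 2 =>
        red P.QL (-(p.1.getD 1 (0, 0)).1) :=
      (((hget 1).1.hasV.neg (by norm_num)).redQL hP (by norm_num)).weaken (by norm_num) le_rfl
    have h3 : Has (ansEnc T 2) S ((ansEnc T 2).κ ^ 18) fun S => PairAv (ansEnc T 2) S
        fun p : AnsInput P 2 => keyAnswer h ρ e (p.1.getD 0 (0, 0)).1 (p.1.getD 1 (0, 0)).1 := by
      refine ((h2.save hnl).bind fun S₁ hS₁ ha => ((Has.andE 3 (Has.constRow hP hT.N_le hρ)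
        (Has.constRow hP hT.N_le he) (AvRow.inherited _) (AvRow.inherited _)
        (by norm_num)).bind fun S₂ hS₂ hrow => ?_)).weaken
          ((Nat.add_le_add_left (Enc.add_le _ (a := 3) (b := 16) (c := 17) (by norm_num)) _).trans
            (Enc.add_le _ (a := 3) (b := 17) (by norm_num))) fun _ _ h => h
      have ha₂ := ha.mono hS₂
      have hsum := HasV.sum hT.N_le (fun i => hasV_pkShare (h := h) hP hrow.1
        (p := fun p : AnsInput P 2 => (red P.QL (-(p.1.getD 1 (0, 0)).1), (0 : P.Poly)))
        ⟨ha₂, hz.mono (hS₁.trans hS₂)⟩ hrow.2 i) (by norm_num)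
      refine (((hsum.neg (by norm_num)).sub (((hget 0).1.mono (hS₁.trans hS₂)).hasV)
        (by norm_num)).redQL hP (by norm_num) |>.save hnl).weaken (Enc.pow_mono _ (by norm_num))
          fun S₃ hS₃ h => ⟨ha₂.mono hS₃, h⟩
    exact (Has.andE 19 h1 h3 (fun _ _ hS h => h.imp fun _ h => h.mono hS)
      (fun _ _ hS h => h.mono hS) (by norm_num)).weaken (Enc.pow_mono _ (by norm_num))
        fun _ _ h => .cons h.2 h.1
  · exact (Has.constV hT.params.n_le .zero).weaken (Enc.pow_mono _ (by norm_num)) fun _ _ h => h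
  · exact (Has.constRow hT.params hT.N_le hρ).weaken (Enc.pow_mono _ (by norm_num)) fun _ _ h => h
  · exact (Has.constInp hT T.d_le x).weaken (Enc.pow_mono _ (by norm_num)) fun _ _ h => h

/-- One re-randomized ciphertext may be replaced with a uniform pair. -/
theorem near_rer (hsec : SecurityLevel P T.lam) (hh : h ∉ A) {sk : Fin T.N → P.Poly}
    (hsk : ∀ i, SmallV T.kappa (Function.update sk h 0 i)) {r r' : List (Item P)}
    (hr : SmallItems T r) (hr' : SmallItems T r')
    (hpos : (itemNodes (totalNodes T A))[r.length]? = some (.rer .real))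
    {ans : List (P.Poly × P.Poly)} (hans : ValidAns ans) (hlen : ans.length ≤ T.kappa ^ 8)
    (x : T.Inputs) (D : Distinguisher) (pre post : List ℤ) :
    Near ((T.kappa ^ 58 + 4 * D.cost : ℕ) * tick T.lam)
      (ex ((Kind.unif P.QL).poly P) fun a => ex ((Kind.unif P.QL).poly P) fun b =>
        ex ((INode.rer .real).dist P) fun t => D.pr (pre ++ (eval 0
          (gTotal T A h (Function.update sk h 0) x) ⟨r ++ t :: r', (a, b) :: ans, [], []⟩).2.log ++
            post))
      (ex ((Kind.unif P.QL).poly P) fun a => ex ((Kind.unif P.QL).poly P) fun b =>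
        ex ((INode.rer .ideal).dist P) fun t => D.pr (pre ++ (eval 0
          (gTotal T A h (Function.update sk h 0) x) ⟨r ++ t :: r', (a, b) :: ans, [], []⟩).2.log ++
            post)) := by
  set ρ := Function.update sk h 0 with hρ
  set e : Fin T.N → P.Poly := fun i => (r.getD i (Item.zero P)).v0 with he
  have hes : ∀ i, SmallV T.kappa (e i) := fun i => by
    by_cases hi : (i : ℕ) < r.length
    · rw [he]
      simp only [List.getD_eq_getElem _ _ hi]
      exact (hr.small _ (List.getElem_mem hi)).1
    · rw [he]
      simp only [List.getD_eq_default _ _ (not_lt.1 hi)]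
      exact .zero
  obtain ⟨S, hG, hev⟩ := exists_gen_samples (A := A) (h := h) hsk hes hr hr' hans hlen x
  obtain ⟨D', hD', hprob⟩ := hG.distinguisher D pre post hev.log
  let H : P.Poly × P.Poly → Item P → ℝ≥0∞ := fun p t => D.pr (pre ++ (eval 0
    (gTotal T A h ρ x) ⟨r ++ t :: r', p :: ans, [], []⟩).2.log ++ post)
  have hpr : ∀ a1 b1 a2 b2, ValidAns [(a1, b1), (a2, b2)] →
      D'.pr (flatAns [(a1, b1), (a2, b2)]) = H (keyAnswer h ρ e a1 a2) ⟨.shift, b1, b2, 0⟩ :=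
    fun a1 b1 a2 b2 hv => congrArg ENNReal.ofReal (hprob ⟨_, hv, rfl⟩)
  have hvalid : ∀ {a1 b1 a2 b2 : P.Poly}, a1 ∈ ((Kind.unif P.QL).poly P).support →
      (∀ j, 0 ≤ b1 j ∧ b1 j < P.QL) → a2 ∈ ((Kind.unif P.QL).poly P).support →
      (∀ j, 0 ≤ b2 j ∧ b2 j < P.QL) → ValidAns [(a1, b1), (a2, b2)] := by
    intro a1 b1 a2 b2 h1 h2 h3 h4 p hp j
    rcases List.mem_cons.1 hp with rfl | hp
    · exact ⟨mem_support_unifPoly h1 j, h2 j⟩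
    · obtain rfl := List.mem_singleton.1 hp
      exact ⟨mem_support_unifPoly h3 j, h4 j⟩
  have hred : ∀ (v : P.Poly) (j), 0 ≤ red P.QL v j ∧ red P.QL v j < P.QL := fun v j =>
    ⟨red_nonneg P.QL_pos _ _, red_lt P.QL_pos _ _⟩
  have hnear := near_samples hsec D'
  -- On RLWE samples with secret `u`, the distinguisher plays the game with a uniform first answer
  -- and a genuine re-randomization.
  have h1 : (ex P.ternaryPoly fun u => ex ((Kind.unif P.QL).poly P) fun a1 => ex P.errPoly fun e1 =>
        ex ((Kind.unif P.QL).poly P) fun a2 => ex P.errPoly fun e2 =>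
          D'.pr (flatAns [(a1, red P.QL (-(nmul u a1) + e1)),
            (a2, red P.QL (-(nmul u a2) + e2))])) =
      ex ((Kind.unif P.QL).poly P) fun a => ex ((Kind.unif P.QL).poly P) fun b =>
        ex ((INode.rer .real).dist P) fun t => H (a, b) t := by
    rw [← ex_keyAnswer (h := h) ρ e fun p => ex ((INode.rer .real).dist P) fun t => H p t, ex_comm]
    refine ex_congr_support fun a1 ha1 => ?_
    simp only [INode.dist, ex_bind, ex_map]
    rw [ex_comm ((Kind.unif P.QL).poly P) (Kind.tern.poly P)]
    refine ex_congr fun u => ?_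
    rw [ex_comm ((Kind.unif P.QL).poly P) (Kind.err.poly P)]
    refine ex_congr fun e1 => ex_congr_support fun a2 ha2 => ex_congr fun e2 => ?_
    rw [hpr _ _ _ _ (hvalid ha1 (hred _) ha2 (hred _))]
    exact congrArg (fun q : _ × Ev P => D.pr (pre ++ q.2.log ++ post))
      (eval_gTotal_shift hh sk x 0 ans hpos u e1 e2 a1 a2 he).symm
  -- On uniform pairs, the shift is uniform and independent of the key, and erases the ciphertext.
  have h2 : (ex ((Kind.unif P.QL).poly P) fun a1 => ex ((Kind.unif P.QL).poly P) fun b1 =>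
        ex ((Kind.unif P.QL).poly P) fun a2 => ex ((Kind.unif P.QL).poly P) fun b2 =>
          D'.pr (flatAns [(a1, b1), (a2, b2)])) =
      ex ((Kind.unif P.QL).poly P) fun a => ex ((Kind.unif P.QL).poly P) fun b =>
        ex ((INode.rer .ideal).dist P) fun t => H (a, b) t := by
    rw [← ex_keyAnswer (h := h) ρ e fun p => ex ((INode.rer .ideal).dist P) fun t => H p t]
    refine ex_congr_support fun a1 ha1 => ?_
    simp only [INode.dist, ex_bind, ex_map]
    rw [ex_comm]
    refine ex_congr_support fun a2 ha2 => ?_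
    refine Eq.trans ?_ (ex_eval_shift_eq_ideal (ok_gTotal (sk := sk) hh x) 0 r r'
      (keyAnswer h ρ e a1 a2 :: ans) [] [] fun _ l => D.pr (pre ++ l ++ post))
    refine ex_congr_support fun b1 hb1 => ex_congr_support fun b2 hb2 => ?_
    exact hpr _ _ _ _ (hvalid ha1 (mem_support_unifPoly hb1) ha2 (mem_support_unifPoly hb2))
  rw [h1, h2] at hnear
  refine hnear.mono ?_
  have e1 : T.kappa ^ 55 * ((ansEnc T 2).W + 1) ≤ T.kappa ^ 57 :=
    (ansEnc T 2).cost_le (a := 55) le_rfl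
  have e2 : P.n ≤ T.kappa := (T.fits (ansEnc T 0) rfl).params.n_le
  have e3 : 64 * T.kappa ^ 57 ≤ T.kappa ^ 58 := (ansEnc T 2).mul_pow_le le_rfl (by norm_num)
  have e4 : T.kappa ≤ T.kappa ^ 57 := Nat.le_self_pow (by norm_num) _
  have key : 4 * P.n + D'.cost ≤ T.kappa ^ 58 + 4 * D.cost := by omega
  exact mul_le_mul' (by exact_mod_cast key) le_rfl

/-! ### Replacing items one by one -/

/-- A hybrid argument from left to right: when `ν` is exchanged, the items before it have been
exchanged already and those after it have not. -/
theorem near_itemsDist (f : INode → INode) {ε : ℝ≥0∞} (νs : List INode)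
    (F : List (Item P) → ℝ≥0∞)
    (H : ∀ νs₁ ν νs₂, νs = νs₁ ++ ν :: νs₂ → ∀ r ∈ (itemsDist P (νs₁.map f)).support,
      ∀ r' ∈ (itemsDist P νs₂).support,
        Near ε (ex (ν.dist P) fun t => F (r ++ t :: r'))
          (ex ((f ν).dist P) fun t => F (r ++ t :: r'))) :
    Near (νs.length * ε) (ex (itemsDist P νs) F) (ex (itemsDist P (νs.map f)) F) := by
  induction νs generalizing F with
  | nil => exact .refl _ _
  | cons ν νs ih =>
    have h1 : Near ε (ex (itemsDist P (ν :: νs)) F)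
        (ex ((f ν).dist P) fun t => ex (itemsDist P νs) fun r => F (t :: r)) := by
      simp only [itemsDist, ex_bind, ex_map]
      rw [ex_comm, ex_comm ((f ν).dist P)]
      exact Near.ex fun r hr => H [] ν νs rfl [] ((PMF.mem_support_pure_iff _ _).2 rfl) r hr
    have h2 : Near (νs.length * ε)
        (ex ((f ν).dist P) fun t => ex (itemsDist P νs) fun r => F (t :: r))
        (ex (itemsDist P ((ν :: νs).map f)) F) := by
      simp only [List.map_cons, itemsDist, ex_bind, ex_map]
      refine Near.ex fun t ht => ih (fun r => F (t :: r)) fun νs₁ ν' νs₂ hν r hr r' hr' => ?_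
      refine H (ν :: νs₁) ν' νs₂ (by rw [hν]; rfl) (t :: r) ?_ r' hr'
      exact (PMF.mem_support_bind_iff _ _ _).2 ⟨t, ht, (PMF.mem_support_map_iff _ _ _).2
          ⟨r, hr, rfl⟩⟩
    refine (h1.trans h2).mono (le_of_eq ?_)
    rw [List.length_cons]
    push_cast
    ring

/-- Genuine re-randomizations are replaced with uniform pairs. -/
def INode.idealize : INode → INode
  | .coin κ => .coin κ
  | .rer _ => .rer .ideal

theorem mem_itemNodes {ns : List Node} {ν : INode} (h : ν ∈ itemNodes ns) :
    (∃ κ, ν = .coin κ) ∨ ν = .rer .real := by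
  induction ns with
  | nil => simp [itemNodes] at h
  | cons ν' ns ih =>
    cases ν' with
    | coin κ =>
      rcases List.mem_cons.1 h with rfl | h
      · exact Or.inl ⟨_, rfl⟩
      · exact ih h
    | query => exact ih h
    | rer =>
      rcases List.mem_cons.1 h with rfl | h
      · exact Or.inr rfl
      · exact ih h

theorem INode.Fits.idealize {κ : ℕ} {ν : INode} (h : ν.Fits κ) : ν.idealize.Fits κ := by
  cases ν with
  | coin _ => exact h
  | rer _ => trivial

/-- The first operation is the query for the key share of `h`; its answer is the one to be
programmed. -/
theorem queries_totalNodes (T : Training P) (A : Finset (Fin T.N)) :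
    ∃ q, queries (totalNodes T A) = q + 1 := ⟨_, rfl⟩

theorem smallItems_of_mem_support {νs : List INode} (hlen : νs.length ≤ T.kappa ^ 8)
    (hν : ∀ ν ∈ νs, ν.Fits T.kappa) {r : List (Item P)} (hr : r ∈ (itemsDist P νs).support) :
    SmallItems T r := by
  obtain ⟨h1, h2⟩ := small_of_mem_support_itemsDist T.le_kappa T.QL_le hν hr
  exact ⟨h1.trans_le hlen, h2⟩

theorem length_itemNodes_totalNodes_le : (itemNodes (totalNodes T A)).length ≤ T.kappa ^ 8 := by
  have := length_itemNodes_add_queries (totalNodes T A)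
  have := length_totalNodes_le T A
  omega

/-- All re-randomized ciphertexts may be replaced with uniform pairs. -/
theorem near_ideal (hsec : SecurityLevel P T.lam) (hh : h ∉ A) {sk : Fin T.N → P.Poly}
    (hsk : ∀ i, SmallV T.kappa (Function.update sk h 0 i)) (x : T.Inputs) (D : Distinguisher)
    (pre post : List ℤ) :
    Near ((T.kappa ^ 8 * (T.kappa ^ 58 + 4 * D.cost) : ℕ) * tick T.lam)
      (ex (itemsDist P (itemNodes (totalNodes T A))) fun r =>
        ex (ansDist P (queries (totalNodes T A))) fun ans => D.pr (pre ++ (eval 0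
          (gTotal T A h (Function.update sk h 0) x) ⟨r, ans, [], []⟩).2.log ++ post))
      (ex (itemsDist P ((itemNodes (totalNodes T A)).map INode.idealize)) fun r =>
        ex (ansDist P (queries (totalNodes T A))) fun ans => D.pr (pre ++ (eval 0
          (gTotal T A h (Function.update sk h 0) x) ⟨r, ans, [], []⟩).2.log ++ post)) := by
  have hfit := fits_itemNodes (fits_totalNodes T A)
  have hle := length_itemNodes_totalNodes_le (T := T) (A := A)
  have hql := queries_totalNodes_le (T := T) (A := A)
  obtain ⟨q, hq⟩ := queries_totalNodes T A
  rw [hq] at hql ⊢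
  refine (near_itemsDist INode.idealize (itemNodes (totalNodes T A)) _
    (ε := (T.kappa ^ 58 + 4 * D.cost : ℕ) * tick T.lam) fun νs₁ ν νs₂ hν r hr r' hr' => ?_).mono ?_
  · have hmem : ν ∈ itemNodes (totalNodes T A) := by
      rw [hν]
      simp
    rcases mem_itemNodes hmem with ⟨κ, rfl⟩ | rfl
    · exact .refl _ _
    have hlen := congrArg List.length hν
    rw [List.length_append, List.length_cons] at hlen
    have hfit₁ : ∀ ν ∈ νs₁.map INode.idealize, ν.Fits T.kappa := fun ν hν' => by
      obtain ⟨ν', h', rfl⟩ := List.mem_map.1 hν'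
      exact (hfit ν' (by rw [hν]; exact List.mem_append_left _ h')).idealize
    have hr1 := smallItems_of_mem_support (T := T) (by rw [List.length_map]; omega) hfit₁ hr
    have hr2 := smallItems_of_mem_support (T := T) (by omega) (fun ν h' => hfit ν (by
      rw [hν]; exact List.mem_append_right _ (List.mem_cons_of_mem _ h'))) hr'
    have hrl := (small_of_mem_support_itemsDist T.le_kappa T.QL_le hfit₁ hr).1
    rw [List.length_map] at hrl
    have hpos : (itemNodes (totalNodes T A))[r.length]? = some (.rer .real) := by
      rw [hν, hrl]
      simp
    simp only [ansDist, ex_bind, ex_map]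
    -- The later answers are drawn first and kept fixed, so that only the first answer and the item
    -- in question are still random.
    have hswap : ∀ (ν : INode) (G : Item P → P.Poly → P.Poly → List (P.Poly × P.Poly) → ℝ≥0∞),
        (ex (ν.dist P) fun t => ex ((Kind.unif P.QL).poly P) fun a =>
          ex ((Kind.unif P.QL).poly P) fun b => ex (ansDist P q) fun ans => G t a b ans) =
        ex (ansDist P q) fun ans => ex ((Kind.unif P.QL).poly P) fun a =>
          ex ((Kind.unif P.QL).poly P) fun b => ex (ν.dist P) fun t => G t a b ans := by
      intro ν G
      rw [ex_comm (ansDist P q), ex_comm (ν.dist P)]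
      refine ex_congr fun a => ?_
      rw [ex_comm (ansDist P q), ex_comm (ν.dist P)]
      refine ex_congr fun b => ?_
      rw [ex_comm]
    rw [hswap, hswap]
    refine Near.ex fun ans hans => ?_
    obtain ⟨hl, hv⟩ := validAns_of_mem_support hans
    exact near_rer hsec hh hsk hr1 hr2 hpos hv (by omega) x D pre post
  · rw [← mul_assoc]
    refine mul_le_mul' ?_ le_rfl
    exact_mod_cast Nat.mul_le_mul_right _ hle

end Hybrid

/-! ## The length of the view -/

section LogLe

open Prog

variable {P : Params} {α β : Type} {N : ℕ}

/-- At most `b` numbers become visible in `p`. -/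
def Prog.LogLe (b : ℕ) (p : Prog P α) : Prop :=
  ∀ s σ, (p.eval s σ).2.log.length ≤ σ.log.length + b

theorem Prog.LogLe.mono {b b' : ℕ} {p : Prog P α} (h : p.LogLe b) (hb : b ≤ b') : p.LogLe b' :=
  fun s σ => (h s σ).trans (Nat.add_le_add_left hb _)

theorem Prog.LogLe.pure (b : ℕ) (a : α) : (Pure.pure a : Prog P α).LogLe b :=
  fun _ _ => Nat.le_add_right _ _

theorem Prog.LogLe.emit {b : ℕ} {l : List ℤ} (h : l.length ≤ b) : (emit' l : Prog P Unit).LogLe b :=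
  fun s σ => by
    change (σ.log ++ l).length ≤ _
    rw [List.length_append]
    omega

theorem Prog.LogLe.coin (b : ℕ) (κ : Kind) : (coin' κ : Prog P P.Poly).LogLe b :=
  fun _ _ => Nat.le_add_right _ _

theorem Prog.LogLe.query (b : ℕ) (msg : P.Poly → P.Poly) : (query' msg : Prog P _).LogLe b :=
  fun _ _ => Nat.le_add_right _ _

theorem Prog.LogLe.bind {a b : ℕ} {p : Prog P α} {f : α → Prog P β} (hp : p.LogLe a)
    (hf : ∀ x, (f x).LogLe b) : (p >>= f).LogLe (a + b) := fun s σ => by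
  rw [eval_bind]
  have := hf (p.eval s σ).1 s (p.eval s σ).2
  have := hp s σ
  omega

theorem Prog.LogLe.seqFin {k b : ℕ} {p : Fin k → Prog P α} (h : ∀ i, (p i).LogLe b) :
    (Poseidon.seqFin p).LogLe (k * b) := by
  induction k with
  | zero => exact .pure _ _
  | succ k ih =>
    refine LogLe.mono (b := b + (k * b + 0)) ?_ (by rw [Nat.succ_mul]; omega)
    exact (h 0).bind fun x => (ih fun i => h i.succ).bind fun xs => .pure _ _

theorem Prog.LogLe.foldlM {γ : Type} {b : ℕ} {p : α → γ → Prog P α}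
    (h : ∀ a c, (p a c).LogLe b) (l : List γ) (a : α) : (l.foldlM p a).LogLe (l.length * b) := by
  induction l generalizing a with
  | nil => exact .pure _ _
  | cons c l ih =>
    refine LogLe.mono (b := b + l.length * b) ?_ (by rw [List.length_cons, Nat.succ_mul]; omega)
    rw [List.foldlM_cons]
    exact (h a c).bind fun a' => ih a'

theorem length_vis_le (A : Finset (Fin N)) (l : List (Option (Fin N) × P.Poly)) :
    (vis A l).length ≤ l.length * P.n := by
  induction l with
  | nil => exact Nat.zero_le _
  | cons p l ih =>
    rw [vis_cons, List.length_append, List.length_cons, Nat.succ_mul, add_comm]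
    refine Nat.add_le_add ih ?_
    rw [vis, List.flatMap_cons, List.flatMap_nil, List.append_nil]
    split_ifs <;> simp

theorem length_flatten_ofFn_const {k c : ℕ} {f : Fin k → List α} (h : ∀ i, (f i).length = c) :
    (List.ofFn f).flatten.length = k * c := by
  induction k with
  | zero => simp
  | succ k ih =>
    rw [List.ofFn_succ, List.flatten_cons, List.length_append, h, ih fun i => h i.succ,
        Nat.succ_mul,
      add_comm]

variable {κ : ℕ}

theorem Prog.LogLe.bindE (hκ : 64 ≤ κ) {a b : ℕ} (c : ℕ) {p : Prog P α} {f : α → Prog P β}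
    (hp : p.LogLe (κ ^ a))
    (hf : ∀ x, (f x).LogLe (κ ^ b)) (hc : max a b < c) : (p >>= f).LogLe (κ ^ c) := by
  refine (hp.bind hf).mono ?_
  have h1 : κ ^ a ≤ κ ^ max a b := Nat.pow_le_pow_right (by omega) (le_max_left _ _)
  have h2 : κ ^ b ≤ κ ^ max a b := Nat.pow_le_pow_right (by omega) (le_max_right _ _)
  have h3 : κ ^ (max a b + 1) ≤ κ ^ c := Nat.pow_le_pow_right (by omega) hc
  have h4 : 64 * κ ^ max a b ≤ κ ^ (max a b + 1) := by
    rw [pow_succ, mul_comm]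
    exact Nat.mul_le_mul_left _ hκ
  omega

theorem Prog.LogLe.seqFinE (hκ : 64 ≤ κ) {k a : ℕ} (c : ℕ) (hk : k ≤ κ) {p : Fin k → Prog P α}
    (h : ∀ i, (p i).LogLe (κ ^ a)) (hc : a < c) : (Poseidon.seqFin p).LogLe (κ ^ c) := by
  refine (LogLe.seqFin h).mono (le_trans ?_ (Nat.pow_le_pow_right (by omega) hc))
  rw [Nat.succ_eq_add_one, pow_succ, mul_comm]
  exact Nat.mul_le_mul_left _ hk

theorem logLe_vis (hκ : 64 ≤ κ) {A : Finset (Fin N)} {l : List (Option (Fin N) × P.Poly)} {a c : ℕ}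
    (hn : P.n ≤ κ) (hl : l.length ≤ κ ^ a) (hc : a < c) :
    (emit' (vis A l) : Prog P Unit).LogLe (κ ^ c) := by
  refine .emit ((length_vis_le A l).trans (le_trans ?_ (Nat.pow_le_pow_right (by omega) hc)))
  exact Nat.mul_le_mul hl hn

theorem le_sq (hκ : 64 ≤ κ) {k : ℕ} (hk : k ≤ 64 * κ) : k ≤ κ ^ 2 := by nlinarith

variable {A : Finset (Fin N)} {h : Fin N} {ρ : Fin N → P.Poly} {K : PubKeys P} {lam : ℕ}

theorem logLe_gRer (hκ : 64 ≤ κ) (hn : P.n ≤ κ) (i : Fin N) (c : Ct P) :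
    (gRer A K i c).LogLe (κ ^ 7) := by
  unfold gRer
  split_ifs
  · refine LogLe.bindE hκ (a := 0) (b := 6) _ (.coin _ _) (fun u => ?_) (by norm_num)
    refine LogLe.bindE hκ (a := 0) (b := 5) _ (.coin _ _) (fun e0 => ?_) (by norm_num)
    refine LogLe.bindE hκ (a := 0) (b := 4) _ (.coin _ _) (fun e1 => ?_) (by norm_num)
    exact LogLe.bindE hκ (a := 3) (b := 0) _ (logLe_vis hκ (a := 1) hn (by simp; omega)
        (by norm_num))
      (fun _ => .pure _ _) (by norm_num)
  · exact fun _ _ => Nat.le_add_right _ _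

theorem logLe_gSend (hκ : 64 ≤ κ) (hn : P.n ≤ κ) (c : Ct P) : (gSend A c).LogLe (κ ^ 3) :=
  logLe_vis hκ (a := 1) hn (by simp; omega) (by norm_num)

theorem logLe_gSwitch (hκ : 64 ≤ κ) (hn : P.n ≤ κ) (hd : P.digits ≤ κ) (msg : P.Poly → P.Poly) :
    (gSwitch A ρ msg).LogLe (κ ^ 6) := by
  refine LogLe.seqFinE hκ (a := 5) _ hd (fun t => ?_) (by norm_num)
  refine LogLe.bindE hκ (a := 0) (b := 4) _ (.query _ _) (fun p => ?_) (by norm_num)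
  exact LogLe.bindE hκ (a := 3) (b := 0) _ (logLe_vis hκ (a := 1) hn (by simp; omega) (by norm_num))
    (fun _ => .pure _ _) (by norm_num)

theorem logLe_gKeys (hκ : 64 ≤ κ) (hn : P.n ≤ κ) (hd : P.digits ≤ κ) (hN : N ≤ κ) :
    (gKeys A h ρ).LogLe (κ ^ 10) := by
  refine LogLe.bindE hκ (a := 7) (b := 9) _ ?_ (fun p => ?_) (by norm_num)
  · refine LogLe.bindE hκ (a := 0) (b := 6) _ (.query _ _) (fun p => ?_) (by norm_num)
    refine LogLe.bindE hκ (a := 1) (b := 5) _ (.seqFinE hκ (a := 0) _ hN (fun i => .coin _ _)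
      (by norm_num)) (fun e => ?_) (by norm_num)
    refine LogLe.bindE hκ (a := 3) (b := 0) _ (logLe_vis hκ (a := 2) hn ?_ (by norm_num))
      (fun _ => .pure _ _) (by norm_num)
    rw [List.length_cons, length_flatten_ofFn_const (c := 2) fun i => rfl]
    exact le_sq hκ (by omega)
  · refine LogLe.bindE hκ (a := 6) (b := 8) _ (logLe_gSwitch hκ hn hd _) (fun rlk => ?_)
      (by norm_num)
    exact LogLe.bindE hκ (a := 7) (b := 0) _ (.seqFinE hκ _ (P.slots_le.trans hn)
      (fun k => logLe_gSwitch hκ hn hd _) (by norm_num)) (fun _ => .pure _ _) (by norm_num)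

theorem logLe_gBoot (hκ : 64 ≤ κ) (hn : P.n ≤ κ) (hN : N ≤ κ) (i : Fin N)
    (Φ : Matrix (Fin P.slots) (Fin P.slots) ℂ) (B : ℕ) (c : Ct P) :
    (gBoot A h ρ K lam i Φ B c).LogLe (κ ^ 10) := by
  refine LogLe.bindE hκ (b := 9) _ (logLe_gRer hκ hn i c) (fun c => ?_) (by norm_num)
  refine LogLe.bindE hκ (b := 8) _ (logLe_gSend hκ hn c) (fun _ => ?_) (by norm_num)
  have hcoins : ∀ k : Kind, (seqFin fun _ : Fin N => (coin' k : Prog P P.Poly)).LogLe (κ ^ 1) :=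
    fun k => .seqFinE hκ (a := 0) _ hN (fun i => .coin _ _) (by norm_num)
  refine LogLe.bindE hκ (b := 7) _ (hcoins _) (fun M => ?_) (by norm_num)
  refine LogLe.bindE hκ (b := 6) _ (hcoins _) (fun e0 => ?_) (by norm_num)
  refine LogLe.bindE hκ (b := 5) _ (hcoins _) (fun e1 => ?_) (by norm_num)
  refine LogLe.bindE hκ (a := 0) (b := 4) _ (.query _ _) (fun p => ?_) (by norm_num)
  refine LogLe.bindE hκ (a := 3) (b := 0) _ (logLe_vis hκ (a := 2) hn ?_ (by norm_num))
    (fun _ => .pure _ _) (by norm_num)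
  rw [List.length_cons, length_flatten_ofFn_const (c := 5) fun i => rfl]
  exact le_sq hκ (by omega)

theorem logLe_gLocal (hκ : 64 ≤ κ) (hn : P.n ≤ κ) (hN : N ≤ κ) (i : Fin N) {d : ℕ}
    (own : Fin d → P.Msg)
    (Is : List (Instr P d)) (regs : List (Ct P)) :
    (gLocal A h ρ K lam i own Is regs).LogLe (Is.length * κ ^ 10) := by
  induction Is generalizing regs with
  | nil => exact .pure _ _
  | cons I Is ih =>
    refine LogLe.mono (b := κ ^ 10 + Is.length * κ ^ 10) ?_
      (by rw [List.length_cons, Nat.succ_mul]; omega)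
    refine LogLe.bind ?_ fun c => ih _
    cases I with
    | boot a Φ B => exact logLe_gBoot hκ hn hN i Φ B _
    | _ => exact .pure _ _

end LogLe

section Training

open Prog

variable {P : Params} {T : Training P} {A : Finset (Fin T.N)} {h : Fin T.N}

/-- A program may output the same cell many times, so the number of instructions does not bound the
length of the output. Since outputs are charged for, that length has to be bounded separately. -/
theorem logLe_gTotal {X : Type} {E : Enc X} (hT : T.Fits E) (ρ : Fin T.N → P.Poly) (x : T.Inputs) :
    (gTotal T A h ρ x).LogLe (E.κ ^ 19) := by
  have hκ := E.le_κ
  have hn := hT.params.n_le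
  have hN := hT.N_le
  have hrer : ∀ (K : PubKeys P) (i : Fin T.N) (c : Ct P), (do
      let c ← gRer A K i c
      gSend A c
      pure c).LogLe (E.κ ^ 8) := fun K i c =>
    LogLe.bindE hκ (b := 4) _ (logLe_gRer hκ hn i c) (fun c => LogLe.bindE hκ (b := 0) _
      (logLe_gSend hκ hn c) (fun _ => .pure _ _) (by norm_num)) (by norm_num)
  refine LogLe.bindE hκ (a := 2) (b := 18) _ (logLe_vis hκ (a := 1) hn (by simpa using hN)
    (by norm_num)) (fun _ => ?_) (by norm_num)
  refine LogLe.bindE hκ (b := 17) _ (logLe_gKeys hκ hn hT.params.digits_le hN) (fun K => ?_)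
    (by norm_num)
  refine LogLe.bindE hκ (a := 8) (b := 16) _ (.seqFinE hκ _ hT.nW_le (fun j => logLe_gRer hκ hn _ _)
    (by norm_num)) (fun W => ?_) (by norm_num)
  refine (LogLe.foldlM (b := E.κ ^ 15) (fun W k => ?_) _ _).mono ?_
  · refine LogLe.bindE hκ (a := 9) (b := 14) _ (.seqFinE hκ _ hT.nW_le (fun j => hrer K _ _)
      (by norm_num)) (fun W => ?_) (by norm_num)
    refine LogLe.bindE hκ (a := 13) (b := 11) _ (.seqFinE hκ (a := 12) _ hN (fun i => ?_)
      (by norm_num)) (fun G => ?_) (by norm_num)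
    · refine LogLe.bindE hκ (a := 11) (b := 9) _ ((logLe_gLocal hκ hn hN i _ _ _).mono ?_)
        (fun regs => .seqFinE hκ _ hT.nW_le (fun j => hrer K _ _) (by norm_num)) (by norm_num)
      rw [pow_succ _ 10, mul_comm]
      exact Nat.mul_le_mul_left _ (hT.lgd_le k i)
    · exact .seqFinE hκ _ hT.nW_le (fun j => logLe_gBoot hκ hn hN _ _ _ _) (by norm_num)
  · rw [List.length_finRange, pow_succ _ 15, mul_comm]
    exact Nat.mul_le_mul_left _ hT.m_le

end Training

/-! ## The simulator -/

section Samples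

variable {P : Params} {α β γ : Type}

/-- The coins `cs`, decoded by `dec`, are a sample of `μ`; further coins are not touched. -/
def Samples (cs : List Coin) (dec : List ℤ → α) (μ : PMF α) : Prop :=
  ∀ (cs' : List Coin) (F : α → List ℤ → ℝ≥0∞),
    ex ((cs ++ cs').mapM Coin.dist) (fun c => F (dec c) (c.drop cs.length)) =
      ex μ fun a => ex (cs'.mapM Coin.dist) fun c => F a c

theorem ex_mapM_cons (c : Coin) (cs : List Coin) (F : List ℤ → ℝ≥0∞) :
    ex ((c :: cs).mapM Coin.dist) F =
      ex c.dist fun z => ex (cs.mapM Coin.dist) fun zs => F (z :: zs) := by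
  rw [List.mapM_cons, ex_bind']
  simp only [ex_bind', ex_pure']

theorem Samples.nil (a : α) : Samples [] (fun _ => a) (PMF.pure a) := fun cs' F => by
  rw [ex_pure]
  rfl

theorem Samples.single (c : Coin) (g : ℤ → α) :
    Samples [c] (fun l => g (l.getD 0 0)) (c.dist.map g) := fun cs' F => by
  rw [List.singleton_append, ex_mapM_cons, ex_map]
  rfl

/-- The second decoder reads the coins that the first has left untouched, whence independence. -/
theorem Samples.map₂ {cs₁ cs₂ : List Coin} {d₁ : List ℤ → α} {d₂ : List ℤ → β} {μ : PMF α}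
    {ν : PMF β} (h₁ : Samples cs₁ d₁ μ) (h₂ : Samples cs₂ d₂ ν) (f : α → β → γ) :
    Samples (cs₁ ++ cs₂) (fun l => f (d₁ l) (d₂ (l.drop cs₁.length)))
      (μ.bind fun a => ν.map fun b => f a b) := fun cs' F => by
  rw [List.append_assoc, List.length_append]
  have := h₁ (cs₂ ++ cs') fun a l => F (f a (d₂ l)) (l.drop cs₂.length)
  simp only [List.drop_drop] at this
  rw [this, ex_bind]
  refine ex_congr fun a => ?_
  rw [h₂ cs' fun b l => F (f a b) l, ex_map]

theorem Samples.congr {cs : List Coin} {d d' : List ℤ → α} {μ ν : PMF α} (h : Samples cs d μ)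
    (hd : ∀ l, d' l = d l) (hμ : ∀ F, ex ν F = ex μ F) : Samples cs d' ν := fun cs' F => by
  simp only [hd, hμ]
  exact h cs' F

theorem Samples.map {cs : List Coin} {d : List ℤ → α} {μ : PMF α} (h : Samples cs d μ)
    (f : α → β) : Samples cs (fun l => f (d l)) (μ.map f) := fun cs' F => by
  rw [ex_map]
  exact h cs' fun a => F (f a)

theorem Samples.seqFin {cs : List Coin} {d : List ℤ → α} {μ : PMF α} (h : Samples cs d μ) (k : ℕ) :
    Samples (List.replicate k cs).flatten (fun l (i : Fin k) => d (l.drop (i * cs.length)))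
      (Poseidon.seqFin fun _ : Fin k => μ) := by
  induction k with
  | zero => exact (Samples.nil Fin.elim0).congr (fun l => funext fun i => i.elim0) fun F => rfl
  | succ k ih =>
    rw [List.replicate_succ, List.flatten_cons]
    refine (h.map₂ ih fun a v => (Fin.cons a v : Fin (k + 1) → α)).congr
        (fun l => funext fun i => ?_)
      fun F => ?_
    · refine Fin.cases ?_ (fun j => ?_) i
      · simp
      · simp [Nat.succ_mul, add_comm]
    · rw [ex_seqFin_succ, ex_bind]
      simp only [ex_map]

/-- The coin from which a coefficient is computed. -/
def Kind.coin : Kind → Coin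
  | .tern => .unif 3
  | .err => .gauss
  | .unif B => .unif B

/-- The difference between a coefficient and its coin. -/
def Kind.offset : Kind → ℤ
  | .tern => -1
  | _ => 0

theorem Kind.dist_eq (κ : Kind) : κ.dist = κ.coin.dist.map fun z => z + κ.offset := by
  cases κ with
  | tern => rfl
  | err =>
    simp only [Kind.dist, Kind.coin, Kind.offset, Coin.dist, add_zero]
    exact (PMF.map_id _).symm
  | unif B =>
    simp only [Kind.dist, Kind.coin, Kind.offset, Coin.dist, add_zero]
    exact (PMF.map_id _).symm

/-- Polynomials with coefficients of kind `κ` from coins. -/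
def Kind.dec (P : Params) (κ : Kind) (l : List ℤ) : P.Poly := fun j => l.getD j 0 + κ.offset

theorem Kind.samples (κ : Kind) :
    Samples (List.replicate P.n κ.coin) (κ.dec P) (κ.poly P) := by
  have := (Samples.single κ.coin fun z => z + κ.offset).seqFin P.n
  rw [← κ.dist_eq, List.flatten_replicate_singleton] at this
  exact this.congr (fun l => funext fun j => by simp [Kind.dec]) fun F => rfl

def INode.coins (P : Params) : INode → List Coin
  | .coin κ => List.replicate P.n κ.coin
  | .rer _ => List.replicate P.n (.unif P.QL) ++ List.replicate P.n (.unif P.QL)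

def INode.dec (P : Params) : INode → List ℤ → Item P
  | .coin κ, l => ⟨.ideal, κ.dec P l, 0, 0⟩
  | .rer _, l => ⟨.ideal, (Kind.unif P.QL).dec P l, (Kind.unif P.QL).dec P (l.drop P.n), 0⟩

/-- Whatever its mode, a re-randomization is sampled in its ideal form, for which `2 n` uniform
coefficients suffice. -/
theorem INode.samples (ν : INode) : Samples (ν.coins P) (ν.dec P) (ν.idealize.dist P) := by
  cases ν with
  | coin κ =>
    exact κ.samples.map fun v => (⟨.ideal, v, 0, 0⟩ : Item P)
  | rer m =>
    refine ((Kind.unif P.QL).samples.map₂ (Kind.unif P.QL).samples fun v w =>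
      (⟨.ideal, v, w, 0⟩ : Item P)).congr (fun l => ?_) fun F => rfl
    simp [INode.dec]

def itemsCoins (P : Params) (νs : List INode) : List Coin := νs.flatMap (INode.coins P)

def decItems (P : Params) : List INode → List ℤ → List (Item P)
  | [], _ => []
  | ν :: νs, l => ν.dec P l :: decItems P νs (l.drop (ν.coins P).length)

theorem samples_items (νs : List INode) :
    Samples (itemsCoins P νs) (decItems P νs) (itemsDist P (νs.map INode.idealize)) := by
  induction νs with
  | nil => exact .nil _
  | cons ν νs ih => exact ν.samples.map₂ ih List.cons

def ansCoins (P : Params) (k : ℕ) : List Coin :=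
  (List.replicate k (List.replicate P.n (Coin.unif P.QL) ++
    List.replicate P.n (Coin.unif P.QL))).flatten

theorem samples_ans (k : ℕ) : Samples (ansCoins P k) (decAns P k) (ansDist P k) := by
  induction k with
  | zero => exact .nil _
  | succ k ih =>
    have h := (Kind.unif P.QL).samples (P := P)
    refine ((h.map₂ h Prod.mk).map₂ ih List.cons).congr (fun l => ?_) fun F => ?_
    · simp only [decAns, List.length_replicate, List.length_append, List.drop_drop]
      congr 2 <;> exact funext fun j => (add_zero _).symm
    · simp only [ansDist, ex_bind, ex_map]

theorem mem_support_mapM {cs : List Coin} {c : List ℤ} (h : c ∈ (cs.mapM Coin.dist).support) :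
    List.Forall₂ (fun k z => z ∈ (Coin.dist k).support) cs c := by
  induction cs generalizing c with
  | nil =>
    obtain rfl : c = [] := (PMF.mem_support_pure_iff _ _).1 h
    exact .nil
  | cons k cs ih =>
    rw [List.mapM_cons] at h
    obtain ⟨z, hz, h⟩ := (PMF.mem_support_bind_iff _ _ _).1 h
    obtain ⟨zs, hzs, h⟩ := (PMF.mem_support_bind_iff _ _ _).1 h
    obtain rfl := (PMF.mem_support_pure_iff _ _).1 h
    exact .cons hz (ih hzs)

end Samples

/-! ### The inputs of the coalition as memory cells -/

section Cells

variable {P : Params} (T : Training P) (A : Finset (Fin T.N))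

/-- The entries of `inputsOf`, as functions of the inputs. -/
def inputCells : List (T.Inputs → ℤ) :=
  (List.finRange T.N).flatMap fun i =>
    if i ∈ A then
      ((List.finRange T.d).flatMap fun t =>
        List.ofFn fun j x => P.encode P.S ((x i).data t) j) ++
        (if i = T.first then
          (List.finRange T.nW).flatMap fun t => List.ofFn fun j x => P.encode P.S ((x i).w0 t) j
        else [])
    else []

theorem inputsOf_eq (x : T.Inputs) : T.inputsOf A x = (inputCells T A).map fun f => f x := by
  rw [Training.inputsOf, inputCells, List.map_flatMap]
  congr 1
  funext i
  split_ifs <;> simp [List.map_flatMap, List.map_ofFn, Function.comp_def]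

variable {T A}

theorem mem_inputCells_data {i : Fin T.N} (hi : i ∈ A) (t : Fin T.d) (j : Fin P.n) :
    (fun x : T.Inputs => P.encode P.S ((x i).data t) j) ∈ inputCells T A := by
  refine List.mem_flatMap.2 ⟨i, List.mem_finRange i, ?_⟩
  rw [if_pos hi]
  exact List.mem_append_left _ (List.mem_flatMap.2 ⟨t, List.mem_finRange t,
    List.mem_ofFn.2 ⟨j, rfl⟩⟩)

theorem mem_inputCells_w0 (hi : T.first ∈ A) (t : Fin T.nW) (j : Fin P.n) :
    (fun x : T.Inputs => P.encode P.S ((x T.first).w0 t) j) ∈ inputCells T A := by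
  refine List.mem_flatMap.2 ⟨T.first, List.mem_finRange _, ?_⟩
  rw [if_pos hi, if_pos rfl]
  exact List.mem_append_right _ (List.mem_flatMap.2 ⟨t, List.mem_finRange t,
    List.mem_ofFn.2 ⟨j, rfl⟩⟩)

theorem abs_encode_le (s : ℝ) (z : P.Msg) (j : Fin P.n) : |P.encode s z j| ≤ 2 ^ T.kappa := by
  rw [Params.encode, abs_of_nonneg (red_nonneg P.QL_pos _ _)]
  exact (red_lt P.QL_pos _ _).le.trans (by exact_mod_cast T.QL_le)

theorem abs_inputCells_le {f : T.Inputs → ℤ} (hf : f ∈ inputCells T A) (x : T.Inputs) :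
    |f x| ≤ 2 ^ T.kappa := by
  obtain ⟨i, -, hf⟩ := List.mem_flatMap.1 hf
  split_ifs at hf
  · rcases List.mem_append.1 hf with hf | hf <;>
    · obtain ⟨t, -, hf⟩ := List.mem_flatMap.1 hf
      obtain ⟨j, rfl⟩ := List.mem_ofFn.1 hf
      exact abs_encode_le _ _ _
  · rcases List.mem_append.1 hf with hf | hf
    · obtain ⟨t, -, hf⟩ := List.mem_flatMap.1 hf
      obtain ⟨j, rfl⟩ := List.mem_ofFn.1 hf
      exact abs_encode_le _ _ _
    · simp at hf
  · simp at hf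

theorem length_inputCells_le : (inputCells T A).length ≤ T.N * (T.d * P.n + T.nW * P.n) := by
  have h1 : ∀ (k : ℕ) (f : Fin k → Fin P.n → T.Inputs → ℤ),
      ((List.finRange k).flatMap fun t => List.ofFn (f t)).length ≤ k * P.n := fun k f => by
    rw [List.flatMap_def]
    exact (length_flatten_map_le _ fun t _ => (List.length_ofFn).le).trans_eq
      (by rw [List.length_finRange])
  rw [inputCells, List.flatMap_def]
  refine (length_flatten_map_le (c := T.d * P.n + T.nW * P.n) _ fun i _ => ?_).trans_eq
    (by rw [List.length_finRange])
  split_ifs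
  · rw [List.length_append]
    exact Nat.add_le_add (h1 _ _) (h1 _ _)
  · rw [List.append_nil]
    exact (h1 _ _).trans (Nat.le_add_right _ _)
  · exact Nat.zero_le _

end Cells

/-! ### The coins of the simulator -/

section Coins

variable {P : Params}

def Coin.Fits (κ : ℕ) : Coin → Prop
  | .unif B => B ≤ 2 ^ κ
  | .gauss => True

theorem Coin.cost_le {κ : ℕ} {c : Coin} (h : c.Fits κ) : c.cost ≤ κ + 2 := by
  cases c with
  | unif B =>
    have : Nat.size B ≤ κ + 1 :=
      Nat.size_le.2 (lt_of_le_of_lt h (Nat.pow_lt_pow_right (by norm_num) (Nat.lt_succ_self _)))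
    simp only [Coin.cost]
    omega
  | gauss => simp only [Coin.cost]; omega

/-- The inequality is strict to leave room for the offset between a coin and a coefficient. -/
theorem Coin.abs_lt {κ : ℕ} (hκ : 64 ≤ κ) {c : Coin} (h : c.Fits κ) {z : ℤ}
    (hz : z ∈ c.dist.support) : |z| < 2 ^ κ := by
  cases c with
  | unif B =>
    rcases Nat.eq_zero_or_pos B with rfl | hB
    · have := mem_support_unif hz
      obtain rfl : z = 0 := by
        have h1 := this.1
        have h2 := this.2
        push_cast at h2
        omega
      simp
    · obtain ⟨h1, h2⟩ := mem_support_unif_lt hB hz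
      rw [abs_of_nonneg h1]
      exact h2.trans_le (by exact_mod_cast h)
  | gauss =>
    exact lt_of_lt_of_le (lt_of_le_of_lt (mem_support_gaussErr hz) (by norm_num : (19 : ℤ) < 64))
      (two_pow_le hκ le_rfl)

theorem Kind.coin_fits {κ : ℕ} (hκ : 64 ≤ κ) {k : Kind} (h : (INode.coin k).Fits κ) :
    k.coin.Fits κ := by
  cases k with
  | tern =>
    have := two_pow_le hκ (z := 3) (by norm_num)
    change 3 ≤ 2 ^ κ
    exact_mod_cast this
  | err => trivial
  | unif B => exact h

theorem INode.coins_fits {κ : ℕ} (hκ : 64 ≤ κ) (hQ : P.QL ≤ 2 ^ κ) {ν : INode} (h : ν.Fits κ) :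
    ∀ c ∈ ν.coins P, c.Fits κ := by
  intro c hc
  cases ν with
  | coin k =>
    rw [List.eq_of_mem_replicate hc]
    exact Kind.coin_fits hκ h
  | rer m =>
    rcases List.mem_append.1 hc with hc | hc <;>
    · rw [List.eq_of_mem_replicate hc]
      exact hQ

theorem INode.length_coins_le (ν : INode) : (ν.coins P).length ≤ P.n + P.n := by
  cases ν <;> simp [INode.coins]

/-- The coins of the simulator. -/
def simCoins (T : Training P) (A : Finset (Fin T.N)) : List Coin :=
  (List.replicate T.N (List.replicate P.n Kind.tern.coin)).flatten ++
    (itemsCoins P (itemNodes (totalNodes T A)) ++ ansCoins P (queries (totalNodes T A)))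

def decSk (T : Training P) (c : List ℤ) (i : Fin T.N) : P.Poly :=
  Kind.tern.dec P (c.drop (i * (List.replicate P.n Kind.tern.coin).length))

variable {T : Training P} {A : Finset (Fin T.N)}

theorem simCoins_fits : ∀ c ∈ simCoins T A, c.Fits T.kappa := by
  intro c hc
  rcases List.mem_append.1 hc with hc | hc
  · obtain ⟨l, hl, hc⟩ := List.mem_flatten.1 hc
    rw [List.eq_of_mem_replicate hl] at hc
    rw [List.eq_of_mem_replicate hc]
    exact Kind.coin_fits T.le_kappa trivial
  · rcases List.mem_append.1 hc with hc | hc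
    · obtain ⟨ν, hν, hc⟩ := List.mem_flatMap.1 hc
      exact INode.coins_fits T.le_kappa T.QL_le (fits_itemNodes (fits_totalNodes T A) ν hν) c hc
    · obtain ⟨l, hl, hc⟩ := List.mem_flatten.1 hc
      rw [List.eq_of_mem_replicate hl] at hc
      rcases List.mem_append.1 hc with hc | hc <;>
      · rw [List.eq_of_mem_replicate hc]
        exact T.QL_le

theorem length_simCoins_le : (simCoins T A).length ≤ T.kappa ^ 10 := by
  have hT := T.fits (ansEnc T 0) rfl
  have hn : P.n ≤ T.kappa := hT.params.n_le
  have hN : T.N ≤ T.kappa := hT.N_le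
  have h1 : ((List.replicate T.N (List.replicate P.n Kind.tern.coin)).flatten).length =
      T.N * P.n := by simp
  have h2 : (itemsCoins P (itemNodes (totalNodes T A))).length ≤
      (itemNodes (totalNodes T A)).length * (P.n + P.n) := by
    rw [itemsCoins, List.flatMap_def]
    exact length_flatten_map_le _ fun ν _ => ν.length_coins_le
  have h3 : (ansCoins P (queries (totalNodes T A))).length =
      queries (totalNodes T A) * (P.n + P.n) := by simp [ansCoins]
  rw [simCoins, List.length_append, List.length_append, h1, h3]
  have h4 := length_itemNodes_add_queries (totalNodes T A)
  have h5 := length_totalNodes_le T A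
  have h6 : (itemNodes (totalNodes T A)).length * (P.n + P.n) + queries (totalNodes T A) *
      (P.n + P.n) ≤ T.kappa ^ 8 * (2 * T.kappa) := by
    rw [← add_mul, h4]
    exact Nat.mul_le_mul h5 (by omega)
  have h7 : T.N * P.n ≤ T.kappa ^ 2 := by
    rw [pow_two]
    exact Nat.mul_le_mul hN hn
  have h8 : T.kappa ^ 8 * (2 * T.kappa) = 2 * T.kappa ^ 9 := by ring
  have h9 : T.kappa ^ 2 ≤ T.kappa ^ 9 := (ansEnc T 0).pow_mono (by norm_num)
  have h10 : 64 * T.kappa ^ 9 ≤ T.kappa ^ 10 := (ansEnc T 0).mul_pow_le le_rfl (by norm_num)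
  omega

theorem ex_simCoins (T : Training P) (A : Finset (Fin T.N)) :
    ∃ k k', ∀ F : (Fin T.N → P.Poly) → List (Item P) → List (P.Poly × P.Poly) → ℝ≥0∞,
      (ex ((simCoins T A).mapM Coin.dist) fun c => F (decSk T c)
        (decItems P (itemNodes (totalNodes T A)) (c.drop k))
        (decAns P (queries (totalNodes T A)) (c.drop k'))) =
      ex (seqFin fun _ : Fin T.N => P.ternaryPoly) fun sk =>
        ex (itemsDist P ((itemNodes (totalNodes T A)).map INode.idealize)) fun r =>
          ex (ansDist P (queries (totalNodes T A))) fun ans => F sk r ans := by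
  have h := (Kind.tern.samples (P := P)).seqFin T.N |>.map₂
    ((samples_items (P := P) (itemNodes (totalNodes T A))).map₂
      (samples_ans (P := P) (queries (totalNodes T A))) Prod.mk) Prod.mk
  refine ⟨((List.replicate T.N (List.replicate P.n Kind.tern.coin)).flatten).length,
    ((List.replicate T.N (List.replicate P.n Kind.tern.coin)).flatten).length +
      (itemsCoins P (itemNodes (totalNodes T A))).length, fun F => ?_⟩
  have := h [] fun p _ => F p.1 p.2.1 p.2.2
  rw [List.append_nil] at this
  simp only [ex_bind, ex_map, ex_const, List.drop_drop] at this
  exact this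

end Coins

/-! ### Construction of the simulator -/

section Simulator

open Prog

variable {P : Params} {T : Training P} {A : Finset (Fin T.N)} {h : Fin T.N}

/-- Inputs and coins. -/
def SimInput (T : Training P) (A : Finset (Fin T.N)) : Type :=
  {p : T.Inputs × List ℤ // p.2.length = (simCoins T A).length ∧ ∀ z ∈ p.2, |z| < 2 ^ T.kappa}

/-- The index carries the inputs of all parties, but the memory shows those of `A` only. A program
that computes the visible values from this memory thereby proves that they do not depend on the
other inputs. -/
def simEnc (T : Training P) (A : Finset (Fin T.N)) : Enc (SimInput T A) where
  inp p := T.inputsOf A p.1.1 ++ p.1.2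
  len := (inputCells T A).length + (simCoins T A).length
  length_inp p := by rw [List.length_append, inputsOf_eq, List.length_map, p.2.1]
  κ := T.kappa
  le_κ := T.le_kappa

section Decoding

variable {X : Type} {E : Enc X} {S : Set (X → ℤ)} {l : X → List ℤ}

theorem Has.dec (hn : P.n ≤ E.κ) (κ : Kind) (hl : LAv E S l) (hb : ∀ x, ∀ z ∈ l x, |z| < 2 ^ E.κ) :
    Has E S (E.κ ^ 2) fun S => AvV E S 1 fun x => κ.dec P (l x) := by
  have hoff : |κ.offset| ≤ 1 := by cases κ <;> simp [Kind.offset]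
  have h : HasV E S 1 1 fun x => κ.dec P (l x) := fun j => by
    refine Has.weaken ((hl j).hasE.add (HasE.const (b := 1) κ.offset
      (hoff.trans (le_trans (by norm_num) E.le_bd_one)) (by norm_num)) (by norm_num)) le_rfl
      fun S₁ _ h => ⟨h.1, fun x => ?_⟩
    rw [E.bd_one]
    have hz : |(l x).getD j 0| < 2 ^ E.κ := by
      by_cases hj : (j : ℕ) < (l x).length
      · rw [List.getD_eq_getElem _ _ hj]
        exact hb x _ (List.getElem_mem hj)
      · rw [List.getD_eq_default _ _ (not_lt.1 hj)]
        simp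
    exact (abs_add_le _ _).trans (by omega)
  exact h.save hn

theorem Has.decItem (hn : P.n ≤ E.κ) (ν : INode) (hl : LAv E S l)
    (hb : ∀ x, ∀ z ∈ l x, |z| < 2 ^ E.κ) :
    Has E S (E.κ ^ 4) fun S => ItemAv E False S fun x => ν.dec P (l x) := by
  have hz : ∀ {S}, Has E S (E.κ ^ 1) fun S => AvV E S 1 fun _ => (0 : P.Poly) :=
    Has.constV hn .zero
  cases ν with
  | coin κ =>
    exact (Has.andE 4 (Has.dec hn κ hl hb) hz (inherited_avV _ _) (inherited_avV _ _)
      (by norm_num)).weaken le_rfl fun _ _ h => ⟨_, _, _, _, Or.inl rfl, h.1, h.2, h.2, rfl⟩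
  | rer m =>
    exact (Has.andE 4 (Has.dec hn (.unif P.QL) hl hb) (Has.andE 3 (Has.dec hn (.unif P.QL)
      (hl.drop P.n) fun x z hz => hb x z (List.mem_of_mem_drop hz)) hz (inherited_avV _ _)
      (inherited_avV _ _) (by norm_num)) (inherited_avV _ _)
      (fun _ _ hS h => ⟨h.1.mono hS, h.2.mono hS⟩) (by norm_num)).weaken le_rfl
      fun _ _ h => ⟨_, _, _, _, Or.inl rfl, h.1, h.2.1, h.2.2, rfl⟩

theorem exists_decItems (hn : P.n ≤ E.κ) (νs : List INode) (hl : LAv E S l)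
    (hb : ∀ x, ∀ z ∈ l x, |z| < 2 ^ E.κ) :
    ∃ ls : List (X → Item P), ls.length = νs.length ∧
      (∀ f ∈ ls, Has E S (E.κ ^ 4) fun S => ItemAv E False S f) ∧
      ∀ x, decItems P νs (l x) = ls.map fun f => f x := by
  induction νs generalizing l with
  | nil => exact ⟨[], rfl, by simp, fun x => rfl⟩
  | cons ν νs ih =>
    obtain ⟨ls, h1, h2, h3⟩ := ih (hl.drop (ν.coins P).length)
      fun x z hz => hb x z (List.mem_of_mem_drop hz)
    refine ⟨(fun x => ν.dec P (l x)) :: ls, by rw [List.length_cons, List.length_cons, h1],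
      fun f hf => ?_, fun x => by rw [decItems, h3, List.map_cons]⟩
    rcases List.mem_cons.1 hf with rfl | hf
    · exact Has.decItem hn ν hl hb
    · exact h2 f hf

theorem Has.decItems (hn : P.n ≤ E.κ) {νs : List INode} (hν : νs.length ≤ E.κ ^ 8) (hl : LAv E S l)
    (hb : ∀ x, ∀ z ∈ l x, |z| < 2 ^ E.κ) :
    Has E S (E.κ ^ 12) fun S => ListAv (ItemAv E False S) fun x =>
      Poseidon.decItems P νs (l x) := by
  obtain ⟨ls, h1, h2, h3⟩ := exists_decItems hn νs hl hb
  exact (Has.list (A := fun S f => ItemAv E False S f) (a := 4) (c := 8)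
    (fun _ _ _ hS h => h.mono hS) ls (by rwa [h1]) h2).weaken le_rfl fun _ _ h => ⟨ls, h, h3⟩

end Decoding

/-- Here `full` is false. This is admissible because all items are in mode `ideal` and because
ciphertexts of honest parties are never sent without a re-randomization. -/
theorem exists_gen_sim (h : Fin T.N) (k k' : ℕ) :
    ∃ S', LAv (simEnc T A) S' (simEnc T A).inp ∧ Gen (simEnc T A) (T.kappa ^ 55) S' ∧
      EvAv (simEnc T A) False S' fun p : SimInput T A =>
        (eval 0 (gTotal T A h (Function.update (decSk T p.1.2) h 0) p.1.1)
          ⟨decItems P (itemNodes (totalNodes T A)) (p.1.2.drop k),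
            decAns P (queries (totalNodes T A)) (p.1.2.drop k'), [], []⟩).2 := by
  have hT := T.fits (simEnc T A) rfl
  have hn := hT.params.n_le
  refine exists_gen_of_inputs (E := simEnc T A)
    (items := fun p => decItems P (itemNodes (totalNodes T A)) (p.1.2.drop k))
    (ans := fun p => decAns P (queries (totalNodes T A)) (p.1.2.drop k'))
    (s := fun p => 0) (ρ := fun p => Function.update (decSk T p.1.2) h 0)
    (inp := fun p => p.1.1) rfl (fun p z hz => ?_) fun S hl h0 => ?_
  · rcases List.mem_append.1 hz with hz | hz
    · rw [inputsOf_eq] at hz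
      obtain ⟨f, hf, rfl⟩ := List.mem_map.1 hz
      exact abs_inputCells_le hf _
    · exact (p.2.2 z hz).le
  have hc : LAv (simEnc T A) S fun p : SimInput T A => p.1.2 := by
    convert hl.drop (inputCells T A).length using 2 with p
    change _ = (T.inputsOf A p.1.1 ++ p.1.2).drop _
    rw [inputsOf_eq, List.drop_append_of_le_length (by simp), List.drop_eq_nil_of_le (by simp),
      List.nil_append]
  have hb : ∀ (m : ℕ) (p : SimInput T A), ∀ z ∈ p.1.2.drop m, |z| < 2 ^ (simEnc T A).κ :=
    fun m p z hz => p.2.2 z (List.mem_of_mem_drop hz)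
  have hcell : ∀ f ∈ inputCells T A, (∀ x, |f x| ≤ 2 ^ T.kappa) →
      AvE (simEnc T A) S 1 fun p => f p.1.1 := fun f hf hfb => by
    obtain ⟨i, hi, rfl⟩ := List.getElem_of_mem hf
    convert hl i using 2 with p
    change _ = (T.inputsOf A p.1.1 ++ p.1.2).getD i 0
    rw [inputsOf_eq, List.getD_append _ _ _ _ (by simpa using hi),
      List.getD_eq_getElem _ _ (by simpa using hi), List.getElem_map]
  refine ⟨?_, ?_, ?_, ?_, ?_⟩
  · exact (Has.decItems hn length_itemNodes_totalNodes_le (hc.drop k) (hb k)).weaken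
      (Enc.pow_mono _ (by norm_num)) fun _ _ h => h
  · exact (Has.intro (Q := fun S => ListAv (PairAv (simEnc T A) S) fun p : SimInput T A =>
      decAns P (queries (totalNodes T A)) (p.1.2.drop k')) ((hc.drop k').decAns _)).weaken
      (Nat.zero_le _) fun _ _ h => h
  · exact (Has.constV hn .zero).weaken (Enc.pow_mono _ (by norm_num)) fun _ _ h => h
  · refine (Has.finE (a := 2) 3 hT.N_le (Q := fun i S => AvV (simEnc T A) S 1
      fun p : SimInput T A => Function.update (decSk T p.1.2) h 0 i) (fun i => ?_)
      (fun _ => inherited_avV _ _) (by norm_num)).weaken (Enc.pow_mono _ (by norm_num))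
      fun _ _ h => h
    by_cases hi : i = h
    · subst hi
      simp only [Function.update_self]
      exact (Has.constV hn .zero).weaken (Enc.pow_mono _ (by norm_num)) fun _ _ h => h
    · simp only [Function.update_of_ne hi]
      exact Has.dec hn .tern (hc.drop _) (hb _)
  · refine (Has.intro (Q := fun S => InpAv (simEnc T A) S False A fun p : SimInput T A => p.1.1)
      ⟨fun i hi t j => ?_, fun hi t j => ?_⟩).weaken (Nat.zero_le _) fun _ _ h => h
    · exact hcell _ (mem_inputCells_data (hi.resolve_right id) t j) fun x => abs_encode_le _ _ _
    · exact hcell _ (mem_inputCells_w0 (hi.resolve_right id) t j) fun x => abs_encode_le _ _ _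

instance : Nonempty (SimInput T A) :=
  ⟨⟨(fun _ => ⟨0, 0⟩, List.replicate (simCoins T A).length 0), by simp, fun z hz => by
    rw [List.eq_of_mem_replicate hz]
    simp⟩⟩

theorem mem_support_simCoins {c : List ℤ} (hc : c ∈ ((simCoins T A).mapM Coin.dist).support) :
    c.length = (simCoins T A).length ∧ ∀ z ∈ c, |z| < 2 ^ T.kappa := by
  have hf := mem_support_mapM hc
  refine ⟨hf.length_eq.symm, fun z hz => ?_⟩
  obtain ⟨i, hi, rfl⟩ := List.getElem_of_mem hz
  have hi' : i < (simCoins T A).length := by rwa [hf.length_eq]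
  exact Coin.abs_lt T.le_kappa (simCoins_fits _ (List.getElem_mem hi')) (hf.get hi' hi)

/-- The game without the secrets of honest parties is played by a simulator. -/
theorem exists_simulator (T : Training P) (A : Finset (Fin T.N)) (h : Fin T.N) :
    ∃ Sim : Simulator, Sim.cost ≤ T.kappa ^ 60 ∧ ∀ (x : T.Inputs) (F : List ℤ → ℝ≥0∞),
      ex (Sim.run (T.inputsOf A x)) F = ex (seqFin fun _ : Fin T.N => P.ternaryPoly) fun sk =>
        ex (itemsDist P ((itemNodes (totalNodes T A)).map INode.idealize)) fun r =>
          ex (ansDist P (queries (totalNodes T A))) fun ans => F (T.inputsOf A x ++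
            (eval 0 (gTotal T A h (Function.update sk h 0) x) ⟨r, ans, [], []⟩).2.log) := by
  obtain ⟨k, k', hex⟩ := ex_simCoins T A
  obtain ⟨S, hl, hG, hev⟩ := exists_gen_sim (A := A) h k k'
  have hT := T.fits (simEnc T A) rfl
  let out : SimInput T A → List ℤ := fun p =>
    (eval 0 (gTotal T A h (Function.update (decSk T p.1.2) h 0) p.1.1)
      ⟨decItems P (itemNodes (totalNodes T A)) (p.1.2.drop k),
        decAns P (queries (totalNodes T A)) (p.1.2.drop k'), [], []⟩).2.log
  obtain ⟨ls, hls, hlog⟩ := hev.log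
  -- The number of visible values does not depend on the input, so it can be estimated at any one.
  have hlen : ls.length ≤ T.kappa ^ 19 := by
    obtain ⟨p⟩ : Nonempty (SimInput T A) := inferInstance
    have h1 := congrArg List.length (hlog p)
    have h2 := logLe_gTotal (A := A) (h := h) hT (Function.update (decSk T p.1.2) h 0) p.1.1 0
      ⟨decItems P (itemNodes (totalNodes T A)) (p.1.2.drop k),
        decAns P (queries (totalNodes T A)) (p.1.2.drop k'), [], []⟩
    rw [List.length_map] at h1
    rw [h1] at h2
    change _ ≤ 0 + T.kappa ^ 19 at h2
    rwa [Nat.zero_add] at h2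
  have hin : ListAv (· ∈ S) fun p : SimInput T A => T.inputsOf A p.1.1 := by
    refine ⟨(List.range (inputCells T A).length).map fun i p =>
      (T.inputsOf A p.1.1 ++ p.1.2).getD i 0,
      fun g hg => ?_, fun p => ?_⟩
    · obtain ⟨i, -, rfl⟩ := List.mem_map.1 hg
      exact (hl i).1
    · rw [List.map_map]
      refine List.ext_getElem (by simp [inputsOf_eq]) fun i h1 h2 => ?_
      simp only [List.getElem_map, List.getElem_range, Function.comp_apply]
      rw [List.getD_append _ _ _ _ h1, List.getD_eq_getElem _ _ h1]
  obtain ⟨f, hcost, hf⟩ := hG.wordFn (len := (inputCells T A).length + ls.length)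
    (fun p => T.inputsOf A p.1.1 ++ out p) (hin.append ⟨ls, hls, hlog⟩) fun p => by
      rw [List.length_append, inputsOf_eq, List.length_map]
      exact congrArg _ ((congrArg List.length (hlog p)).trans (List.length_map _))
  refine ⟨⟨simCoins T A, f⟩, ?_, fun x F => ?_⟩
  · have h1 : ((simCoins T A).map Coin.cost).sum ≤ (simCoins T A).length * (T.kappa + 2) := by
      have := List.sum_le_card_nsmul ((simCoins T A).map Coin.cost) (T.kappa + 2) fun c hc => by
        obtain ⟨k, hk, rfl⟩ := List.mem_map.1 hc
        exact Coin.cost_le (simCoins_fits k hk)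
      simpa using this
    have h64 := T.le_kappa
    have hE := fun {c e e' : ℕ} => (simEnc T A).mul_pow_le (c := c) (e := e) (e' := e')
    change ∀ {c e e' : ℕ}, c ≤ 64 → e < e' → c * T.kappa ^ e ≤ T.kappa ^ e' at hE
    have hpow := fun {e e' : ℕ} => (simEnc T A).pow_mono (e := e) (e' := e')
    change ∀ {e e' : ℕ}, e ≤ e' → T.kappa ^ e ≤ T.kappa ^ e' at hpow
    have h2 : (simCoins T A).length * (T.kappa + 2) ≤ 2 * T.kappa ^ 11 := by
      calc _ ≤ T.kappa ^ 10 * (2 * T.kappa) := Nat.mul_le_mul length_simCoins_le (by omega)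
        _ = _ := by ring
    have h3 : T.kappa ^ 55 * ((simEnc T A).W + 1) ≤ T.kappa ^ 57 :=
      (simEnc T A).cost_le (a := 55) le_rfl
    have h4 : (inputCells T A).length ≤ 2 * T.kappa ^ 3 := by
      refine length_inputCells_le.trans ?_
      have hn : P.n ≤ T.kappa := hT.params.n_le
      have hW : T.nW ≤ T.kappa := hT.nW_le
      have hN : T.N ≤ T.kappa := hT.N_le
      calc _ ≤ T.kappa * (T.kappa * T.kappa + T.kappa * T.kappa) := Nat.mul_le_mul hN
            (Nat.add_le_add (Nat.mul_le_mul T.d_le hn) (Nat.mul_le_mul hW hn))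
        _ = _ := by ring
    have h5 : T.kappa ^ 3 ≤ T.kappa ^ 57 := hpow (by norm_num)
    have h6 : T.kappa ^ 11 ≤ T.kappa ^ 57 := hpow (by norm_num)
    have h7 : T.kappa ^ 19 ≤ T.kappa ^ 57 := hpow (by norm_num)
    have h8 : 64 * T.kappa ^ 57 ≤ T.kappa ^ 60 := hE le_rfl (by norm_num)
    simp only [Simulator.cost]
    omega
  · rw [Simulator.run, ex_map, ← hex fun sk r ans => F (T.inputsOf A x ++
      (eval 0 (gTotal T A h (Function.update sk h 0) x) ⟨r, ans, [], []⟩).2.log)]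
    refine ex_congr_support fun c hc => ?_
    exact congrArg F (hf ⟨(x, c), mem_support_simCoins hc⟩)

end Simulator

/-! ## The view of a coalition is simulated -/

section WpCompl

open Prog

variable {P : Params} {α : Type}

theorem Prog.wp_compl {K : (P.Poly → P.Poly) → PMF (P.Poly × P.Poly)} (p : Prog P α)
    {F : α → List ℤ → ℝ≥0∞} (hF : ∀ a l, F a l ≤ 1) (l : List ℤ) :
    wp K p F l + wp K p (fun a l => 1 - F a l) l = 1 := by
  induction p generalizing l with
  | ret a => exact add_tsub_cancel_of_le (hF _ _)
  | coin κ k ih =>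
    simp only [wp]
    rw [← ex_add]
    simp only [ih, ex_const]
  | query msg k ih =>
    simp only [wp]
    rw [← ex_add]
    simp only [ih, ex_const]
  | rer pk0 pk1 c k ih =>
    simp only [wp]
    rw [← ex_add]
    simp only [ih, ex_const]
  | emit v k ih => exact ih _

/-- The comparison with the protocol gives upper bounds only. The upper bound for the complementary
test is the missing lower bound. -/
theorem near_of_compl {ε a b a' b' : ℝ≥0∞} (h : a ≤ b + ε) (h' : a' ≤ b' + ε) (ha : a + a' = 1)
    (hb : b + b' = 1) : Near ε a b := by
  refine ⟨h, ?_⟩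
  have hb' : b' ≠ ∞ := fun e => by simp [e] at hb
  have : b + b' ≤ a + ε + b' := by
    rw [hb, ← ha, add_right_comm, add_assoc]
    exact add_le_add_right h' a
  exact (ENNReal.add_le_add_iff_right hb').1 this

end WpCompl

section Final

open Prog

variable {P : Params} {T : Training P} {A : Finset (Fin T.N)} {h : Fin T.N}

/-- The view of the corrupted parties is close to the game. -/
theorem near_view (hh : h ∉ A) (x : T.Inputs) (hx : T.overflow x ≤ tick T.lam)
    {F : List ℤ → ℝ≥0∞} (hF : ∀ l, F l ≤ 1) :
    Near ((T.kappa ^ 8 * P.n + 1 : ℕ) * tick T.lam) (ex (T.view A x) F)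
      (ex (seqFin fun _ : Fin T.N => P.ternaryPoly) fun sk =>
        wp (encKernel (sk h)) (gTotal T A h (Function.update sk h 0) x)
          (fun _ l => F (T.inputsOf A x ++ l)) []) := by
  have hε : ((totalNodes T A).length * flood P T.lam + T.overflow x : ℝ≥0∞) ≤
      (T.kappa ^ 8 * P.n + 1 : ℕ) * tick T.lam := by
    have h1 : ((totalNodes T A).length : ℝ≥0∞) ≤ (T.kappa ^ 8 : ℕ) :=
      Nat.cast_le.2 (length_totalNodes_le T A)
    rw [Nat.cast_add, Nat.cast_mul, Nat.cast_one, add_mul, one_mul, mul_assoc]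
    exact add_le_add (mul_le_mul' h1 le_rfl) hx
  refine (near_of_compl (ex_view_le hh x F hF)
    (ex_view_le hh x (fun l => 1 - F l) fun _ => tsub_le_self) (ex_compl hF) ?_).mono hε
  rw [← ex_add]
  simp only [Prog.wp_compl _ (fun _ l => hF _), ex_const]

/-- The summands come from flooding, overflow, the step with key-dependent messages, and the hybrid
argument over at most `κ ^ 8` items. -/
theorem error_le {κ n : ℕ} (hκ : 64 ≤ κ) (hn : n ≤ κ) (c : ℕ) :
    κ ^ 8 * n + 1 + (κ ^ 70 + 4 * c) + κ ^ 8 * (κ ^ 58 + 4 * c) ≤ κ ^ 80 * (c + 1) := by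
  have hpow : ∀ {e e' : ℕ}, e ≤ e' → κ ^ e ≤ κ ^ e' := fun h => Nat.pow_le_pow_right (by omega) h
  have h1 : κ ^ 8 * n ≤ κ ^ 70 := by
    refine (Nat.mul_le_mul_left _ hn).trans ?_
    rw [← pow_succ]
    exact hpow (by norm_num)
  have h2 : κ ^ 8 * (κ ^ 58 + 4 * c) = κ ^ 66 + 4 * (κ ^ 8 * c) := by ring
  have h3 : κ ^ 8 * c ≤ κ ^ 70 * c := Nat.mul_le_mul_right _ (hpow (by norm_num))
  have h4 : 1 ≤ κ ^ 70 := Nat.one_le_pow _ _ (by omega)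
  have h5 : c ≤ κ ^ 70 * c := Nat.le_mul_of_pos_left _ h4
  have h6 : κ ^ 66 ≤ κ ^ 70 := hpow (by norm_num)
  have h7 : 64 * κ ^ 70 ≤ κ ^ 80 := by
    refine (Nat.mul_le_mul_right _ hκ).trans ?_
    rw [← pow_succ']
    exact hpow (by norm_num)
  calc _ ≤ 64 * κ ^ 70 * (c + 1) := by
        generalize κ ^ 70 = a at *
        generalize κ ^ 66 = b at *
        rw [h2, mul_add, mul_one, mul_assoc]
        omega
    _ ≤ _ := Nat.mul_le_mul_right _ h7

/-- The view of the corrupted parties is close to the game without the secrets of the others. -/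
theorem near_view_ideal (hsec : SecurityLevel P T.lam) (hh : h ∉ A) (x : T.Inputs)
    (hx : T.overflow x ≤ tick T.lam) (D : Distinguisher) (post : List ℤ) :
    Near ((T.kappa ^ 80 * (D.cost + 1) : ℕ) * tick T.lam)
      (ex (T.view A x) fun l => D.pr (l ++ post))
      (ex (seqFin fun _ : Fin T.N => P.ternaryPoly) fun sk =>
        ex (itemsDist P ((itemNodes (totalNodes T A)).map INode.idealize)) fun r =>
          ex (ansDist P (queries (totalNodes T A))) fun ans => D.pr (T.inputsOf A x ++ (eval 0
            (gTotal T A h (Function.update sk h 0) x) ⟨r, ans, [], []⟩).2.log ++ post)) := by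
  have hview := near_view hh x hx (F := fun l => D.pr (l ++ post)) fun _ => D.pr_le_one _
  have hsmall : ∀ sk ∈ (seqFin fun _ : Fin T.N => P.ternaryPoly).support, ∀ i,
      SmallV T.kappa (sk i) := fun sk hsk i =>
    (smallV_ternary (mem_support_seqFin hsk i)).mono (Nat.zero_le _)
  -- The share of `h` is redrawn as `s` and averaged over last, with all items fixed, as in the game
  -- that defines the security level.
  have hfront : (ex (seqFin fun _ : Fin T.N => P.ternaryPoly) fun sk =>
      wp (encKernel (sk h)) (gTotal T A h (Function.update sk h 0) x)
        (fun _ l => D.pr (T.inputsOf A x ++ l ++ post)) []) =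
      ex (seqFin fun _ : Fin T.N => P.ternaryPoly) fun sk =>
        ex (itemsDist P (itemNodes (totalNodes T A))) fun r => ex P.ternaryPoly fun s =>
          wpI (encKernel s) (gTotal T A h (Function.update sk h 0) x) r
            (fun _ l => D.pr (T.inputsOf A x ++ l ++ post)) [] := by
    rw [ex_seqFin_update _ h]
    refine ex_congr fun sk => ?_
    rw [ex_comm]
    refine ex_congr fun s => ?_
    rw [Function.update_self, Function.update_idem, wp_eq_ex_wpI (ok_gTotal hh x)]
  have hkdm : Near ((T.kappa ^ 70 + 4 * D.cost : ℕ) * tick T.lam) _ _ :=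
    Near.ex fun sk hsk => Near.ex (μ := itemsDist P (itemNodes (totalNodes T A))) fun r hr =>
      near_kdm hsec hh (hsmall sk hsk)
        (smallItems_of_mem_support length_itemNodes_totalNodes_le
          (fits_itemNodes (fits_totalNodes T A)) hr) x D (T.inputsOf A x) post
  have hideal : Near ((T.kappa ^ 8 * (T.kappa ^ 58 + 4 * D.cost) : ℕ) * tick T.lam) _ _ :=
    Near.ex (μ := seqFin fun _ : Fin T.N => P.ternaryPoly) fun sk hsk =>
      near_ideal (sk := sk) hsec hh (fun i => by
        by_cases hi : i = h
        · subst hi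
          rw [Function.update_self]
          exact fun j => by simp
        · rw [Function.update_of_ne hi]
          exact hsmall sk hsk i) x D (T.inputsOf A x) post
  rw [hfront] at hview
  simp only [wpI_unifKernel (ok_gTotal hh x) 0 _ _ [] []] at hkdm
  refine ((hview.trans hkdm).trans hideal).mono ?_
  rw [← add_mul, ← add_mul, ← Nat.cast_add, ← Nat.cast_add]
  refine mul_le_mul' (Nat.cast_le.2 ?_) le_rfl
  exact error_le T.le_kappa (T.fits (ansEnc T 0) rfl).params.n_le D.cost

/-- The estimate holds for each input separately, and for fixed `x` the list `aux (secret x)` is a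
constant that can be hard-wired. So it does not matter what the secret is, and the simulator is
chosen before it. -/
theorem exists_simulates (hsec : SecurityLevel P T.lam) (hA : A.card ≤ T.N - 1)
    (Adm : Fin T.N → Set (Input P T.d T.nW))
    (hAdm : ∀ x : T.Inputs, (∀ i, x i ∈ Adm i) → T.overflow x ≤ tick T.lam) :
    ∃ Sim : Simulator, Sim.cost ≤ T.kappa ^ 60 ∧
      ∀ {σ : Type} (secret : T.Inputs → σ), T.Simulates A Adm Sim
        (fun c => ((T.kappa ^ 80 * (c + 1) : ℕ) : ℝ) / 2 ^ T.lam) secret := by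
  -- As there is at least one party, the bound `T.N - 1` on the size of `A` leaves someone honest.
  obtain ⟨h, hh⟩ : ∃ h, h ∉ A := by
    by_contra! hall
    rw [Finset.eq_univ_iff_forall.2 hall, Finset.card_univ, Fintype.card_fin] at hA
    have := T.N_pos
    omega
  obtain ⟨Sim, hcost, hSim⟩ := exists_simulator T A h
  refine ⟨Sim, hcost, fun secret μ hμ aux D => ?_⟩
  rw [D.adv_le_iff_near]
  simp only [ex_bind, ex_map]
  refine Near.ex fun x hx => ?_
  rw [hSim x fun l => D.pr (l ++ aux (secret x))]
  exact near_view_ideal hsec hh x (hAdm x (hμ x hx)) D _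

end Final

end Poseidon

end

theorem proposition1 :
    ∃ p : Polynomial ℕ,
      ∀ (P : Poseidon.Params) (T : Poseidon.Training P)
        (Adm : Fin T.N → Set (Poseidon.Input P T.d T.nW)),
        Poseidon.SecurityLevel P T.lam →
        (∀ x : T.Inputs, (∀ i, x i ∈ Adm i) → T.overflow x ≤ (2 ^ T.lam)⁻¹) →
        ∀ A : Finset (Fin T.N), A.card ≤ T.N - 1 →
          ∃ Sim : Poseidon.Simulator,
            Sim.cost ≤ p.eval T.size ∧
            T.DataConfidential A Adm Sim
              (fun c => ((p.eval T.size : ℕ) : ℝ) * (c + 1) / 2 ^ T.lam) ∧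
            T.ModelConfidential A Adm Sim
              (fun c => ((p.eval T.size : ℕ) : ℝ) * (c + 1) / 2 ^ T.lam) := by
  -- The value at `T.size` is `T.kappa ^ 80`: this is the factor in the error, and it exceeds the
  -- cost `T.kappa ^ 60` of the simulator.
  refine ⟨(Polynomial.X + Polynomial.C 64) ^ 80, fun P T Adm hsec hAdm A hA => ?_⟩
  have hp : ((Polynomial.X + Polynomial.C 64) ^ 80 : Polynomial ℕ).eval T.size = T.kappa ^ 80 := by
    simp [Poseidon.Training.kappa]
  obtain ⟨Sim, hcost, hSim⟩ := Poseidon.exists_simulates hsec hA Adm hAdm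
  have hε : (fun c : ℕ => ((T.kappa ^ 80 * (c + 1) : ℕ) : ℝ) / 2 ^ T.lam) =
      fun c : ℕ => ((T.kappa ^ 80 : ℕ) : ℝ) * (c + 1) / 2 ^ T.lam := by
    funext c
    push_cast
    ring
  rw [hp]
  refine ⟨Sim, hcost.trans (Nat.pow_le_pow_right ?_ (by norm_num)), ?_, ?_⟩
  · have := T.le_kappa
    omega
  · exact hε ▸ hSim _
  · exact hε ▸ hSim _
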